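/- Let $d\ge 2$ and $\epsilon\in[0,1]$, and let $(\boldsymbol\tau_\epsilon(u))_u$ be independent random variables indexed by the edges $u$ of the nearest-neighbour graph $\mathbb Z^d$, each equal to $0$ with probability $\epsilon$ and to $1$ with probability $1-\epsilon$. Let $\mathbf T_\epsilon(x,y)$ be the infimum, over all nearest-neighbour paths from $x$ to $y$, of the sum of the $\boldsymbol\tau_\epsilon(u)$ over the edges of the path. For $z\in\mathbb R^d\setminus\{0\}$ let $\boldsymbol\mu_\epsilon(z)$ be the time constant, that is, the deterministic limit $$\boldsymbol\mu_\epsilon(z)=\lim_{n\to\infty}\frac1n\,\mathbf T_\epsilon(0,\lfloor nz\rfloor)\qquad\text{almost surely and in }L^1,$$ where $\lfloor nz\rfloor$ is the coordinate-wise integer part (this limit exists). Write $d_1(z)=\#\{i: z_i\ne0\}$, $d_2(z)=d-d_1(z)$ and $\gamma(z)=\prod_{i:z_i\neq0}|z_i|^{1/d_1(z)}$. **Theorem.** There is a family of positive constants $(\mathbf C(d_1,d_2))_{d_1\ge1,\,d_2\ge0}$ such that for all $d\ge2$ and all $z\in\mathbb R^d\setminus\{0\}$, $$\boldsymbol\mu_\epsilon(z)=\|z\|_1-\mathbf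 C(d_1(z),d_2(z))\,\gamma(z)\,\epsilon^{1/d_1(z)}+o\big(\epsilon^{1/d_1(z)}\big)\quad\text{as }\epsilon\to0^+.$$ Moreover $\mathbf C(d_1,d_2)$ is, for all $d_1\ge1$, $d_2\ge0$, the directional score $$\mathbf C(d_1,d_2)=\lim_{\lambda\to\infty}\frac1\lambda\,\mathbb E\big[\mathbf S(\lambda)\big]\in(0,\infty)$$ of the following model. Let $\xi_1,\dots,\xi_{d_1+d_2}$ be independent Poisson point processes on $\mathbb R^{d_1}\times\mathbb Z^{d_2}$ whose intensity is the product of Lebesgue measure and counting measure; the points of $\xi_j$ are called particles of type $j$. Then $$\mathbf S(\lambda)=\sup\big(k-\mathbf V(w(1),\dots,w(k))\big),$$ where the supremum is over all $k\ge0$ and all sequences of particles $w(i)=(x(i),v(i))$ with $0\le x(1)_l<x(2)_l<\dots<x(k)_l<\lambda$ for each $l\in\{1,\dots,d_1\}$, and $\mathbf V(w(1),\dots,w(k))$ is the length of the shortest nearest-neighbour path in $\mathbb Z^{d_2}$ from $0$ to $0$ that goes successively, in this order, through $A(1),\dots,A(k)$. Here $A(i)$ is the site $v(i)$ if $w(i)$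 has type $j\le d_1$, and the unoriented edge $\{v(i),v(i)+e_{j-d_1}\}$, with $(e_1,\dots,e_{d_2})$ the canonical basis of $\mathbb Z^{d_2}$, if $w(i)$ has type $j>d_1$; edges attached to different particles of the sequence require different crossings. -/

import Mathlib

open MeasureTheory ProbabilityTheory Filter Topology Asymptotics
open scoped ENNReal unitInterval

noncomputable section

namespace FPP

/-! ### Bernoulli bond first-passage percolation on the cubic lattice -/

/-- The usual graph structure on `ℤ^d`: two vertices are neighbours when their distance is one. -/
def lattice (d : ℕ) : SimpleGraph (Fin d → ℤ) where
  Adj x y := ∑ i, |x i - y i| = 1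
  symm := ⟨fun x y h => by simpa only [abs_sub_comm] using h⟩
  loopless := ⟨fun x h => by simp at h⟩

/-- Travel time of a path: the sum of the passage times of the edges it crosses, with
multiplicity. -/
def travelTime {d : ℕ} (t : (lattice d).edgeSet → ℝ) :
    {x y : Fin d → ℤ} → (lattice d).Walk x y → ℝ
  | _, _, .nil => 0
  | _, _, .cons h p => t ⟨s(_, _), h⟩ + travelTime t p

/-- The time between two vertices: the infimum of the travel times of all paths joining them. -/
def passageTime {d : ℕ} (t : (lattice d).edgeSet → ℝ) (x y : Fin d → ℤ) : ℝ :=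
  ⨅ p : (lattice d).Walk x y, travelTime t p

/-- `τ` is a family of independent Bernoulli variables with parameter `1 - ε`, indexed by the
edges of `ℤ^d`: each of them is `0` with probability `ε` and `1` with probability `1 - ε`. -/
structure IsBernoulliBond {Ω : Type*} [MeasurableSpace Ω] (P : Measure Ω) {d : ℕ} (ε : I)
    (τ : (lattice d).edgeSet → Ω → ℝ) : Prop where
  measurable : ∀ e, Measurable (τ e)
  law : ∀ e, P.map (τ e) = bernoulliMeasure (0 : ℝ) 1 ε
  indep : iIndepFun τ P

/-- The vertex `⌊n z⌋` (coordinate-wise integer part). -/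
def floorPoint {d : ℕ} (z : Fin d → ℝ) (n : ℕ) : Fin d → ℤ := fun i => ⌊(n : ℝ) * z i⌋

/-- `m` is the time constant in the direction `z` of the passage times `τ`: the limit of
`T(0, ⌊n z⌋) / n`, almost surely and in `L¹`. -/
def IsTimeConstant {Ω : Type*} [MeasurableSpace Ω] (P : Measure Ω) {d : ℕ}
    (τ : (lattice d).edgeSet → Ω → ℝ) (z : Fin d → ℝ) (m : ℝ) : Prop :=
  (∀ᵐ ω ∂P, Tendsto (fun n : ℕ => passageTime (fun e => τ e ω) 0 (floorPoint z n) / n)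
    atTop (𝓝 m)) ∧
  (∀ n : ℕ, Integrable (fun ω => passageTime (fun e => τ e ω) 0 (floorPoint z n)) P) ∧
  Tendsto (fun n : ℕ =>
    eLpNorm (fun ω => passageTime (fun e => τ e ω) 0 (floorPoint z n) / n - m) 1 P)
    atTop (𝓝 0)

/-- The `ℓ¹`-norm. -/
def l1norm {d : ℕ} (z : Fin d → ℝ) : ℝ := ∑ i, |z i|

/-- The number of non-zero coordinates. -/
def numNonzero {d : ℕ} (z : Fin d → ℝ) : ℕ := {i | z i ≠ 0}.ncard

/-- The number of zero coordinates. -/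
def numZero {d : ℕ} (z : Fin d → ℝ) : ℕ := {i | z i = 0}.ncard

open Classical in
/-- The geometric mean of the absolute values of the non-zero coordinates. -/
def geomMean {d : ℕ} (z : Fin d → ℝ) : ℝ :=
  ∏ i with z i ≠ 0, |z i| ^ ((1 : ℝ) / numNonzero z)

/-! ### Poisson point processes -/

/-- The random set `ξ` is a Poisson point process with intensity `ν`. -/
structure IsPoissonProcess {Ω E : Type*} [MeasurableSpace Ω] [MeasurableSpace E]
    (P : Measure Ω) (ν : Measure E) (ξ : Ω → Set E) : Prop where
  measurable : ∀ B, MeasurableSet B → Measurable fun ω => (ξ ω ∩ B).encard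
  law : ∀ B, MeasurableSet B → ν B ≠ ∞ →
    P.map (fun ω => (ξ ω ∩ B).encard) =
      (poissonMeasure (ν B).toNNReal).map (fun n : ℕ => (n : ℕ∞))
  indep : ∀ (n : ℕ) (B : Fin n → Set E), (∀ i, MeasurableSet (B i)) →
    Pairwise (fun i j => Disjoint (B i) (B j)) →
    iIndepFun (fun i ω => (ξ ω ∩ B i).encard) P

/-- The σ-algebra generated by a random set, through its counting variables. -/
@[reducible] def processSigma {Ω E : Type*} [MeasurableSpace E] (ξ : Ω → Set E) : MeasurableSpace Ω :=
  ⨆ (B : Set E) (_ : MeasurableSet B),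
    MeasurableSpace.comap (fun ω => (ξ ω ∩ B).encard) inferInstance

/-! ### The semi-continuous oriented model on `ℝ^{d₁} × ℤ^{d₂}` -/

/-- The `d₁ + d₂` edge types: `Sum.inl` for the horizontal and `Sum.inr` for the vertical ones. -/
abbrev EdgeType (d₁ d₂ : ℕ) := Fin d₁ ⊕ Fin d₂

/-- Positions in `ℝ^{d₁} × ℤ^{d₂}`. -/
abbrev Position (d₁ d₂ : ℕ) := (Fin d₁ → ℝ) × (Fin d₂ → ℤ)

/-- One Poisson point process for each edge type, all independent, whose intensity is the product
of the Lebesgue measure on `ℝ^{d₁}` and the counting measure on `ℤ^{d₂}`. -/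
structure IsPoissonModel {Ω : Type*} [MeasurableSpace Ω] (P : Measure Ω) {d₁ d₂ : ℕ}
    (ξ : EdgeType d₁ d₂ → Ω → Set (Position d₁ d₂)) : Prop where
  poisson : ∀ j, IsPoissonProcess P
    ((volume : Measure (Fin d₁ → ℝ)).prod (Measure.count : Measure (Fin d₂ → ℤ))) (ξ j)
  indep : iIndep (fun j => processSigma (ξ j)) P

/-- A particle together with its type. -/
abbrev Particle (d₁ d₂ : ℕ) := Position d₁ d₂ × EdgeType d₁ d₂

/-- `VerticalTour w p n`: there is a nearest-neighbour path of length `n` in `ℤ^{d₂}` from `p` to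
`0` that goes successively, in this order, through the sites and the (unoriented) edges attached
to the particles of the list `w`. A particle of horizontal type at `(x, v)` is attached to the
site `v`, a particle of vertical type `j` at `(x, v)` to the edge between `v` and `v + e_j`;
distinct particles of the list require distinct crossings of their edges. -/
inductive VerticalTour {d₁ d₂ : ℕ} : List (Particle d₁ d₂) → (Fin d₂ → ℤ) → ℕ → Prop
  | nil : VerticalTour [] 0 0
  | move {w p q n} : (lattice d₂).Adj p q → VerticalTour w q n → VerticalTour w p (n + 1)
  | site {w x p n} (i : Fin d₁) : VerticalTour w p n →
      VerticalTour (((x, p), Sum.inl i) :: w) p n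
  | up {w x v p n} (j : Fin d₂) : p = v + Pi.single j 1 → VerticalTour w p n →
      VerticalTour (((x, v), Sum.inr j) :: w) v (n + 1)
  | down {w x v p n} (j : Fin d₂) : p = v + Pi.single j 1 → VerticalTour w v n →
      VerticalTour (((x, v), Sum.inr j) :: w) p (n + 1)

/-- The vertical length of a sequence of particles: the length of the shortest path in `ℤ^{d₂}`
from `0` to `0` that goes successively through the attached sites and edges. -/
def verticalLength {d₁ d₂ : ℕ} (w : List (Particle d₁ d₂)) : ℕ :=
  sInf {n | VerticalTour w 0 n}

/-- The monotone sequences of particles between `0` and `(z, 0)`: the horizontal coordinates of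
the successive particles are strictly increasing, non-negative, and strictly below those
of `z`. The vertical coordinates are free. -/
def IsMonotoneSeq {d₁ d₂ : ℕ} (X : EdgeType d₁ d₂ → Set (Position d₁ d₂)) (z : Fin d₁ → ℝ)
    (w : List (Particle d₁ d₂)) : Prop :=
  (∀ a ∈ w, a.1 ∈ X a.2) ∧
  (∀ a ∈ w, ∀ i, 0 ≤ a.1.1 i ∧ a.1.1 i < z i) ∧
  w.Pairwise (fun a b => ∀ i, a.1.1 i < b.1.1 i)

/-- The score: the supremum over the monotone sequences of the number of particles minus the
vertical length. It is non-negative because of the empty sequence, so negative values may be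
replaced by `0`, and it is a priori possibly infinite. -/
def score {d₁ d₂ : ℕ} (X : EdgeType d₁ d₂ → Set (Position d₁ d₂)) (z : Fin d₁ → ℝ) : ℝ≥0∞ :=
  ⨆ (w : List (Particle d₁ d₂)) (_ : IsMonotoneSeq X z w),
    ENNReal.ofReal ((w.length : ℝ) - (verticalLength w : ℝ))

/-- `c` is the mean directional score in the direction `z`: the limit of `𝔼[S(ℓ z)] / ℓ` as the
real number `ℓ` tends to infinity. -/
def IsDirectionalScore {Ω : Type*} [MeasurableSpace Ω] (P : Measure Ω) {d₁ d₂ : ℕ}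
    (ξ : EdgeType d₁ d₂ → Ω → Set (Position d₁ d₂)) (z : Fin d₁ → ℝ) (c : ℝ) : Prop :=
  Tendsto (fun l : ℝ => (∫⁻ ω, score (fun j => ξ j ω) (l • z) ∂P) / ENNReal.ofReal l)
    atTop (𝓝 (ENNReal.ofReal c))

end FPP

end

/-! Call savings of a path to `y` the horizontal (nonzero) part of the displacement minus the
passage time. When `ε` is small, free edges are so sparse that a good path is almost a geodesic: it
goes through free edges whose horizontal coordinates increase. If the horizontal coordinates are
rescaled by `ε^(1/d₁)`, these edges become Poisson points of `ℝ^{d₁} × ℤ^{d₂}`; the coordinates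
where `z` vanishes are not rescaled, and every vertical step is paid. A free horizontal edge saves
one horizontal step, a free vertical edge refunds one vertical step, so the savings become the
number of particles minus the vertical length. After a further anisotropic scaling, which preserves
the Poisson law, only `γ(z)` remembers the direction.

The free edges form a Bernoulli random set, and `ptime` is the least cost of a list of free edges
joined by jumps paid at their `ℓ¹`-length. The discrete score `dscore` is the score of such a set in
a box. With cell probability `1 - exp (-a)`, merging cells is exact in law (`map_coarseEdge`), so
that refining the mesh increases the score; with superadditivity this makes `scoreConst`, the
supremum of the normalised mean scores, the correct limit. It is finite by an exponential moment
(`meanScore_crude`), and equals the directional score of the Poisson model, since each Poisson score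
lies above its discretisations and below their lower limit.

Lower bound for the savings: an increasing list of free edges can be followed along an optimal
vertical tour (`ptime_add_length_le`), and almost optimal boxes are concatenated in direction `z`
(`meanTime_horPoint_le`).

The upper bound is the difficult half, since an optimal path may go backwards, leave the box, or
drift vertically. Weighted first moments over lists of distinct free edges bound the exponential
moments of the savings and show that trails which are not increasing, or overshoot, are rare. What
remains is bounded by `dscore`, whose upper tail follows from its mean and its lower tail
(`measure_dscore_gt_le`). A reflection reduces a vertical displacement to the case without one
(`measure_slab_savings_sq_le`). Space is then cut into large cells; a path is cut each time it has
climbed `L` cell levels, and the pieces use disjoint free edges, so a BK-type inequality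
(`lintegral_disjointProd_le`) bounds the exponential moment of the whole path by a product. The
number of relevant cell displacements per piece is polynomial in the exponent `B`, hence negligible
against `exp (B * …)` (`tsum_cellMoment_le`).

The time constant itself is obtained without the subadditive ergodic theorem: the upper limit by a
law of large numbers in finite windows, the lower limit by a greedy covering with fast stretches. -/

noncomputable section

namespace FPP

set_option linter.unusedSectionVars false
/-! ### Bernoulli random sets -/

section BernoulliSet

variable {α β : Type*}

/-- The law of a random set containing each element independently with probability `p`. -/
abbrev bernoulliSet (α : Type*) (p : I) : Measure (Set α) := setBernoulli Set.univ p

/-- The sets avoiding a given finite set. -/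
def avoiding (F : Finset α) : Set (Set α) := {S | ∀ a ∈ F, a ∉ S}

lemma measurableSet_avoiding (F : Finset α) : MeasurableSet (avoiding F) := by
  have : avoiding F = ⋂ a ∈ F, {S : Set α | a ∉ S} := by ext S; simp [avoiding]
  rw [this]
  exact Finset.measurableSet_biInter _ fun a _ => measurableSet_notMem a

lemma toNNReal_symm_eq (p : I) : ((unitInterval.toNNReal (unitInterval.symm p) : NNReal) : ℝ≥0∞)
    = ENNReal.ofReal (1 - p) := by
  rw [ENNReal.ofReal, ENNReal.coe_inj]
  ext
  simp [unitInterval.one_minus_nonneg p]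

lemma toNNReal_eq_ofReal (p : I) : ((unitInterval.toNNReal p : NNReal) : ℝ≥0∞)
    = ENNReal.ofReal p := by
  rw [ENNReal.ofReal, ENNReal.coe_inj]
  ext
  simp [p.2.1]

/-- A cylinder is a finite box for the product measure; leaving `b` free treats presence and absence
together. -/
lemma bernoulliSet_cylinder (p : I) (F : Finset α) (b : Prop) :
    bernoulliSet α p {S | ∀ a ∈ F, (a ∈ S) = b} =
      ((unitInterval.toNNReal p : ℝ≥0∞) * (Measure.dirac True {b}) +
        (unitInterval.toNNReal (unitInterval.symm p) : ℝ≥0∞) * (Measure.dirac False {b})) ^ F.card := by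
  rw [setBernoulli_apply']
  have : ((fun p : α → Prop => {i | p i}) ⁻¹' {S | ∀ a ∈ F, (a ∈ S) = b})
      = Set.pi (F : Set α) (fun _ => ({b} : Set Prop)) := by
    ext f; simp [Set.mem_pi]
  rw [this, Measure.infinitePi_pi]
  · simp
    rfl
  · intro i _; exact measurableSet_singleton _

lemma bernoulliSet_avoiding (p : I) (F : Finset α) :
    bernoulliSet α p (avoiding F) = ENNReal.ofReal (1 - p) ^ F.card := by
  have := bernoulliSet_cylinder p F False
  simp only [eq_iff_iff, iff_false] at this
  rw [avoiding, this]
  simp [toNNReal_symm_eq]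

lemma bernoulliSet_containing (p : I) (F : Finset α) :
    bernoulliSet α p {S | ∀ a ∈ F, a ∈ S} = ENNReal.ofReal p ^ F.card := by
  have := bernoulliSet_cylinder p F True
  simp only [eq_iff_iff, iff_true] at this
  rw [this]
  simp [toNNReal_eq_ofReal]

/-- With `isPiSystem_avoiding`, this makes avoidance probabilities determine the law. All identities
in law below (pullback, union, splicing, coarse-graining, Poisson cells) are checked on them,
because missing `F` translates each time into missing some other finite or bounded set. -/
lemma generateFrom_avoiding :
    (Set.instMeasurableSpace : MeasurableSpace (Set α)) =
      MeasurableSpace.generateFrom (Set.range (avoiding : Finset α → Set (Set α))) := by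
  apply le_antisymm
  · have h : Measurable[MeasurableSpace.generateFrom (Set.range (avoiding : Finset α → _))]
        (id : Set α → Set α) := by
      rw [@measurable_set_iff]
      intro a
      have : @MeasurableSet _ (MeasurableSpace.generateFrom (Set.range (avoiding : Finset α → _)))
          {S : Set α | a ∉ S} := by
        apply MeasurableSpace.measurableSet_generateFrom
        exact ⟨{a}, by ext S; simp [avoiding]⟩
      have h2 := this.compl
      refine measurable_to_prop ?_
      convert h2 using 1
      ext S; simp
    simpa using h.comap_le
  · apply MeasurableSpace.generateFrom_le
    rintro _ ⟨F, rfl⟩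
    exact measurableSet_avoiding F

lemma isPiSystem_avoiding : IsPiSystem (Set.range (avoiding : Finset α → Set (Set α))) := by
  classical
  rintro _ ⟨F, rfl⟩ _ ⟨G, rfl⟩ _
  refine ⟨F ∪ G, ?_⟩
  ext S
  simp only [avoiding, Finset.mem_union, Set.mem_inter_iff, Set.mem_ofPred_eq]
  constructor
  · intro h; exact ⟨fun a ha => h a (Or.inl ha), fun a ha => h a (Or.inr ha)⟩
  · rintro ⟨h1, h2⟩ a (h | h)
    exacts [h1 a h, h2 a h]

/-- A Bernoulli random set is characterised by its avoidance probabilities. -/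
theorem eq_bernoulliSet {Q : Measure (Set α)} [IsProbabilityMeasure Q] {p : I}
    (h : ∀ F : Finset α, Q (avoiding F) = ENNReal.ofReal (1 - p) ^ F.card) :
    Q = bernoulliSet α p := by
  refine ext_of_generate_finite _ generateFrom_avoiding isPiSystem_avoiding ?_ (by simp)
  rintro _ ⟨F, rfl⟩
  rw [h, bernoulliSet_avoiding]

lemma map_eq_bernoulliSet {Ω : Type*} [MeasurableSpace Ω] {P : Measure Ω} [IsProbabilityMeasure P]
    {p : I} {X : Ω → Set α} (hX : Measurable X)
    (h : ∀ F : Finset α, P {ω | ∀ a ∈ F, a ∉ X ω} = ENNReal.ofReal (1 - p) ^ F.card) :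
    P.map X = bernoulliSet α p := by
  have := Measure.isProbabilityMeasure_map (μ := P) hX.aemeasurable
  refine eq_bernoulliSet fun F => ?_
  rw [Measure.map_apply hX (measurableSet_avoiding F)]
  exact h F

lemma measurable_preimage_set (f : α → β) : Measurable fun S : Set β => f ⁻¹' S :=
  measurable_set_iff.2 fun a => measurable_set_mem (f a)

lemma measurable_inter_set (A : Set α) : Measurable fun S : Set α => S ∩ A :=
  measurable_set_iff.2 fun a => by
    by_cases h : a ∈ A
    · simpa [h] using measurable_set_mem a
    · simp [h]

/-- The pullback of a Bernoulli set by an injective map is a Bernoulli set. -/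
theorem map_preimage_bernoulliSet (p : I) {f : α → β} (hf : Function.Injective f) :
    (bernoulliSet β p).map (fun S => f ⁻¹' S) = bernoulliSet α p := by
  classical
  refine map_eq_bernoulliSet (measurable_preimage_set f) fun F => ?_
  have := bernoulliSet_avoiding p (F.image f)
  rw [Finset.card_image_of_injective _ hf] at this
  rw [← this]
  congr 1
  ext S
  simp [avoiding]

theorem lintegral_preimage_bernoulliSet (p : I) {f : α → β} (hf : Function.Injective f)
    {g : Set α → ℝ≥0∞} (hg : Measurable g) :
    ∫⁻ S, g (f ⁻¹' S) ∂bernoulliSet β p = ∫⁻ S, g S ∂bernoulliSet α p := by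
  rw [← map_preimage_bernoulliSet p hf, lintegral_map hg (measurable_preimage_set f)]

/-- The union of two independent Bernoulli sets is a Bernoulli set. -/
theorem map_union_bernoulliSet {p q r : I} (h : (1 - (r : ℝ)) = (1 - p) * (1 - q)) :
    ((bernoulliSet α p).prod (bernoulliSet α q)).map (fun S => S.1 ∪ S.2) = bernoulliSet α r := by
  refine map_eq_bernoulliSet ?_ fun F => ?_
  · refine measurable_set_iff.2 fun a => ?_
    have h1 : Measurable fun S : Set α × Set α => a ∈ S.1 :=
      (measurable_set_mem a).comp measurable_fst
    have h2 : Measurable fun S : Set α × Set α => a ∈ S.2 :=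
      (measurable_set_mem a).comp measurable_snd
    exact h1.or h2
  · have : {S : Set α × Set α | ∀ a ∈ F, a ∉ S.1 ∪ S.2} = avoiding F ×ˢ avoiding F := by
      ext S
      simp only [avoiding, Set.mem_union, not_or, Set.mem_ofPred_eq, Set.mem_prod]
      exact ⟨fun h => ⟨fun a ha => (h a ha).1, fun a ha => (h a ha).2⟩,
        fun h a ha => ⟨h.1 a ha, h.2 a ha⟩⟩
    rw [this, Measure.prod_prod, bernoulliSet_avoiding, bernoulliSet_avoiding, ← mul_pow,
      ← ENNReal.ofReal_mul (unitInterval.one_minus_nonneg p), h]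

/-- The expectation of a monotone function of a Bernoulli set is monotone in the parameter. -/
theorem lintegral_bernoulliSet_mono {p r : I} (h : p ≤ r) {f : Set α → ℝ≥0∞} (hf : Measurable f)
    (hm : Monotone f) : ∫⁻ S, f S ∂bernoulliSet α p ≤ ∫⁻ S, f S ∂bernoulliSet α r := by
  by_cases hp : (p : ℝ) = 1
  · have : p = r := le_antisymm h (Subtype.coe_le_coe.1 (by rw [hp]; exact r.2.2))
    rw [this]
  have hp1 : 0 < 1 - (p : ℝ) := by
    have := p.2.2; exact sub_pos.2 (lt_of_le_of_ne this hp)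
  have hpr : (p : ℝ) ≤ r := h
  -- Monotone coupling: `q` solves `1 - r = (1 - p) * (1 - q)`, so an `r`-set is a `p`-set together
  -- with an independent `q`-set.
  let q : I := ⟨1 - (1 - r) / (1 - p), by
    rw [sub_nonneg, div_le_one hp1]; linarith, by
    rw [sub_le_self_iff]; exact div_nonneg (unitInterval.one_minus_nonneg r) hp1.le⟩
  have hq : (1 - (r : ℝ)) = (1 - p) * (1 - q) := by
    simp only [q]; field_simp; ring
  have hmeas : Measurable fun S : Set α × Set α => S.1 ∪ S.2 := by
    refine measurable_set_iff.2 fun a => ?_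
    have h1 : Measurable fun S : Set α × Set α => a ∈ S.1 :=
      (measurable_set_mem a).comp measurable_fst
    have h2 : Measurable fun S : Set α × Set α => a ∈ S.2 :=
      (measurable_set_mem a).comp measurable_snd
    exact h1.or h2
  rw [← map_union_bernoulliSet hq, lintegral_map hf hmeas]
  calc ∫⁻ S, f S ∂bernoulliSet α p
      = ∫⁻ S, f S.1 ∂((bernoulliSet α p).prod (bernoulliSet α q)) := by
        rw [← lintegral_map (μ := (bernoulliSet α p).prod (bernoulliSet α q)) hf measurable_fst,
          Measure.map_fst_prod]
        simp
    _ ≤ _ := lintegral_mono fun S => hm Set.subset_union_left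

lemma measurable_splice (A : Set α) :
    Measurable fun S : Set α × Set α => (S.1 ∩ A) ∪ (S.2 \ A) := by
  refine measurable_set_iff.2 fun a => ?_
  have h1 : Measurable fun S : Set α × Set α => a ∈ S.1 :=
    (measurable_set_mem a).comp measurable_fst
  have h2 : Measurable fun S : Set α × Set α => a ∈ S.2 :=
    (measurable_set_mem a).comp measurable_snd
  by_cases h : a ∈ A
  · simpa [h] using h1
  · simpa [h] using h2

/-- Two independent Bernoulli sets, spliced along a set `A`. -/
theorem map_splice_bernoulliSet (p : I) (A : Set α) :
    ((bernoulliSet α p).prod (bernoulliSet α p)).map (fun S => (S.1 ∩ A) ∪ (S.2 \ A)) =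
      bernoulliSet α p := by
  classical
  refine map_eq_bernoulliSet (measurable_splice A) fun F => ?_
  have : {S : Set α × Set α | ∀ a ∈ F, a ∉ (S.1 ∩ A) ∪ (S.2 \ A)} =
      avoiding (F.filter (· ∈ A)) ×ˢ avoiding (F.filter (· ∉ A)) := by
    ext S
    simp only [avoiding, Set.mem_union, Set.mem_inter_iff, Set.mem_sdiff, not_or, not_and, not_not,
      Set.mem_ofPred_eq, Finset.mem_filter, and_imp, Set.mem_prod]
    grind
  rw [this, Measure.prod_prod, bernoulliSet_avoiding, bernoulliSet_avoiding, ← pow_add,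
    Finset.card_filter_add_card_filter_not]

/-- The splice of two independent copies along `A` has the original law, and its traces inside and
outside `A` come from different copies. -/
theorem lintegral_bernoulliSet_split (p : I) (A : Set α) {f : Set α → Set α → ℝ≥0∞}
    (hf : Measurable (Function.uncurry f)) :
    ∫⁻ S, f (S ∩ A) (S \ A) ∂bernoulliSet α p =
      ∫⁻ S₁, ∫⁻ S₂, f (S₁ ∩ A) (S₂ \ A) ∂bernoulliSet α p ∂bernoulliSet α p := by
  have hd : Measurable fun S : Set α => S \ A := by
    simpa [Set.sdiff_eq] using measurable_inter_set Aᶜ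
  have h1 : Measurable fun S : Set α => f (S ∩ A) (S \ A) :=
    hf.comp ((measurable_inter_set A).prodMk hd)
  have h2 : Measurable fun S : Set α × Set α => f (S.1 ∩ A) (S.2 \ A) :=
    hf.comp (((measurable_inter_set A).comp measurable_fst).prodMk (hd.comp measurable_snd))
  conv_lhs => rw [← map_splice_bernoulliSet p A, lintegral_map h1 (measurable_splice A)]
  rw [lintegral_prod _ (by
    refine Measurable.aemeasurable ?_
    exact h1.comp (measurable_splice A))]
  refine lintegral_congr fun S₁ => lintegral_congr fun S₂ => ?_
  congr 1
  · ext a; by_cases h : a ∈ A <;> simp [h]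
  · ext a; by_cases h : a ∈ A <;> simp [h]

/-- Functions of a Bernoulli set depending on disjoint regions are independent. -/
theorem lintegral_mul_bernoulliSet (p : I) {A B : Set α} (hAB : Disjoint A B) {f g : Set α → ℝ≥0∞}
    (hf : Measurable f) (hg : Measurable g) :
    ∫⁻ S, f (S ∩ A) * g (S ∩ B) ∂bernoulliSet α p =
      (∫⁻ S, f (S ∩ A) ∂bernoulliSet α p) * ∫⁻ S, g (S ∩ B) ∂bernoulliSet α p := by
  have key := lintegral_bernoulliSet_split p A (f := fun S T => f S * g (T ∩ B)) (by
    exact (hf.comp measurable_fst).mul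
      (hg.comp ((measurable_inter_set B).comp measurable_snd)))
  have hd : ∀ S : Set α, (S \ A) ∩ B = S ∩ B := by
    intro S; ext a
    simp only [Set.mem_inter_iff, Set.mem_sdiff]
    exact ⟨fun h => ⟨h.1.1, h.2⟩, fun h => ⟨⟨h.1, fun ha => Set.disjoint_left.1 hAB ha h.2⟩, h.2⟩⟩
  simp only [hd] at key
  rw [key]
  have : ∀ S₁ : Set α, ∫⁻ S₂, f (S₁ ∩ A) * g (S₂ ∩ B) ∂bernoulliSet α p
      = f (S₁ ∩ A) * ∫⁻ S₂, g (S₂ ∩ B) ∂bernoulliSet α p := fun S₁ =>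
    lintegral_const_mul _ (hg.comp (measurable_inter_set B))
  simp_rw [this]
  rw [lintegral_mul_const _ (show Measurable fun S : Set α => f (S ∩ A) from
    hf.comp (measurable_inter_set A))]

theorem indepFun_bernoulliSet (p : I) {A B : Set α} (hAB : Disjoint A B) {γ δ : Type*}
    [MeasurableSpace γ] [MeasurableSpace δ] {f : Set α → γ} {g : Set α → δ}
    (hf : Measurable f) (hg : Measurable g) :
    IndepFun (fun S => f (S ∩ A)) (fun S => g (S ∩ B)) (bernoulliSet α p) := by
  rw [indepFun_iff_measure_inter_preimage_eq_mul]
  intro s t hs ht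
  have hs' := hf hs
  have ht' := hg ht
  have key := lintegral_mul_bernoulliSet p hAB (f := (f ⁻¹' s).indicator 1)
    (g := (g ⁻¹' t).indicator 1) (measurable_one.indicator hs') (measurable_one.indicator ht')
  have e1 : ∀ (A : Set α) (u : Set (Set α)) (S : Set α), u.indicator (1 : Set α → ℝ≥0∞) (S ∩ A) =
      ((fun S => S ∩ A) ⁻¹' u).indicator 1 S := fun A u S => rfl
  simp only [e1] at key
  have e2 : ∀ (u v : Set (Set α)) (S : Set α), u.indicator (1 : Set α → ℝ≥0∞) S * v.indicator 1 S
      = (u ∩ v).indicator 1 S := by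
    intro u v S
    rw [Set.inter_indicator_one]; rfl
  simp only [e2] at key
  rw [lintegral_indicator_one ((measurable_inter_set A hs').inter (measurable_inter_set B ht')),
    lintegral_indicator_one (measurable_inter_set A hs'),
    lintegral_indicator_one (measurable_inter_set B ht')] at key
  exact key

/-- Coarse-graining of a Bernoulli set along blocks of equal finite size. -/
theorem map_coarsen_bernoulliSet {p r : I} {b : α → β} {D : Set α} {n : ℕ} (B : β → Finset α)
    (hB : ∀ c a, a ∈ B c ↔ a ∈ D ∧ b a = c) (hcard : ∀ c, (B c).card = n)
    (h : 1 - (r : ℝ) = (1 - p) ^ n) :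
    Measurable (fun S : Set α => b '' (S ∩ D)) ∧
    (bernoulliSet α p).map (fun S => b '' (S ∩ D)) = bernoulliSet β r := by
  classical
  have hm : Measurable (fun S : Set α => b '' (S ∩ D)) := by
    refine measurable_set_iff.2 fun c => ?_
    have : (fun S : Set α => c ∈ b '' (S ∩ D)) = fun S => ∃ a ∈ B c, a ∈ S := by
      ext S
      simp only [Set.mem_image, Set.mem_inter_iff, hB]
      exact ⟨fun ⟨a, h1, h2⟩ => ⟨a, ⟨h1.2, h2⟩, h1.1⟩, fun ⟨a, h1, h2⟩ => ⟨a, ⟨h2, h1.1⟩, h1.2⟩⟩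
    rw [this]
    refine measurable_to_prop ?_
    have h2 := (measurableSet_avoiding (B c)).compl
    convert h2 using 1
    ext S; simp [avoiding]
  refine ⟨hm, map_eq_bernoulliSet hm fun F => ?_⟩
  have hd : (F : Set β).PairwiseDisjoint B := by
    intro c _ c' _ hcc
    refine Finset.disjoint_left.2 fun a ha ha' => hcc ?_
    rw [← ((hB _ _).1 ha).2, ← ((hB _ _).1 ha').2]
  -- The image misses `F` exactly when the set misses all the blocks over `F`, which are disjoint
  -- and of size `n`.
  have := bernoulliSet_avoiding p (F.biUnion B)
  rw [Finset.card_biUnion hd, Finset.sum_congr rfl (fun c _ => hcard c), Finset.sum_const,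
    smul_eq_mul, mul_comm, pow_mul, ← ENNReal.ofReal_pow (unitInterval.one_minus_nonneg p), ← h]
    at this
  rw [← this]
  congr 1
  ext S
  simp only [avoiding, Set.mem_image, Set.mem_inter_iff, Finset.mem_biUnion, hB, Set.mem_ofPred_eq]
  grind

end BernoulliSet
/-! ### Passage times in an environment of free edges -/

section Passage

variable {ι κ : Type*} [Fintype ι] [DecidableEq ι] [Fintype κ] [DecidableEq κ]

/-- The edge `(x, i)` of `ℤ^ι` joins `x` and `x + e_i`. -/
abbrev Edge (ι : Type*) := (ι → ℤ) × ι

/-- An edge together with an orientation. -/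
abbrev OEdge (ι : Type*) := Edge ι × Bool

/-- The starting point of an oriented edge. -/
def OEdge.src (e : OEdge ι) : ι → ℤ := if e.2 then e.1.1 else e.1.1 + Pi.single e.1.2 1

/-- The end point of an oriented edge. -/
def OEdge.tgt (e : OEdge ι) : ι → ℤ := if e.2 then e.1.1 + Pi.single e.1.2 1 else e.1.1

/-- The same edge with the opposite orientation. -/
def OEdge.flip (e : OEdge ι) : OEdge ι := (e.1, !e.2)

@[simp] lemma OEdge.src_flip (e : OEdge ι) : e.flip.src = e.tgt := by
  rcases e with ⟨e, _ | _⟩ <;> simp [OEdge.flip, OEdge.src, OEdge.tgt]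

@[simp] lemma OEdge.tgt_flip (e : OEdge ι) : e.flip.tgt = e.src := by
  rcases e with ⟨e, _ | _⟩ <;> simp [OEdge.flip, OEdge.src, OEdge.tgt]

/-- The `ℓ¹`-norm on `ℤ^ι`. -/
def l1 (x : ι → ℤ) : ℕ := ∑ i, (x i).natAbs

lemma l1_add_le (x y : ι → ℤ) : l1 (x + y) ≤ l1 x + l1 y := by
  rw [l1, l1, l1, ← Finset.sum_add_distrib]
  exact Finset.sum_le_sum fun i _ => Int.natAbs_add_le _ _

@[simp] lemma l1_zero : l1 (0 : ι → ℤ) = 0 := by simp [l1]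

@[simp] lemma l1_neg (x : ι → ℤ) : l1 (-x) = l1 x := by simp [l1]

lemma l1_sub_comm (x y : ι → ℤ) : l1 (x - y) = l1 (y - x) := by rw [← l1_neg, neg_sub]

lemma l1_sub_le (x y z : ι → ℤ) : l1 (z - x) ≤ l1 (y - x) + l1 (z - y) := by
  have := l1_add_le (y - x) (z - y)
  rwa [show y - x + (z - y) = z - x by abel] at this

@[simp] lemma l1_single (i : ι) (a : ℤ) : l1 (Pi.single i a) = a.natAbs := by
  rw [l1, Finset.sum_eq_single i]
  · simp
  · intro j _ h; simp [h]
  · simp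

lemma l1_eq_zero {x : ι → ℤ} : l1 x = 0 ↔ x = 0 := by
  simp [l1, funext_iff]

/-- The cost of going from `x` to `y` through the given oriented edges: the edges are free, and
the jumps between them are paid at their `ℓ¹`-length. -/
def jumpCost : (ι → ℤ) → List (OEdge ι) → (ι → ℤ) → ℕ
  | x, [], y => l1 (y - x)
  | x, e :: l, y => l1 (e.src - x) + jumpCost e.tgt l y

/-- Only the first jump depends on the starting point. -/
lemma jumpCost_start (x x' : ι → ℤ) (l : List (OEdge ι)) (y : ι → ℤ) :
    jumpCost x l y ≤ l1 (x' - x) + jumpCost x' l y := by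
  cases l with
  | nil => exact l1_sub_le _ _ _
  | cons e l =>
    have := l1_sub_le x x' e.src
    simp only [jumpCost]; omega

lemma jumpCost_append (l l' : List (OEdge ι)) (x y z : ι → ℤ) :
    jumpCost x (l ++ l') z ≤ jumpCost x l y + jumpCost y l' z := by
  induction l generalizing x with
  | nil => exact jumpCost_start _ _ _ _
  | cons e l ih =>
    have := ih e.tgt
    simp only [List.cons_append, jumpCost]; omega

/-- The passage time between two vertices when the edges of `S` are free and the others cost `1`. -/
def ptime (S : Set (Edge ι)) (x y : ι → ℤ) : ℕ :=
  sInf {n | ∃ l : List (OEdge ι), (∀ e ∈ l, e.1 ∈ S) ∧ jumpCost x l y = n}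

lemma ptime_le {S : Set (Edge ι)} {x y : ι → ℤ} {l : List (OEdge ι)} (hl : ∀ e ∈ l, e.1 ∈ S) :
    ptime S x y ≤ jumpCost x l y := Nat.sInf_le ⟨l, hl, rfl⟩

lemma exists_jumpCost_eq_ptime (S : Set (Edge ι)) (x y : ι → ℤ) :
    ∃ l : List (OEdge ι), (∀ e ∈ l, e.1 ∈ S) ∧ jumpCost x l y = ptime S x y :=
  Nat.sInf_mem (s := {n | ∃ l : List (OEdge ι), (∀ e ∈ l, e.1 ∈ S) ∧ jumpCost x l y = n})
    ⟨_, [], by simp, rfl⟩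

lemma ptime_le_l1 (S : Set (Edge ι)) (x y : ι → ℤ) : ptime S x y ≤ l1 (y - x) :=
  ptime_le (l := []) (by simp)

@[simp] lemma ptime_self (S : Set (Edge ι)) (x : ι → ℤ) : ptime S x x = 0 := by
  simpa using ptime_le_l1 S x x

lemma ptime_triangle (S : Set (Edge ι)) (x y z : ι → ℤ) :
    ptime S x z ≤ ptime S x y + ptime S y z := by
  obtain ⟨l, hl, h⟩ := exists_jumpCost_eq_ptime S x y
  obtain ⟨l', hl', h'⟩ := exists_jumpCost_eq_ptime S y z
  rw [← h, ← h']
  refine (ptime_le ?_).trans (jumpCost_append l l' x y z)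
  intro e he
  rcases List.mem_append.1 he with he | he
  exacts [hl e he, hl' e he]

lemma ptime_anti {S S' : Set (Edge ι)} (h : S ⊆ S') (x y : ι → ℤ) :
    ptime S' x y ≤ ptime S x y := by
  obtain ⟨l, hl, h1⟩ := exists_jumpCost_eq_ptime S x y
  rw [← h1]
  exact ptime_le fun e he => h (hl e he)

/-- Passage times between images under an `ℓ¹`-isometry compatible with the environments. -/
lemma ptime_map_le {S : Set (Edge ι)} {S' : Set (Edge κ)} (f : (ι → ℤ) → (κ → ℤ))
    (hf : ∀ x y, l1 (f y - f x) ≤ l1 (y - x))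
    (hS : ∀ e : OEdge ι, e.1 ∈ S → ∃ e' : OEdge κ, e'.1 ∈ S' ∧ e'.src = f e.src ∧ e'.tgt = f e.tgt)
    (x y : ι → ℤ) : ptime S' (f x) (f y) ≤ ptime S x y := by
  obtain ⟨l, hl, h⟩ := exists_jumpCost_eq_ptime S x y
  rw [← h]
  clear h
  have : ∃ l' : List (OEdge κ), (∀ e ∈ l', e.1 ∈ S') ∧
      jumpCost (f x) l' (f y) ≤ jumpCost x l y := by
    induction l generalizing x with
    | nil => exact ⟨[], by simp, hf _ _⟩
    | cons e l ih =>
      obtain ⟨l', h1, h2⟩ := ih e.tgt fun e he => hl e (List.mem_cons_of_mem _ he)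
      obtain ⟨e', h3, h4, h5⟩ := hS e (hl e List.mem_cons_self)
      refine ⟨e' :: l', ?_, ?_⟩
      · intro a ha
        rcases List.mem_cons.1 ha with rfl | ha
        exacts [h3, h1 a ha]
      · simp only [jumpCost, h4, h5]
        exact add_le_add (hf _ _) h2
  obtain ⟨l', h1, h2⟩ := this
  exact (ptime_le h1).trans h2

/-- Reverse the list and flip every edge: the jumps are the same, read backwards. -/
lemma ptime_symm_le (S : Set (Edge ι)) (x y : ι → ℤ) : ptime S y x ≤ ptime S x y := by
  obtain ⟨l, hl, h⟩ := exists_jumpCost_eq_ptime S x y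
  rw [← h]
  clear h
  have : ∃ l' : List (OEdge ι), (∀ e ∈ l', e.1 ∈ S) ∧ jumpCost y l' x ≤ jumpCost x l y := by
    induction l generalizing x with
    | nil => exact ⟨[], by simp, by simp [jumpCost, l1_sub_comm]⟩
    | cons e l ih =>
      obtain ⟨l', h1, h2⟩ := ih e.tgt fun e he => hl e (List.mem_cons_of_mem _ he)
      refine ⟨l' ++ [e.flip], ?_, ?_⟩
      · intro a ha
        rcases List.mem_append.1 ha with ha | ha
        · exact h1 a ha
        · obtain rfl := List.mem_singleton.1 ha
          exact hl e List.mem_cons_self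
      · have := jumpCost_append l' [e.flip] y e.tgt x
        simp only [jumpCost, OEdge.src_flip, OEdge.tgt_flip, sub_self, l1_zero, zero_add] at this ⊢
        rw [l1_sub_comm e.src]
        omega
  obtain ⟨l', h1, h2⟩ := this
  exact (ptime_le h1).trans h2

lemma ptime_symm (S : Set (Edge ι)) (x y : ι → ℤ) : ptime S y x = ptime S x y :=
  le_antisymm (ptime_symm_le _ _ _) (ptime_symm_le _ _ _)

lemma OEdge.eq_or_eq_flip {e e' : OEdge ι} (h : e.1 = e'.1) : e' = e ∨ e' = e.flip := by
  rcases e with ⟨e, _ | _⟩ <;> rcases e' with ⟨e', _ | _⟩ <;> simp_all [OEdge.flip]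

lemma jumpCost_drop (x : ι → ℤ) (a b : List (OEdge ι)) (e : OEdge ι) (y : ι → ℤ) :
    jumpCost e.tgt b y ≤ jumpCost x (a ++ e :: b) y := by
  induction a generalizing x with
  | nil => simp [jumpCost]
  | cons e' a ih => exact (ih e'.tgt).trans (by simp [jumpCost])

/-- Among the lists of edges realising the passage time, one goes through distinct edges. -/
lemma exists_nodup_jumpCost_le (x y : ι → ℤ) (l : List (OEdge ι)) :
    ∃ l' : List (OEdge ι), l' ⊆ l ∧ (l'.map Prod.fst).Nodup ∧ jumpCost x l' y ≤ jumpCost x l y := by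
  induction l generalizing x with
  | nil => exact ⟨[], by simp, by simp, le_rfl⟩
  | cons e l ih =>
    obtain ⟨l', h1, h2, h3⟩ := ih e.tgt
    -- The tail has already been made repetition free; only a second crossing of the first edge
    -- remains to be removed.
    by_cases he : e.1 ∈ l'.map Prod.fst
    · obtain ⟨e', he', hee⟩ := List.mem_map.1 he
      obtain ⟨a, b, rfl⟩ := List.append_of_mem he'
      have hb : (e' :: b) ⊆ e :: l := fun z hz =>
        List.mem_cons_of_mem _ (h1 (List.mem_append_right _ hz))
      have hn : ((e' :: b).map Prod.fst).Nodup := by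
        rw [List.map_append] at h2
        exact (List.nodup_append.1 h2).2.1
      have hd := jumpCost_drop e.tgt a b e' y
      -- Same orientation: the loop between the two crossings is cut. Opposite orientation: the
      -- second crossing returns to `e.src`, so both crossings are dropped.
      rcases OEdge.eq_or_eq_flip hee.symm with rfl | rfl
      · refine ⟨e' :: b, hb, hn, ?_⟩
        simp only [jumpCost]; omega
      · refine ⟨b, fun z hz => hb (List.mem_cons_of_mem _ hz), (List.nodup_cons.1 hn).2, ?_⟩
        have := jumpCost_start x e.src b y
        simp only [jumpCost, OEdge.tgt_flip] at hd ⊢; omega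
    · refine ⟨e :: l', ?_, ?_, ?_⟩
      · intro z hz
        rcases List.mem_cons.1 hz with rfl | hz
        exacts [List.mem_cons_self, List.mem_cons_of_mem _ (h1 hz)]
      · exact List.nodup_cons.2 ⟨he, h2⟩
      · simp only [jumpCost]; omega

lemma exists_nodup_jumpCost_eq_ptime (S : Set (Edge ι)) (x y : ι → ℤ) :
    ∃ l : List (OEdge ι), (∀ e ∈ l, e.1 ∈ S) ∧ (l.map Prod.fst).Nodup ∧
      jumpCost x l y = ptime S x y := by
  obtain ⟨l, hl, h⟩ := exists_jumpCost_eq_ptime S x y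
  obtain ⟨l', h1, h2, h3⟩ := exists_nodup_jumpCost_le x y l
  have hl' : ∀ e ∈ l', e.1 ∈ S := fun e he => hl e (h1 he)
  exact ⟨l', hl', h2, le_antisymm (h3.trans h.le) (ptime_le hl')⟩

/-- Only finitely many edges matter for a given passage time. -/
lemma exists_finset_ptime_inter (S : Set (Edge ι)) (x y : ι → ℤ) :
    ∃ F : Finset (Edge ι), ∀ A : Set (Edge ι), (F : Set (Edge ι)) ⊆ A →
      ptime (S ∩ A) x y = ptime S x y := by
  classical
  obtain ⟨l, hl, h⟩ := exists_jumpCost_eq_ptime S x y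
  refine ⟨(l.map Prod.fst).toFinset, fun A hA => le_antisymm ?_
    (ptime_anti Set.inter_subset_left _ _)⟩
  rw [← h]
  refine ptime_le fun e he => ⟨hl e he, hA ?_⟩
  simp only [Finset.mem_coe, List.mem_toFinset]
  exact List.mem_map_of_mem he

/-- There are countably many lists of edges, and each of them being free is a cylinder event. -/
lemma measurable_ptime (x y : ι → ℤ) : Measurable fun S : Set (Edge ι) => ptime S x y := by
  refine measurable_of_Iic fun n => ?_
  have : (fun S : Set (Edge ι) => ptime S x y) ⁻¹' Set.Iic n =
      ⋃ l ∈ {l : List (OEdge ι) | jumpCost x l y ≤ n}, ⋂ e ∈ l.toFinset, {S | e.1 ∈ S} := by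
    ext S
    simp only [Set.mem_preimage, Set.mem_Iic, Set.mem_ofPred_eq, List.mem_toFinset, Set.mem_iUnion,
      Set.mem_iInter, exists_prop]
    constructor
    · intro h
      obtain ⟨l, hl, h1⟩ := exists_jumpCost_eq_ptime S x y
      exact ⟨l, h1.le.trans h, hl⟩
    · rintro ⟨l, h1, hl⟩
      exact (ptime_le hl).trans h1
  rw [this]
  refine MeasurableSet.biUnion (Set.to_countable _) fun l _ => ?_
  exact Finset.measurableSet_biInter _ fun e _ => measurableSet_mem e.1

/-- Translation of edges. -/
def shiftEdge (a : ι → ℤ) (e : Edge ι) : Edge ι := (e.1 + a, e.2)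

lemma shiftEdge_injective (a : ι → ℤ) : Function.Injective (shiftEdge a) := by
  intro e e' h
  simp only [shiftEdge, Prod.mk.injEq, add_left_inj] at h
  exact Prod.ext h.1 h.2

lemma ptime_shift_le (S : Set (Edge ι)) (a x y : ι → ℤ) :
    ptime S (x + a) (y + a) ≤ ptime (shiftEdge a ⁻¹' S) x y := by
  refine ptime_map_le (· + a) (fun x y => by simp) (fun e he => ⟨(shiftEdge a e.1, e.2), he, ?_⟩) x y
  rcases e with ⟨e, _ | _⟩ <;> simp [OEdge.src, OEdge.tgt, shiftEdge, add_right_comm]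

lemma ptime_shift (S : Set (Edge ι)) (a x y : ι → ℤ) :
    ptime (shiftEdge a ⁻¹' S) x y = ptime S (x + a) (y + a) := by
  refine le_antisymm ?_ (ptime_shift_le S a x y)
  have := ptime_shift_le (shiftEdge a ⁻¹' S) (-a) (x + a) (y + a)
  have h : shiftEdge (-a) ⁻¹' (shiftEdge a ⁻¹' S) = S := by
    ext e; simp [shiftEdge]
  simpa [h] using this

end Passage
/-! ### Existence of the time constant -/

section TimeConstant

variable {ι : Type*} [Fintype ι] [DecidableEq ι]

lemma measurePreserving_shiftEdge (p : I) (a : ι → ℤ) :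
    MeasurePreserving (fun S : Set (Edge ι) => shiftEdge a ⁻¹' S)
      (bernoulliSet (Edge ι) p) (bernoulliSet (Edge ι) p) :=
  ⟨measurable_preimage_set _, map_preimage_bernoulliSet p (shiftEdge_injective a)⟩

lemma measurable_ptime_real (x y : ι → ℤ) :
    Measurable fun S : Set (Edge ι) => (ptime S x y : ℝ) :=
  measurable_from_top.comp (measurable_ptime x y)

lemma integrable_of_natCast_le {Ω : Type*} [MeasurableSpace Ω] {P : Measure Ω} [IsFiniteMeasure P]
    {f : Ω → ℕ} (hf : Measurable f) (c : ℕ) (h : ∀ ω, f ω ≤ c) :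
    Integrable (fun ω => (f ω : ℝ)) P := by
  refine Integrable.of_bound (C := c) (measurable_from_top.comp hf).aestronglyMeasurable
    (ae_of_all _ fun ω => ?_)
  simpa using h ω

lemma integrable_ptime (p : I) (x y : ι → ℤ) :
    Integrable (fun S : Set (Edge ι) => (ptime S x y : ℝ)) (bernoulliSet (Edge ι) p) :=
  integrable_of_natCast_le (measurable_ptime x y) _ fun _ => ptime_le_l1 _ x y

/-- The expected passage time. -/
def meanTime (p : I) (x y : ι → ℤ) : ℝ := ∫ S, (ptime S x y : ℝ) ∂bernoulliSet (Edge ι) p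

lemma meanTime_shift (p : I) (a x y : ι → ℤ) :
    meanTime p (x + a) (y + a) = meanTime p x y := by
  have hm := measurePreserving_shiftEdge p a
  have := integral_map (μ := bernoulliSet (Edge ι) p)
    (f := fun S : Set (Edge ι) => (ptime S x y : ℝ)) hm.measurable.aemeasurable
    (measurable_ptime_real x y).aestronglyMeasurable
  rw [hm.map_eq] at this
  simp only [ptime_shift] at this
  exact this.symm

lemma meanTime_nonneg (p : I) (x y : ι → ℤ) : 0 ≤ meanTime p x y :=
  integral_nonneg fun _ => Nat.cast_nonneg _

lemma meanTime_triangle (p : I) (x y z : ι → ℤ) :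
    meanTime p x z ≤ meanTime p x y + meanTime p y z := by
  rw [meanTime, meanTime, meanTime, ← integral_add (integrable_ptime p x y) (integrable_ptime p y z)]
  refine integral_mono (integrable_ptime p x z)
    ((integrable_ptime p x y).add (integrable_ptime p y z)) fun S => ?_
  have := ptime_triangle S x y z
  show (ptime S x z : ℝ) ≤ ptime S x y + ptime S y z
  exact_mod_cast this

lemma meanTime_le_l1 (p : I) (x y : ι → ℤ) : meanTime p x y ≤ l1 (y - x) := by
  have := integral_mono (μ := bernoulliSet (Edge ι) p) (integrable_ptime p x y)
    (integrable_const ((l1 (y - x) : ℕ) : ℝ)) fun _ => by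
      simpa using ptime_le_l1 _ x y
  simpa [meanTime] using this

/-- Triangle inequality and translation invariance; Fekete's lemma then gives the limit of the
normalised means. -/
lemma subadditive_meanTime (p : I) (y : ι → ℤ) :
    Subadditive fun n : ℕ => meanTime p 0 (n • y) := by
  intro m n
  have h := meanTime_triangle p 0 (m • y) ((m + n) • y)
  have h2 := meanTime_shift p (m • y) 0 (n • y)
  rw [zero_add, ← add_smul, add_comm n m] at h2
  simp only
  linarith

/-- The time constant in an integer direction. -/
def intTimeConstant (p : I) (y : ι → ℤ) : ℝ := (subadditive_meanTime p y).lim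

lemma bddBelow_meanTime (p : I) (y : ι → ℤ) :
    BddBelow (Set.range fun n : ℕ => meanTime p 0 (n • y) / n) :=
  ⟨0, by rintro _ ⟨n, rfl⟩; exact div_nonneg (meanTime_nonneg _ _ _) (Nat.cast_nonneg _)⟩

lemma tendsto_meanTime (p : I) (y : ι → ℤ) :
    Tendsto (fun n : ℕ => meanTime p 0 (n • y) / n) atTop (𝓝 (intTimeConstant p y)) :=
  (subadditive_meanTime p y).tendsto_lim (bddBelow_meanTime p y)

lemma intTimeConstant_mul_le (p : I) (y : ι → ℤ) (n : ℕ) :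
    n * intTimeConstant p y ≤ meanTime p 0 (n • y) := by
  rcases Nat.eq_zero_or_pos n with rfl | hn
  · simpa using meanTime_nonneg p _ _
  · have := (subadditive_meanTime p y).lim_le_div (bddBelow_meanTime p y) hn.ne'
    rw [le_div_iff₀ (by exact_mod_cast hn)] at this
    rw [mul_comm]; exact this

lemma intTimeConstant_nonneg (p : I) (y : ι → ℤ) : 0 ≤ intTimeConstant p y :=
  ge_of_tendsto' (tendsto_meanTime p y) fun _ =>
    div_nonneg (meanTime_nonneg _ _ _) (Nat.cast_nonneg _)

/-- A finite window in which the passage time has almost the same mean. -/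
lemma exists_finset_integral_ptime_lt (p : I) (x y : ι → ℤ) {δ : ℝ} (hδ : 0 < δ) :
    ∃ F : Finset (Edge ι),
      ∫ S, (ptime (S ∩ F) x y : ℝ) ∂bernoulliSet (Edge ι) p < meanTime p x y + δ := by
  obtain ⟨f, hf⟩ := Countable.exists_injective_nat (Edge ι)
  have hfin : ∀ k : ℕ, (f ⁻¹' Set.Iio k).Finite := fun k =>
    (Set.finite_Iio k).preimage hf.injOn
  have hlim : Tendsto (fun k : ℕ => ∫ S, (ptime (S ∩ f ⁻¹' Set.Iio k) x y : ℝ)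
      ∂bernoulliSet (Edge ι) p) atTop (𝓝 (meanTime p x y)) := by
    refine tendsto_integral_of_dominated_convergence (fun _ => (l1 (y - x) : ℝ)) (fun k => ?_)
      (integrable_const _) (fun k => ae_of_all _ fun S => ?_) (ae_of_all _ fun S => ?_)
    · exact ((measurable_ptime_real x y).comp (measurable_inter_set _)).aestronglyMeasurable
    · simpa using ptime_le_l1 _ x y
    · obtain ⟨F, hF⟩ := exists_finset_ptime_inter S x y
      refine tendsto_const_nhds.congr' ?_
      filter_upwards [eventually_gt_atTop (F.sup f)] with k hk
      rw [hF]
      intro e he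
      exact lt_of_le_of_lt (Finset.le_sup (f := f) he) hk
  obtain ⟨k, hk⟩ := (hlim.eventually_lt_const (lt_add_of_pos_right _ hδ)).exists
  exact ⟨(hfin k).toFinset, by simpa using hk⟩

/-- The passage time over the `j`-th step of length `N`, in a finite window. -/
def windowTime (F : Finset (Edge ι)) (y : ι → ℤ) (j : ℕ) (S : Set (Edge ι)) : ℕ :=
  ptime (shiftEdge (j • y) ⁻¹' S ∩ F) 0 y

/-- Concatenate the steps `j • y → (j + 1) • y`; forbidding free edges outside a window only
increases each time. -/
lemma ptime_nsmul_le_sum (F : Finset (Edge ι)) (y : ι → ℤ) (n : ℕ) (S : Set (Edge ι)) :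
    ptime S 0 (n • y) ≤ ∑ j ∈ Finset.range n, windowTime F y j S := by
  induction n with
  | zero => simp
  | succ n ih =>
    rw [Finset.sum_range_succ]
    refine (ptime_triangle S 0 (n • y) _).trans (add_le_add ih ?_)
    have h1 := ptime_anti (S := shiftEdge (n • y) ⁻¹' S ∩ F) Set.inter_subset_left 0 y
    rw [ptime_shift, zero_add] at h1
    rwa [succ_nsmul, add_comm (n • y)]

lemma measurable_windowTime (F : Finset (Edge ι)) (y : ι → ℤ) (j : ℕ) :
    Measurable (windowTime F y j) :=
  (measurable_ptime 0 y).comp ((measurable_inter_set _).comp (measurable_preimage_set _))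

lemma identDistrib_windowTime (p : I) (F : Finset (Edge ι)) (y : ι → ℤ) (i j : ℕ) :
    IdentDistrib (fun S => (windowTime F y i S : ℝ)) (fun S => (windowTime F y j S : ℝ))
      (bernoulliSet (Edge ι) p) (bernoulliSet (Edge ι) p) := by
  have hg : Measurable fun S : Set (Edge ι) => (ptime (S ∩ F) 0 y : ℝ) :=
    (measurable_ptime_real 0 y).comp (measurable_inter_set _)
  have h : ∀ j : ℕ, (bernoulliSet (Edge ι) p).map (fun S => (windowTime F y j S : ℝ)) =
      (bernoulliSet (Edge ι) p).map fun S => (ptime (S ∩ F) 0 y : ℝ) := by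
    intro j
    have hm := measurePreserving_shiftEdge p (j • y)
    conv_rhs => rw [← hm.map_eq, Measure.map_map hg hm.measurable]
    rfl
  have hmeas : ∀ j : ℕ, Measurable fun S => (windowTime F y j S : ℝ) := fun j =>
    measurable_from_top.comp (measurable_windowTime F y j)
  exact ⟨(hmeas i).aemeasurable, (hmeas j).aemeasurable, by rw [h i, h j]⟩

/-- Windows that are far apart are disjoint. -/
lemma exists_gap_windows (F : Finset (Edge ι)) {y : ι → ℤ} (hy : y ≠ 0) :
    ∃ m : ℕ, 0 < m ∧ ∀ i j : ℕ, i + m ≤ j →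
      Disjoint (shiftEdge (i • y) '' F) (shiftEdge (j • y) '' (F : Set (Edge ι))) := by
  obtain ⟨l, hl⟩ : ∃ l, y l ≠ 0 := by
    by_contra h
    push Not at h
    exact hy (funext h)
  -- Along a coordinate where `y` is nonzero, translates by more than twice the extent of `F` cannot
  -- meet.
  refine ⟨2 * F.sup (fun e => (e.1 l).natAbs) + 1, by omega, fun i j hij => ?_⟩
  rw [Set.disjoint_left]
  rintro _ ⟨e, he, rfl⟩ ⟨e', he', h⟩
  have h1 : (e.1 l).natAbs ≤ F.sup (fun e => (e.1 l).natAbs) :=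
    Finset.le_sup (f := fun e : Edge ι => (e.1 l).natAbs) he
  have h2 : (e'.1 l).natAbs ≤ F.sup (fun e => (e.1 l).natAbs) :=
    Finset.le_sup (f := fun e : Edge ι => (e.1 l).natAbs) he'
  have h3 := congrFun (congrArg Prod.fst h) l
  simp only [shiftEdge, Pi.add_apply, Pi.smul_apply] at h3
  rw [nsmul_eq_mul, nsmul_eq_mul] at h3
  have h4 : ((j : ℤ) - i) * y l = e.1 l - e'.1 l := by linarith
  have h5 : ((j : ℤ) - i).natAbs * (y l).natAbs = (e.1 l - e'.1 l).natAbs := by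
    rw [← Int.natAbs_mul, h4]
  have h6 : 1 ≤ (y l).natAbs := by omega
  have h7 : ((j : ℤ) - i).natAbs ≤ (e.1 l - e'.1 l).natAbs := by
    rw [← h5]; exact Nat.le_mul_of_pos_right _ h6
  omega

lemma windowTime_eq (F : Finset (Edge ι)) (y : ι → ℤ) (j : ℕ) (S : Set (Edge ι)) :
    windowTime F y j S = windowTime F y j (S ∩ shiftEdge (j • y) '' F) := by
  unfold windowTime
  congr 1
  ext e
  simp only [Set.mem_inter_iff, Set.mem_preimage, Finset.mem_coe]
  constructor
  · rintro ⟨h1, h2⟩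
    exact ⟨⟨h1, e, h2, rfl⟩, h2⟩
  · rintro ⟨⟨h1, _⟩, h2⟩
    exact ⟨h1, h2⟩

lemma indepFun_windowTime (p : I) (F : Finset (Edge ι)) (y : ι → ℤ) {i j : ℕ}
    (h : Disjoint (shiftEdge (i • y) '' F) (shiftEdge (j • y) '' (F : Set (Edge ι)))) :
    IndepFun (fun S => (windowTime F y i S : ℝ)) (fun S => (windowTime F y j S : ℝ))
      (bernoulliSet (Edge ι) p) := by
  have := indepFun_bernoulliSet p h (f := fun S => (windowTime F y i S : ℝ))
    (g := fun S => (windowTime F y j S : ℝ))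
    (measurable_from_top.comp (measurable_windowTime F y i))
    (measurable_from_top.comp (measurable_windowTime F y j))
  simpa only [← windowTime_eq] using this

/-- Grouping by residues modulo `m` leaves in each group only windows at distance at least `m`,
hence pairwise independent. -/
lemma sum_range_mul (m n : ℕ) (f : ℕ → ℝ) :
    ∑ j ∈ Finset.range (n * m), f j =
      ∑ r ∈ Finset.range m, ∑ j ∈ Finset.range n, f (r + j * m) := by
  induction n with
  | zero => simp
  | succ n ih =>
    rw [add_mul, one_mul, Finset.sum_range_add, ih, ← Finset.sum_add_distrib]
    refine Finset.sum_congr rfl fun r _ => ?_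
    rw [Finset.sum_range_succ, add_comm (n * m)]

/-- The law of large numbers for the window times. -/
lemma ae_tendsto_sum_windowTime (p : I) (F : Finset (Edge ι)) {y : ι → ℤ} {m : ℕ}
    (h : ∀ i j : ℕ, i + m ≤ j →
      Disjoint (shiftEdge (i • y) '' F) (shiftEdge (j • y) '' (F : Set (Edge ι)))) :
    ∀ᵐ S ∂bernoulliSet (Edge ι) p,
      Tendsto (fun n : ℕ => (∑ j ∈ Finset.range (n * m), (windowTime F y j S : ℝ)) / n) atTop
        (𝓝 (m * ∫ S, (ptime (S ∩ F) 0 y : ℝ) ∂bernoulliSet (Edge ι) p)) := by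
  -- Pairwise independence is enough for the strong law used here, applied in each residue class.
  have key : ∀ r : ℕ, ∀ᵐ S ∂bernoulliSet (Edge ι) p,
      Tendsto (fun n : ℕ => (∑ j ∈ Finset.range n, (windowTime F y (r + j * m) S : ℝ)) / n) atTop
        (𝓝 (∫ S, (ptime (S ∩ F) 0 y : ℝ) ∂bernoulliSet (Edge ι) p)) := by
    intro r
    have hslln := strong_law_ae_real (μ := bernoulliSet (Edge ι) p)
      (fun j S => (windowTime F y (r + j * m) S : ℝ)) ?_ ?_ ?_
    · have e : ∫ S, (windowTime F y (r + 0 * m) S : ℝ) ∂bernoulliSet (Edge ι) p =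
          ∫ S, (ptime (S ∩ F) 0 y : ℝ) ∂bernoulliSet (Edge ι) p := by
        rw [(identDistrib_windowTime p F y (r + 0 * m) 0).integral_eq]
        have h0 : ∀ S : Set (Edge ι), shiftEdge 0 ⁻¹' S = S := fun S => by ext; simp [shiftEdge]
        simp [windowTime, h0]
      rw [← e]
      exact hslln
    · exact integrable_of_natCast_le (measurable_windowTime F y _) _ fun S => ptime_le_l1 _ 0 y
    · intro i j hij
      rcases lt_or_gt_of_ne hij with hij | hij
      · exact indepFun_windowTime p F y (h _ _ (by nlinarith))
      · exact (indepFun_windowTime p F y (h _ _ (by nlinarith))).symm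
    · intro i
      exact identDistrib_windowTime p F y _ _
  filter_upwards [ae_all_iff.2 key] with S hS
  have := tendsto_finsetSum (Finset.range m) fun r _ => hS r
  simp only [Finset.sum_const, Finset.card_range, nsmul_eq_mul] at this
  refine this.congr fun n => ?_
  rw [sum_range_mul, Finset.sum_div]

lemma ptime_nsmul_add_le (S : Set (Edge ι)) (y : ι → ℤ) (x : ι → ℤ) (m n : ℕ) :
    ptime S x ((m + n) • y) ≤ ptime S x (m • y) + n * l1 y := by
  refine (ptime_triangle S x (m • y) _).trans (add_le_add_right ?_ _)
  refine (ptime_le_l1 S _ _).trans ?_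
  rw [add_smul, add_sub_cancel_left]
  induction n with
  | zero => simp
  | succ n ih =>
    rw [succ_nsmul, add_mul, one_mul]
    exact (l1_add_le _ _).trans (by omega)

/-- The error `δ` is shared in three: the mean over `N` steps is close to its limit, restricting to
a finite window costs little, and the `n % (m * N)` leftover steps have bounded cost. The law of
large numbers for the windows does the rest. -/
lemma ae_eventually_ptime_le (p : I) (y : ι → ℤ) {δ : ℝ} (hδ : 0 < δ) :
    ∀ᵐ S ∂bernoulliSet (Edge ι) p, ∀ᶠ n : ℕ in atTop,
      (ptime S 0 (n • y) : ℝ) ≤ (intTimeConstant p y + δ) * n := by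
  by_cases hy : y = 0
  · subst hy
    refine ae_of_all _ fun S => Eventually.of_forall fun n => ?_
    simp only [smul_zero, ptime_self, Nat.cast_zero]
    have := intTimeConstant_nonneg p (0 : ι → ℤ)
    positivity
  obtain ⟨N, hN, hN0⟩ := (((tendsto_meanTime p y).eventually_lt_const
    (show intTimeConstant p y < intTimeConstant p y + δ / 3 by linarith)).and
    (eventually_gt_atTop 0)).exists
  have hN' : (0 : ℝ) < N := by exact_mod_cast hN0
  rw [div_lt_iff₀ hN'] at hN
  obtain ⟨F, hF⟩ := exists_finset_integral_ptime_lt p 0 (N • y) (show 0 < δ / 3 * N by positivity)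
  have hNy : N • y ≠ 0 := by
    simp only [ne_eq, smul_eq_zero, not_or]; exact ⟨hN0.ne', hy⟩
  obtain ⟨m, hm, hdisj⟩ := exists_gap_windows F hNy
  have hm' : (0 : ℝ) < m := by exact_mod_cast hm
  filter_upwards [ae_tendsto_sum_windowTime p F hdisj] with S hS
  set c := ∫ S, (ptime (S ∩ F) 0 (N • y) : ℝ) ∂bernoulliSet (Edge ι) p with hc
  have hc' : m * c < m * (N * (intTimeConstant p y + 2 * δ / 3)) := by
    refine mul_lt_mul_of_pos_left ?_ hm'
    linarith
  have h1 := (hS.eventually_lt_const hc')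
  have hM : 0 < m * N := Nat.mul_pos hm hN0
  have hdiv : Tendsto (fun n : ℕ => n / (m * N)) atTop atTop :=
    Nat.tendsto_div_const_atTop hM.ne'
  have h2 := hdiv.eventually (h1.and (eventually_gt_atTop 0))
  have h3 : ∀ᶠ n : ℕ in atTop, (m * N * l1 y : ℝ) ≤ δ / 3 * n := by
    have := tendsto_natCast_atTop_atTop (R := ℝ)
    filter_upwards [this.eventually_ge_atTop ((m * N * l1 y : ℝ) / (δ / 3))] with n hn
    rw [div_le_iff₀ (by positivity)] at hn
    linarith
  filter_upwards [h2, h3] with n ⟨h2, h2'⟩ h3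
  set q := n / (m * N) with hq
  have hq' : (0 : ℝ) < q := by exact_mod_cast h2'
  rw [div_lt_iff₀ hq'] at h2
  have h4 : q * (m * N) + n % (m * N) = n := by
    rw [mul_comm]; exact Nat.div_add_mod n (m * N)
  have h5 := ptime_nsmul_add_le S y 0 (q * (m * N)) (n % (m * N))
  rw [h4] at h5
  have h6 := ptime_nsmul_le_sum F (N • y) (q * m) S
  rw [smul_smul, mul_assoc] at h6
  have h7 : n % (m * N) ≤ m * N := (Nat.mod_lt _ hM).le
  have h8 : (n % (m * N)) * l1 y ≤ m * N * l1 y := Nat.mul_le_mul_right _ h7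
  have h9 : (ptime S 0 (n • y) : ℝ) ≤
      ∑ j ∈ Finset.range (q * m), (windowTime F (N • y) j S : ℝ) + m * N * l1 y := by
    have : ptime S 0 (n • y) ≤
      ∑ j ∈ Finset.range (q * m), windowTime F (N • y) j S + m * N * l1 y := by omega
    exact_mod_cast this
  have h10 : (q * (m * N) : ℝ) ≤ n := by exact_mod_cast (by omega : q * (m * N) ≤ n)
  have hν := intTimeConstant_nonneg p y
  calc (ptime S 0 (n • y) : ℝ) ≤ m * (N * (intTimeConstant p y + 2 * δ / 3)) * q + δ / 3 * n := by
        linarith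
    _ = (intTimeConstant p y + 2 * δ / 3) * (q * (m * N)) + δ / 3 * n := by ring
    _ ≤ (intTimeConstant p y + 2 * δ / 3) * n + δ / 3 * n := by gcongr
    _ = _ := by ring

end TimeConstant
-- Almost sure lower limit by a greedy covering argument
section LowerLimit

variable {ι : Type*} [Fintype ι] [DecidableEq ι]

/-- The environments in which the passage times in direction `y` are infinitely often below a
speed strictly smaller than `c`. -/
def slowEvent (y : ι → ℤ) (c : ℝ) : Set (Set (Edge ι)) :=
  {S | ∃ k : ℕ, ∀ N : ℕ, ∃ n : ℕ, N ≤ n ∧ (ptime S 0 (n • y) : ℝ) ≤ (c - 1 / (k + 1)) * n}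

lemma measurableSet_slowEvent (y : ι → ℤ) (c : ℝ) : MeasurableSet (slowEvent y c) := by
  have : slowEvent y c = ⋃ k : ℕ, ⋂ N : ℕ, ⋃ n : ℕ, ⋃ (_ : N ≤ n),
      {S | (ptime S 0 (n • y) : ℝ) ≤ (c - 1 / (k + 1)) * n} := by
    ext S; simp [slowEvent]
  rw [this]
  refine MeasurableSet.iUnion fun k => MeasurableSet.iInter fun N => MeasurableSet.iUnion fun n =>
    MeasurableSet.iUnion fun _ => ?_
  exact measurableSet_le (measurable_ptime_real _ _) measurable_const

/-- A translation changes passage times by at most `2 * l1 a`, negligible against `n`. The definite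
gap `1 / (k + 1)` in the event leaves room for it: it is shrunk to `1 / (k + 2)`. -/
lemma shift_mem_slowEvent {y : ι → ℤ} {c : ℝ} (a : ι → ℤ) {S : Set (Edge ι)}
    (h : S ∈ slowEvent y c) : shiftEdge a ⁻¹' S ∈ slowEvent y c := by
  obtain ⟨k, hk⟩ := h
  refine ⟨k + 1, fun N => ?_⟩
  have hpos : (0 : ℝ) < 1 / (k + 1) - 1 / ((k + 1 : ℕ) + 1) := by
    rw [sub_pos]
    apply one_div_lt_one_div_of_lt (by positivity)
    push_cast; linarith
  obtain ⟨M, hM⟩ := exists_nat_gt ((2 * l1 a : ℝ) / (1 / (k + 1) - 1 / ((k + 1 : ℕ) + 1)))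
  obtain ⟨n, hn, h1⟩ := hk (max N M)
  refine ⟨n, (le_max_left _ _).trans hn, ?_⟩
  have h2 : ptime (shiftEdge a ⁻¹' S) 0 (n • y) ≤ ptime S 0 (n • y) + 2 * l1 a := by
    rw [ptime_shift]
    have e1 := ptime_triangle S (0 + a) 0 (n • y + a)
    have e2 := ptime_triangle S 0 (n • y) (n • y + a)
    have e3 := ptime_le_l1 S (0 + a) 0
    have e4 := ptime_le_l1 S (n • y) (n • y + a)
    simp only [zero_add, zero_sub, l1_neg, add_sub_cancel_left] at e1 e3 e4 ⊢
    omega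
  have h3 : (ptime (shiftEdge a ⁻¹' S) 0 (n • y) : ℝ) ≤ ptime S 0 (n • y) + 2 * l1 a := by
    exact_mod_cast h2
  have h4 : (M : ℝ) ≤ n := by exact_mod_cast (le_max_right _ _).trans hn
  rw [div_lt_iff₀ hpos] at hM
  have h5 : (M : ℝ) * (1 / (k + 1) - 1 / ((k + 1 : ℕ) + 1)) ≤
      n * (1 / (k + 1) - 1 / ((k + 1 : ℕ) + 1)) := mul_le_mul_of_nonneg_right h4 hpos.le
  linarith

lemma shift_mem_slowEvent_iff {y : ι → ℤ} {c : ℝ} (a : ι → ℤ) {S : Set (Edge ι)} :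
    shiftEdge a ⁻¹' S ∈ slowEvent y c ↔ S ∈ slowEvent y c := by
  refine ⟨fun h => ?_, shift_mem_slowEvent a⟩
  have := shift_mem_slowEvent (-a) h
  have e : shiftEdge (-a) ⁻¹' (shiftEdge a ⁻¹' S) = S := by ext e; simp [shiftEdge]
  rwa [e] at this

/-- The vertex `j y` is the start of a fast stretch of at most `N` steps. -/
def FastFrom (y : ι → ℤ) (h : ℝ) (N j : ℕ) (S : Set (Edge ι)) : Prop :=
  ∃ n : ℕ, 1 ≤ n ∧ n ≤ N ∧ (ptime S (j • y) ((j + n) • y) : ℝ) ≤ h * n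

open Classical in
/-- Greedy covering by fast stretches. -/
lemma ptime_le_covering (S : Set (Edge ι)) (y : ι → ℤ) {h : ℝ} (hh : 0 ≤ h) (N K i : ℕ) :
    (ptime S (i • y) ((i + K) • y) : ℝ) ≤
      h * K + l1 y * ((Finset.Ico i (i + K)).filter fun j => ¬ FastFrom y h N j S).card
        + l1 y * N := by
  induction K using Nat.strong_induction_on generalizing i with
  | _ K ih =>
    -- A stretch may overrun the end when fewer than `N` steps remain; these are paid at full price,
    -- whence the last term.
    rcases le_or_gt K N with hK | hK
    · have h1 := ptime_nsmul_add_le S y (i • y) i K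
      rw [ptime_self, zero_add] at h1
      have h2 : (ptime S (i • y) ((i + K) • y) : ℝ) ≤ K * l1 y := by exact_mod_cast h1
      have h3 : (K * l1 y : ℝ) ≤ l1 y * N := by
        rw [mul_comm]; gcongr
      have : 0 ≤ h * K + l1 y *
          ((Finset.Ico i (i + K)).filter fun j => ¬ FastFrom y h N j S).card := by positivity
      linarith
    -- From a fast vertex, follow its fast stretch; from any other, take one step at price at most
    -- `l1 y` and count the vertex.
    by_cases hf : FastFrom y h N i S
    · obtain ⟨n, hn1, hn2, hn3⟩ := hf
      have h1 := ih (K - n) (by omega) (i + n)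
      have e : i + n + (K - n) = i + K := by omega
      rw [e] at h1
      have h2 : (ptime S (i • y) ((i + K) • y) : ℝ) ≤
          ptime S (i • y) ((i + n) • y) + ptime S ((i + n) • y) ((i + K) • y) := by
        exact_mod_cast ptime_triangle S _ _ _
      have h3 : (((Finset.Ico (i + n) (i + K)).filter fun j => ¬ FastFrom y h N j S).card : ℝ) ≤
          ((Finset.Ico i (i + K)).filter fun j => ¬ FastFrom y h N j S).card := by
        exact_mod_cast Finset.card_le_card (Finset.filter_subset_filter _
          (Finset.Ico_subset_Ico_left (by omega)))
      have h4 : (l1 y : ℝ) *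
          ((Finset.Ico (i + n) (i + K)).filter fun j => ¬ FastFrom y h N j S).card ≤ l1 y *
          ((Finset.Ico i (i + K)).filter fun j => ¬ FastFrom y h N j S).card := by gcongr
      rw [Nat.cast_sub (by omega)] at h1
      linarith
    · have h1 := ih (K - 1) (by omega) (i + 1)
      have e : i + 1 + (K - 1) = i + K := by omega
      rw [e] at h1
      have h2 : (ptime S (i • y) ((i + K) • y) : ℝ) ≤
          ptime S (i • y) ((i + 1) • y) + ptime S ((i + 1) • y) ((i + K) • y) := by
        exact_mod_cast ptime_triangle S _ _ _
      have h5 : (ptime S (i • y) ((i + 1) • y) : ℝ) ≤ l1 y := by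
        have := ptime_nsmul_add_le S y (i • y) i 1
        rw [ptime_self, zero_add, one_mul] at this
        exact_mod_cast this
      have h3 : ((Finset.Ico i (i + K)).filter fun j => ¬ FastFrom y h N j S) =
          insert i ((Finset.Ico (i + 1) (i + K)).filter fun j => ¬ FastFrom y h N j S) := by
        rw [← Finset.insert_Ico_add_one_left_eq_Ico (by omega : i < i + K), Finset.filter_insert,
          if_pos hf]
      rw [h3, Finset.card_insert_of_notMem (by simp)]
      rw [Nat.cast_sub (by omega)] at h1
      have h6 : h * (K - (1 : ℕ)) ≤ h * K := by push_cast; nlinarith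
      push_cast at h1 ⊢
      push_cast at h6
      linarith

lemma fastFrom_shift (y : ι → ℤ) (h : ℝ) (N j : ℕ) (S : Set (Edge ι)) :
    FastFrom y h N j S ↔ FastFrom y h N 0 (shiftEdge (j • y) ⁻¹' S) := by
  have h1 : ∀ n : ℕ, ptime (shiftEdge (j • y) ⁻¹' S) (0 • y) ((0 + n) • y) =
      ptime S (j • y) ((j + n) • y) := fun n => by
    rw [ptime_shift, zero_smul, zero_add, zero_add, add_smul, add_comm (n • y)]
  simp only [FastFrom, h1]

open Classical in
/-- The speed reached from every vertex. -/
def reachedSpeed (p : I) (y : ι → ℤ) (c δ : ℝ) (S : Set (Edge ι)) : ℝ :=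
  if S ∈ slowEvent y c then c else intTimeConstant p y + δ

/-- Invariance of the speed makes `no fast stretch from j • y` the translate of one event at the
origin, so that the mean number of bad vertices among `K` is `K` times one probability. -/
lemma reachedSpeed_shift (p : I) (y : ι → ℤ) (c δ : ℝ) (a : ι → ℤ) (S : Set (Edge ι)) :
    reachedSpeed p y c δ (shiftEdge a ⁻¹' S) = reachedSpeed p y c δ S := by
  unfold reachedSpeed
  by_cases h : S ∈ slowEvent y c
  · rw [if_pos h, if_pos (shift_mem_slowEvent a h)]
  · rw [if_neg h, if_neg (fun h' => h ((shift_mem_slowEvent_iff a).1 h'))]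

lemma measurable_reachedSpeed (p : I) (y : ι → ℤ) (c δ : ℝ) :
    Measurable (reachedSpeed p y c δ) :=
  Measurable.ite (measurableSet_slowEvent y c) measurable_const measurable_const

/-- On the slow event the speed `c` is reached by definition; off it, `intTimeConstant p y + δ` is
reached by the upper bound. -/
lemma ae_exists_fastFrom (p : I) (y : ι → ℤ) (c : ℝ) {δ : ℝ} (hδ : 0 < δ) :
    ∀ᵐ S ∂bernoulliSet (Edge ι) p, ∃ N, FastFrom y (reachedSpeed p y c δ S) N 0 S := by
  filter_upwards [ae_eventually_ptime_le p y hδ] with S hS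
  by_cases hA : S ∈ slowEvent y c
  · obtain ⟨k, hk⟩ := hA
    obtain ⟨n, hn, h1⟩ := hk 1
    refine ⟨n, n, hn, le_rfl, ?_⟩
    simp only [zero_smul, zero_add]
    rw [reachedSpeed, if_pos ⟨k, hk⟩]
    refine h1.trans (mul_le_mul_of_nonneg_right ?_ (Nat.cast_nonneg n))
    have : (0 : ℝ) < 1 / (k + 1) := by positivity
    linarith
  · obtain ⟨n, h1, hn⟩ := (hS.and (eventually_ge_atTop 1)).exists
    refine ⟨n, n, hn, le_rfl, ?_⟩
    simp only [zero_smul, zero_add]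
    rw [reachedSpeed, if_neg hA]
    exact h1

/-- The environments without fast stretch from the origin. -/
def noFastEvent (p : I) (y : ι → ℤ) (c δ : ℝ) (N : ℕ) : Set (Set (Edge ι)) :=
  {S | ¬ FastFrom y (reachedSpeed p y c δ S) N 0 S}

lemma measurableSet_noFastEvent (p : I) (y : ι → ℤ) (c δ : ℝ) (N : ℕ) :
    MeasurableSet (noFastEvent p y c δ N) := by
  have : noFastEvent p y c δ N = (⋃ n : ℕ, ⋃ (_ : 1 ≤ n), ⋃ (_ : n ≤ N),
      {S : Set (Edge ι) | (ptime S (0 • y) ((0 + n) • y) : ℝ) ≤ reachedSpeed p y c δ S * n})ᶜ := by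
    ext S; simp [noFastEvent, FastFrom]
  rw [this]
  refine (MeasurableSet.iUnion fun n => MeasurableSet.iUnion fun _ =>
    MeasurableSet.iUnion fun _ => ?_).compl
  exact measurableSet_le (measurable_ptime_real _ _)
    ((measurable_reachedSpeed p y c δ).mul measurable_const)

lemma tendsto_noFastEvent (p : I) (y : ι → ℤ) (c : ℝ) {δ : ℝ} (hδ : 0 < δ) :
    Tendsto (fun N => (bernoulliSet (Edge ι) p).real (noFastEvent p y c δ N)) atTop (𝓝 0) := by
  have h := tendsto_measure_iInter_atTop (μ := bernoulliSet (Edge ι) p)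
    (s := noFastEvent p y c δ) (fun N => (measurableSet_noFastEvent p y c δ N).nullMeasurableSet)
    (fun N M hNM S hS => fun ⟨n, h1, h2, h3⟩ => hS ⟨n, h1, h2.trans hNM, h3⟩)
    ⟨0, measure_ne_top _ _⟩
  have h0 : bernoulliSet (Edge ι) p (⋂ N, noFastEvent p y c δ N) = 0 := by
    have := ae_exists_fastFrom p y c hδ
    rw [ae_iff] at this
    rw [← this]
    congr 1
    ext S; simp [noFastEvent]
  rw [h0] at h
  have := (ENNReal.tendsto_toReal ENNReal.zero_ne_top).comp h
  exact this

/-- Integrate the covering bound over `K` steps. The mean of the left side is at least `K` times the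
time constant, while on the right the speed drops to `c` on the slow event. Dividing by `K` and
letting `K → ∞` removes the boundary term `l1 y * N`. -/
lemma measureReal_slowEvent_le (p : I) (y : ι → ℤ) {c : ℝ} (hc : 0 ≤ c) {δ : ℝ} (hδ : 0 < δ)
    (N : ℕ) :
    intTimeConstant p y ≤ intTimeConstant p y + δ -
      (intTimeConstant p y + δ - c) * (bernoulliSet (Edge ι) p).real (slowEvent y c)
      + l1 y * (bernoulliSet (Edge ι) p).real (noFastEvent p y c δ N) := by
  classical
  set ν := intTimeConstant p y with hν
  have hν0 := intTimeConstant_nonneg p y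
  set Q := bernoulliSet (Edge ι) p with hQ
  have hind : ∀ {A : Set (Set (Edge ι))}, MeasurableSet A →
      Integrable (A.indicator (fun _ => (1 : ℝ))) Q := fun hA =>
    (integrable_const _).indicator hA
  have hshift : ∀ j : ℕ, Integrable (fun S : Set (Edge ι) =>
      (noFastEvent p y c δ N).indicator (fun _ => (1 : ℝ)) (shiftEdge (j • y) ⁻¹' S)) Q := fun j =>
    (measurePreserving_shiftEdge p (j • y)).integrable_comp_of_integrable
      (hind (measurableSet_noFastEvent p y c δ N))
  have key : ∀ K : ℕ, (K : ℝ) * ν ≤ K * (ν + δ - (ν + δ - c) * Q.real (slowEvent y c)) +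
      l1 y * (K * Q.real (noFastEvent p y c δ N)) + l1 y * N := by
    intro K
    have hpt : ∀ S : Set (Edge ι), (ptime S 0 (K • y) : ℝ) ≤
        ((ν + δ) * K - (ν + δ - c) * K * (slowEvent y c).indicator (fun _ => (1 : ℝ)) S) +
        l1 y * (∑ j ∈ Finset.range K, (noFastEvent p y c δ N).indicator (fun _ => (1 : ℝ))
          (shiftEdge (j • y) ⁻¹' S)) + l1 y * N := by
      intro S
      have h0 : 0 ≤ reachedSpeed p y c δ S := by
        rw [reachedSpeed]; split_ifs <;> linarith
      have h1 := ptime_le_covering S y h0 N K 0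
      simp only [zero_smul, zero_add] at h1
      have h2 : ((Finset.Ico 0 K).filter
          fun j => ¬ FastFrom y (reachedSpeed p y c δ S) N j S).card =
          ∑ j ∈ Finset.range K, (noFastEvent p y c δ N).indicator (fun _ => (1 : ℝ))
          (shiftEdge (j • y) ⁻¹' S) := by
        rw [← Finset.range_eq_Ico, Finset.card_filter]
        push_cast
        refine Finset.sum_congr rfl fun j _ => ?_
        rw [Set.indicator_apply]
        simp only [noFastEvent, Set.mem_ofPred_eq, reachedSpeed_shift]
        rw [fastFrom_shift]
      rw [h2] at h1
      have h3 : reachedSpeed p y c δ S * K =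
          (ν + δ) * K - (ν + δ - c) * K * (slowEvent y c).indicator (fun _ => (1 : ℝ)) S := by
        rw [reachedSpeed, Set.indicator_apply]
        split_ifs <;> ring
      linarith
    have hA : Integrable (fun S => (ν + δ) * K -
        (ν + δ - c) * K * (slowEvent y c).indicator (fun _ => (1 : ℝ)) S) Q :=
      (integrable_const _).sub ((hind (measurableSet_slowEvent y c)).const_mul _)
    have hB : Integrable (fun S => (l1 y : ℝ) * ∑ j ∈ Finset.range K,
        (noFastEvent p y c δ N).indicator (fun _ => (1 : ℝ)) (shiftEdge (j • y) ⁻¹' S)) Q :=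
      (integrable_finsetSum _ fun j _ => hshift j).const_mul _
    have hAB : Integrable (fun S => ((ν + δ) * K -
        (ν + δ - c) * K * (slowEvent y c).indicator (fun _ => (1 : ℝ)) S) +
        (l1 y : ℝ) * ∑ j ∈ Finset.range K,
        (noFastEvent p y c δ N).indicator (fun _ => (1 : ℝ)) (shiftEdge (j • y) ⁻¹' S)) Q :=
      hA.add hB
    have hint := integral_mono (μ := Q) (integrable_ptime p 0 (K • y))
      (hAB.add (integrable_const ((l1 y : ℝ) * N))) hpt
    rw [integral_add' hAB (integrable_const _), integral_add hA hB,
      integral_sub (integrable_const _) ((hind (measurableSet_slowEvent y c)).const_mul _),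
      integral_const_mul, integral_const_mul, integral_const_mul, integral_finsetSum _ fun j _ => hshift j] at hint
    have hj : ∀ j : ℕ, ∫ S, (noFastEvent p y c δ N).indicator (fun _ => (1 : ℝ))
        (shiftEdge (j • y) ⁻¹' S) ∂Q = Q.real (noFastEvent p y c δ N) := by
      intro j
      have hm := measurePreserving_shiftEdge p (j • y)
      have h5 := integral_map (μ := Q) (f := (noFastEvent p y c δ N).indicator (fun _ => (1 : ℝ)))
        hm.measurable.aemeasurable
        (measurable_const.indicator (measurableSet_noFastEvent p y c δ N)).aestronglyMeasurable
      rw [hm.map_eq] at h5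
      rw [← h5, integral_indicator_const _ (measurableSet_noFastEvent p y c δ N),
        smul_eq_mul, mul_one]
    have hsum : ∑ j ∈ Finset.range K, ∫ S, (noFastEvent p y c δ N).indicator (fun _ => (1 : ℝ))
        (shiftEdge (j • y) ⁻¹' S) ∂Q = K * Q.real (noFastEvent p y c δ N) := by
      rw [Finset.sum_congr rfl fun j _ => hj j]
      simp
    rw [hsum] at hint
    simp only [integral_const, probReal_univ, integral_indicator_const _ (measurableSet_slowEvent y c),
      smul_eq_mul, mul_one, one_mul] at hint
    have := intTimeConstant_mul_le p y K
    unfold meanTime at this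
    linarith
  -- Otherwise a large `K` makes the linear gap exceed the boundary term `l1 y * N`.
  by_contra hcon
  push Not at hcon
  set r := ν + δ - (ν + δ - c) * Q.real (slowEvent y c) + l1 y * Q.real (noFastEvent p y c δ N)
  obtain ⟨K, hK⟩ := exists_nat_gt ((l1 y * N : ℝ) / (ν - r))
  rw [div_lt_iff₀ (by linarith)] at hK
  have := key K
  have e : (K : ℝ) * (ν - r) = K * ν - (K * (ν + δ - (ν + δ - c) * Q.real (slowEvent y c)) +
      l1 y * (K * Q.real (noFastEvent p y c δ N))) := by
    simp only [r]; ring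
  linarith

/-- Letting `N → ∞` in the preceding inequality removes the bad vertices and leaves `(ν + δ - c) *
P(slow) ≤ δ`, with `ν` the time constant; for small `δ` this forces a null probability. For `c < 0`
the event is empty, passage times being non-negative. -/
lemma measure_slowEvent (p : I) (y : ι → ℤ) {c : ℝ} (hc : c < intTimeConstant p y) :
    bernoulliSet (Edge ι) p (slowEvent y c) = 0 := by
  set Q := bernoulliSet (Edge ι) p
  rcases lt_or_ge c 0 with hc0 | hc0
  · have : slowEvent y c = (∅ : Set (Set (Edge ι))) := by
      rw [Set.eq_empty_iff_forall_notMem]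
      rintro S ⟨k, hk⟩
      obtain ⟨n, hn, h⟩ := hk 1
      have h1 : (1 : ℝ) ≤ n := by exact_mod_cast hn
      have h2 : (0 : ℝ) < 1 / (k + 1) := by positivity
      have h3 : (c - 1 / (k + 1)) * n < 0 := mul_neg_of_neg_of_pos (by linarith) (by linarith)
      have h4 : (0 : ℝ) ≤ ptime S 0 (n • y) := Nat.cast_nonneg _
      linarith
    rw [this]; simp
  have h1 : ∀ δ : ℝ, 0 < δ → (intTimeConstant p y + δ - c) * Q.real (slowEvent y c) ≤ δ := by
    intro δ hδ
    have hlim := ((tendsto_noFastEvent p y c hδ).const_mul (l1 y : ℝ)).const_add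
      (intTimeConstant p y + δ - (intTimeConstant p y + δ - c) * Q.real (slowEvent y c))
    have := ge_of_tendsto' hlim fun N => measureReal_slowEvent_le p y hc0 hδ N
    rw [mul_zero, add_zero] at this
    linarith
  have h2 : Q.real (slowEvent y c) ≤ 0 := by
    by_contra hcon
    push Not at hcon
    set a := Q.real (slowEvent y c)
    have hpos : 0 < (intTimeConstant p y - c) * a := mul_pos (by linarith) hcon
    have := h1 _ (half_pos hpos)
    nlinarith
  have h3 : Q.real (slowEvent y c) = 0 := le_antisymm h2 measureReal_nonneg
  rwa [measureReal_eq_zero_iff] at h3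

/-- The time constant exists in integer directions. -/
theorem ae_tendsto_ptime_nsmul (p : I) (y : ι → ℤ) :
    ∀ᵐ S ∂bernoulliSet (Edge ι) p,
      Tendsto (fun n : ℕ => (ptime S 0 (n • y) : ℝ) / n) atTop (𝓝 (intTimeConstant p y)) := by
  have h1 : ∀ k : ℕ, ∀ᵐ S ∂bernoulliSet (Edge ι) p, ∀ᶠ n : ℕ in atTop,
      (ptime S 0 (n • y) : ℝ) ≤ (intTimeConstant p y + 1 / (k + 1)) * n := fun k =>
    ae_eventually_ptime_le p y (by positivity)
  have h2 : ∀ k : ℕ, ∀ᵐ S ∂bernoulliSet (Edge ι) p,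
      S ∉ slowEvent y (intTimeConstant p y - 1 / (k + 1)) := fun k =>
    measure_eq_zero_iff_ae_notMem.1 (measure_slowEvent p y (by
      have : (0 : ℝ) < 1 / (k + 1) := by positivity
      linarith))
  filter_upwards [ae_all_iff.2 h1, ae_all_iff.2 h2] with S hS1 hS2
  rw [Metric.tendsto_atTop']
  intro δ hδ
  obtain ⟨k, hk⟩ := exists_nat_one_div_lt (half_pos hδ)
  have h3 := hS2 k
  simp only [slowEvent, Set.mem_ofPred_eq, not_exists, not_forall, not_and, not_le] at h3
  obtain ⟨N, hN⟩ := h3 k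
  obtain ⟨M, hM⟩ := eventually_atTop.1 (hS1 k)
  refine ⟨max N M, fun n hn => ?_⟩
  have hn0 : (0 : ℝ) < n := by
    exact_mod_cast lt_of_le_of_lt (Nat.zero_le _) hn
  have h4 := hN n ((le_max_left _ _).trans hn.le)
  have h5 := hM n ((le_max_right _ _).trans hn.le)
  rw [← lt_div_iff₀ hn0] at h4
  rw [← div_le_iff₀ hn0] at h5
  rw [Real.dist_eq, abs_lt]
  constructor <;> linarith

end LowerLimit
-- Time constant in real directions
section RealDirection

variable {ι : Type*} [Fintype ι] [DecidableEq ι]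

/-- Coordinate-wise integer part of `n z`. -/
def floorVec (z : ι → ℝ) (n : ℕ) : ι → ℤ := fun i => ⌊(n : ℝ) * z i⌋

lemma l1_cast (x : ι → ℤ) : (l1 x : ℝ) = ∑ i, |(x i : ℝ)| := by
  simp [l1, Nat.cast_natAbs]

lemma ptime_abs_sub_le (S : Set (Edge ι)) (x y y' : ι → ℤ) :
    |(ptime S x y : ℝ) - ptime S x y'| ≤ l1 (y' - y) := by
  have h1 := (ptime_triangle S x y y').trans (add_le_add_right (ptime_le_l1 S y y') _)
  have h2 := (ptime_triangle S x y' y).trans (add_le_add_right (ptime_le_l1 S y' y) _)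
  rw [l1_sub_comm] at h2
  have h1' : (ptime S x y' : ℝ) ≤ ptime S x y + l1 (y' - y) := by exact_mod_cast h1
  have h2' : (ptime S x y : ℝ) ≤ ptime S x y' + l1 (y' - y) := by exact_mod_cast h2
  rw [abs_le]
  constructor <;> linarith

/-- Rounding `q z` costs at most one per coordinate and is repeated `n / q` times; the remainder `n
% q` costs a bounded amount. -/
lemma l1_floorVec_sub_le (z : ι → ℝ) {q : ℕ} (hq : 0 < q) (n : ℕ) :
    (l1 ((n / q) • floorVec z q - floorVec z n) : ℝ) ≤
      n * (Fintype.card ι / q) + ∑ i, (1 + q * |z i|) := by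
  have hq' : (0 : ℝ) < q := by exact_mod_cast hq
  rw [l1_cast]
  have e : (n * (Fintype.card ι / q) : ℝ) = ∑ _i : ι, (n / q : ℝ) := by
    rw [Finset.sum_const, Finset.card_univ, nsmul_eq_mul]; ring
  rw [e, ← Finset.sum_add_distrib]
  refine Finset.sum_le_sum fun i _ => ?_
  have h1 := Int.floor_le ((n : ℝ) * z i)
  have h2 := Int.lt_floor_add_one ((n : ℝ) * z i)
  have h3 := Int.floor_le ((q : ℝ) * z i)
  have h4 := Int.lt_floor_add_one ((q : ℝ) * z i)
  have h5 : ((n / q : ℕ) : ℝ) * q + (n % q : ℕ) = n := by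
    have := Nat.div_add_mod n q
    rw [mul_comm]
    exact_mod_cast this
  have h6 : ((n / q : ℕ) : ℝ) ≤ n / q := Nat.cast_div_le
  have h7 : ((n % q : ℕ) : ℝ) ≤ q := by exact_mod_cast (Nat.mod_lt _ hq).le
  have h8 : |((n % q : ℕ) : ℝ) * z i| ≤ q * |z i| := by
    rw [abs_mul, Nat.abs_cast]; gcongr
  have h9 := abs_le.1 h8
  have hk : (0 : ℝ) ≤ ((n / q : ℕ) : ℝ) := Nat.cast_nonneg _
  simp only [Pi.sub_apply, Pi.smul_apply, floorVec]
  rw [nsmul_eq_mul]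
  generalize n / q = k at *
  generalize n % q = r at *
  push_cast
  have h10 : (n : ℝ) * z i = (k : ℝ) * (q * z i) + (r : ℝ) * z i := by
    rw [← h5]; ring
  have h11 : (k : ℝ) * (⌊(q : ℝ) * z i⌋ : ℝ) ≤ (k : ℝ) * (q * z i) :=
    mul_le_mul_of_nonneg_left h3 hk
  have h12 : (k : ℝ) * (q * z i) ≤ (k : ℝ) * (⌊(q : ℝ) * z i⌋ + 1) :=
    mul_le_mul_of_nonneg_left h4.le hk
  rw [abs_le]
  constructor <;> linarith

/-- Passage times are Lipschitz in the end point, so the integer direction `floorVec z q`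
approximates the direction `z` up to a relative error of order `1 / q`. -/
lemma abs_div_sub_div_le (p : I) (z : ι → ℝ) {q : ℕ} (hq : 0 < q) {S : Set (Edge ι)}
    (hS : Tendsto (fun n : ℕ => (ptime S 0 (n • floorVec z q) : ℝ) / n) atTop
      (𝓝 (intTimeConstant p (floorVec z q)))) {η : ℝ} (hη : 0 < η) :
    ∀ᶠ n : ℕ in atTop, |(ptime S 0 (floorVec z n) : ℝ) / n -
      intTimeConstant p (floorVec z q) / q| ≤ Fintype.card ι / q + η := by
  have hq' : (0 : ℝ) < q := by exact_mod_cast hq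
  have hdiv : Tendsto (fun n : ℕ => n / q) atTop atTop := Nat.tendsto_div_const_atTop hq.ne'
  have hr : Tendsto (fun n : ℕ => ((n / q : ℕ) : ℝ) / n) atTop (𝓝 (1 / q)) := by
    have h := (tendsto_nat_floor_mul_div_atTop (R := ℝ) (a := 1 / q) (by positivity)).comp
      (tendsto_natCast_atTop_atTop (R := ℝ))
    refine h.congr fun n => ?_
    have e : (1 / (q : ℝ) * n) = (n : ℝ) / q := by ring
    simp only [Function.comp_apply]
    rw [e, Nat.floor_div_natCast, Nat.floor_natCast]
  have h1 : Tendsto (fun n : ℕ => (ptime S 0 ((n / q) • floorVec z q) : ℝ) / n) atTop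
      (𝓝 (intTimeConstant p (floorVec z q) / q)) := by
    have := (hS.comp hdiv).mul hr
    rw [mul_one_div] at this
    refine this.congr' ?_
    filter_upwards [eventually_ge_atTop q] with n hn
    have : 0 < n / q := Nat.div_pos hn hq
    have h2 : ((n / q : ℕ) : ℝ) ≠ 0 := by exact_mod_cast this.ne'
    simp only [Function.comp_apply]
    field_simp
  have h2 : Tendsto (fun n : ℕ => (∑ i, (1 + q * |z i|)) / (n : ℝ)) atTop (𝓝 0) :=
    tendsto_const_div_atTop_nhds_zero_nat _
  filter_upwards [(Metric.tendsto_atTop'.1 h1 (η / 2) (by positivity)).elim fun N hN =>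
      (eventually_gt_atTop N).mono hN, h2.eventually_lt_const (half_pos hη),
      eventually_gt_atTop 0] with n h3 h4 h5
  have hn : (0 : ℝ) < n := by exact_mod_cast h5
  rw [Real.dist_eq] at h3
  have h6 := (ptime_abs_sub_le S 0 (floorVec z n) ((n / q) • floorVec z q)).trans
    (l1_floorVec_sub_le z hq n)
  have h7 : |(ptime S 0 (floorVec z n) : ℝ) / n - ptime S 0 ((n / q) • floorVec z q) / n| ≤
      Fintype.card ι / q + (∑ i, (1 + q * |z i|)) / n := by
    rw [← sub_div, abs_div, abs_of_pos hn, div_le_iff₀ hn]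
    refine h6.trans (le_of_eq ?_)
    field_simp
  have h8 := abs_sub_le ((ptime S 0 (floorVec z n) : ℝ) / n)
    (ptime S 0 ((n / q) • floorVec z q) / n) (intTimeConstant p (floorVec z q) / q)
  linarith

/-- Existence of the time constant in every direction. -/
theorem exists_timeConstant (p : I) (z : ι → ℝ) :
    ∃ m : ℝ, ∀ᵐ S ∂bernoulliSet (Edge ι) p,
      Tendsto (fun n : ℕ => (ptime S 0 (floorVec z n) : ℝ) / n) atTop (𝓝 m) := by
  set d : ℝ := (Fintype.card ι : ℝ)
  have hae : ∀ᵐ S ∂bernoulliSet (Edge ι) p, ∀ y : ι → ℤ,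
      Tendsto (fun n : ℕ => (ptime S 0 (n • y) : ℝ) / n) atTop (𝓝 (intTimeConstant p y)) :=
    ae_all_iff.2 fun y => ae_tendsto_ptime_nsmul p y
  have hlim : ∀ S : Set (Edge ι), (∀ y : ι → ℤ, Tendsto
      (fun n : ℕ => (ptime S 0 (n • y) : ℝ) / n) atTop (𝓝 (intTimeConstant p y))) →
      ∃ m : ℝ, Tendsto (fun n : ℕ => (ptime S 0 (floorVec z n) : ℝ) / n) atTop (𝓝 m) := by
    intro S hS
    refine cauchySeq_tendsto_of_complete (Metric.cauchySeq_iff'.2 fun δ hδ => ?_)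
    obtain ⟨q, hq⟩ := exists_nat_gt (d / (δ / 8))
    have hq0 : 0 < q + 1 := Nat.succ_pos q
    have hqd : d / (q + 1 : ℕ) ≤ δ / 8 := by
      rw [div_lt_iff₀ (by positivity)] at hq
      rw [div_le_iff₀ (by positivity)]
      push_cast; nlinarith
    obtain ⟨N, hN⟩ := eventually_atTop.1
      (abs_div_sub_div_le p z hq0 (hS _) (show 0 < δ / 8 by positivity))
    refine ⟨N, fun n hn => ?_⟩
    have h1 := hN n hn
    have h2 := hN N le_rfl
    rw [Real.dist_eq]
    have h3 := abs_sub_le ((ptime S 0 (floorVec z n) : ℝ) / n)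
      (intTimeConstant p (floorVec z (q + 1)) / (q + 1 : ℕ)) ((ptime S 0 (floorVec z N) : ℝ) / N)
    rw [abs_sub_comm (intTimeConstant p (floorVec z (q + 1)) / ((q + 1 : ℕ) : ℝ))] at h3
    linarith
  -- The limit is also that of `intTimeConstant p (floorVec z q) / q`, which is deterministic; hence
  -- it does not depend on the environment.
  have huniq : ∀ S : Set (Edge ι), (∀ y : ι → ℤ, Tendsto
      (fun n : ℕ => (ptime S 0 (n • y) : ℝ) / n) atTop (𝓝 (intTimeConstant p y))) →
      ∀ m : ℝ, Tendsto (fun n : ℕ => (ptime S 0 (floorVec z n) : ℝ) / n) atTop (𝓝 m) →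
      Tendsto (fun q : ℕ => intTimeConstant p (floorVec z q) / q) atTop (𝓝 m) := by
    intro S hS m hm
    rw [tendsto_iff_dist_tendsto_zero]
    refine squeeze_zero' (Eventually.of_forall fun _ => dist_nonneg) (g := fun q : ℕ => d / q) ?_
      (tendsto_const_div_atTop_nhds_zero_nat _)
    filter_upwards [eventually_gt_atTop 0] with q hq
    rw [Real.dist_eq, abs_sub_comm]
    refine le_of_forall_pos_le_add fun η hη => ?_
    exact le_of_tendsto ((hm.sub_const _).abs) (abs_div_sub_div_le p z hq (hS _) hη)
  obtain ⟨S₀, hS₀⟩ := hae.exists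
  obtain ⟨m, hm⟩ := hlim S₀ hS₀
  refine ⟨m, ?_⟩
  filter_upwards [hae] with S hS
  obtain ⟨m', hm'⟩ := hlim S hS
  rwa [tendsto_nhds_unique (huniq S₀ hS₀ m hm) (huniq S hS m' hm')]

end RealDirection
/-! ### Exponential moments of the savings -/

section Weights

/-- A sum of products is at most the product of the sums. -/
lemma tsum_pi_prod_le {ι : Type*} [Fintype ι] [DecidableEq ι] (f : ι → ℤ → ℝ≥0∞) :
    ∑' x : ι → ℤ, ∏ i, f i (x i) ≤ ∏ i, ∑' n, f i n := by
  classical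
  rw [ENNReal.tsum_eq_iSup_sum]
  refine iSup_le fun F => ?_
  have hF : F ⊆ Fintype.piFinset fun i => F.image fun x => x i := by
    intro x hx
    rw [Fintype.mem_piFinset]
    exact fun i => Finset.mem_image_of_mem _ hx
  calc ∑ x ∈ F, ∏ i, f i (x i)
      ≤ ∑ x ∈ Fintype.piFinset fun i => F.image fun x => x i, ∏ i, f i (x i) :=
        Finset.sum_le_sum_of_subset hF
    _ = ∏ i, ∑ n ∈ F.image fun x => x i, f i n := (Finset.prod_univ_sum _ _).symm
    _ ≤ _ := Finset.prod_le_prod' fun i _ => ENNReal.sum_le_tsum _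

lemma exp_neg_le_one_sub {a : ℝ} (h0 : 0 ≤ a) (h1 : a ≤ 1) : Real.exp (-a) ≤ 1 - a / 2 := by
  have h2 : Real.exp (-a) * (1 + a) ≤ 1 := by
    have := Real.add_one_le_exp a
    rw [Real.exp_neg, inv_mul_le_iff₀ (Real.exp_pos a)]
    linarith
  nlinarith [Real.exp_pos (-a)]

lemma tsum_ofReal_exp_neg_le {a : ℝ} (h0 : 0 < a) (h1 : a ≤ 1) :
    ∑' n : ℕ, ENNReal.ofReal (Real.exp (-(a * n))) ≤ ENNReal.ofReal (2 / a) := by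
  have h2 := exp_neg_le_one_sub h0.le h1
  have h3 : Real.exp (-a) < 1 := by linarith
  have e : ∀ n : ℕ, Real.exp (-(a * n)) = Real.exp (-a) ^ n := fun n => by
    rw [← Real.exp_nat_mul]; ring_nf
  simp_rw [e]
  rw [← ENNReal.ofReal_tsum_of_nonneg (fun n => by positivity)
    (summable_geometric_of_lt_one (Real.exp_pos _).le h3),
    tsum_geometric_of_lt_one (Real.exp_pos _).le h3]
  refine ENNReal.ofReal_le_ofReal ?_
  rw [inv_eq_one_div, div_le_div_iff₀ (by linarith) h0]
  linarith

lemma tsum_int_eq (f : ℤ → ℝ≥0∞) :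
    ∑' n : ℤ, f n = ∑' n : ℕ, f n + ∑' n : ℕ, f (-((n : ℤ) + 1)) :=
  (HasSum.of_nat_of_neg_add_one ENNReal.summable.hasSum ENNReal.summable.hasSum).tsum_eq

/-- One-dimensional weight of a horizontal displacement. -/
def horWeight (θ : ℝ) (n : ℤ) : ℝ≥0∞ :=
  ENNReal.ofReal (Real.exp (-(|(n : ℝ)| - n) / 2 - θ * n))

/-- One-dimensional weight of a vertical displacement. -/
def verWeight (n : ℤ) : ℝ≥0∞ := ENNReal.ofReal (Real.exp (-|(n : ℝ)| / 2))

/-- For a backward displacement the exponent is `-(1 - θ) * |n|`, at most `-|n| / 2`: backward moves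
contribute a constant, whereas forward moves contribute `2 / θ`. -/
lemma tsum_horWeight_neg_le {θ : ℝ} (h1 : θ ≤ 1 / 2) :
    ∑' n : ℕ, horWeight θ (-((n : ℤ) + 1)) ≤ ENNReal.ofReal 4 := by
  have : (4 : ℝ) = 2 / (1 / 2) := by norm_num
  rw [this]
  refine le_trans (ENNReal.tsum_le_tsum fun n => ?_)
    (tsum_ofReal_exp_neg_le (by norm_num) (by norm_num))
  refine ENNReal.ofReal_le_ofReal (Real.exp_le_exp.2 ?_)
  push_cast
  have hn : (0 : ℝ) ≤ n := Nat.cast_nonneg n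
  rw [abs_of_nonpos (by linarith)]
  nlinarith

lemma tsum_horWeight_le {θ : ℝ} (h0 : 0 < θ) (h1 : θ ≤ 1 / 2) :
    ∑' n : ℤ, horWeight θ n ≤ ENNReal.ofReal (6 / θ) := by
  rw [tsum_int_eq]
  have hA : ∑' n : ℕ, horWeight θ (n : ℤ) ≤ ENNReal.ofReal (2 / θ) := by
    refine le_trans (ENNReal.tsum_le_tsum fun n => ?_)
      (tsum_ofReal_exp_neg_le h0 (by linarith))
    refine ENNReal.ofReal_le_ofReal (Real.exp_le_exp.2 ?_)
    push_cast
    rw [abs_of_nonneg (Nat.cast_nonneg n)]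
    linarith
  refine (add_le_add hA (tsum_horWeight_neg_le h1)).trans ?_
  rw [← ENNReal.ofReal_add (by positivity) (by norm_num)]
  refine ENNReal.ofReal_le_ofReal ?_
  rw [div_add' _ _ _ h0.ne', div_le_div_iff_of_pos_right h0]
  linarith

/-- The large factor `1 / θ` comes only from long forward moves. Without them a constant remains,
which is why defects gain a factor `θ`. -/
lemma tsum_horWeight_defect_le {θ : ℝ} (h0 : 0 < θ) (h1 : θ ≤ 1 / 2) :
    ∑' n : ℤ, (if n ≤ 1 then horWeight θ n else 0) ≤ ENNReal.ofReal 6 := by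
  rw [tsum_int_eq]
  have hA : ∑' n : ℕ, (if (n : ℤ) ≤ 1 then horWeight θ (n : ℤ) else 0) ≤ ENNReal.ofReal 2 := by
    rw [tsum_eq_sum (s := {0, 1})]
    · rw [Finset.sum_pair (by norm_num)]
      have e : ENNReal.ofReal 2 = ENNReal.ofReal 1 + ENNReal.ofReal 1 := by
        rw [← ENNReal.ofReal_add] <;> norm_num
      rw [e]
      refine add_le_add ?_ ?_
      · simp [horWeight]
      · simp only [Nat.cast_one, le_refl, if_true, horWeight]
        refine ENNReal.ofReal_le_ofReal (Real.exp_le_one_iff.2 ?_)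
        simp; linarith
    · intro n hn
      rw [if_neg]
      simp only [Finset.mem_insert, Finset.mem_singleton, not_or] at hn
      omega
  have hB : ∑' n : ℕ, (if -((n : ℤ) + 1) ≤ 1 then horWeight θ (-((n : ℤ) + 1)) else 0) ≤
      ENNReal.ofReal 4 := by
    refine le_trans (ENNReal.tsum_le_tsum fun n => ?_) (tsum_horWeight_neg_le h1)
    split_ifs <;> simp
  refine (add_le_add hA hB).trans ?_
  rw [← ENNReal.ofReal_add (by norm_num) (by norm_num)]
  norm_num

lemma tsum_verWeight_le : ∑' n : ℤ, verWeight n ≤ ENNReal.ofReal 8 := by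
  rw [tsum_int_eq]
  have e : ENNReal.ofReal 8 = ENNReal.ofReal (2 / (1 / 2)) + ENNReal.ofReal (2 / (1 / 2)) := by
    rw [← ENNReal.ofReal_add] <;> norm_num
  rw [e]
  have hA := tsum_ofReal_exp_neg_le (a := 1 / 2) (by norm_num) (by norm_num)
  refine add_le_add (le_trans (ENNReal.tsum_le_tsum fun n => ?_) hA)
    (le_trans (ENNReal.tsum_le_tsum fun n => ?_) hA)
  · refine ENNReal.ofReal_le_ofReal (Real.exp_le_exp.2 ?_)
    push_cast
    rw [abs_of_nonneg (Nat.cast_nonneg n)]; linarith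
  · refine ENNReal.ofReal_le_ofReal (Real.exp_le_exp.2 ?_)
    push_cast
    have hn : (0 : ℝ) ≤ n := Nat.cast_nonneg n
    rw [abs_of_nonpos (by linarith)]; linarith

variable {d₁ d₂ : ℕ}

/-- Sum of the horizontal coordinates. -/
def hor (x : EdgeType d₁ d₂ → ℤ) : ℤ := ∑ i, x (Sum.inl i)

/-- Excess length of a displacement: its length minus its horizontal progress. -/
def exc (x : EdgeType d₁ d₂ → ℤ) : ℝ := l1 x - hor x

/-- Tilt of the horizontal coordinates. -/
def tilt (θ : Fin d₁ → ℝ) (x : EdgeType d₁ d₂ → ℤ) : ℝ := ∑ i, θ i * x (Sum.inl i)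

lemma hor_add (x y : EdgeType d₁ d₂ → ℤ) : hor (x + y) = hor x + hor y := by
  simp [hor, Finset.sum_add_distrib]

lemma hor_sub (x y : EdgeType d₁ d₂ → ℤ) : hor (x - y) = hor x - hor y := by
  simp [hor, Finset.sum_sub_distrib]

lemma tilt_add (θ : Fin d₁ → ℝ) (x y : EdgeType d₁ d₂ → ℤ) :
    tilt θ (x + y) = tilt θ x + tilt θ y := by
  simp [tilt, mul_add, Finset.sum_add_distrib]

lemma exc_eq (x : EdgeType d₁ d₂ → ℤ) :
    exc x = ∑ i, (|(x (Sum.inl i) : ℝ)| - x (Sum.inl i)) + ∑ j, |(x (Sum.inr j) : ℝ)| := by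
  rw [exc, l1_cast, Fintype.sum_sum_type, hor, Finset.sum_sub_distrib]
  push_cast
  ring

lemma exc_nonneg (x : EdgeType d₁ d₂ → ℤ) : 0 ≤ exc x := by
  rw [exc_eq]
  refine add_nonneg (Finset.sum_nonneg fun i _ => ?_) (Finset.sum_nonneg fun j _ => abs_nonneg _)
  linarith [le_abs_self (x (Sum.inl i) : ℝ)]

lemma exc_add_le (x y : EdgeType d₁ d₂ → ℤ) : exc (x + y) ≤ exc x + exc y := by
  have h := l1_add_le x y
  have h' : (l1 (x + y) : ℝ) ≤ l1 x + l1 y := by exact_mod_cast h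
  simp only [exc, hor_add]
  push_cast
  linarith

/-- A negative coordinate `x` lowers the tilt by at most `|x| / 2` and adds `2 * |x|` to the excess;
the other coordinates only help. -/
lemma neg_exc_le_tilt {θ : Fin d₁ → ℝ} (h0 : ∀ i, 0 ≤ θ i) (h1 : ∀ i, θ i ≤ 1 / 2)
    (x : EdgeType d₁ d₂ → ℤ) : -(exc x / 4) ≤ tilt θ x := by
  have : ∀ i, -((|(x (Sum.inl i) : ℝ)| - x (Sum.inl i)) / 4) ≤ θ i * x (Sum.inl i) := by
    intro i
    rcases le_total 0 (x (Sum.inl i) : ℝ) with h | h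
    · rw [abs_of_nonneg h]
      have := mul_nonneg (h0 i) h
      linarith
    · rw [abs_of_nonpos h]
      nlinarith [h1 i]
  have h2 := Finset.sum_le_sum fun i (_ : i ∈ Finset.univ) => this i
  rw [Finset.sum_neg_distrib, ← Finset.sum_div] at h2
  have h3 : 0 ≤ ∑ j, |(x (Sum.inr j) : ℝ)| := Finset.sum_nonneg fun j _ => abs_nonneg _
  rw [exc_eq, tilt]
  linarith

/-- Weight of a jump. -/
def jumpWeight (θ : Fin d₁ → ℝ) (x : EdgeType d₁ d₂ → ℤ) : ℝ≥0∞ :=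
  ENNReal.ofReal (Real.exp (-exc x / 2 - tilt θ x))

/-- Excess and tilt are sums over coordinates, so the sum over all jumps is bounded by a product of
one-dimensional sums. -/
lemma jumpWeight_eq (θ : Fin d₁ → ℝ) (x : EdgeType d₁ d₂ → ℤ) :
    jumpWeight θ x = ∏ i, Sum.elim (fun i => horWeight (θ i)) (fun _ => verWeight) i (x i) := by
  rw [Fintype.prod_sum_type]
  simp only [Sum.elim_inl, Sum.elim_inr, horWeight, verWeight]
  rw [← ENNReal.ofReal_prod_of_nonneg (fun i _ => (Real.exp_pos _).le),
    ← ENNReal.ofReal_prod_of_nonneg (fun i _ => (Real.exp_pos _).le),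
    ← ENNReal.ofReal_mul (Finset.prod_nonneg fun i _ => (Real.exp_pos _).le), ← Real.exp_sum,
    ← Real.exp_sum, ← Real.exp_add, jumpWeight, exc_eq, tilt]
  congr 2
  simp only [neg_sub, sub_div, neg_div, add_div, neg_add, Finset.sum_sub_distrib,
    Finset.sum_neg_distrib, Finset.sum_div]
  ring

/-- The common bound for the total weight of the jumps. -/
def weightBound (d₂ : ℕ) (θ : Fin d₁ → ℝ) : ℝ := 8 ^ d₂ * ∏ i, (6 / θ i)

lemma tsum_jumpWeight_le {θ : Fin d₁ → ℝ} (h0 : ∀ i, 0 < θ i) (h1 : ∀ i, θ i ≤ 1 / 2) :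
    ∑' x : EdgeType d₁ d₂ → ℤ, jumpWeight θ x ≤ ENNReal.ofReal (weightBound d₂ θ) := by
  simp_rw [jumpWeight_eq]
  refine (tsum_pi_prod_le _).trans ?_
  rw [Fintype.prod_sum_type, weightBound, mul_comm ((8 : ℝ) ^ d₂), ENNReal.ofReal_mul (Finset.prod_nonneg
    fun i _ => (div_pos (by norm_num) (h0 i)).le), ENNReal.ofReal_prod_of_nonneg
    (fun i _ => (div_pos (by norm_num) (h0 i)).le)]
  refine mul_le_mul' (Finset.prod_le_prod' fun i _ => ?_) ?_
  · exact tsum_horWeight_le (h0 i) (h1 i)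
  · refine (Finset.prod_le_prod' fun j _ => tsum_verWeight_le).trans (le_of_eq ?_)
    rw [Finset.prod_const, Finset.card_univ, Fintype.card_fin, ENNReal.ofReal_pow (by norm_num)]

open Classical in
lemma tsum_jumpWeight_defect_le {θ : Fin d₁ → ℝ} (h0 : ∀ i, 0 < θ i) (h1 : ∀ i, θ i ≤ 1 / 2) :
    ∑' x : EdgeType d₁ d₂ → ℤ, (if ∃ i, x (Sum.inl i) ≤ 1 then jumpWeight θ x else 0) ≤
      ENNReal.ofReal ((∑ i, θ i) * weightBound d₂ θ) := by
  have hpos : ∀ i, 0 ≤ 6 / θ i := fun i => (div_pos (by norm_num) (h0 i)).le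
  have hle : ∀ x : EdgeType d₁ d₂ → ℤ, (if ∃ i, x (Sum.inl i) ≤ 1 then jumpWeight θ x else 0) ≤
      ∑ i, (if x (Sum.inl i) ≤ 1 then jumpWeight θ x else 0) := by
    intro x
    split_ifs with h
    · obtain ⟨i, hi⟩ := h
      have := Finset.single_le_sum (f := fun i => if x (Sum.inl i) ≤ 1 then jumpWeight θ x else 0)
        (fun i _ => zero_le) (Finset.mem_univ i)
      simpa [hi] using this
    · exact zero_le
  refine (ENNReal.tsum_le_tsum hle).trans ?_
  rw [Summable.tsum_finsetSum fun _ _ => ENNReal.summable, Finset.sum_mul,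
    ENNReal.ofReal_sum_of_nonneg (f := fun i => θ i * weightBound d₂ θ) fun i _ =>
      mul_nonneg (h0 i).le (mul_nonneg (by positivity) (Finset.prod_nonneg fun i _ => hpos i))]
  refine Finset.sum_le_sum fun i _ => ?_
  -- Union bound over the defective coordinate `i`: only its one-dimensional weight is truncated, so
  -- that `6 / θ i` is replaced by `6`.
  let f : EdgeType d₁ d₂ → ℤ → ℝ≥0∞ := Sum.elim (fun k n => if k = i then
    (if n ≤ 1 then horWeight (θ k) n else 0) else horWeight (θ k) n) (fun _ => verWeight)
  have e : ∀ x : EdgeType d₁ d₂ → ℤ, (if x (Sum.inl i) ≤ 1 then jumpWeight θ x else 0) =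
      ∏ k, f k (x k) := by
    intro x
    rw [jumpWeight_eq, Fintype.prod_sum_type, Fintype.prod_sum_type]
    simp only [f, Sum.elim_inl, Sum.elim_inr]
    split_ifs with h
    · congr 1
      refine Finset.prod_congr rfl fun k _ => ?_
      split_ifs with h2 h3
      · rfl
      · subst h2; exact absurd h h3
      · rfl
    · rw [Finset.prod_eq_zero (Finset.mem_univ i) (by simp [h]), zero_mul]
  simp_rw [e]
  refine (tsum_pi_prod_le _).trans ?_
  rw [Fintype.prod_sum_type]
  have hver : ∏ j : Fin d₂, ∑' n, f (Sum.inr j) n ≤ ENNReal.ofReal (8 ^ d₂) := by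
    refine (Finset.prod_le_prod' fun j _ => tsum_verWeight_le).trans (le_of_eq ?_)
    rw [Finset.prod_const, Finset.card_univ, Fintype.card_fin, ENNReal.ofReal_pow (by norm_num)]
  have hhor : ∏ k : Fin d₁, ∑' n, f (Sum.inl k) n ≤
      ENNReal.ofReal (θ i * ∏ k, (6 / θ k)) := by
    rw [← Finset.mul_prod_erase _ _ (Finset.mem_univ i),
      ← Finset.mul_prod_erase _ (fun k => 6 / θ k) (Finset.mem_univ i), ← mul_assoc,
      mul_div_cancel₀ _ (h0 i).ne', ENNReal.ofReal_mul (by norm_num),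
      ENNReal.ofReal_prod_of_nonneg fun k _ => hpos k]
    refine mul_le_mul' ?_ (Finset.prod_le_prod' fun k hk => ?_)
    · simpa [f] using tsum_horWeight_defect_le (h0 i) (h1 i)
    · simpa [f, Finset.ne_of_mem_erase hk] using tsum_horWeight_le (h0 k) (h1 k)
  refine (mul_le_mul' hhor hver).trans (le_of_eq ?_)
  rw [← ENNReal.ofReal_mul (mul_nonneg (h0 i).le (Finset.prod_nonneg fun i _ => hpos i)),
    weightBound]
  congr 1
  ring

end Weights
-- First moments over lists of distinct free edges
section ListSums

variable {d₁ d₂ : ℕ}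

lemma l1_tgt_sub_src {ι : Type*} [Fintype ι] [DecidableEq ι] (e : OEdge ι) :
    l1 (e.tgt - e.src) = 1 := by
  rcases e with ⟨e, _ | _⟩ <;> simp [OEdge.src, OEdge.tgt]

lemma hor_le_l1 (x : EdgeType d₁ d₂ → ℤ) : (hor x : ℝ) ≤ l1 x := by
  have := exc_nonneg x
  rw [exc] at this
  linarith

lemma neg_hor_le_l1 (x : EdgeType d₁ d₂ → ℤ) : -(hor x : ℝ) ≤ l1 x := by
  have := hor_le_l1 (-x)
  rw [l1_neg] at this
  have h : hor (-x) = - hor x := by simp [hor]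
  rw [h] at this
  push_cast at this
  exact this

/-- Logarithmic weight of a list of oriented edges visited from `x`. -/
def listLog (θ : Fin d₁ → ℝ) :
    (EdgeType d₁ d₂ → ℤ) → List (OEdge (EdgeType d₁ d₂)) → ℝ
  | _, [] => 0
  | x, e :: l => 3 + (-exc (e.src - x) / 2 - tilt θ (e.src - x)) + listLog θ e.tgt l

/-- The last vertex visited by a list of oriented edges, starting from `x`. -/
def lastVertex {ι : Type*} [DecidableEq ι] : (ι → ℤ) → List (OEdge ι) → (ι → ℤ)
  | x, [] => x
  | _, e :: l => lastVertex e.tgt l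

/-- A jump loses its excess: one half stays in the weight of the list, the other half pays for the
excess of the total displacement. Tilts add up along the path and telescope to the tilt of `y - x`.
A free edge gains at most one unit, and the allowance `3` per edge also covers its own excess and
tilt. -/
lemma savings_le_listLog {θ : Fin d₁ → ℝ} (h0 : ∀ i, 0 ≤ θ i) (h1 : ∀ i, θ i ≤ 1 / 2)
    (x y : EdgeType d₁ d₂ → ℤ) (l : List (OEdge (EdgeType d₁ d₂))) :
    (hor (y - x) : ℝ) - jumpCost x l y ≤ listLog θ x l + (tilt θ (y - x) - exc (y - x) / 2) := by
  induction l generalizing x with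
  | nil =>
    have := neg_exc_le_tilt h0 h1 (y - x)
    have h2 := exc_nonneg (y - x)
    simp only [jumpCost, listLog]
    have h3 : (hor (y - x) : ℝ) - l1 (y - x) = - exc (y - x) := by rw [exc]; ring
    linarith
  | cons e l ih =>
    have := ih e.tgt
    set δ := e.src - x with hδ
    set s := e.tgt - e.src with hs
    set r := y - e.tgt with hr
    have e1 : y - x = δ + s + r := by rw [hδ, hs, hr]; abel
    have hs1 : (l1 s : ℝ) = 1 := by rw [hs, l1_tgt_sub_src]; norm_num
    have hs2 := hor_le_l1 s
    have hs3 := neg_exc_le_tilt h0 h1 s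
    have hs4 : exc s = 1 - hor s := by rw [exc, hs1]
    have h5 := exc_add_le (δ + s) r
    have h6 := exc_add_le δ s
    have h7 : (l1 δ : ℝ) = exc δ + hor δ := by rw [exc]; ring
    simp only [jumpCost, listLog, ← hδ]
    rw [e1, hor_add, hor_add, tilt_add, tilt_add]
    push_cast
    linarith

/-- Coming back from beyond `y` in coordinate `i` costs an excess of twice the overshoot in the last
jump. The half of the excess not kept in the weight is spent on this instead of on `exc (y - x)`. -/
lemma savings_le_listLog_overshoot {θ : Fin d₁ → ℝ} (h0 : ∀ i, 0 ≤ θ i) (h1 : ∀ i, θ i ≤ 1 / 2)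
    (x y : EdgeType d₁ d₂ → ℤ) (l : List (OEdge (EdgeType d₁ d₂))) (i : Fin d₁) :
    (hor (y - x) : ℝ) - jumpCost x l y ≤ listLog θ x l + tilt θ (y - x) -
      ((lastVertex x l (Sum.inl i) : ℝ) - y (Sum.inl i)) := by
  induction l generalizing x with
  | nil =>
    have h2 := neg_exc_le_tilt h0 h1 (y - x)
    have h3 : (hor (y - x) : ℝ) - l1 (y - x) = - exc (y - x) := by rw [exc]; ring
    have h4 : (x (Sum.inl i) : ℝ) - y (Sum.inl i) ≤ exc (y - x) / 2 := by
      rw [exc_eq]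
      have h5 : |((y - x) (Sum.inl i) : ℝ)| - (y - x) (Sum.inl i) ≤
          ∑ i, (|((y - x) (Sum.inl i) : ℝ)| - (y - x) (Sum.inl i)) :=
        Finset.single_le_sum (f := fun i => |((y - x) (Sum.inl i) : ℝ)| - (y - x) (Sum.inl i))
          (fun k _ => by linarith [le_abs_self ((y - x) (Sum.inl k) : ℝ)]) (Finset.mem_univ i)
      have h6 : 0 ≤ ∑ j, |((y - x) (Sum.inr j) : ℝ)| := Finset.sum_nonneg fun j _ => abs_nonneg _
      have h7 := neg_abs_le ((y - x) (Sum.inl i) : ℝ)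
      have h8 : ((y - x) (Sum.inl i) : ℝ) = y (Sum.inl i) - x (Sum.inl i) := by simp
      linarith
    have h9 := exc_nonneg (y - x)
    simp only [jumpCost, listLog, lastVertex]
    linarith
  | cons e l ih =>
    have := ih e.tgt
    set δ := e.src - x with hδ
    set s := e.tgt - e.src with hs
    set r := y - e.tgt with hr
    have e1 : y - x = δ + s + r := by rw [hδ, hs, hr]; abel
    have hs1 : (l1 s : ℝ) = 1 := by rw [hs, l1_tgt_sub_src]; norm_num
    have hs2 := hor_le_l1 s
    have hs3 := neg_exc_le_tilt h0 h1 s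
    have hs4 : exc s = 1 - hor s := by rw [exc, hs1]
    have hs5 := neg_hor_le_l1 s
    have h7 : (l1 δ : ℝ) = exc δ + hor δ := by rw [exc]; ring
    have h8 := exc_nonneg δ
    simp only [jumpCost, listLog, lastVertex, ← hδ]
    rw [e1, hor_add, hor_add, tilt_add, tilt_add]
    push_cast
    linarith

/-- Some jump of the list makes almost no progress in some horizontal direction. -/
def HasDefect : (EdgeType d₁ d₂ → ℤ) → List (OEdge (EdgeType d₁ d₂)) → Prop
  | _, [] => False
  | x, e :: l => (∃ i, (e.src - x) (Sum.inl i) ≤ 1) ∨ HasDefect e.tgt l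

/-- Sum over the oriented edges of a function of their starting point. -/
lemma tsum_oedge_eq {ι : Type*} [Fintype ι] [DecidableEq ι] (f : (ι → ℤ) → ℝ≥0∞) (x : ι → ℤ) :
    ∑' e : OEdge ι, f (e.src - x) = (2 * Fintype.card ι : ℕ) * ∑' y, f y := by
  let φ : OEdge ι ≃ (ι × Bool) × (ι → ℤ) :=
    { toFun := fun e => ((e.1.2, e.2), e.src - x)
      invFun := fun a => ((if a.1.2 then a.2 + x else a.2 + x - Pi.single a.1.1 1, a.1.1), a.1.2)
      left_inv := by
        rintro ⟨⟨y, i⟩, _ | _⟩ <;> simp [OEdge.src]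
      right_inv := by
        rintro ⟨⟨i, _ | _⟩, y⟩ <;> simp [OEdge.src] }
  have h := φ.symm.tsum_eq (fun e : OEdge ι => f (e.src - x))
  rw [← h]
  have e : ∀ a : (ι × Bool) × (ι → ℤ), f ((φ.symm a).src - x) = f a.2 := by
    intro a
    have : (φ (φ.symm a)).2 = a.2 := by rw [Equiv.apply_symm_apply]
    exact congrArg f this
  simp_rw [e]
  refine (ENNReal.tsum_prod (f := fun (_ : ι × Bool) y => f y)).trans ?_
  rw [tsum_fintype, Finset.sum_const, Finset.card_univ, Fintype.card_prod,
    Fintype.card_bool, nsmul_eq_mul, mul_comm 2]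

/-- Lists of length `k + 1` as pairs. -/
def consEquiv (α : Type*) (k : ℕ) :
    {l : List α // l.length = k + 1} ≃ α × {l : List α // l.length = k} where
  toFun l := (l.1.head (by intro h; have := l.2; simp [h] at this), ⟨l.1.tail, by simp [l.2]⟩)
  invFun a := ⟨a.1 :: a.2.1, by simp [a.2.2]⟩
  left_inv l := by
    apply Subtype.ext; simp
  right_inv a := by simp

lemma tsum_length_succ {α : Type*} (k : ℕ) (f : List α → ℝ≥0∞) :
    ∑' l : {l : List α // l.length = k + 1}, f l =
      ∑' a : α, ∑' l : {l : List α // l.length = k}, f (a :: l) := by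
  rw [← (consEquiv α k).symm.tsum_eq]
  exact ENNReal.tsum_prod (f := fun (a : α) (l : {l : List α // l.length = k}) => f (a :: l.1))

lemma tsum_list_eq {α : Type*} (f : List α → ℝ≥0∞) :
    ∑' l : List α, f l = ∑' k : ℕ, ∑' l : {l : List α // l.length = k}, f l := by
  rw [← (Equiv.sigmaFiberEquiv (List.length : List α → ℕ)).tsum_eq]
  exact ENNReal.tsum_sigma (fun (k : ℕ) (l : {l : List α // l.length = k}) => f l.1)

/-- Weight of a list, with a factor `c` for each edge. -/
def listWeight (c : ℝ≥0∞) (θ : Fin d₁ → ℝ) (x : EdgeType d₁ d₂ → ℤ)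
    (l : List (OEdge (EdgeType d₁ d₂))) : ℝ≥0∞ :=
  c ^ l.length * ENNReal.ofReal (Real.exp (listLog θ x l))

lemma listWeight_cons (c : ℝ≥0∞) (θ : Fin d₁ → ℝ) (x : EdgeType d₁ d₂ → ℤ)
    (e : OEdge (EdgeType d₁ d₂)) (l : List (OEdge (EdgeType d₁ d₂))) :
    listWeight c θ x (e :: l) = c * ENNReal.ofReal (Real.exp 3) * jumpWeight θ (e.src - x) *
      listWeight c θ e.tgt l := by
  rw [listWeight, listLog, Real.exp_add, Real.exp_add, ENNReal.ofReal_mul (by positivity),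
    ENNReal.ofReal_mul (by positivity), List.length_cons, pow_succ, listWeight, jumpWeight]
  ring

/-- Bound for the total weight of the first jump. -/
def stepBound (d₂ : ℕ) (ε : ℝ) (θ : Fin d₁ → ℝ) : ℝ :=
  2 * (d₁ + d₂) * Real.exp 3 * weightBound d₂ θ * ε

lemma tsum_step_le {ε : ℝ} {θ : Fin d₁ → ℝ} (h0 : ∀ i, 0 < θ i)
    (h1 : ∀ i, θ i ≤ 1 / 2) (hε : 0 ≤ ε) (x : EdgeType d₁ d₂ → ℤ) :
    ∑' e : OEdge (EdgeType d₁ d₂), ENNReal.ofReal ε * ENNReal.ofReal (Real.exp 3) *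
      jumpWeight θ (e.src - x) ≤ ENNReal.ofReal (stepBound d₂ ε θ) := by
  rw [ENNReal.tsum_mul_left, tsum_oedge_eq]
  refine (mul_le_mul_right (mul_le_mul_right (tsum_jumpWeight_le h0 h1) _) _).trans (le_of_eq ?_)
  rw [← ENNReal.ofReal_natCast, ← ENNReal.ofReal_mul (by positivity),
    ← ENNReal.ofReal_mul (by positivity), ← ENNReal.ofReal_mul (by positivity), stepBound]
  congr 1
  simp only [Fintype.card_sum, Fintype.card_fin]
  push_cast
  ring

open Classical in
lemma tsum_step_defect_le {ε : ℝ} {θ : Fin d₁ → ℝ} (h0 : ∀ i, 0 < θ i)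
    (h1 : ∀ i, θ i ≤ 1 / 2) (hε : 0 ≤ ε) (x : EdgeType d₁ d₂ → ℤ) :
    ∑' e : OEdge (EdgeType d₁ d₂), ENNReal.ofReal ε * ENNReal.ofReal (Real.exp 3) *
      (if ∃ i, (e.src - x) (Sum.inl i) ≤ 1 then jumpWeight θ (e.src - x) else 0) ≤
      ENNReal.ofReal ((∑ i, θ i) * stepBound d₂ ε θ) := by
  rw [ENNReal.tsum_mul_left, tsum_oedge_eq
    (fun y => if ∃ i, y (Sum.inl i) ≤ 1 then jumpWeight θ y else 0)]
  refine (mul_le_mul_right (mul_le_mul_right (tsum_jumpWeight_defect_le h0 h1) _) _).trans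
    (le_of_eq ?_)
  rw [← ENNReal.ofReal_natCast, ← ENNReal.ofReal_mul (by positivity),
    ← ENNReal.ofReal_mul (by positivity), ← ENNReal.ofReal_mul (by positivity), stepBound]
  congr 1
  simp only [Fintype.card_sum, Fintype.card_fin]
  push_cast
  ring

/-- Summing over the first edge costs at most `stepBound ≤ 1 / 4`, uniformly in the starting vertex;
induct on the length. -/
lemma tsum_listWeight_length_le {ε : ℝ} {θ : Fin d₁ → ℝ} (h0 : ∀ i, 0 < θ i)
    (h1 : ∀ i, θ i ≤ 1 / 2) (hε : 0 ≤ ε) (hs : stepBound d₂ ε θ ≤ 1 / 4) (k : ℕ)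
    (x : EdgeType d₁ d₂ → ℤ) :
    ∑' l : {l : List (OEdge (EdgeType d₁ d₂)) // l.length = k},
      listWeight (ENNReal.ofReal ε) θ x l ≤ ENNReal.ofReal (1 / 4) ^ k := by
  induction k generalizing x with
  | zero =>
    rw [tsum_eq_single ⟨[], rfl⟩]
    · simp [listWeight, listLog]
    · rintro ⟨l, hl⟩ h
      exact absurd (Subtype.ext (List.length_eq_zero_iff.1 hl)) h
  | succ k ih =>
    rw [tsum_length_succ]
    simp_rw [listWeight_cons, ENNReal.tsum_mul_left]
    calc ∑' e : OEdge (EdgeType d₁ d₂), ENNReal.ofReal ε * ENNReal.ofReal (Real.exp 3) *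
          jumpWeight θ (e.src - x) * ∑' l : {l : List (OEdge (EdgeType d₁ d₂)) // l.length = k},
            listWeight (ENNReal.ofReal ε) θ e.tgt l
        ≤ ∑' e : OEdge (EdgeType d₁ d₂), ENNReal.ofReal ε * ENNReal.ofReal (Real.exp 3) *
          jumpWeight θ (e.src - x) * ENNReal.ofReal (1 / 4) ^ k :=
          ENNReal.tsum_le_tsum fun e => mul_le_mul_right (ih e.tgt) _
      _ ≤ _ := by
          rw [ENNReal.tsum_mul_right, pow_succ, mul_comm]
          exact mul_le_mul_right
            ((tsum_step_le h0 h1 hε x).trans (ENNReal.ofReal_le_ofReal hs)) _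

open Classical in
lemma tsum_listWeight_defect_length_le {ε : ℝ} {θ : Fin d₁ → ℝ} (h0 : ∀ i, 0 < θ i)
    (h1 : ∀ i, θ i ≤ 1 / 2) (hε : 0 ≤ ε) (hs : stepBound d₂ ε θ ≤ 1 / 4) (k : ℕ)
    (x : EdgeType d₁ d₂ → ℤ) :
    ∑' l : {l : List (OEdge (EdgeType d₁ d₂)) // l.length = k},
      (if HasDefect x l then listWeight (ENNReal.ofReal ε) θ x l else 0) ≤
      ENNReal.ofReal ((∑ i, θ i) * (1 / 2) ^ k) := by
  have hθ : 0 ≤ ∑ i, θ i := Finset.sum_nonneg fun i _ => (h0 i).le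
  induction k generalizing x with
  | zero =>
    rw [tsum_eq_single ⟨[], rfl⟩]
    · simp [HasDefect]
    · rintro ⟨l, hl⟩ h
      exact absurd (Subtype.ext (List.length_eq_zero_iff.1 hl)) h
  | succ k ih =>
    rw [tsum_length_succ k (fun l => if HasDefect x l then
      listWeight (ENNReal.ofReal ε) θ x l else 0)]
    have hle : ∀ (e : OEdge (EdgeType d₁ d₂)) (l : List (OEdge (EdgeType d₁ d₂))),
        (if HasDefect x (e :: l) then listWeight (ENNReal.ofReal ε) θ x (e :: l) else 0) ≤
        ENNReal.ofReal ε * ENNReal.ofReal (Real.exp 3) *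
          (if ∃ i, (e.src - x) (Sum.inl i) ≤ 1 then jumpWeight θ (e.src - x) else 0) *
          listWeight (ENNReal.ofReal ε) θ e.tgt l +
        ENNReal.ofReal ε * ENNReal.ofReal (Real.exp 3) * jumpWeight θ (e.src - x) *
          (if HasDefect e.tgt l then listWeight (ENNReal.ofReal ε) θ e.tgt l else 0) := by
      intro e l
      simp only [HasDefect, listWeight_cons]
      by_cases hA : ∃ i, (e.src - x) (Sum.inl i) ≤ 1
      · rw [if_pos (Or.inl hA), if_pos hA]
        exact le_self_add
      · by_cases hB : HasDefect e.tgt l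
        · rw [if_pos (Or.inr hB), if_pos hB]
          exact le_add_self
        · rw [if_neg (by tauto)]
          exact zero_le
    refine (ENNReal.tsum_le_tsum fun e => ENNReal.tsum_le_tsum
      fun l : {l : List (OEdge (EdgeType d₁ d₂)) // l.length = k} => hle e l.1).trans ?_
    simp_rw [ENNReal.tsum_add, ENNReal.tsum_mul_left]
    have hA : ∑' e : OEdge (EdgeType d₁ d₂), ENNReal.ofReal ε * ENNReal.ofReal (Real.exp 3) *
          (if ∃ i, (e.src - x) (Sum.inl i) ≤ 1 then jumpWeight θ (e.src - x) else 0) *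
          ∑' l : {l : List (OEdge (EdgeType d₁ d₂)) // l.length = k},
            listWeight (ENNReal.ofReal ε) θ e.tgt l ≤
        ENNReal.ofReal ((∑ i, θ i) * (1 / 4) * (1 / 4) ^ k) := by
      refine (ENNReal.tsum_le_tsum fun e : OEdge (EdgeType d₁ d₂) => mul_le_mul_right
        (tsum_listWeight_length_le h0 h1 hε hs k e.tgt) _).trans ?_
      rw [ENNReal.tsum_mul_right, ENNReal.ofReal_mul (by positivity),
        ENNReal.ofReal_pow (by norm_num)]
      refine mul_le_mul_left ((tsum_step_defect_le h0 h1 hε x).trans ?_) _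
      exact ENNReal.ofReal_le_ofReal (mul_le_mul_of_nonneg_left hs hθ)
    have hB : ∑' e : OEdge (EdgeType d₁ d₂), ENNReal.ofReal ε * ENNReal.ofReal (Real.exp 3) *
          jumpWeight θ (e.src - x) * ∑' l : {l : List (OEdge (EdgeType d₁ d₂)) // l.length = k},
            (if HasDefect e.tgt l then listWeight (ENNReal.ofReal ε) θ e.tgt l else 0) ≤
        ENNReal.ofReal (1 / 4 * ((∑ i, θ i) * (1 / 2) ^ k)) := by
      refine (ENNReal.tsum_le_tsum fun e : OEdge (EdgeType d₁ d₂) =>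
        mul_le_mul_right (ih e.tgt) _).trans ?_
      rw [ENNReal.tsum_mul_right, ENNReal.ofReal_mul (p := 1 / 4) (by norm_num)]
      exact mul_le_mul_left ((tsum_step_le h0 h1 hε x).trans (ENNReal.ofReal_le_ofReal hs)) _
    refine (add_le_add hA hB).trans ?_
    rw [← ENNReal.ofReal_add (by positivity) (by positivity)]
    refine ENNReal.ofReal_le_ofReal ?_
    -- A defect in the first jump contributes `(∑ θ) / 4 * (1 / 4) ^ k`, a later one `(∑ θ) / 4 * (1
    -- / 2) ^ k`; together they stay below `(∑ θ) * (1 / 2) ^ (k + 1)`.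
    have : (1 / 4 : ℝ) ^ k ≤ (1 / 2) ^ k := pow_le_pow_left₀ (by norm_num) (by norm_num) k
    rw [pow_succ]
    nlinarith

lemma tsum_listWeight_le {ε : ℝ} {θ : Fin d₁ → ℝ} (h0 : ∀ i, 0 < θ i)
    (h1 : ∀ i, θ i ≤ 1 / 2) (hε : 0 ≤ ε) (hs : stepBound d₂ ε θ ≤ 1 / 4)
    (x : EdgeType d₁ d₂ → ℤ) :
    ∑' l : List (OEdge (EdgeType d₁ d₂)), listWeight (ENNReal.ofReal ε) θ x l ≤
      ENNReal.ofReal 2 := by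
  rw [tsum_list_eq]
  refine (ENNReal.tsum_le_tsum fun k => tsum_listWeight_length_le h0 h1 hε hs k x).trans ?_
  simp_rw [← ENNReal.ofReal_pow (show (0 : ℝ) ≤ 1 / 4 by norm_num)]
  rw [← ENNReal.ofReal_tsum_of_nonneg (fun n => by positivity)
    (summable_geometric_of_lt_one (by norm_num) (by norm_num)),
    tsum_geometric_of_lt_one (by norm_num) (by norm_num)]
  exact ENNReal.ofReal_le_ofReal (by norm_num)

open Classical in
lemma tsum_listWeight_defect_le {ε : ℝ} {θ : Fin d₁ → ℝ} (h0 : ∀ i, 0 < θ i)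
    (h1 : ∀ i, θ i ≤ 1 / 2) (hε : 0 ≤ ε) (hs : stepBound d₂ ε θ ≤ 1 / 4)
    (x : EdgeType d₁ d₂ → ℤ) :
    ∑' l : List (OEdge (EdgeType d₁ d₂)),
      (if HasDefect x l then listWeight (ENNReal.ofReal ε) θ x l else 0) ≤
      ENNReal.ofReal (2 * ∑ i, θ i) := by
  have hθ : 0 ≤ ∑ i, θ i := Finset.sum_nonneg fun i _ => (h0 i).le
  rw [tsum_list_eq]
  refine (ENNReal.tsum_le_tsum fun k => tsum_listWeight_defect_length_le h0 h1 hε hs k x).trans ?_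
  rw [← ENNReal.ofReal_tsum_of_nonneg (fun n => by positivity)
    ((summable_geometric_of_lt_one (by norm_num) (by norm_num)).mul_left _), tsum_mul_left,
    tsum_geometric_of_lt_one (by norm_num) (by norm_num)]
  exact ENNReal.ofReal_le_ofReal (by linarith)

/-- The lists of distinct edges of `S`. -/
def IsTrailIn {ι : Type*} (S : Set (Edge ι)) (l : List (OEdge ι)) : Prop :=
  (l.map Prod.fst).Nodup ∧ ∀ e ∈ l, e.1 ∈ S

lemma measurableSet_isTrailIn {ι : Type*} (l : List (OEdge ι)) :
    MeasurableSet {S : Set (Edge ι) | IsTrailIn S l} := by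
  have : {S : Set (Edge ι) | IsTrailIn S l} =
      {S | (l.map Prod.fst).Nodup} ∩ ⋂ e ∈ {e | e ∈ l}, {S | e.1 ∈ S} := by
    ext S; simp [IsTrailIn]
  rw [this]
  refine (MeasurableSet.const _).inter ?_
  exact MeasurableSet.biInter (Set.Finite.countable (List.finite_toSet l))
    fun e _ => measurableSet_mem e.1

open Classical in
/-- First moment bound for sums over the lists of distinct free edges. -/
lemma lintegral_tsum_trail_le {ι : Type*} [Countable ι] [Fintype ι] (p : I)
    (F : List (OEdge ι) → ℝ≥0∞) :
    ∫⁻ S, ∑' l : List (OEdge ι), (if IsTrailIn S l then F l else 0) ∂bernoulliSet (Edge ι) p ≤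
      ∑' l : List (OEdge ι), ENNReal.ofReal p ^ l.length * F l := by
  rw [lintegral_tsum fun l => (Measurable.ite (measurableSet_isTrailIn l) measurable_const
    measurable_const).aemeasurable]
  refine ENNReal.tsum_le_tsum fun l => ?_
  have e : ∀ S : Set (Edge ι), (if IsTrailIn S l then F l else 0) =
      {S | IsTrailIn S l}.indicator (fun _ => F l) S := fun S => by
    simp [Set.indicator_apply]
  simp_rw [e]
  rw [lintegral_indicator_const (measurableSet_isTrailIn l), mul_comm]
  refine mul_le_mul_left ?_ _
  by_cases hn : (l.map Prod.fst).Nodup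
  · have := bernoulliSet_containing p (l.map Prod.fst).toFinset
    rw [List.toFinset_card_of_nodup hn, List.length_map] at this
    rw [← this]
    refine measure_mono fun S hS => ?_
    intro a ha
    obtain ⟨e, he, rfl⟩ := List.mem_map.1 (List.mem_toFinset.1 ha)
    exact hS.2 e he
  · have : {S : Set (Edge ι) | IsTrailIn S l} = ∅ := by
      ext S; simp [IsTrailIn, hn]
    rw [this]; simp

/-- Exponential moment of the savings between two vertices. -/
theorem lintegral_exp_savings_le {p : I} {θ : Fin d₁ → ℝ} (h0 : ∀ i, 0 < θ i)
    (h1 : ∀ i, θ i ≤ 1 / 2) (hs : stepBound d₂ p θ ≤ 1 / 4) (x y : EdgeType d₁ d₂ → ℤ) :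
    ∫⁻ S, ENNReal.ofReal (Real.exp ((hor (y - x) : ℝ) - ptime S x y))
      ∂bernoulliSet (Edge (EdgeType d₁ d₂)) p ≤
      ENNReal.ofReal (2 * Real.exp (tilt θ (y - x) - exc (y - x) / 2)) := by
  classical
  set a := ENNReal.ofReal (Real.exp (tilt θ (y - x) - exc (y - x) / 2)) with ha
  calc ∫⁻ S, ENNReal.ofReal (Real.exp ((hor (y - x) : ℝ) - ptime S x y))
        ∂bernoulliSet (Edge (EdgeType d₁ d₂)) p
      ≤ ∫⁻ S, ∑' l : List (OEdge (EdgeType d₁ d₂)), (if IsTrailIn S l then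
          ENNReal.ofReal (Real.exp (listLog θ x l)) * a else 0)
          ∂bernoulliSet (Edge (EdgeType d₁ d₂)) p := by
        refine lintegral_mono fun S => ?_
        obtain ⟨l, hl, hn, h⟩ := exists_nodup_jumpCost_eq_ptime S x y
        refine le_trans ?_ (ENNReal.le_tsum l)
        rw [if_pos ⟨hn, hl⟩, ha, ← ENNReal.ofReal_mul (by positivity), ← Real.exp_add, ← h]
        exact ENNReal.ofReal_le_ofReal (Real.exp_le_exp.2
          (savings_le_listLog (fun i => (h0 i).le) h1 x y l))
    _ ≤ ∑' l : List (OEdge (EdgeType d₁ d₂)), ENNReal.ofReal p ^ l.length *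
          (ENNReal.ofReal (Real.exp (listLog θ x l)) * a) := lintegral_tsum_trail_le p _
    _ = (∑' l : List (OEdge (EdgeType d₁ d₂)), listWeight (ENNReal.ofReal p) θ x l) * a := by
        rw [← ENNReal.tsum_mul_right]
        simp only [listWeight, mul_assoc]
    _ ≤ ENNReal.ofReal 2 * a := mul_le_mul_left (tsum_listWeight_le h0 h1 p.2.1 hs x) _
    _ = _ := by rw [ha, ← ENNReal.ofReal_mul (by norm_num)]

/-- Trails with a defect are unlikely to realise non-negative savings. -/
theorem measure_defect_le {p : I} {θ : Fin d₁ → ℝ} (h0 : ∀ i, 0 < θ i)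
    (h1 : ∀ i, θ i ≤ 1 / 2) (hs : stepBound d₂ p θ ≤ 1 / 4) (x y : EdgeType d₁ d₂ → ℤ) :
    bernoulliSet (Edge (EdgeType d₁ d₂)) p
      {S | ∃ l, IsTrailIn S l ∧ HasDefect x l ∧ (jumpCost x l y : ℝ) ≤ hor (y - x)} ≤
      ENNReal.ofReal (2 * (∑ i, θ i) * Real.exp (tilt θ (y - x))) := by
  classical
  have hθ : 0 ≤ ∑ i, θ i := Finset.sum_nonneg fun i _ => (h0 i).le
  set a := ENNReal.ofReal (Real.exp (tilt θ (y - x))) with ha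
  let F : List (OEdge (EdgeType d₁ d₂)) → ℝ≥0∞ := fun l =>
    if HasDefect x l then ENNReal.ofReal (Real.exp (listLog θ x l)) * a else 0
  have hF := lintegral_tsum_trail_le p F
  have hmeas : Measurable fun S : Set (Edge (EdgeType d₁ d₂)) =>
      ∑' l : List (OEdge (EdgeType d₁ d₂)), (if IsTrailIn S l then F l else 0) :=
    Measurable.tsum fun l => Measurable.ite (measurableSet_isTrailIn l)
      measurable_const measurable_const
  -- Markov's inequality: a trail with non-negative savings has a term at least `1` by
  -- `savings_le_listLog`.
  calc _ ≤ bernoulliSet (Edge (EdgeType d₁ d₂)) p {S | 1 ≤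
        ∑' l : List (OEdge (EdgeType d₁ d₂)), (if IsTrailIn S l then F l else 0)} := by
        refine measure_mono ?_
        rintro S ⟨l, hl, hd, hc⟩
        refine le_trans ?_ (ENNReal.le_tsum l)
        have := savings_le_listLog (fun i => (h0 i).le) h1 x y l
        have h2 := exc_nonneg (y - x)
        simp only [F]
        rw [if_pos hl, if_pos hd, ha, ← ENNReal.ofReal_mul (by positivity), ← Real.exp_add,
          ENNReal.one_le_ofReal]
        exact Real.one_le_exp (by linarith)
    _ ≤ ∫⁻ S, ∑' l : List (OEdge (EdgeType d₁ d₂)), (if IsTrailIn S l then F l else 0)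
          ∂bernoulliSet (Edge (EdgeType d₁ d₂)) p := by
        simpa using mul_meas_ge_le_lintegral hmeas 1
    _ ≤ _ := hF
    _ = (∑' l : List (OEdge (EdgeType d₁ d₂)),
          (if HasDefect x l then listWeight (ENNReal.ofReal p) θ x l else 0)) * a := by
        rw [← ENNReal.tsum_mul_right]
        refine tsum_congr fun l => ?_
        simp only [F, listWeight]
        split_ifs
        · ring
        · simp
    _ ≤ ENNReal.ofReal (2 * ∑ i, θ i) * a :=
        mul_le_mul_left (tsum_listWeight_defect_le h0 h1 p.2.1 hs x) _
    _ = _ := by rw [ha, ← ENNReal.ofReal_mul (by positivity)]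

/-- Trails with a large overshoot are unlikely to realise non-negative savings. -/
theorem measure_overshoot_le {p : I} {θ : Fin d₁ → ℝ} (h0 : ∀ i, 0 < θ i)
    (h1 : ∀ i, θ i ≤ 1 / 2) (hs : stepBound d₂ p θ ≤ 1 / 4) (x y : EdgeType d₁ d₂ → ℤ) (A : ℝ) :
    bernoulliSet (Edge (EdgeType d₁ d₂)) p
      {S | ∃ l, IsTrailIn S l ∧ (∃ i, (y (Sum.inl i) : ℝ) + A ≤ lastVertex x l (Sum.inl i)) ∧
        (jumpCost x l y : ℝ) ≤ hor (y - x)} ≤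
      ENNReal.ofReal (2 * Real.exp (tilt θ (y - x) - A)) := by
  classical
  set a := ENNReal.ofReal (Real.exp (tilt θ (y - x) - A)) with ha
  let F : List (OEdge (EdgeType d₁ d₂)) → ℝ≥0∞ := fun l =>
    ENNReal.ofReal (Real.exp (listLog θ x l)) * a
  have hF := lintegral_tsum_trail_le p F
  have hmeas : Measurable fun S : Set (Edge (EdgeType d₁ d₂)) =>
      ∑' l : List (OEdge (EdgeType d₁ d₂)), (if IsTrailIn S l then F l else 0) :=
    Measurable.tsum fun l => Measurable.ite (measurableSet_isTrailIn l)
      measurable_const measurable_const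
  calc _ ≤ bernoulliSet (Edge (EdgeType d₁ d₂)) p {S | 1 ≤
        ∑' l : List (OEdge (EdgeType d₁ d₂)), (if IsTrailIn S l then F l else 0)} := by
        refine measure_mono ?_
        rintro S ⟨l, hl, ⟨i, hi⟩, hc⟩
        refine le_trans ?_ (ENNReal.le_tsum l)
        have := savings_le_listLog_overshoot (fun i => (h0 i).le) h1 x y l i
        simp only [F]
        rw [if_pos hl, ha, ← ENNReal.ofReal_mul (by positivity), ← Real.exp_add,
          ENNReal.one_le_ofReal]
        exact Real.one_le_exp (by linarith)
    _ ≤ ∫⁻ S, ∑' l : List (OEdge (EdgeType d₁ d₂)), (if IsTrailIn S l then F l else 0)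
          ∂bernoulliSet (Edge (EdgeType d₁ d₂)) p := by
        simpa using mul_meas_ge_le_lintegral hmeas 1
    _ ≤ _ := hF
    _ = (∑' l : List (OEdge (EdgeType d₁ d₂)), listWeight (ENNReal.ofReal p) θ x l) * a := by
        rw [← ENNReal.tsum_mul_right]
        simp only [F, listWeight, mul_assoc]
    _ ≤ ENNReal.ofReal 2 * a := mul_le_mul_left (tsum_listWeight_le h0 h1 p.2.1 hs x) _
    _ = _ := by rw [ha, ← ENNReal.ofReal_mul (by norm_num)]

end ListSums

/-! ### Vertical tours and the discrete score -/

section VerticalTours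

variable {d₁ d₂ : ℕ}

/-- Move a nonzero coordinate one unit towards `0`. -/
lemma exists_single_step {ι : Type*} [Fintype ι] [DecidableEq ι] {x : ι → ℤ} {k : ℕ}
    (h : l1 x = k + 1) : ∃ i, x i ≠ 0 ∧ l1 (x - Pi.single i (x i).sign) = k := by
  have hx : ∃ i, x i ≠ 0 := by
    by_contra! h0
    have : x = 0 := funext h0
    rw [this, l1_zero] at h
    omega
  obtain ⟨i, hi⟩ := hx
  refine ⟨i, hi, ?_⟩
  · have e : l1 x = (x i).natAbs + ∑ j ∈ Finset.univ.erase i, (x j).natAbs :=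
      (Finset.add_sum_erase _ _ (Finset.mem_univ i)).symm
    have e' : l1 (x - Pi.single i (x i).sign) = (x i - (x i).sign).natAbs +
        ∑ j ∈ Finset.univ.erase i, (x j).natAbs := by
      rw [l1, ← Finset.add_sum_erase _ _ (Finset.mem_univ i)]
      congr 1
      · simp
      · refine Finset.sum_congr rfl fun j hj => ?_
        rw [Pi.sub_apply, Pi.single_eq_of_ne (Finset.ne_of_mem_erase hj), sub_zero]
    have e2 : (x i - (x i).sign).natAbs + 1 = (x i).natAbs := by
      rcases lt_trichotomy (x i) 0 with h1 | h1 | h1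
      · rw [Int.sign_eq_neg_one_of_neg h1]; omega
      · exact absurd h1 hi
      · rw [Int.sign_eq_one_of_pos h1]; omega
    omega

lemma exists_unit_step {ι : Type*} [Fintype ι] [DecidableEq ι] {x : ι → ℤ} {k : ℕ}
    (h : l1 x = k + 1) : ∃ s : ι → ℤ, l1 s = 1 ∧ l1 (x - s) = k := by
  obtain ⟨i, hi, h⟩ := exists_single_step h
  exact ⟨_, by rw [l1_single, Int.natAbs_sign_of_ne_zero hi], h⟩

lemma lattice_adj_iff {d : ℕ} {x y : Fin d → ℤ} : (lattice d).Adj x y ↔ l1 (y - x) = 1 := by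
  rw [l1_sub_comm]
  change ∑ i, |x i - y i| = 1 ↔ ∑ i, ((x - y) i).natAbs = 1
  zify
  simp

lemma VerticalTour.moves {w : List (Particle d₁ d₂)} {p q : Fin d₂ → ℤ} {n : ℕ}
    (h : VerticalTour w q n) : VerticalTour w p (n + l1 (q - p)) := by
  obtain ⟨k, hk⟩ : ∃ k, l1 (q - p) = k := ⟨_, rfl⟩
  rw [hk]
  induction k generalizing p with
  | zero =>
    have : q = p := sub_eq_zero.1 (l1_eq_zero.1 hk)
    rwa [← this]
  | succ k ih =>
    obtain ⟨s, hs, hs'⟩ := exists_unit_step hk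
    have := ih (p := p + s) (by rw [← hs']; congr 1; abel)
    exact VerticalTour.move (lattice_adj_iff.2 (by rw [add_sub_cancel_left, hs])) this

lemma exists_verticalTour (w : List (Particle d₁ d₂)) (p : Fin d₂ → ℤ) :
    ∃ n, VerticalTour w p n := by
  induction w generalizing p with
  | nil => exact ⟨_, VerticalTour.nil.moves⟩
  | cons a w ih =>
    obtain ⟨⟨x, v⟩, i | j⟩ := a
    · obtain ⟨n, hn⟩ := ih v
      exact ⟨_, (VerticalTour.site i hn).moves⟩
    · obtain ⟨n, hn⟩ := ih (v + Pi.single j 1)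
      exact ⟨_, (VerticalTour.up j rfl hn).moves⟩

lemma verticalTour_verticalLength (w : List (Particle d₁ d₂)) :
    VerticalTour w 0 (verticalLength w) := Nat.sInf_mem (exists_verticalTour w 0)

lemma verticalLength_le {w : List (Particle d₁ d₂)} {n : ℕ} (h : VerticalTour w 0 n) :
    verticalLength w ≤ n := Nat.sInf_le h

lemma VerticalTour.append {w w' : List (Particle d₁ d₂)} {p : Fin d₂ → ℤ} {a b : ℕ}
    (h : VerticalTour w p a) (h' : VerticalTour w' 0 b) : VerticalTour (w ++ w') p (a + b) := by
  induction h with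
  | nil => simpa using h'
  | move hpq _ ih => rw [Nat.add_right_comm]; exact VerticalTour.move hpq ih
  | site i _ ih => exact VerticalTour.site i ih
  | up j hp _ ih => rw [Nat.add_right_comm]; exact VerticalTour.up j hp ih
  | down j hp _ ih => rw [Nat.add_right_comm]; exact VerticalTour.down j hp ih

@[simp] lemma verticalLength_nil : verticalLength ([] : List (Particle d₁ d₂)) = 0 :=
  Nat.le_zero.1 (verticalLength_le .nil)

lemma verticalLength_append_le (w w' : List (Particle d₁ d₂)) :
    verticalLength (w ++ w') ≤ verticalLength w + verticalLength w' :=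
  verticalLength_le ((verticalTour_verticalLength w).append (verticalTour_verticalLength w'))

/-- Two particles with the same vertical position and type. -/
def SameVertical (a b : Particle d₁ d₂) : Prop := a.1.2 = b.1.2 ∧ a.2 = b.2

/-- Tours see only vertical positions and types. This is what allows particles to be moved
horizontally in all comparisons of scores. -/
lemma VerticalTour.congr {w w' : List (Particle d₁ d₂)} {p : Fin d₂ → ℤ} {n : ℕ}
    (h : VerticalTour w p n) (hw : List.Forall₂ SameVertical w w') : VerticalTour w' p n := by
  induction h generalizing w' with
  | nil => cases hw; exact .nil
  | move hpq _ ih => exact .move hpq (ih hw)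
  | site i _ ih =>
    obtain _ | @⟨_, ⟨⟨x, v⟩, t⟩, _, _, ⟨h1, h2⟩, h3⟩ := hw
    simp only at h1 h2
    subst h1 h2
    exact .site i (ih h3)
  | up j hp _ ih =>
    obtain _ | @⟨_, ⟨⟨x, v⟩, t⟩, _, _, ⟨h1, h2⟩, h3⟩ := hw
    simp only at h1 h2
    subst h1 h2
    exact .up j hp (ih h3)
  | down j hp _ ih =>
    obtain _ | @⟨_, ⟨⟨x, v⟩, t⟩, _, _, ⟨h1, h2⟩, h3⟩ := hw
    simp only at h1 h2
    subst h1 h2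
    exact .down j hp (ih h3)

lemma verticalLength_le_of_forall₂ {w w' : List (Particle d₁ d₂)}
    (hw : List.Forall₂ SameVertical w w') : verticalLength w' ≤ verticalLength w :=
  verticalLength_le ((verticalTour_verticalLength w).congr hw)

lemma verticalLength_map_eq {α : Type*} {f g : α → Particle d₁ d₂} {l : List α}
    (h : ∀ a ∈ l, SameVertical (f a) (g a)) :
    verticalLength (l.map f) = verticalLength (l.map g) := by
  refine le_antisymm (verticalLength_le_of_forall₂ ?_) (verticalLength_le_of_forall₂ ?_)
  · rw [List.forall₂_map_left_iff, List.forall₂_map_right_iff, List.forall₂_same]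
    exact fun a ha => ⟨(h a ha).1.symm, (h a ha).2.symm⟩
  · rw [List.forall₂_map_left_iff, List.forall₂_map_right_iff, List.forall₂_same]
    exact h

/-- The vertical coordinates. -/
def verPart (x : EdgeType d₁ d₂ → ℤ) : Fin d₂ → ℤ := fun j => x (Sum.inr j)

/-- The particle carried by an edge: its base point and its direction. -/
def particleOf (e : Edge (EdgeType d₁ d₂)) : Particle d₁ d₂ :=
  ((fun i => (e.1 (Sum.inl i) : ℝ), verPart e.1), e.2)

/-- Lists of edges of `S` with increasing horizontal coordinates in the box of size `N`. -/
structure IsIncreasing (S : Set (Edge (EdgeType d₁ d₂))) (N : Fin d₁ → ℕ)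
    (l : List (Edge (EdgeType d₁ d₂))) : Prop where
  mem : ∀ e ∈ l, e ∈ S
  bounds : ∀ e ∈ l, ∀ i, 0 ≤ e.1 (Sum.inl i) ∧ e.1 (Sum.inl i) < N i
  increasing : l.Pairwise fun a b => ∀ i, a.1 (Sum.inl i) < b.1 (Sum.inl i)

/-- The discrete score in a box. -/
def dscore (S : Set (Edge (EdgeType d₁ d₂))) (N : Fin d₁ → ℕ) : ℝ≥0∞ :=
  ⨆ (l : List (Edge (EdgeType d₁ d₂))) (_ : IsIncreasing S N l),
    ((l.length - verticalLength (l.map particleOf) : ℕ) : ℝ≥0∞)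

lemma le_dscore {S : Set (Edge (EdgeType d₁ d₂))} {N : Fin d₁ → ℕ}
    {l : List (Edge (EdgeType d₁ d₂))} (h : IsIncreasing S N l) :
    ((l.length - verticalLength (l.map particleOf) : ℕ) : ℝ≥0∞) ≤ dscore S N :=
  le_iSup₂_of_le l h le_rfl

/-- Coordinate `i` is injective along the list and takes at most `N i` values. In particular
discrete scores are bounded. -/
lemma IsIncreasing.length_le {S : Set (Edge (EdgeType d₁ d₂))} {N : Fin d₁ → ℕ}
    {l : List (Edge (EdgeType d₁ d₂))} (h : IsIncreasing S N l) (i : Fin d₁) :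
    l.length ≤ N i := by
  have h1 : (l.map fun e => (e.1 (Sum.inl i)).toNat).Nodup := by
    rw [List.Nodup, List.pairwise_map]
    refine List.Pairwise.imp_of_mem ?_ h.increasing
    intro a b ha hb hab
    have := hab i
    have := (h.bounds a ha i).1
    omega
  have h2 : (l.map fun e => (e.1 (Sum.inl i)).toNat).toFinset ⊆ Finset.range (N i) := by
    intro n hn
    rw [List.mem_toFinset, List.mem_map] at hn
    obtain ⟨e, he, rfl⟩ := hn
    have := h.bounds e he i
    rw [Finset.mem_range]
    omega
  have := Finset.card_le_card h2
  rwa [List.toFinset_card_of_nodup h1, List.length_map, Finset.card_range] at this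

lemma dscore_le (S : Set (Edge (EdgeType d₁ d₂))) (N : Fin d₁ → ℕ) (i : Fin d₁) :
    dscore S N ≤ N i :=
  iSup₂_le fun l hl => by
    exact_mod_cast (Nat.sub_le _ _).trans (hl.length_le i)

lemma dscore_mono {S S' : Set (Edge (EdgeType d₁ d₂))} (h : S ⊆ S') {N N' : Fin d₁ → ℕ}
    (hN : N ≤ N') : dscore S N ≤ dscore S' N' :=
  iSup₂_le fun l hl => le_dscore ⟨fun e he => h (hl.mem e he), fun e he i =>
    ⟨(hl.bounds e he i).1, (hl.bounds e he i).2.trans_le (by exact_mod_cast hN i)⟩, hl.increasing⟩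

/-- The slab of edges based in the box `[a, a + N)`. -/
def slab (a : EdgeType d₁ d₂ → ℤ) (N : Fin d₁ → ℕ) : Set (Edge (EdgeType d₁ d₂)) :=
  {e | ∀ i, a (Sum.inl i) ≤ e.1 (Sum.inl i) ∧ e.1 (Sum.inl i) < a (Sum.inl i) + N i}

lemma dscore_inter_slab (S : Set (Edge (EdgeType d₁ d₂))) (N : Fin d₁ → ℕ) :
    dscore (S ∩ slab 0 N) N = dscore S N :=
  le_antisymm (dscore_mono Set.inter_subset_left le_rfl) (iSup₂_le fun l hl =>
    le_dscore ⟨fun e he => ⟨hl.mem e he, by simpa [slab] using hl.bounds e he⟩,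
      hl.bounds, hl.increasing⟩)

/-- A countable supremum over lists, each being present on a cylinder event. -/
lemma measurable_dscore (N : Fin d₁ → ℕ) :
    Measurable fun S : Set (Edge (EdgeType d₁ d₂)) => dscore S N := by
  classical
  have e : (fun S : Set (Edge (EdgeType d₁ d₂)) => dscore S N) = fun S =>
      ⨆ l : List (Edge (EdgeType d₁ d₂)), if IsIncreasing S N l then
        ((l.length - verticalLength (l.map particleOf) : ℕ) : ℝ≥0∞) else 0 := by
    ext S
    refine iSup_congr fun l => ?_
    by_cases h : IsIncreasing S N l <;> simp [h]
  rw [e]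
  refine Measurable.iSup fun l => Measurable.ite ?_ measurable_const measurable_const
  have : {S : Set (Edge (EdgeType d₁ d₂)) | IsIncreasing S N l} =
      {S | (∀ e ∈ l, ∀ i, 0 ≤ e.1 (Sum.inl i) ∧ e.1 (Sum.inl i) < N i) ∧
        l.Pairwise fun a b => ∀ i, a.1 (Sum.inl i) < b.1 (Sum.inl i)} ∩
      ⋂ e ∈ {e | e ∈ l}, {S | e ∈ S} := by
    ext S
    simp only [Set.mem_ofPred_eq, Set.mem_inter_iff, Set.mem_iInter]
    exact ⟨fun h => ⟨⟨h.2, h.3⟩, h.1⟩, fun h => ⟨h.2, h.1.1, h.1.2⟩⟩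
  rw [this]
  refine (MeasurableSet.const _).inter ?_
  exact MeasurableSet.biInter (Set.Finite.countable (List.finite_toSet l))
    fun e _ => measurableSet_mem e

/-- Superadditivity of the discrete score. -/
lemma dscore_add_le (S : Set (Edge (EdgeType d₁ d₂))) (N N' : Fin d₁ → ℕ)
    (a : EdgeType d₁ d₂ → ℤ) (ha : ∀ i, a (Sum.inl i) = N i) (ha' : verPart a = 0) :
    dscore S N + dscore (shiftEdge a ⁻¹' S) N' ≤ dscore S (N + N') := by
  refine ENNReal.biSup_add_biSup_le' ⟨[], ⟨by simp, by simp, by simp⟩⟩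
    ⟨[], ⟨by simp, by simp, by simp⟩⟩ fun l hl l' hl' => ?_
  -- A list whose truncated score vanishes may be replaced by the empty list, after which the
  -- natural subtractions are genuine.
  wlog h₁ : verticalLength (l.map particleOf) ≤ l.length generalizing l
  · refine le_trans (add_le_add_left ?_ _) (this [] ⟨by simp, by simp, by simp⟩ (by simp))
    rw [Nat.sub_eq_zero_of_le (not_le.1 h₁).le]
    simp
  wlog h₂ : verticalLength (l'.map particleOf) ≤ l'.length generalizing l'
  · refine le_trans (add_le_add_right ?_ _) (this [] ⟨by simp, by simp, by simp⟩ (by simp))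
    rw [Nat.sub_eq_zero_of_le (not_le.1 h₂).le]
    simp
  have hsh : ∀ (e : Edge (EdgeType d₁ d₂)) i,
      (shiftEdge a e).1 (Sum.inl i) = e.1 (Sum.inl i) + N i := fun e i => by
    simp [shiftEdge, ha]
  have h : IsIncreasing S (N + N') (l ++ l'.map (shiftEdge a)) := by
    refine ⟨?_, ?_, ?_⟩
    · intro e he
      rcases List.mem_append.1 he with he | he
      · exact hl.mem e he
      · obtain ⟨f, hf, rfl⟩ := List.mem_map.1 he
        exact hl'.mem f hf
    · intro e he i
      rw [Pi.add_apply]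
      push_cast
      rcases List.mem_append.1 he with he | he
      · have := hl.bounds e he i
        omega
      · obtain ⟨f, hf, rfl⟩ := List.mem_map.1 he
        have := hl'.bounds f hf i
        rw [hsh]
        omega
    · rw [List.pairwise_append]
      refine ⟨hl.increasing, ?_, ?_⟩
      · rw [List.pairwise_map]
        refine hl'.increasing.imp fun {e f} hef i => ?_
        rw [hsh, hsh]
        have := hef i
        omega
      · intro e he f' hf' i
        obtain ⟨f, hf, rfl⟩ := List.mem_map.1 hf'
        have := hl.bounds e he i
        have := hl'.bounds f hf i
        rw [hsh]
        omega
  refine le_trans ?_ (le_dscore h)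
  rw [List.map_append, List.map_map, List.length_append, List.length_map]
  have h1 := verticalLength_append_le (l.map particleOf) (l'.map (particleOf ∘ shiftEdge a))
  have h2 : verticalLength (l'.map (particleOf ∘ shiftEdge a)) =
      verticalLength (l'.map particleOf) := verticalLength_map_eq fun e _ => by
    refine ⟨?_, rfl⟩
    have := congrFun ha'
    ext j
    simp only [verPart] at this
    simp [particleOf, verPart, shiftEdge, this]
  rw [h2] at h1
  norm_cast
  omega

/-- Comparison of discrete scores along a map which increases the horizontal order. -/
lemma dscore_le_of_forall {S S' : Set (Edge (EdgeType d₁ d₂))} {N N' : Fin d₁ → ℕ}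
    (R : Edge (EdgeType d₁ d₂) → Edge (EdgeType d₁ d₂) → Prop)
    (h : ∀ e ∈ S, ∃ f ∈ S', R e f)
    (hv : ∀ e f, R e f → verPart e.1 = verPart f.1 ∧ e.2 = f.2)
    (hb : ∀ e f, R e f → (∀ i, 0 ≤ e.1 (Sum.inl i) ∧ e.1 (Sum.inl i) < N i) →
      ∀ i, 0 ≤ f.1 (Sum.inl i) ∧ f.1 (Sum.inl i) < N' i)
    (hm : ∀ e f e' f', R e f → R e' f' → (∀ i, e.1 (Sum.inl i) < e'.1 (Sum.inl i)) →
      ∀ i, f.1 (Sum.inl i) < f'.1 (Sum.inl i)) :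
    dscore S N ≤ dscore S' N' := by
  classical
  have h' : ∀ e, ∃ f, e ∈ S → f ∈ S' ∧ R e f := fun e => by
    by_cases he : e ∈ S
    · obtain ⟨f, hf⟩ := h e he
      exact ⟨f, fun _ => hf⟩
    · exact ⟨e, fun h => absurd h he⟩
  choose g hg using h'
  refine iSup₂_le fun l hl => ?_
  have : IsIncreasing S' N' (l.map g) := by
    refine ⟨?_, ?_, ?_⟩
    · intro f hf
      obtain ⟨e, he, rfl⟩ := List.mem_map.1 hf
      exact (hg e (hl.mem e he)).1
    · intro f hf
      obtain ⟨e, he, rfl⟩ := List.mem_map.1 hf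
      exact hb e _ (hg e (hl.mem e he)).2 (hl.bounds e he)
    · rw [List.pairwise_map]
      refine List.Pairwise.imp_of_mem ?_ hl.increasing
      intro a b ha hb hab
      exact hm a _ b _ (hg a (hl.mem a ha)).2 (hg b (hl.mem b hb)).2 hab
  refine le_trans ?_ (le_dscore this)
  rw [List.length_map, List.map_map, verticalLength_map_eq (f := particleOf ∘ g) (g := particleOf)]
  intro e he
  have := hv e _ (hg e (hl.mem e he)).2
  exact ⟨this.1.symm, this.2.symm⟩

/-- Coarse-graining of the horizontal coordinates. -/
def coarseEdge (g : Fin d₁ → ℕ) (e : Edge (EdgeType d₁ d₂)) : Edge (EdgeType d₁ d₂) :=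
  (Sum.elim (fun i => e.1 (Sum.inl i) / g i) (fun j => e.1 (Sum.inr j)), e.2)

/-- Strictly ordered quotients come from strictly ordered coordinates, so any choice of fine
representatives of an increasing coarse list is increasing. The converse fails: ordered fine edges
may share a coarse coordinate. -/
lemma dscore_coarse_le (S : Set (Edge (EdgeType d₁ d₂))) (N g : Fin d₁ → ℕ)
    (hg : ∀ i, 0 < g i) : dscore (coarseEdge g '' S) N ≤ dscore S (g * N) := by
  refine dscore_le_of_forall (fun e f => coarseEdge g f = e) ?_ ?_ ?_ ?_
  · rintro e ⟨f, hf, rfl⟩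
    exact ⟨f, hf, rfl⟩
  · rintro e f rfl
    exact ⟨rfl, rfl⟩
  · rintro e f rfl h i
    have hgi : (0 : ℤ) < g i := by exact_mod_cast hg i
    have := h i
    simp only [coarseEdge, Sum.elim_inl] at this
    refine ⟨?_, ?_⟩
    · by_contra hcon
      have := Int.ediv_neg_of_neg_of_pos (not_le.1 hcon) hgi
      omega
    · have := (Int.ediv_lt_iff_lt_mul hgi).1 this.2
      rw [Pi.mul_apply]; push_cast
      linarith
  · rintro e f e' f' rfl rfl h i
    have hgi : (0 : ℤ) < g i := by exact_mod_cast hg i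
    have := h i
    simp only [coarseEdge, Sum.elim_inl] at this
    by_contra hcon
    have := Int.ediv_le_ediv hgi (not_lt.1 hcon)
    omega

end VerticalTours

/-! ### Discrete score and passage times -/

section ScoreTime

variable {d₁ d₂ : ℕ}

/-- The vertex with given horizontal coordinates and no vertical displacement. -/
def corner (N : Fin d₁ → ℕ) : EdgeType d₁ d₂ → ℤ := Sum.elim (fun i => (N i : ℤ)) 0

lemma l1_eq_sum (x : EdgeType d₁ d₂ → ℤ) :
    l1 x = ∑ i, (x (Sum.inl i)).natAbs + l1 (verPart x) := by
  rw [l1, Fintype.sum_sum_type]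
  rfl

lemma hor_add_le_l1 (x : EdgeType d₁ d₂ → ℤ) : hor x + l1 (verPart x) ≤ l1 x := by
  rw [l1_eq_sum, hor]
  push_cast
  exact add_le_add_left (Finset.sum_le_sum fun i _ => le_abs_self _) _

lemma l1_of_nonneg {x : EdgeType d₁ d₂ → ℤ} (h : ∀ i, 0 ≤ x (Sum.inl i)) :
    (l1 x : ℤ) = hor x + l1 (verPart x) := by
  rw [l1_eq_sum, hor]
  push_cast
  congr 1
  exact Finset.sum_congr rfl fun i _ => abs_of_nonneg (h i)

lemma ptime_edge {ι : Type*} [Fintype ι] [DecidableEq ι] {S : Set (Edge ι)} {e : Edge ι}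
    (he : e ∈ S) : ptime S e.1 (e.1 + Pi.single e.2 1) = 0 := by
  have := ptime_le (S := S) (x := e.1) (y := e.1 + Pi.single e.2 1) (l := [(e, true)])
    (by simpa using he)
  simpa [jumpCost, OEdge.src, OEdge.tgt] using this

lemma verPart_add_single_inl (x : EdgeType d₁ d₂ → ℤ) (i : Fin d₁) (a : ℤ) :
    verPart (x + Pi.single (Sum.inl i) a) = verPart x := by
  ext j; simp [verPart]

lemma verPart_add_single_inr (x : EdgeType d₁ d₂ → ℤ) (j : Fin d₂) (a : ℤ) :
    verPart (x + Pi.single (Sum.inr j) a) = verPart x + Pi.single j a := by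
  ext k
  simp only [verPart, Pi.add_apply, add_right_inj]
  by_cases h : k = j
  · subst h; simp
  · rw [Pi.single_eq_of_ne h, Pi.single_eq_of_ne (by simpa using h)]

lemma hor_single_inl (i : Fin d₁) (a : ℤ) :
    hor (Pi.single (Sum.inl i) a : EdgeType d₁ d₂ → ℤ) = a := by
  rw [hor, Finset.sum_eq_single i]
  · simp
  · intro j _ hj
    rw [Pi.single_eq_of_ne (by simpa using hj)]
  · simp

lemma hor_single_inr (j : Fin d₂) (a : ℤ) :
    hor (Pi.single (Sum.inr j) a : EdgeType d₁ d₂ → ℤ) = 0 := by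
  rw [hor]
  exact Finset.sum_eq_zero fun i _ => by simp

/-- Following an increasing list of free edges along a vertical tour. -/
lemma ptime_add_length_le {S : Set (Edge (EdgeType d₁ d₂))} {N : Fin d₁ → ℕ}
    {w : List (Particle d₁ d₂)} {p : Fin d₂ → ℤ} {n : ℕ} (h : VerticalTour w p n) :
    ∀ l : List (Edge (EdgeType d₁ d₂)), l.map particleOf = w → IsIncreasing S N l →
      ∀ x : EdgeType d₁ d₂ → ℤ, verPart x = p → (∀ i, x (Sum.inl i) ≤ N i) →
        (∀ e ∈ l, ∀ i, x (Sum.inl i) ≤ e.1 (Sum.inl i)) →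
        (ptime S x (corner N) : ℤ) + l.length ≤ hor (corner N - x) + n := by
  have tail : ∀ {e : Edge (EdgeType d₁ d₂)} {l : List (Edge (EdgeType d₁ d₂))},
      IsIncreasing S N (e :: l) → IsIncreasing S N l := fun {e l} hl =>
    ⟨fun f hf => hl.mem f (List.mem_cons_of_mem _ hf),
      fun f hf => hl.bounds f (List.mem_cons_of_mem _ hf), (List.pairwise_cons.1 hl.increasing).2⟩
  induction h with
  | nil =>
    intro l hl _ x hx hN _
    rw [List.map_eq_nil_iff] at hl
    subst hl
    have h1 := ptime_le_l1 S x (corner N)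
    have h2 : (l1 (corner N - x) : ℤ) = hor (corner N - x) + l1 (verPart (corner N - x)) :=
      l1_of_nonneg fun i => by simpa [corner] using hN i
    have h3 : verPart (corner N - x) = 0 := by
      ext j
      have := congrFun hx j
      simp only [verPart] at this
      simp [verPart, corner, this]
    rw [h3, l1_zero] at h2
    simp
    omega
  | @move w p q n hpq _ ih =>
    intro l hl hinc x hx hN he
    let x' : EdgeType d₁ d₂ → ℤ := Sum.elim (fun i => x (Sum.inl i)) q
    have h1 := ih l hl hinc x' rfl hN he
    have h2 := ptime_triangle S x x' (corner N)
    have h3 := ptime_le_l1 S x x'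
    have h4 : l1 (x' - x) = 1 := by
      rw [l1_eq_sum, ← lattice_adj_iff.1 hpq, ← hx]
      simp [x']
      rfl
    have h5 : hor (corner N - x') = hor (corner N - x) := by simp [hor, x']
    push_cast
    omega
  | @site w y p n i _ ih =>
    intro l hl hinc x hx hN he
    obtain ⟨e, l, rfl⟩ : ∃ e l', l = e :: l' := by
      cases l with
      | nil => simp at hl
      | cons e l => exact ⟨e, l, rfl⟩
    rw [List.map_cons, List.cons.injEq] at hl
    obtain ⟨he1, hl⟩ := hl
    have ht : e.2 = Sum.inl i := congrArg Prod.snd he1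
    have hv : verPart e.1 = p := congrArg (fun a => a.1.2) he1
    have hp := List.pairwise_cons.1 hinc.increasing
    have hb := hinc.bounds e List.mem_cons_self
    -- A free horizontal edge gives one unit of horizontal progress at no cost and no vertical step.
    -- Its end is still below the next edge because coordinates increase strictly.
    let x' := e.1 + Pi.single (Sum.inl i) 1
    have hx' : ∀ k, x' (Sum.inl k) ≤ e.1 (Sum.inl k) + 1 := fun k => by
      by_cases hk : k = i
      · subst hk; simp [x']
      · simp only [x', Pi.add_apply]
        rw [Pi.single_eq_of_ne (by simpa using hk)]; omega
    have h1 := ih l hl (tail hinc) x' (by rw [verPart_add_single_inl, hv])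
      (fun k => by have := hx' k; have := hb k; omega)
      (fun f hf k => by have := hx' k; have := hp.1 f hf k; omega)
    have h2 := ptime_triangle S x e.1 (corner N)
    have h3 := ptime_triangle S e.1 x' (corner N)
    have h4 : ptime S e.1 x' = 0 := by
      rw [← ptime_edge (hinc.mem e List.mem_cons_self), ht]
    have h5 := ptime_le_l1 S x e.1
    have h6 : (l1 (e.1 - x) : ℤ) = hor (e.1 - x) + l1 (verPart (e.1 - x)) :=
      l1_of_nonneg fun k => sub_nonneg.2 (he e List.mem_cons_self k)
    have h7 : verPart (e.1 - x) = 0 := by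
      have : verPart (e.1 - x) = verPart e.1 - verPart x := rfl
      rw [this, hv, hx, sub_self]
    rw [h7, l1_zero] at h6
    have h8 : hor (corner N - x') = hor (corner N : EdgeType d₁ d₂ → ℤ) - hor e.1 - 1 := by
      rw [hor_sub, hor_add, hor_single_inl]; ring
    rw [hor_sub] at h6 ⊢
    rw [List.length_cons]
    push_cast
    omega
  | @up w y v p n j hp' _ ih =>
    intro l hl hinc x hx hN he
    obtain ⟨e, l, rfl⟩ : ∃ e l', l = e :: l' := by
      cases l with
      | nil => simp at hl
      | cons e l => exact ⟨e, l, rfl⟩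
    rw [List.map_cons, List.cons.injEq] at hl
    obtain ⟨he1, hl⟩ := hl
    have ht : e.2 = Sum.inr j := congrArg Prod.snd he1
    have hv : verPart e.1 = v := congrArg (fun a => a.1.2) he1
    have hp := List.pairwise_cons.1 hinc.increasing
    have hb := hinc.bounds e List.mem_cons_self
    -- A free vertical edge is one of the steps counted in the tour, but it is not paid.
    let x' := e.1 + Pi.single (Sum.inr j) 1
    have hx' : ∀ k, x' (Sum.inl k) = e.1 (Sum.inl k) := fun k => by simp [x']
    have h1 := ih l hl (tail hinc) x' (by rw [verPart_add_single_inr, hv, hp'])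
      (fun k => by have := hx' k; have := hb k; omega)
      (fun f hf k => by have := hx' k; have := hp.1 f hf k; omega)
    have h2 := ptime_triangle S x e.1 (corner N)
    have h3 := ptime_triangle S e.1 x' (corner N)
    have h4 : ptime S e.1 x' = 0 := by
      rw [← ptime_edge (hinc.mem e List.mem_cons_self), ht]
    have h5 := ptime_le_l1 S x e.1
    have h6 : (l1 (e.1 - x) : ℤ) = hor (e.1 - x) + l1 (verPart (e.1 - x)) :=
      l1_of_nonneg fun k => sub_nonneg.2 (he e List.mem_cons_self k)
    have h7 : verPart (e.1 - x) = 0 := by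
      have : verPart (e.1 - x) = verPart e.1 - verPart x := rfl
      rw [this, hv, hx, sub_self]
    rw [h7, l1_zero] at h6
    have h8 : hor (corner N - x') = hor (corner N : EdgeType d₁ d₂ → ℤ) - hor e.1 := by
      rw [hor_sub, hor_add, hor_single_inr]; ring
    rw [hor_sub] at h6 ⊢
    rw [List.length_cons]
    push_cast
    omega
  | @down w y v p n j hp' _ ih =>
    intro l hl hinc x hx hN he
    obtain ⟨e, l, rfl⟩ : ∃ e l', l = e :: l' := by
      cases l with
      | nil => simp at hl
      | cons e l => exact ⟨e, l, rfl⟩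
    rw [List.map_cons, List.cons.injEq] at hl
    obtain ⟨he1, hl⟩ := hl
    have ht : e.2 = Sum.inr j := congrArg Prod.snd he1
    have hv : verPart e.1 = v := congrArg (fun a => a.1.2) he1
    have hp := List.pairwise_cons.1 hinc.increasing
    have hb := hinc.bounds e List.mem_cons_self
    let x' := e.1 + Pi.single (Sum.inr j) 1
    have hx' : ∀ k, x' (Sum.inl k) = e.1 (Sum.inl k) := fun k => by simp [x']
    -- The edge is crossed from its upper end `x'` down to its base point.
    have h1 := ih l hl (tail hinc) e.1 hv
      (fun k => (hb k).2.le) (fun f hf k => (hp.1 f hf k).le)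
    have h2 := ptime_triangle S x x' (corner N)
    have h3 := ptime_triangle S x' e.1 (corner N)
    have h4 : ptime S x' e.1 = 0 := by
      rw [ptime_symm, ← ptime_edge (hinc.mem e List.mem_cons_self), ht]
    have h5 := ptime_le_l1 S x x'
    have h6 : (l1 (x' - x) : ℤ) = hor (x' - x) + l1 (verPart (x' - x)) :=
      l1_of_nonneg fun k => sub_nonneg.2 ((he e List.mem_cons_self k).trans_eq (hx' k).symm)
    have h7 : verPart (x' - x) = 0 := by
      have : verPart (x' - x) = verPart x' - verPart x := rfl
      rw [this, verPart_add_single_inr, hv, hx, hp', sub_self]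
    rw [h7, l1_zero] at h6
    have h8 : hor x' = hor e.1 := by
      rw [hor_add, hor_single_inr]; ring
    rw [hor_sub] at h6 h1 ⊢
    rw [List.length_cons]
    push_cast
    omega

/-- The discrete score bounds the savings from below. -/
lemma dscore_le_savings (S : Set (Edge (EdgeType d₁ d₂))) (N : Fin d₁ → ℕ) :
    dscore S N ≤ ENNReal.ofReal ((hor (corner N : EdgeType d₁ d₂ → ℤ) : ℝ) -
      ptime S 0 (corner N)) := by
  refine iSup₂_le fun l hl => ?_
  rw [← ENNReal.ofReal_natCast]
  by_cases h : l.length ≤ verticalLength (l.map particleOf)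
  · rw [Nat.sub_eq_zero_of_le h]; simp
  refine ENNReal.ofReal_le_ofReal ?_
  have h1 := ptime_add_length_le (verticalTour_verticalLength (l.map particleOf)) l rfl hl 0
    rfl (fun i => by simp) (fun e he i => (hl.bounds e he i).1)
  rw [sub_zero] at h1
  rw [Nat.cast_sub (not_le.1 h).le]
  have h2 : ((ptime S 0 (corner N) : ℤ) : ℝ) + ((l.length : ℤ) : ℝ) ≤
      (hor (corner N : EdgeType d₁ d₂ → ℤ) : ℝ) + ((verticalLength (l.map particleOf) : ℤ) : ℝ) :=
    by exact_mod_cast h1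
  push_cast at h2
  linarith

/-- Converse comparison: the vertical trace of the path is a tour. A jump pays at least its
horizontal progress plus its vertical length; a free horizontal edge yields at most one unit of
progress, a free vertical edge exactly one step of the tour, whence the term `l.length`. -/
lemma exists_verticalTour_le (l : List (OEdge (EdgeType d₁ d₂))) (x y : EdgeType d₁ d₂ → ℤ)
    (hy : verPart y = 0) :
    ∃ n, VerticalTour (l.map fun e => particleOf e.1) (verPart x) n ∧
      (n : ℤ) + hor (y - x) ≤ jumpCost x l y + l.length := by
  induction l generalizing x with
  | nil =>
    refine ⟨_, VerticalTour.nil.moves, ?_⟩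
    have := hor_add_le_l1 (y - x)
    have e : verPart (y - x) = 0 - verPart x := by rw [← hy]; rfl
    rw [e] at this
    simp only [jumpCost, List.length_nil]
    push_cast
    omega
  | cons e l ih =>
    obtain ⟨n, hn, h⟩ := ih e.tgt
    have h2 := hor_add_le_l1 (e.src - x)
    have e2 : verPart (e.src - x) = verPart e.src - verPart x := rfl
    rw [e2] at h2
    rw [hor_sub] at h h2 ⊢
    simp only [jumpCost, List.length_cons, List.map_cons]
    obtain ⟨⟨b, i | j⟩, o⟩ := e
    · have h3 : verPart (OEdge.tgt ((b, Sum.inl i), o) : EdgeType d₁ d₂ → ℤ) = verPart b := by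
        cases o <;> simp [OEdge.tgt, verPart_add_single_inl]
      have h4 : verPart (OEdge.src ((b, Sum.inl i), o) : EdgeType d₁ d₂ → ℤ) = verPart b := by
        cases o <;> simp [OEdge.src, verPart_add_single_inl]
      have h5 : hor (OEdge.tgt ((b, Sum.inl i), o) : EdgeType d₁ d₂ → ℤ) ≤
          hor (OEdge.src ((b, Sum.inl i), o) : EdgeType d₁ d₂ → ℤ) + 1 := by
        cases o <;> simp only [OEdge.tgt, OEdge.src, if_true, hor_add, hor_single_inl,
          Bool.false_eq_true, if_false] <;> omega
      rw [h3] at hn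
      rw [h4] at h2
      refine ⟨_, (VerticalTour.site (x := fun k => (b (Sum.inl k) : ℝ)) i hn).moves, ?_⟩
      push_cast
      omega
    · have h5 : hor (OEdge.tgt ((b, Sum.inr j), o) : EdgeType d₁ d₂ → ℤ) =
          hor (OEdge.src ((b, Sum.inr j), o) : EdgeType d₁ d₂ → ℤ) := by
        cases o <;> simp only [OEdge.tgt, OEdge.src, if_true, hor_add, hor_single_inr,
          Bool.false_eq_true, if_false] <;> omega
      cases o
      · have h3 : verPart (OEdge.tgt ((b, Sum.inr j), false) : EdgeType d₁ d₂ → ℤ) = verPart b := by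
          simp [OEdge.tgt]
        rw [h3] at hn
        have h4 : verPart (OEdge.src ((b, Sum.inr j), false) : EdgeType d₁ d₂ → ℤ) =
            verPart b + Pi.single j 1 := by
          simp [OEdge.src, verPart_add_single_inr]
        refine ⟨_, (VerticalTour.down (x := fun k => (b (Sum.inl k) : ℝ)) j h4 hn).moves, ?_⟩
        push_cast
        omega
      · have h3 : verPart (OEdge.tgt ((b, Sum.inr j), true) : EdgeType d₁ d₂ → ℤ) =
            verPart b + Pi.single j 1 := by
          simp [OEdge.tgt, verPart_add_single_inr]
        have h4 : verPart (OEdge.src ((b, Sum.inr j), true) : EdgeType d₁ d₂ → ℤ) =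
            verPart b := by
          simp [OEdge.src]
        rw [h4] at h2
        refine ⟨_, (VerticalTour.up (x := fun k => (b (Sum.inl k) : ℝ)) j h3 hn).moves, ?_⟩
        push_cast
        omega

lemma base_bounds (e : OEdge (EdgeType d₁ d₂)) (i : Fin d₁) :
    e.src (Sum.inl i) ≤ e.1.1 (Sum.inl i) + 1 ∧ e.1.1 (Sum.inl i) ≤ e.tgt (Sum.inl i) := by
  have : ∀ t : EdgeType d₁ d₂, 0 ≤ (Pi.single t 1 : EdgeType d₁ d₂ → ℤ) (Sum.inl i) ∧
      (Pi.single t 1 : EdgeType d₁ d₂ → ℤ) (Sum.inl i) ≤ 1 := fun t => by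
    by_cases h : Sum.inl i = t
    · subst h; simp
    · rw [Pi.single_eq_of_ne h]; omega
  obtain ⟨⟨b, t⟩, o⟩ := e
  have := this t
  cases o <;> simp [OEdge.src, OEdge.tgt] <;> omega

/-- An edge crossed backwards has its base one unit before its source. This is why a defect is a
progress of at most `1` rather than `0`: with progress at least `2`, the base points themselves
increase strictly. -/
lemma increasing_of_not_hasDefect (l : List (OEdge (EdgeType d₁ d₂))) (x : EdgeType d₁ d₂ → ℤ)
    (h : ¬ HasDefect x l) :
    (∀ e ∈ l, ∀ i, x (Sum.inl i) + 1 ≤ e.1.1 (Sum.inl i) ∧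
      e.1.1 (Sum.inl i) ≤ lastVertex x l (Sum.inl i)) ∧
    (∀ i, x (Sum.inl i) ≤ lastVertex x l (Sum.inl i)) ∧
    l.Pairwise fun a b => ∀ i, a.1.1 (Sum.inl i) < b.1.1 (Sum.inl i) := by
  induction l generalizing x with
  | nil => simp [lastVertex]
  | cons e l ih =>
    simp only [HasDefect, not_or, not_exists, not_le, Pi.sub_apply] at h
    obtain ⟨h1, h2, h3⟩ := ih e.tgt h.2
    simp only [lastVertex]
    refine ⟨?_, ?_, ?_⟩
    · intro f hf i
      have hb := base_bounds e i
      have := h.1 i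
      have := h2 i
      rcases List.mem_cons.1 hf with rfl | hf
      · omega
      · have := h1 f hf i
        omega
    · intro i
      have hb := base_bounds e i
      have := h.1 i
      have := h2 i
      omega
    · refine List.pairwise_cons.2 ⟨fun f hf i => ?_, h3⟩
      have hb := base_bounds e i
      have := h1 f hf i
      omega

/-- Trails without defect are bounded by the discrete score. -/
lemma savings_le_dscore {S : Set (Edge (EdgeType d₁ d₂))} {N : Fin d₁ → ℕ}
    {l : List (OEdge (EdgeType d₁ d₂))} {y : EdgeType d₁ d₂ → ℤ} (hy : verPart y = 0)
    (hl : ∀ e ∈ l, e.1 ∈ S) (hd : ¬ HasDefect 0 l)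
    (hN : ∀ i, lastVertex 0 l (Sum.inl i) < N i) :
    ENNReal.ofReal ((hor y : ℝ) - jumpCost 0 l y) ≤ dscore S N := by
  obtain ⟨h1, h2, h3⟩ := increasing_of_not_hasDefect l 0 hd
  have hinc : IsIncreasing S N (l.map Prod.fst) := by
    refine ⟨?_, ?_, ?_⟩
    · intro e he
      obtain ⟨f, hf, rfl⟩ := List.mem_map.1 he
      exact hl f hf
    · intro e he i
      obtain ⟨f, hf, rfl⟩ := List.mem_map.1 he
      have := h1 f hf i
      have := hN i
      simp only [Pi.zero_apply] at *
      omega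
    · rw [List.pairwise_map]
      exact h3
  refine le_trans ?_ (le_dscore hinc)
  obtain ⟨n, hn, h⟩ := exists_verticalTour_le l 0 y hy
  have h4 := verticalLength_le (w := l.map fun e => particleOf e.1) hn
  rw [List.length_map, List.map_map, ← ENNReal.ofReal_natCast]
  refine ENNReal.ofReal_le_ofReal ?_
  have h5 : (n : ℝ) + hor y ≤ jumpCost 0 l y + l.length := by
    rw [sub_zero] at h
    exact_mod_cast h
  have h6 : ((l.length : ℝ) - verticalLength (l.map (particleOf ∘ Prod.fst))) ≤
      ((l.length - verticalLength (l.map (particleOf ∘ Prod.fst)) : ℕ) : ℝ) := by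
    rw [sub_le_iff_le_add]
    exact_mod_cast le_tsub_add
  have h7 : (verticalLength (l.map (particleOf ∘ Prod.fst)) : ℝ) ≤ n := by exact_mod_cast h4
  linarith

end ScoreTime

/-! ### The mean discrete score -/

section MeanScore

variable {d₁ d₂ : ℕ}

/-- Probability that a Poisson variable with mean `|a|` is positive. -/
def cellProb (a : ℝ) : I :=
  ⟨1 - Real.exp (-|a|), sub_nonneg.2 (Real.exp_le_one_iff.2 (neg_nonpos.2 (abs_nonneg a))),
    sub_le_self _ (Real.exp_pos _).le⟩

lemma one_sub_cellProb {a : ℝ} (ha : 0 ≤ a) : 1 - (cellProb a : ℝ) = Real.exp (-a) := by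
  simp [cellProb, abs_of_nonneg ha]

lemma cellProb_mono {a b : ℝ} (ha : 0 ≤ a) (hab : a ≤ b) : cellProb a ≤ cellProb b := by
  refine Subtype.coe_le_coe.1 ?_
  have h1 := one_sub_cellProb ha
  have h2 := one_sub_cellProb (ha.trans hab)
  have := Real.exp_le_exp.2 (neg_le_neg hab)
  linarith

lemma cellProb_le {a : ℝ} (ha : 0 ≤ a) : (cellProb a : ℝ) ≤ a := by
  have h1 := one_sub_cellProb ha
  have := Real.add_one_le_exp (-a)
  linarith

lemma cellProb_pos {a : ℝ} (ha : 0 < a) : 0 < (cellProb a : ℝ) := by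
  have h1 := one_sub_cellProb ha.le
  have := Real.exp_lt_one_iff.2 (neg_neg_of_pos ha)
  linarith

/-- The fine edges of a coarse edge. -/
def fineEdges (g : Fin d₁ → ℕ) (c : Edge (EdgeType d₁ d₂)) : Finset (Edge (EdgeType d₁ d₂)) :=
  (Fintype.piFinset fun t : EdgeType d₁ d₂ => Sum.elim
    (fun i => Finset.Ico (c.1 (Sum.inl i) * g i) (c.1 (Sum.inl i) * g i + g i))
    (fun j => {c.1 (Sum.inr j)}) t) ×ˢ {c.2}

lemma mem_fineEdges (g : Fin d₁ → ℕ) (hg : ∀ i, 0 < g i) (c a : Edge (EdgeType d₁ d₂)) :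
    a ∈ fineEdges g c ↔ a ∈ Set.univ ∧ coarseEdge g a = c := by
  obtain ⟨x, t⟩ := a
  obtain ⟨y, s⟩ := c
  have h : ∀ i, x (Sum.inl i) / (g i : ℤ) = y (Sum.inl i) ↔
      y (Sum.inl i) * g i ≤ x (Sum.inl i) ∧ x (Sum.inl i) < y (Sum.inl i) * g i + g i := by
    intro i
    have hgi : (0 : ℤ) < g i := by exact_mod_cast hg i
    rw [Int.ediv_eq_iff_of_pos hgi]
  simp only [fineEdges, Finset.mem_product, Fintype.mem_piFinset, Finset.mem_singleton,
    Set.mem_univ, true_and, coarseEdge, Prod.mk.injEq, Sum.forall, Sum.elim_inl, Sum.elim_inr,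
    Finset.mem_Ico, funext_iff, h]

lemma card_fineEdges (g : Fin d₁ → ℕ) (c : Edge (EdgeType d₁ d₂)) :
    (fineEdges g c).card = ∏ i, g i := by
  rw [fineEdges, Finset.card_product, Fintype.card_piFinset, Fintype.prod_sum_type]
  simp

/-- A block of `∏ g i` cells is empty with probability `exp (-(∏ g i) * a)`: the parametrisation by
`cellProb` makes intensities additive and coarse-graining exact. -/
lemma map_coarseEdge (g : Fin d₁ → ℕ) (hg : ∀ i, 0 < g i) {a : ℝ} (ha : 0 ≤ a) :
    Measurable (fun S : Set (Edge (EdgeType d₁ d₂)) => coarseEdge g '' S) ∧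
    (bernoulliSet (Edge (EdgeType d₁ d₂)) (cellProb a)).map (fun S => coarseEdge g '' S) =
      bernoulliSet (Edge (EdgeType d₁ d₂)) (cellProb ((∏ i, g i : ℕ) * a)) := by
  have := map_coarsen_bernoulliSet (p := cellProb a) (r := cellProb ((∏ i, g i : ℕ) * a))
    (b := coarseEdge (d₂ := d₂) g) (D := Set.univ) (n := ∏ i, g i) (fineEdges g)
    (mem_fineEdges g hg) (card_fineEdges g) (by
      rw [one_sub_cellProb ha, one_sub_cellProb (by positivity), ← Real.exp_nat_mul]
      ring_nf)
  simpa only [Set.inter_univ] using this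

/-- Refining the mesh increases the discrete score in law. -/
theorem lintegral_dscore_refine (N g : Fin d₁ → ℕ) (hg : ∀ i, 0 < g i) {a : ℝ} (ha : 0 ≤ a)
    {φ : ℝ≥0∞ → ℝ≥0∞} (hφ : Monotone φ) :
    ∫⁻ S, φ (dscore S N) ∂bernoulliSet (Edge (EdgeType d₁ d₂)) (cellProb ((∏ i, g i : ℕ) * a)) ≤
      ∫⁻ S, φ (dscore S (g * N)) ∂bernoulliSet (Edge (EdgeType d₁ d₂)) (cellProb a) := by
  obtain ⟨h1, h2⟩ := map_coarseEdge (d₂ := d₂) g hg ha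
  rw [← h2, lintegral_map (f := fun S => φ (dscore S N))
    (hφ.measurable.comp (measurable_dscore N)) h1]
  exact lintegral_mono fun S => hφ (dscore_coarse_le S N g hg)

theorem lintegral_dscore_mono (N : Fin d₁ → ℕ) {p r : I} (h : p ≤ r)
    {φ : ℝ≥0∞ → ℝ≥0∞} (hφ : Monotone φ) :
    ∫⁻ S, φ (dscore S N) ∂bernoulliSet (Edge (EdgeType d₁ d₂)) p ≤
      ∫⁻ S, φ (dscore S N) ∂bernoulliSet (Edge (EdgeType d₁ d₂)) r :=
  lintegral_bernoulliSet_mono h (hφ.measurable.comp (measurable_dscore N))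
    fun _ _ hS => hφ (dscore_mono hS le_rfl)

lemma monotone_indicator_Ioi (t : ℝ≥0∞) :
    Monotone ((Set.Ioi t).indicator (1 : ℝ≥0∞ → ℝ≥0∞)) := by
  intro x y hxy
  by_cases hx : t < x
  · rw [Set.indicator_of_mem (show x ∈ Set.Ioi t from hx),
      Set.indicator_of_mem (show y ∈ Set.Ioi t from hx.trans_le hxy)]
    rfl
  · rw [Set.indicator_of_notMem (show x ∉ Set.Ioi t from hx)]
    exact zero_le

lemma monotone_indicator_Ici (t : ℝ≥0∞) :
    Monotone ((Set.Ici t).indicator (1 : ℝ≥0∞ → ℝ≥0∞)) := by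
  intro x y hxy
  by_cases hx : t ≤ x
  · rw [Set.indicator_of_mem (show x ∈ Set.Ici t from hx),
      Set.indicator_of_mem (show y ∈ Set.Ici t from le_trans hx hxy)]
    rfl
  · rw [Set.indicator_of_notMem (show x ∉ Set.Ici t from hx)]
    exact zero_le

lemma lintegral_indicator_dscore (N : Fin d₁ → ℕ) (p : I) {A : Set ℝ≥0∞} (hA : MeasurableSet A) :
    ∫⁻ S, A.indicator 1 (dscore S N) ∂bernoulliSet (Edge (EdgeType d₁ d₂)) p =
      bernoulliSet (Edge (EdgeType d₁ d₂)) p {S | dscore S N ∈ A} := by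
  have : MeasurableSet {S : Set (Edge (EdgeType d₁ d₂)) | dscore S N ∈ A} :=
    measurable_dscore N hA
  rw [← lintegral_indicator_one this]
  rfl

/-- The mean discrete score in a cubic box, when the total intensity of a line of cells is
`lam`. -/
def meanScore (d₁ d₂ : ℕ) (n : ℕ) (lam : ℝ) : ℝ≥0∞ :=
  ∫⁻ S, dscore S (fun _ => n) ∂bernoulliSet (Edge (EdgeType d₁ d₂)) (cellProb ((lam / n) ^ d₁))

/-- The intensity of the whole box is `lam ^ d₁` whatever the mesh; only the resolution of the order
changes. -/
lemma meanScore_refine {g n : ℕ} (hg : 0 < g) (hn : 0 < n) {lam : ℝ} (hl : 0 ≤ lam) :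
    meanScore d₁ d₂ n lam ≤ meanScore d₁ d₂ (g * n) lam := by
  have := lintegral_dscore_refine (d₂ := d₂) (fun _ : Fin d₁ => n) (fun _ => g) (fun _ => hg)
    (a := (lam / (g * n : ℕ)) ^ d₁) (by positivity) monotone_id
  have e : ((∏ _i : Fin d₁, g : ℕ) : ℝ) * (lam / (g * n : ℕ)) ^ d₁ = (lam / n) ^ d₁ := by
    rw [Finset.prod_const, Finset.card_univ, Fintype.card_fin]
    push_cast
    rw [← mul_pow]
    congr 1
    field_simp
  rw [e] at this
  exact this

/-- The diagonal horizontal vector. -/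
def diag (n : ℕ) : EdgeType d₁ d₂ → ℤ := corner fun _ => n

lemma sum_dscore_le (S : Set (Edge (EdgeType d₁ d₂))) (n m : ℕ) :
    ∑ k ∈ Finset.range m, dscore (shiftEdge (diag (k * n)) ⁻¹' S) (fun _ => n) ≤
      dscore S (fun _ => m * n) := by
  induction m with
  | zero => simp
  | succ m ih =>
    rw [Finset.sum_range_succ]
    refine (add_le_add_left ih _).trans ?_
    refine (dscore_add_le S (fun _ => m * n) (fun _ => n) (diag (m * n))
      (fun i => by simp [diag, corner]) (by ext j; simp [diag, corner, verPart])).trans (le_of_eq ?_)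
    congr 1
    ext i
    simp [add_mul]

lemma nsmul_lintegral_dscore_le (p : I) (n m : ℕ) :
    m * ∫⁻ S, dscore S (fun _ => n) ∂bernoulliSet (Edge (EdgeType d₁ d₂)) p ≤
      ∫⁻ S, dscore S (fun _ => m * n) ∂bernoulliSet (Edge (EdgeType d₁ d₂)) p := by
  refine le_trans (le_of_eq ?_) (lintegral_mono fun S => sum_dscore_le S n m)
  rw [lintegral_finsetSum' (f := fun k S => dscore (shiftEdge (diag (k * n)) ⁻¹' S) fun _ => n) _
    fun k _ => ((measurable_dscore _).comp (measurable_preimage_set _)).aemeasurable]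
  have : ∀ k ∈ Finset.range m, ∫⁻ S, dscore (shiftEdge (diag (k * n)) ⁻¹' S) (fun _ => n)
      ∂bernoulliSet (Edge (EdgeType d₁ d₂)) p =
      ∫⁻ S, dscore S (fun _ => n) ∂bernoulliSet (Edge (EdgeType d₁ d₂)) p := fun k _ =>
    (measurePreserving_shiftEdge p _).lintegral_comp (measurable_dscore _)
  rw [Finset.sum_congr rfl this]
  simp

/-- Put `m` stationary copies along the diagonal, keeping the mesh `lam / n`. -/
lemma mul_meanScore_le {n m : ℕ} (hm : 0 < m) (lam : ℝ) :
    m * meanScore d₁ d₂ n lam ≤ meanScore d₁ d₂ (m * n) (m * lam) := by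
  have e : (m * lam / (m * n : ℕ) : ℝ) = lam / n := by
    push_cast
    field_simp
  rw [meanScore, meanScore, e]
  exact nsmul_lintegral_dscore_le _ n m

/-- Constant of the crude exponential bound. -/
def crudeConst (d₁ d₂ : ℕ) : ℝ := 48 * (d₁ + d₂) * Real.exp 3 * 8 ^ d₂

lemma crudeConst_ge (hd : 1 ≤ d₁) : 48 ≤ crudeConst d₁ d₂ := by
  have h1 : (1 : ℝ) ≤ d₁ := by exact_mod_cast hd
  have h2 : (1 : ℝ) ≤ d₁ + d₂ := by have : (0 : ℝ) ≤ d₂ := Nat.cast_nonneg _; linarith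
  have h3 : (1 : ℝ) ≤ Real.exp 3 := Real.one_le_exp (by norm_num)
  have h4 : (1 : ℝ) ≤ 8 ^ d₂ := one_le_pow₀ (by norm_num)
  have h5 : 1 ≤ (d₁ + d₂ : ℝ) * Real.exp 3 := one_le_mul_of_one_le_of_one_le h2 h3
  have h6 := one_le_mul_of_one_le_of_one_le h5 h4
  rw [crudeConst]
  linarith

/-- With `θ i` equal to `crudeConst * r i` and `p ≤ ∏ r i`, the product `p * ∏ (6 / θ i)` is at most
`6 / crudeConst`; the constant `48 = 4 * 2 * 6` makes the step bound at most `1 / 4`. -/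
lemma stepBound_le (hd : 1 ≤ d₁) {r : Fin d₁ → ℝ} (hr : ∀ i, 0 < r i) {p : ℝ} (hp : 0 ≤ p)
    (h : p ≤ ∏ i, r i) : stepBound d₂ p (fun i => crudeConst d₁ d₂ * r i) ≤ 1 / 4 := by
  have hK := crudeConst_ge (d₂ := d₂) hd
  have hr0 : 0 < ∏ i, r i := Finset.prod_pos fun i _ => hr i
  have e : ∏ i, (6 / (crudeConst d₁ d₂ * r i)) = (6 / crudeConst d₁ d₂) ^ d₁ / ∏ i, r i := by
    have : ∀ i, 6 / (crudeConst d₁ d₂ * r i) = (6 / crudeConst d₁ d₂) / r i := fun i => by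
      rw [div_mul_eq_div_div]
    simp_rw [this]
    rw [Finset.prod_div_distrib, Finset.prod_const, Finset.card_univ, Fintype.card_fin]
  have h6 : (6 / crudeConst d₁ d₂) ^ d₁ ≤ 6 / crudeConst d₁ d₂ := by
    refine pow_le_of_le_one (by positivity) ?_ (by omega)
    rw [div_le_one (by linarith)]
    linarith
  have hq : p / ∏ i, r i ≤ 1 := (div_le_one hr0).2 h
  have hq0 : 0 ≤ p / ∏ i, r i := by positivity
  rw [stepBound, weightBound, e]
  have h7 : (6 / crudeConst d₁ d₂) ^ d₁ * (p / ∏ i, r i) ≤ 6 / crudeConst d₁ d₂ :=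
    (mul_le_of_le_one_right (by positivity) hq).trans h6
  calc 2 * (d₁ + d₂) * Real.exp 3 * (8 ^ d₂ * ((6 / crudeConst d₁ d₂) ^ d₁ / ∏ i, r i)) * p
      = 2 * (d₁ + d₂) * Real.exp 3 * 8 ^ d₂ *
        ((6 / crudeConst d₁ d₂) ^ d₁ * (p / ∏ i, r i)) := by ring
    _ ≤ 2 * (d₁ + d₂) * Real.exp 3 * 8 ^ d₂ * (6 / crudeConst d₁ d₂) :=
        mul_le_mul_of_nonneg_left h7 (by positivity)
    _ = crudeConst d₁ d₂ / 24 * (6 / crudeConst d₁ d₂) := by rw [crudeConst]; ring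
    _ = 1 / 4 := by
        have : crudeConst d₁ d₂ ≠ 0 := by linarith
        field_simp
        norm_num

lemma exc_corner (N : Fin d₁ → ℕ) : exc (corner N : EdgeType d₁ d₂ → ℤ) = 0 := by
  have := l1_of_nonneg (x := (corner N : EdgeType d₁ d₂ → ℤ)) (fun i => by simp [corner])
  have h : verPart (corner N : EdgeType d₁ d₂ → ℤ) = 0 := by ext j; simp [verPart, corner]
  rw [h, l1_zero] at this
  rw [Nat.cast_zero, add_zero] at this
  rw [exc, sub_eq_zero]
  exact_mod_cast this

/-- Superadditivity allows `lam` to be multiplied by `m` until it exceeds `1`, and refinement allows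
the mesh to be made so fine that the tilt is at most `1 / 2`. There the exponential moment of the
savings gives a bound linear in `lam`. -/
lemma meanScore_crude (hd : 1 ≤ d₁) {n : ℕ} (hn : 0 < n) {lam : ℝ} (hl : 0 < lam) :
    meanScore d₁ d₂ n lam ≤ ENNReal.ofReal ((crudeConst d₁ d₂ * d₁ + 2) * lam) := by
  set K := crudeConst d₁ d₂ with hK
  have hK0 : 48 ≤ K := crudeConst_ge hd
  obtain ⟨m, hm⟩ := exists_nat_ge (1 / lam)
  have hm0 : 0 < m := by
    rcases Nat.eq_zero_or_pos m with h | h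
    · rw [h, Nat.cast_zero] at hm
      exact absurd hm (not_le.2 (by positivity))
    · exact h
  have hml : 1 ≤ m * lam := by rwa [div_le_iff₀ hl] at hm
  obtain ⟨g, hg⟩ := exists_nat_ge (2 * K * (m * lam))
  have hg0 : 0 < g := by
    rcases Nat.eq_zero_or_pos g with h | h
    · rw [h, Nat.cast_zero] at hg
      exact absurd hg (not_le.2 (by positivity))
    · exact h
  set M := g * (m * n) with hM
  have hM0 : 0 < M := by positivity
  have hMg : (g : ℝ) ≤ M := by
    rw [hM]; exact_mod_cast Nat.le_mul_of_pos_right g (by positivity)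
  set r := m * lam / M with hr
  have hr0 : 0 < r := by positivity
  have hθ : K * r ≤ 1 / 2 := by
    rw [hr, mul_div_assoc', div_le_iff₀ (by positivity)]
    linarith
  have hs : stepBound d₂ (cellProb (r ^ d₁)) (fun _ : Fin d₁ => K * r) ≤ 1 / 4 :=
    stepBound_le hd (r := fun _ => r) (fun _ => hr0) (cellProb _).2.1
      ((cellProb_le (by positivity)).trans (by simp))
  have hcr := lintegral_exp_savings_le (d₂ := d₂) (θ := fun _ : Fin d₁ => K * r)
    (fun _ => by positivity) (fun _ => hθ) hs 0 (corner fun _ => M)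
  rw [sub_zero, exc_corner] at hcr
  have ht : tilt (fun _ : Fin d₁ => K * r) (corner (fun _ => M) : EdgeType d₁ d₂ → ℤ) =
      K * d₁ * (m * lam) := by
    simp only [tilt, corner, Sum.elim_inl, Finset.sum_const, Finset.card_univ, Fintype.card_fin,
      nsmul_eq_mul]
    rw [hr]
    push_cast
    field_simp
  set A := K * d₁ * (m * lam) with hA
  rw [ht] at hcr
  have hb : meanScore d₁ d₂ M (m * lam) ≤ ENNReal.ofReal (A + 2) := by
    calc meanScore d₁ d₂ M (m * lam)
        ≤ ∫⁻ S, (ENNReal.ofReal A + ENNReal.ofReal (Real.exp (-A)) *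
          ENNReal.ofReal (Real.exp ((hor (corner (fun _ => M) : EdgeType d₁ d₂ → ℤ) : ℝ) -
            ptime S 0 (corner fun _ => M))))
          ∂bernoulliSet (Edge (EdgeType d₁ d₂)) (cellProb (r ^ d₁)) := by
          refine lintegral_mono fun S => ?_
          refine (dscore_le_savings S _).trans ?_
          rw [← ENNReal.ofReal_mul (Real.exp_pos _).le, ← Real.exp_add,
            ← ENNReal.ofReal_add (by positivity) (Real.exp_pos _).le]
          refine ENNReal.ofReal_le_ofReal ?_
          -- From `X ≤ A + exp (X - A)`, where `exp A` is half the bound on the exponential moment;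
          -- the mean is then at most `A + 2`.
          have := Real.add_one_le_exp (-A + ((hor (corner (fun _ => M) : EdgeType d₁ d₂ → ℤ) : ℝ) -
            ptime S 0 (corner fun _ => M)))
          linarith
      _ ≤ ENNReal.ofReal A + ENNReal.ofReal (Real.exp (-A)) *
          ENNReal.ofReal (2 * Real.exp (A - 0 / 2)) := by
          rw [lintegral_add_left measurable_const, lintegral_const_mul' _ _ ENNReal.ofReal_ne_top,
            lintegral_const, measure_univ, mul_one]
          exact add_le_add_right (mul_le_mul_right hcr _) _
      _ = ENNReal.ofReal (A + 2) := by
          rw [← ENNReal.ofReal_mul (Real.exp_pos _).le,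
            ← ENNReal.ofReal_add (by positivity) (by positivity)]
          congr 2
          rw [zero_div, sub_zero, mul_left_comm, ← Real.exp_add]
          simp
  have h1 := mul_meanScore_le (d₁ := d₁) (d₂ := d₂) (n := n) hm0 lam
  have h2 := meanScore_refine (d₁ := d₁) (d₂ := d₂) (n := m * n) (lam := m * lam) hg0
    (by positivity) (by positivity)
  have h3 := (h1.trans h2).trans hb
  have h4 : ENNReal.ofReal (A + 2) ≤ m * ENNReal.ofReal ((K * d₁ + 2) * lam) := by
    rw [← ENNReal.ofReal_natCast, ← ENNReal.ofReal_mul (by positivity)]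
    refine ENNReal.ofReal_le_ofReal ?_
    rw [hA]
    nlinarith
  have h5 := h3.trans h4
  rwa [ENNReal.mul_le_mul_iff_right (by exact_mod_cast hm0.ne') (ENNReal.natCast_ne_top m)] at h5

/-- The supremum of the normalised mean scores. -/
def scoreSup (d₁ d₂ : ℕ) : ℝ≥0∞ :=
  ⨆ (n : ℕ) (_ : 0 < n) (lam : ℝ) (_ : 0 < lam), meanScore d₁ d₂ n lam / ENNReal.ofReal lam

/-- The directional score. -/
def scoreConst (d₁ d₂ : ℕ) : ℝ := (scoreSup d₁ d₂).toReal

lemma scoreSup_ne_top (hd : 1 ≤ d₁) : scoreSup d₁ d₂ ≠ ∞ := by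
  have : scoreSup d₁ d₂ ≤ ENNReal.ofReal (crudeConst d₁ d₂ * d₁ + 2) := by
    refine iSup₂_le fun n hn => iSup₂_le fun lam hl => ?_
    refine ENNReal.div_le_of_le_mul ?_
    rw [← ENNReal.ofReal_mul (by have := crudeConst_ge (d₂ := d₂) hd; positivity)]
    exact meanScore_crude hd hn hl
  exact ne_top_of_le_ne_top ENNReal.ofReal_ne_top this

lemma meanScore_le (hd : 1 ≤ d₁) {n : ℕ} (hn : 0 < n) {lam : ℝ} (hl : 0 < lam) :
    meanScore d₁ d₂ n lam ≤ ENNReal.ofReal (scoreConst d₁ d₂ * lam) := by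
  have h : meanScore d₁ d₂ n lam / ENNReal.ofReal lam ≤ scoreSup d₁ d₂ :=
    le_iSup₂_of_le n hn (le_iSup₂_of_le lam hl le_rfl)
  rw [ENNReal.div_le_iff (by simpa using hl) ENNReal.ofReal_ne_top] at h
  rwa [scoreConst, ENNReal.ofReal_mul ENNReal.toReal_nonneg,
    ENNReal.ofReal_toReal (scoreSup_ne_top hd)]

lemma exists_meanScore_ge (hd : 1 ≤ d₁) {c : ℝ} (hc0 : 0 ≤ c) (hc : c < scoreConst d₁ d₂) :
    ∃ n : ℕ, 0 < n ∧ ∃ lam : ℝ, 0 < lam ∧ ENNReal.ofReal (c * lam) ≤ meanScore d₁ d₂ n lam := by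
  have h : ENNReal.ofReal c < scoreSup d₁ d₂ := by
    rwa [ENNReal.ofReal_lt_iff_lt_toReal hc0 (scoreSup_ne_top hd)]
  simp only [scoreSup, lt_iSup_iff] at h
  obtain ⟨n, hn, lam, hl, h⟩ := h
  refine ⟨n, hn, lam, hl, ?_⟩
  rw [ENNReal.ofReal_mul hc0]
  exact ((ENNReal.lt_div_iff_mul_lt (Or.inl (by simpa using hl))
    (Or.inl ENNReal.ofReal_ne_top)).1 h).le

/-- In a single cell, a horizontal edge at the origin has score one and is present with positive
probability. -/
lemma scoreConst_pos (hd : 1 ≤ d₁) : 0 < scoreConst d₁ d₂ := by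
  have h := meanScore_le (d₂ := d₂) hd one_pos one_pos
  have hp : 0 < (cellProb ((1 / (1 : ℕ) : ℝ) ^ d₁) : ℝ) := cellProb_pos (by norm_num)
  have h2 : ENNReal.ofReal (cellProb ((1 / (1 : ℕ) : ℝ) ^ d₁)) ≤ meanScore d₁ d₂ 1 1 := by
    let e : Edge (EdgeType d₁ d₂) := (0, Sum.inl ⟨0, hd⟩)
    have h3 := bernoulliSet_containing (cellProb ((1 / (1 : ℕ) : ℝ) ^ d₁)) {e}
    simp only [Finset.mem_singleton, forall_eq, Finset.card_singleton, pow_one] at h3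
    rw [← h3, ← lintegral_indicator_one (measurableSet_mem e)]
    refine lintegral_mono fun S => ?_
    by_cases hS : e ∈ S
    · rw [Set.indicator_of_mem (show S ∈ {S | e ∈ S} from hS)]
      have hinc : IsIncreasing S (fun _ => 1) [e] := ⟨by simpa using hS, by simp [e], by simp⟩
      refine le_trans ?_ (le_dscore hinc)
      have : verticalLength ([e].map particleOf) = 0 :=
        Nat.le_zero.1 (verticalLength_le (VerticalTour.site _ .nil))
      rw [this]
      simp
    · rw [Set.indicator_of_notMem (show S ∉ {S | e ∈ S} from hS)]
      exact zero_le
  have h4 := (ENNReal.ofReal_pos.2 hp).trans_le (h2.trans h)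
  rw [ENNReal.ofReal_pos] at h4
  linarith

end MeanScore

/-! ### Concentration of the discrete score -/

section ScoreTail

variable {d₁ d₂ : ℕ}

/-- Scores of successive diagonal boxes. -/
def blockScore (n k : ℕ) (S : Set (Edge (EdgeType d₁ d₂))) : ℝ :=
  (dscore (shiftEdge (diag (k * n)) ⁻¹' S) fun _ => n).toReal

lemma measurable_blockScore (n k : ℕ) :
    Measurable fun S : Set (Edge (EdgeType d₁ d₂)) => blockScore n k S :=
  ((measurable_dscore _).comp (measurable_preimage_set _)).ennreal_toReal

lemma dscore_ne_top (hd : 1 ≤ d₁) (S : Set (Edge (EdgeType d₁ d₂))) (N : Fin d₁ → ℕ) :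
    dscore S N ≠ ∞ :=
  ne_top_of_le_ne_top (ENNReal.natCast_ne_top _) (dscore_le S N ⟨0, hd⟩)

lemma blockScore_mem_Icc (hd : 1 ≤ d₁) (n k : ℕ) (S : Set (Edge (EdgeType d₁ d₂))) :
    blockScore n k S ∈ Set.Icc (0 : ℝ) n :=
  ⟨ENNReal.toReal_nonneg, ENNReal.toReal_le_of_le_ofReal (Nat.cast_nonneg n)
    (by rw [ENNReal.ofReal_natCast]; exact dscore_le _ _ ⟨0, hd⟩)⟩

lemma blockScore_inter (n k : ℕ) (S : Set (Edge (EdgeType d₁ d₂))) :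
    blockScore n k (S ∩ slab (diag (k * n)) fun _ => n) = blockScore n k S := by
  rw [blockScore, blockScore, ← dscore_inter_slab (shiftEdge (diag (k * n)) ⁻¹' S)]
  congr 2
  ext e
  simp only [Set.mem_preimage, Set.mem_inter_iff, slab, Set.mem_ofPred_eq, shiftEdge,
    Pi.add_apply, Pi.zero_apply, zero_add]
  refine and_congr_right fun _ => forall_congr' fun i => ?_
  constructor <;> rintro ⟨h1, h2⟩ <;> constructor <;> omega

/-- Each block score depends on its own slab, and the slabs are disjoint already in one horizontal
coordinate. -/
lemma indepFun_blockScore (hd : 1 ≤ d₁) (p : I) (n : ℕ) {k k' : ℕ} (h : k ≠ k') :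
    IndepFun (blockScore n k) (blockScore n k') (bernoulliSet (Edge (EdgeType d₁ d₂)) p) := by
  have hdisj : Disjoint (slab (diag (k * n)) fun _ => n : Set (Edge (EdgeType d₁ d₂)))
      (slab (diag (k' * n)) fun _ => n) := by
    rw [Set.disjoint_left]
    intro e h1 h2
    have h1 := h1 ⟨0, hd⟩
    have h2 := h2 ⟨0, hd⟩
    simp only [diag, corner, Sum.elim_inl] at h1 h2
    rcases lt_or_gt_of_ne h with h | h
    · have : (k + 1) * n ≤ k' * n := Nat.mul_le_mul_right n h
      rw [add_mul, one_mul] at this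
      have : ((k * n : ℕ) : ℤ) + n ≤ (k' * n : ℕ) := by exact_mod_cast this
      omega
    · have : (k' + 1) * n ≤ k * n := Nat.mul_le_mul_right n h
      rw [add_mul, one_mul] at this
      have : ((k' * n : ℕ) : ℤ) + n ≤ (k * n : ℕ) := by exact_mod_cast this
      omega
  have := indepFun_bernoulliSet p hdisj (measurable_blockScore n k) (measurable_blockScore n k')
  simpa only [blockScore_inter] using this

/-- Lower deviations of the score of a long box. -/
lemma measure_dscore_lt_le (hd : 1 ≤ d₁) (p : I) (n m : ℕ) {η : ℝ} (hη : 0 < η) {E : ℝ}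
    (hE : ENNReal.ofReal E ≤ ∫⁻ S, dscore S (fun _ => n) ∂bernoulliSet (Edge (EdgeType d₁ d₂)) p) :
    bernoulliSet (Edge (EdgeType d₁ d₂)) p
      {S | dscore S (fun _ => m * n) < ENNReal.ofReal (m * (E - η))} ≤
      ENNReal.ofReal (n ^ 2 / (m * η ^ 2)) := by
  rcases Nat.eq_zero_or_pos m with rfl | hm
  · simp
  set Q := bernoulliSet (Edge (EdgeType d₁ d₂)) p with hQ
  have hm' : (0 : ℝ) < m := by exact_mod_cast hm
  have hL2 : ∀ k, MemLp (blockScore n k) 2 Q := fun k =>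
    memLp_of_bounded (ae_of_all _ (blockScore_mem_Icc hd n k))
      (measurable_blockScore n k).aestronglyMeasurable 2
  have hint : ∀ k, Integrable (blockScore n k) Q := fun k => (hL2 k).integrable (by norm_num)
  have hmean : ∀ k, E ≤ ∫ S, blockScore n k S ∂Q := by
    intro k
    have h1 : ∫ S, blockScore n k S ∂Q =
        (∫⁻ S, dscore S (fun _ => n) ∂Q).toReal := by
      have h2 := (measurePreserving_shiftEdge p (diag (k * n) : EdgeType d₁ d₂ → ℤ)).lintegral_comp
        (measurable_dscore (d₂ := d₂) (fun _ : Fin d₁ => n))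
      rw [← h2]
      exact integral_toReal ((measurable_dscore _).comp
        (measurable_preimage_set _)).aemeasurable
        (ae_of_all _ fun S => (dscore_ne_top hd _ _).lt_top)
    rw [h1]
    refine (ENNReal.ofReal_le_iff_le_toReal (ne_top_of_le_ne_top (ENNReal.natCast_ne_top n) ?_)).1 hE
    calc ∫⁻ S, dscore S (fun _ => n) ∂Q ≤ ∫⁻ _, (n : ℝ≥0∞) ∂Q :=
          lintegral_mono fun S => dscore_le _ _ ⟨0, hd⟩
      _ = n := by simp
  set X : Set (Edge (EdgeType d₁ d₂)) → ℝ := ∑ k ∈ Finset.range m, blockScore n k with hX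
  have hXL : MemLp X 2 Q := memLp_finsetSum' _ fun k _ => hL2 k
  -- The block scores are pairwise independent with values in `[0, n]`, so Chebyshev's inequality
  -- applies to their sum.
  have hvar : Var[X; Q] ≤ m * n ^ 2 := by
    rw [hX, IndepFun.variance_sum (fun k _ => hL2 k)
      (fun k _ k' _ h => indepFun_blockScore hd p n h)]
    calc ∑ k ∈ Finset.range m, Var[blockScore n k; Q] ≤ ∑ _k ∈ Finset.range m, (n : ℝ) ^ 2 :=
          Finset.sum_le_sum fun k _ => by
            refine (variance_le_sq_of_bounded (ae_of_all _ (blockScore_mem_Icc hd n k))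
              (measurable_blockScore n k).aemeasurable).trans ?_
            nlinarith [sq_nonneg (n : ℝ)]
      _ = m * n ^ 2 := by simp
  have hXm : (m : ℝ) * E ≤ ∫ S, X S ∂Q := by
    rw [hX]
    simp only [Finset.sum_apply]
    rw [integral_finsetSum _ fun k _ => hint k]
    calc (m : ℝ) * E = ∑ _k ∈ Finset.range m, E := by simp
      _ ≤ _ := Finset.sum_le_sum fun k _ => hmean k
  have hch := meas_ge_le_variance_div_sq hXL (c := m * η) (by positivity)
  refine (measure_mono ?_).trans (hch.trans (ENNReal.ofReal_le_ofReal ?_))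
  · intro S hS
    have h1 := (sum_dscore_le S n m).trans_lt hS
    have h2 : X S < m * (E - η) := by
      have h3 : ENNReal.ofReal (X S) = ∑ k ∈ Finset.range m,
          dscore (shiftEdge (diag (k * n)) ⁻¹' S) fun _ => n := by
        rw [hX, Finset.sum_apply, ENNReal.ofReal_sum_of_nonneg
          fun k _ => (blockScore_mem_Icc hd n k S).1]
        exact Finset.sum_congr rfl fun k _ => ENNReal.ofReal_toReal (dscore_ne_top hd _ _)
      rw [← h3] at h1
      exact (ENNReal.ofReal_lt_ofReal_iff_of_nonneg (by
        rw [hX, Finset.sum_apply]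
        exact Finset.sum_nonneg fun k _ => (blockScore_mem_Icc hd n k S).1)).1 h1
    change (m : ℝ) * η ≤ |X S - ∫ S, X S ∂Q|
    rw [abs_sub_comm]
    refine le_trans ?_ (le_abs_self _)
    linarith
  · rw [div_le_div_iff₀ (by positivity) (by positivity)]
    calc Var[X; Q] * (m * η ^ 2) ≤ (m * n ^ 2) * (m * η ^ 2) :=
          mul_le_mul_of_nonneg_right hvar (by positivity)
      _ = n ^ 2 * (m * η) ^ 2 := by ring

/-- Upper deviations of a variable which is not much smaller than its mean bound. -/
lemma measure_gt_le_of_lower {Ω : Type*} [MeasurableSpace Ω] {P : Measure Ω}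
    [IsProbabilityMeasure P] {X : Ω → ℝ≥0∞} (hX : Measurable X) {a b c q : ℝ}
    (ha : 0 ≤ a) (hab : a < b) (hq : 0 ≤ q) (hc : 0 ≤ c) (hmean : ∫⁻ ω, X ω ∂P ≤ ENNReal.ofReal c)
    (hlow : P {ω | X ω < ENNReal.ofReal a} ≤ ENNReal.ofReal q) :
    P {ω | ENNReal.ofReal b < X ω} ≤ ENNReal.ofReal ((c - a + a * q) / (b - a)) := by
  have hA : MeasurableSet {ω | X ω < ENNReal.ofReal a} := measurableSet_lt hX measurable_const
  have hB : MeasurableSet {ω | ENNReal.ofReal b < X ω} := measurableSet_lt measurable_const hX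
  -- Above `b` the variable exceeds `a` by `b - a`, and it falls below `a` only on the rare event.
  -- Integrating, a mean close to `a` leaves little room above `b`.
  have hpt : ∀ ω, ENNReal.ofReal (b - a) * {ω | ENNReal.ofReal b < X ω}.indicator 1 ω +
      ENNReal.ofReal a ≤ X ω + ENNReal.ofReal a * {ω | X ω < ENNReal.ofReal a}.indicator 1 ω := by
    intro ω
    by_cases h1 : ENNReal.ofReal b < X ω
    · rw [Set.indicator_of_mem (show ω ∈ {ω | ENNReal.ofReal b < X ω} from h1), Pi.one_apply,
        mul_one, ← ENNReal.ofReal_add (by linarith) ha, sub_add_cancel]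
      exact h1.le.trans le_self_add
    · rw [Set.indicator_of_notMem (show ω ∉ {ω | ENNReal.ofReal b < X ω} from h1), mul_zero,
        zero_add]
      by_cases h2 : X ω < ENNReal.ofReal a
      · rw [Set.indicator_of_mem (show ω ∈ {ω | X ω < ENNReal.ofReal a} from h2), Pi.one_apply,
          mul_one]
        exact le_add_self
      · exact (not_lt.1 h2).trans le_self_add
  have h := lintegral_mono (μ := P) hpt
  rw [lintegral_add_right _ measurable_const, lintegral_const_mul' _ _ ENNReal.ofReal_ne_top,
    lintegral_indicator_one hB, lintegral_const, measure_univ, mul_one,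
    lintegral_add_left hX, lintegral_const_mul' _ _ ENNReal.ofReal_ne_top,
    lintegral_indicator_one hA] at h
  have h2 : ENNReal.ofReal (b - a) * P {ω | ENNReal.ofReal b < X ω} + ENNReal.ofReal a ≤
      ENNReal.ofReal c + ENNReal.ofReal a * ENNReal.ofReal q := by
    refine h.trans (add_le_add hmean (mul_le_mul_right hlow _))
  rw [← ENNReal.ofReal_mul ha, ← ENNReal.ofReal_add hc (by positivity)] at h2
  set R := (P {ω | ENNReal.ofReal b < X ω}).toReal with hR
  have hRe : P {ω | ENNReal.ofReal b < X ω} = ENNReal.ofReal R :=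
    (ENNReal.ofReal_toReal (measure_ne_top _ _)).symm
  have hR0 : 0 ≤ R := ENNReal.toReal_nonneg
  rw [hRe, ← ENNReal.ofReal_mul (by linarith), ← ENNReal.ofReal_add
    (mul_nonneg (by linarith) hR0) ha, ENNReal.ofReal_le_ofReal_iff (by positivity)] at h2
  rw [hRe]
  refine ENNReal.ofReal_le_ofReal ?_
  rw [le_div_iff₀ (by linarith)]
  linarith

/-- The score of a box of normalised size `lam` rarely exceeds `scoreConst * lam`. -/
theorem measure_dscore_gt_le (hd : 1 ≤ d₁) {η δ : ℝ} (hη : 0 < η) (hδ : 0 < δ) :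
    ∃ L > 0, ∀ (N : Fin d₁ → ℕ), (∀ i, 0 < N i) → ∀ a : ℝ, 0 ≤ a → ∀ lam : ℝ, L ≤ lam →
      (∏ i, N i : ℕ) * a ≤ lam ^ d₁ →
      bernoulliSet (Edge (EdgeType d₁ d₂)) (cellProb a)
        {S | ENNReal.ofReal ((scoreConst d₁ d₂ + η) * lam) < dscore S N} ≤ ENNReal.ofReal δ := by
  set c := scoreConst d₁ d₂ with hc
  have hc0 : 0 < c := scoreConst_pos hd
  set κ := min (η * δ / 6) (c / 4) with hκ
  have hκ0 : 0 < κ := lt_min (by positivity) (by positivity)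
  have hκ1 : κ ≤ η * δ / 6 := min_le_left _ _
  have hκ2 : κ ≤ c / 4 := min_le_right _ _
  obtain ⟨n, hn, l0, hl0, hE⟩ := exists_meanScore_ge (d₁ := d₁) (d₂ := d₂) hd
    (c := c - κ) (by linarith) (by linarith)
  set q := η * δ / (2 * c) with hq
  have hq0 : 0 < q := by positivity
  obtain ⟨m0, hm0⟩ := exists_nat_ge ((n : ℝ) ^ 2 / ((κ * l0) ^ 2 * q) + 1)
  have hm01 : (1 : ℝ) ≤ m0 := le_trans (by
    have : 0 ≤ (n : ℝ) ^ 2 / ((κ * l0) ^ 2 * q) := by positivity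
    linarith) hm0
  -- The first bound gives at least `m0` blocks, enough for Chebyshev; the second makes the loss of
  -- one incomplete block at most `κ * lam`.
  refine ⟨max (m0 * l0) (c * l0 / κ), lt_max_of_lt_right (by positivity), ?_⟩
  intro N hN a ha lam hlam hvol
  have hlam1 : m0 * l0 ≤ lam := (le_max_left _ _).trans hlam
  have hlam2 : c * l0 / κ ≤ lam := (le_max_right _ _).trans hlam
  have hlam0 : 0 < lam := lt_of_lt_of_le (by positivity) hlam2
  set m := ⌊lam / l0⌋₊ with hm
  have hmm : m0 ≤ m := Nat.le_floor (by rwa [le_div_iff₀ hl0])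
  have hm1 : (1 : ℝ) ≤ m := hm01.trans (by exact_mod_cast hmm)
  have hmpos : 0 < m := by exact_mod_cast (zero_lt_one.trans_le hm1)
  have hml : m * l0 ≤ lam := (le_div_iff₀ hl0).1 (Nat.floor_le (by positivity))
  have hml' : lam - l0 ≤ m * l0 := by
    have := (div_lt_iff₀ hl0).1 (Nat.lt_floor_add_one (lam / l0))
    rw [← hm] at this
    linarith
  -- `M = G * (m * n)` is a multiple of every `N i` and of `m * n`: the given box and the long cubic
  -- box of the lower deviations are both coarse-grainings of one cube of side `M`.
  set G := ∏ i, N i with hG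
  have hGpos : 0 < G := Finset.prod_pos fun i _ => hN i
  set M := G * (m * n) with hM
  have hMpos : 0 < M := by positivity
  set r := lam / M with hr
  -- refine the box to a cubic one
  have hstep1 : bernoulliSet (Edge (EdgeType d₁ d₂)) (cellProb a)
      {S | ENNReal.ofReal ((c + η) * lam) < dscore S N} ≤
      bernoulliSet (Edge (EdgeType d₁ d₂)) (cellProb (r ^ d₁))
        {S | ENNReal.ofReal ((c + η) * lam) < dscore S fun _ => M} := by
    set g : Fin d₁ → ℕ := fun i => (G / N i) * (m * n) with hg
    have hdvd : ∀ i, N i ∣ G := fun i => Finset.dvd_prod_of_mem N (Finset.mem_univ i)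
    have hgpos : ∀ i, 0 < g i := fun i => by
      have := Nat.div_pos (Nat.le_of_dvd hGpos (hdvd i)) (hN i)
      positivity
    have hgN : g * N = fun _ => M := by
      ext i
      rw [Pi.mul_apply, hg, hM, mul_right_comm, Nat.div_mul_cancel (hdvd i)]
    have hprod : (∏ i, g i) * G = M ^ d₁ := by
      rw [hG, ← Finset.prod_mul_distrib]
      have : ∀ i, g i * N i = M := fun i => congrFun hgN i
      simp_rw [this]
      simp
    have hab : a ≤ (∏ i, g i : ℕ) * r ^ d₁ := by
      have h1 : ((∏ i, g i : ℕ) : ℝ) * G = (M : ℝ) ^ d₁ := by exact_mod_cast hprod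
      have hGr : (0 : ℝ) < G := by exact_mod_cast hGpos
      have hMr : (0 : ℝ) < M := by exact_mod_cast hMpos
      rw [hr, div_pow, mul_div_assoc', le_div_iff₀ (by positivity), ← h1]
      calc a * (((∏ i, g i : ℕ) : ℝ) * G) = ((∏ i, g i : ℕ) : ℝ) * (G * a) := by ring
        _ ≤ _ := mul_le_mul_of_nonneg_left hvol (Nat.cast_nonneg _)
    have h1 := lintegral_dscore_mono (d₂ := d₂) N (cellProb_mono ha hab)
      (monotone_indicator_Ioi (ENNReal.ofReal ((c + η) * lam)))
    have h2 := lintegral_dscore_refine (d₂ := d₂) N g hgpos (a := r ^ d₁) (by positivity)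
      (monotone_indicator_Ioi (ENNReal.ofReal ((c + η) * lam)))
    have h3 := h1.trans h2
    rw [lintegral_indicator_dscore _ _ measurableSet_Ioi,
      lintegral_indicator_dscore _ _ measurableSet_Ioi, hgN] at h3
    exact h3
  -- lower deviations
  set A := (c - 3 * κ) * lam with hA
  have hA0 : 0 ≤ A := mul_nonneg (by linarith) hlam0.le
  have hlow : bernoulliSet (Edge (EdgeType d₁ d₂)) (cellProb (r ^ d₁))
      {S | dscore S (fun _ => M) < ENNReal.ofReal A} ≤ ENNReal.ofReal q := by
    have hch := measure_dscore_lt_le (d₁ := d₁) (d₂ := d₂) hd (cellProb ((l0 / n) ^ d₁)) n m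
      (η := κ * l0) (by positivity) (E := (c - κ) * l0) hE
    have hAle : A ≤ m * ((c - κ) * l0 - κ * l0) := by
      have h1 : A ≤ (c - 2 * κ) * (lam - l0) := by
        have : c * l0 ≤ κ * lam := by rwa [div_le_iff₀' hκ0] at hlam2
        rw [hA]
        nlinarith
      have h2 : (c - 2 * κ) * (lam - l0) ≤ (c - 2 * κ) * (m * l0) :=
        mul_le_mul_of_nonneg_left hml' (by linarith)
      linarith
    have h1 := lintegral_dscore_mono (d₂ := d₂) (fun _ : Fin d₁ => m * n)
      (cellProb_mono (a := (l0 / n) ^ d₁) (b := (lam / (m * n : ℕ)) ^ d₁) (by positivity) (by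
        refine pow_le_pow_left₀ (by positivity) ?_ _
        push_cast
        rw [div_le_div_iff₀ (by positivity) (by positivity)]
        nlinarith)) (monotone_indicator_Ici (ENNReal.ofReal A))
    have h2 := lintegral_dscore_refine (d₂ := d₂) (fun _ : Fin d₁ => m * n) (fun _ => G)
      (fun _ => hGpos) (a := r ^ d₁) (by positivity) (monotone_indicator_Ici (ENNReal.ofReal A))
    have e : ((∏ _i : Fin d₁, G : ℕ) : ℝ) * r ^ d₁ = (lam / (m * n : ℕ)) ^ d₁ := by
      rw [Finset.prod_const, Finset.card_univ, Fintype.card_fin, hr, hM]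
      push_cast
      rw [← mul_pow]
      congr 1
      have : (G : ℝ) ≠ 0 := by exact_mod_cast hGpos.ne'
      field_simp
    rw [e] at h2
    have h3 := h1.trans h2
    rw [lintegral_indicator_dscore _ _ measurableSet_Ici,
      lintegral_indicator_dscore _ _ measurableSet_Ici] at h3
    have hcompl : ∀ (p : I) (N' : Fin d₁ → ℕ), bernoulliSet (Edge (EdgeType d₁ d₂)) p
        {S | dscore S N' < ENNReal.ofReal A} = 1 - bernoulliSet (Edge (EdgeType d₁ d₂)) p
          {S | dscore S N' ∈ Set.Ici (ENNReal.ofReal A)} := fun p N' => by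
      have hms : MeasurableSet {S : Set (Edge (EdgeType d₁ d₂)) |
          dscore S N' ∈ Set.Ici (ENNReal.ofReal A)} := measurable_dscore N' measurableSet_Ici
      rw [← prob_compl_eq_one_sub hms]
      congr 1
      ext S
      simp
    rw [hcompl]
    refine (tsub_le_tsub_left h3 1).trans ?_
    rw [← hcompl]
    refine (measure_mono ?_).trans (hch.trans (ENNReal.ofReal_le_ofReal ?_))
    · intro S hS
      exact lt_of_lt_of_le hS (ENNReal.ofReal_le_ofReal hAle)
    · rw [div_le_iff₀ (by positivity)]
      have h4 : (n : ℝ) ^ 2 / ((κ * l0) ^ 2 * q) ≤ m := by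
        have : (m0 : ℝ) ≤ m := by exact_mod_cast hmm
        linarith
      rw [div_le_iff₀ (by positivity)] at h4
      linarith
  refine hstep1.trans ((measure_gt_le_of_lower (measurable_dscore _) hA0
    (b := (c + η) * lam) ?_ hq0.le (c := c * lam) (by positivity) ?_ hlow).trans (ENNReal.ofReal_le_ofReal ?_))
  · rw [hA]; nlinarith
  · exact meanScore_le hd hMpos hlam0
  · have hcq : c * q = η * δ / 2 := by rw [hq]; field_simp
    have h5 : 0 < (c + η) * lam - A := by rw [hA]; nlinarith
    rw [div_le_iff₀ h5, hA]
    have h6 : 3 * κ + (c - 3 * κ) * q ≤ δ * (η + 3 * κ) := by nlinarith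
    nlinarith

end ScoreTail

/-! ### Disjoint occurrence -/

section DisjointOccurrence

variable {α : Type*} [Countable α]

/-- There are only finitely many traces on `E`, each seen on a cylinder event; `f` need not be
measurable. -/
lemma measurable_finite_restrict {γ : Type*} [MeasurableSpace γ] (E : Finset α)
    (f : Set α → γ) : Measurable fun S : Set α => f (S ∩ E) := by
  classical
  intro t _
  have : (fun S : Set α => f (S ∩ E)) ⁻¹' t =
      ⋃ F ∈ {F | F ∈ E.powerset ∧ f (F : Set α) ∈ t}, ⋂ e ∈ E, {S : Set α | e ∈ S ↔ e ∈ F} := by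
    ext S
    simp only [Set.mem_preimage, Set.mem_iUnion, Set.mem_iInter, Set.mem_ofPred_eq,
      Finset.mem_powerset, exists_prop]
    constructor
    · intro h
      refine ⟨E.filter (· ∈ S), ⟨Finset.filter_subset _ _, ?_⟩, fun e he => by simp [he]⟩
      convert h using 2
      ext e
      simp [and_comm]
    · rintro ⟨F, ⟨hF, h⟩, h1⟩
      convert h using 2
      ext e
      simp only [Set.mem_inter_iff, Finset.mem_coe]
      exact ⟨fun h2 => (h1 e h2.2).1 h2.1, fun h2 => ⟨(h1 e (hF h2)).2 h2, hF h2⟩⟩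
  rw [this]
  refine MeasurableSet.biUnion (Set.to_countable _) fun F _ => ?_
  refine Finset.measurableSet_biInter _ fun e _ => ?_
  by_cases h : e ∈ F
  · simpa [h] using measurableSet_mem e
  · simpa [h] using measurableSet_notMem e

open Classical in
/-- Conditioning on one element. -/
lemma lintegral_restrict_insert (p : I) {E : Finset α} {a : α} (ha : a ∉ E)
    (f : Set α → ℝ≥0∞) :
    ∫⁻ S, f (S ∩ (insert a E : Finset α)) ∂bernoulliSet α p =
      ENNReal.ofReal (1 - p) * ∫⁻ S, f (S ∩ E) ∂bernoulliSet α p +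
      ENNReal.ofReal p * ∫⁻ S, f (insert a (S ∩ E)) ∂bernoulliSet α p := by
  have hdisj : Disjoint ({a} : Set α) (E : Set α) := by simpa using ha
  have h0 : MeasurableSet {S : Set α | a ∉ S} := measurableSet_notMem a
  have h1 : MeasurableSet {S : Set α | a ∈ S} := measurableSet_mem a
  have key0 := lintegral_mul_bernoulliSet p hdisj (f := {S : Set α | a ∉ S}.indicator 1)
    (g := fun S => f (S ∩ E)) (measurable_one.indicator h0) (measurable_finite_restrict E f)
  have key1 := lintegral_mul_bernoulliSet p hdisj (f := {S : Set α | a ∈ S}.indicator 1)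
    (g := fun S => f (insert a (S ∩ E))) (measurable_one.indicator h1)
    (measurable_finite_restrict E fun S => f (insert a S))
  have e0 : ∀ S : Set α, {S : Set α | a ∉ S}.indicator (1 : Set α → ℝ≥0∞) (S ∩ {a}) =
      {S : Set α | a ∉ S}.indicator 1 S := fun S => by
    simp [Set.indicator_apply]
  have e1 : ∀ S : Set α, {S : Set α | a ∈ S}.indicator (1 : Set α → ℝ≥0∞) (S ∩ {a}) =
      {S : Set α | a ∈ S}.indicator 1 S := fun S => by
    simp [Set.indicator_apply]
  have e2 : ∀ S : Set α, S ∩ (E : Set α) ∩ E = S ∩ E := fun S => by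
    rw [Set.inter_assoc, Set.inter_self]
  simp only [e0, e2, lintegral_indicator_one h0] at key0
  simp only [e1, e2, lintegral_indicator_one h1] at key1
  have p0 : bernoulliSet α p {S | a ∉ S} = ENNReal.ofReal (1 - p) := by
    have := bernoulliSet_avoiding p {a}
    simpa [avoiding] using this
  have p1 : bernoulliSet α p {S | a ∈ S} = ENNReal.ofReal p := by
    have := bernoulliSet_containing p {a}
    simpa using this
  rw [p0] at key0
  rw [p1] at key1
  have hm : Measurable fun S : Set α =>
      {S : Set α | a ∉ S}.indicator (1 : Set α → ℝ≥0∞) S * f (S ∩ E) :=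
    (measurable_one.indicator h0).mul (measurable_finite_restrict E f)
  rw [← key0, ← key1, ← lintegral_add_left hm]
  refine lintegral_congr fun S => ?_
  by_cases h : a ∈ S
  · have : S ∩ (insert a E : Finset α) = insert a (S ∩ E) := by
      ext e
      simp only [Set.mem_inter_iff, Finset.mem_coe, Finset.mem_insert, Set.mem_insert_iff]
      constructor
      · rintro ⟨h1, h2 | h2⟩ <;> tauto
      · rintro (h2 | h2)
        · subst h2; tauto
        · tauto
    rw [this]
    simp [h]
  · have : S ∩ (insert a E : Finset α) = S ∩ E := by
      ext e
      simp only [Set.mem_inter_iff, Finset.mem_coe, Finset.mem_insert]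
      constructor
      · rintro ⟨h3, h2 | h2⟩
        · exact absurd (h2 ▸ h3) h
        · exact ⟨h3, h2⟩
      · tauto
    rw [this]
    simp [h]

/-- Supremum of products over disjoint subsets. -/
def disjointProd (φ ψ : Set α → ℝ≥0∞) (T : Set α) : ℝ≥0∞ :=
  ⨆ (A : Set α) (B : Set α) (_ : A ⊆ T) (_ : B ⊆ T) (_ : Disjoint A B), φ A * ψ B

lemma le_disjointProd (φ ψ : Set α → ℝ≥0∞) {T A B : Set α} (hA : A ⊆ T) (hB : B ⊆ T)
    (h : Disjoint A B) : φ A * ψ B ≤ disjointProd φ ψ T :=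
  le_iSup_of_le A (le_iSup_of_le B (le_iSup_of_le hA (le_iSup_of_le hB (le_iSup_of_le h le_rfl))))

lemma disjointProd_le {φ ψ : Set α → ℝ≥0∞} {T : Set α} {c : ℝ≥0∞}
    (h : ∀ A B, A ⊆ T → B ⊆ T → Disjoint A B → φ A * ψ B ≤ c) : disjointProd φ ψ T ≤ c :=
  iSup_le fun A => iSup_le fun B => iSup_le fun hA => iSup_le fun hB => iSup_le fun hd =>
    h A B hA hB hd

lemma disjointProd_mono {φ φ' ψ ψ' : Set α → ℝ≥0∞} (h : φ ≤ φ') (h' : ψ ≤ ψ') (T : Set α) :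
    disjointProd φ ψ T ≤ disjointProd φ' ψ' T :=
  disjointProd_le fun A B hA hB hd =>
    (mul_le_mul' (h A) (h' B)).trans (le_disjointProd φ' ψ' hA hB hd)

/-- By disjointness the new element belongs to one of the two subsets or to neither. -/
lemma disjointProd_insert_le {φ ψ : Set α → ℝ≥0∞} (a : α) (T : Set α) :
    disjointProd φ ψ (insert a T) ≤
      max (disjointProd (fun A => φ (insert a A)) ψ T)
        (disjointProd φ (fun B => ψ (insert a B)) T) ⊔ disjointProd φ ψ T := by
  have hsub : ∀ {A : Set α}, A ⊆ insert a T → A \ {a} ⊆ T := fun {A} hA x hx =>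
    (hA hx.1).resolve_left hx.2
  refine disjointProd_le fun A B hA hB hd => ?_
  by_cases h1 : a ∈ A
  · have h2 : a ∉ B := Set.disjoint_left.1 hd h1
    have hB' : B ⊆ T := fun x hx => (hB hx).resolve_left fun h => h2 (h ▸ hx)
    refine le_trans ?_ (le_max_left _ _)
    refine le_trans ?_ (le_max_left _ _)
    have := le_disjointProd (fun A => φ (insert a A)) ψ (hsub hA) hB'
      (hd.mono_left Set.sdiff_subset)
    rwa [Set.insert_sdiff_singleton, Set.insert_eq_of_mem h1] at this
  · have hA' : A ⊆ T := fun x hx => (hA hx).resolve_left fun h => h1 (h ▸ hx)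
    by_cases h2 : a ∈ B
    · refine le_trans ?_ (le_max_left _ _)
      refine le_trans ?_ (le_max_right _ _)
      have := le_disjointProd φ (fun B => ψ (insert a B)) hA' (hsub hB)
        (hd.mono_right Set.sdiff_subset)
      rwa [Set.insert_sdiff_singleton, Set.insert_eq_of_mem h2] at this
    · have hB' : B ⊆ T := fun x hx => (hB hx).resolve_left fun h => h2 (h ▸ hx)
      exact le_trans (le_disjointProd φ ψ hA' hB' hd) (le_max_right _ _)

/-- One-element case of the disjoint occurrence inequality. With `a₁ = a₀ + s` and `b₁ = b₀ + t`,
the right side exceeds the left side by exactly `p² * s * t`. -/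
lemma mixture_le {p : ℝ} (hp0 : 0 ≤ p) (hp : p ≤ 1 / 2) {a₀ a₁ b₀ b₁ : ℝ≥0∞} (ha : a₀ ≤ a₁)
    (hb : b₀ ≤ b₁) :
    ENNReal.ofReal (1 - 2 * p) * (a₀ * b₀) + ENNReal.ofReal p * (a₁ * b₀ + a₀ * b₁) ≤
      (ENNReal.ofReal (1 - p) * a₀ + ENNReal.ofReal p * a₁) *
        (ENNReal.ofReal (1 - p) * b₀ + ENNReal.ofReal p * b₁) := by
  obtain ⟨s, rfl⟩ := exists_add_of_le ha
  obtain ⟨t, rfl⟩ := exists_add_of_le hb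
  have e1 : ENNReal.ofReal (1 - p) + ENNReal.ofReal p = 1 := by
    rw [← ENNReal.ofReal_add (by linarith) hp0]; simp
  have e2 : ENNReal.ofReal (1 - 2 * p) + 2 * ENNReal.ofReal p = 1 := by
    rw [two_mul (ENNReal.ofReal p), ← ENNReal.ofReal_add hp0 hp0, ← ENNReal.ofReal_add (by linarith) (by linarith)]
    ring_nf
    simp
  set q := ENNReal.ofReal p
  set r := ENNReal.ofReal (1 - p)
  set u := ENNReal.ofReal (1 - 2 * p)
  have h1 : u * (a₀ * b₀) + q * ((a₀ + s) * b₀ + a₀ * (b₀ + t)) =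
      (u + 2 * q) * (a₀ * b₀) + q * s * b₀ + q * a₀ * t := by ring
  have h2 : (r * a₀ + q * (a₀ + s)) * (r * b₀ + q * (b₀ + t)) =
      ((r + q) * a₀ + q * s) * ((r + q) * b₀ + q * t) := by ring
  rw [h1, h2, e1, e2, one_mul, one_mul, one_mul]
  have h3 : (a₀ + q * s) * (b₀ + q * t) =
      (a₀ * b₀ + q * s * b₀ + q * a₀ * t) + q * s * (q * t) := by ring
  rw [h3]
  exact le_self_add

/-- The mean of a supremum of products over disjoint subsets is at most the product of the
means. -/
theorem lintegral_disjointProd_le {p : I} (hp : (p : ℝ) ≤ 1 / 2) (E : Finset α)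
    {φ ψ : Set α → ℝ≥0∞} (hφ : Monotone φ) (hψ : Monotone ψ) :
    ∫⁻ S, disjointProd φ ψ (S ∩ E) ∂bernoulliSet α p ≤
      (∫⁻ S, φ (S ∩ E) ∂bernoulliSet α p) * ∫⁻ S, ψ (S ∩ E) ∂bernoulliSet α p := by
  classical
  induction E using Finset.induction_on generalizing φ ψ with
  | empty =>
    simp only [Finset.coe_empty, Set.inter_empty, lintegral_const, measure_univ, mul_one]
    refine disjointProd_le fun A B hA hB _ => ?_
    rw [Set.subset_empty_iff.1 hA, Set.subset_empty_iff.1 hB]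
  | insert a E ha ih =>
    rw [lintegral_restrict_insert p ha, lintegral_restrict_insert p ha,
      lintegral_restrict_insert p ha]
    have hφ1 : Monotone fun A => φ (insert a A) := fun A B h => hφ (Set.insert_subset_insert h)
    have hψ1 : Monotone fun A => ψ (insert a A) := fun A B h => hψ (Set.insert_subset_insert h)
    have hφ01 : φ ≤ fun A => φ (insert a A) := fun A => hφ (Set.subset_insert a A)
    have hψ01 : ψ ≤ fun A => ψ (insert a A) := fun A => hψ (Set.subset_insert a A)
    set w := fun S : Set α => disjointProd φ ψ (S ∩ E) with hw
    set u := fun S : Set α => disjointProd (fun A => φ (insert a A)) ψ (S ∩ E) with hu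
    set v := fun S : Set α => disjointProd φ (fun A => ψ (insert a A)) (S ∩ E) with hv
    have hwm : Measurable w := measurable_finite_restrict E (disjointProd φ ψ)
    have hum : Measurable u := measurable_finite_restrict E
      (disjointProd (fun A => φ (insert a A)) ψ)
    have hwu : w ≤ u := fun S => disjointProd_mono hφ01 le_rfl _
    have hwv : w ≤ v := fun S => disjointProd_mono le_rfl hψ01 _
    -- Since `w` is below both `u` and `v`, adding it to `max u v` gives at most `u + v`.
    have hpt : ∀ S : Set α, disjointProd φ ψ (insert a (S ∩ E)) + w S ≤ u S + v S := by
      intro S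
      have h1 := disjointProd_insert_le (φ := φ) (ψ := ψ) a (S ∩ E)
      have h2 : disjointProd φ ψ (insert a (S ∩ E)) ≤ max (u S) (v S) :=
        h1.trans (max_le le_rfl ((hwu S).trans (le_max_left _ _)))
      rcases le_total (u S) (v S) with h | h
      · rw [max_eq_right h] at h2
        rw [add_comm (u S)]
        exact add_le_add h2 (hwu S)
      · rw [max_eq_left h] at h2
        exact add_le_add h2 (hwv S)
    -- A part `p` of the weight `1 - p` is moved to the second term in order to use `hpt`; `p ≤ 1 /
    -- 2` keeps the rest non-negative.
    have h1p : ENNReal.ofReal (1 - p) = ENNReal.ofReal (1 - 2 * p) + ENNReal.ofReal p := by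
      rw [← ENNReal.ofReal_add (by linarith) p.2.1]
      congr 1; ring
    calc ENNReal.ofReal (1 - p) * ∫⁻ S, w S ∂bernoulliSet α p +
          ENNReal.ofReal p * ∫⁻ S, disjointProd φ ψ (insert a (S ∩ E)) ∂bernoulliSet α p
        = ENNReal.ofReal (1 - 2 * p) * ∫⁻ S, w S ∂bernoulliSet α p + ENNReal.ofReal p *
          ∫⁻ S, (disjointProd φ ψ (insert a (S ∩ E)) + w S) ∂bernoulliSet α p := by
          rw [lintegral_add_right _ hwm, h1p]
          ring
      _ ≤ ENNReal.ofReal (1 - 2 * p) * ∫⁻ S, w S ∂bernoulliSet α p + ENNReal.ofReal p *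
          (∫⁻ S, u S ∂bernoulliSet α p + ∫⁻ S, v S ∂bernoulliSet α p) := by
          rw [← lintegral_add_left hum]
          exact add_le_add_right (mul_le_mul_right (lintegral_mono hpt) _) _
      _ ≤ _ := by
          refine le_trans (add_le_add (mul_le_mul_right (ih hφ hψ) _)
            (mul_le_mul_right (add_le_add (ih hφ1 hψ) (ih hφ hψ1)) _))
            (mixture_le p.2.1 hp (lintegral_mono fun S => hφ01 (S ∩ E))
              (lintegral_mono fun S => hψ01 (S ∩ E)))

end DisjointOccurrence

/-! ### Skeleton of a path in a grid of cells -/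

section Skeleton

variable {d₁ d₂ : ℕ}

/-- Discrete intermediate values along a geodesic: `f` grows by at most one per unit step, hence
cannot skip the level `t`. -/
lemma exists_between {ι : Type*} [Fintype ι] [DecidableEq ι] {f : (ι → ℤ) → ℤ}
    (hf : ∀ x s, l1 s = 1 → f (x + s) ≤ f x + 1) {x y : ι → ℤ} {t : ℤ} (hx : f x ≤ t)
    (hy : t ≤ f y) : ∃ r, f r = t ∧ l1 (r - x) + l1 (y - r) ≤ l1 (y - x) := by
  obtain ⟨k, hk⟩ : ∃ k, l1 (y - x) = k := ⟨_, rfl⟩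
  rw [hk]
  induction k generalizing x with
  | zero =>
    have : y = x := sub_eq_zero.1 (l1_eq_zero.1 hk)
    subst this
    exact ⟨y, le_antisymm hx hy, by simp⟩
  | succ k ih =>
    rcases eq_or_lt_of_le hx with h | h
    · exact ⟨x, h, by simp [hk]⟩
    · obtain ⟨s, hs, hs'⟩ := exists_unit_step hk
      have h1 := hf x s hs
      obtain ⟨r, hr, hr'⟩ := ih (x := x + s) (by omega) (by rw [← hs']; congr 1; abel)
      refine ⟨r, hr, ?_⟩
      have h2 := l1_sub_le x (x + s) r
      rw [add_sub_cancel_left, hs] at h2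
      omega

lemma l1_step {ι : Type*} [Fintype ι] [DecidableEq ι] (e : OEdge ι) :
    ∃ s, l1 s = 1 ∧ e.tgt = e.src + s :=
  ⟨e.tgt - e.src, l1_tgt_sub_src e, by abel⟩

/-- Cutting a list of edges at the first passage of a given level. -/
lemma exists_cut {ι : Type*} [Fintype ι] [DecidableEq ι] {f : (ι → ℤ) → ℤ}
    (hf : ∀ x s, l1 s = 1 → f (x + s) ≤ f x + 1) {y : ι → ℤ} {t : ℤ} (hy : t ≤ f y)
    (l : List (OEdge ι)) (x : ι → ℤ) (hx : f x ≤ t) :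
    ∃ r l' l'', f r = t ∧ l = l' ++ l'' ∧
      jumpCost x l' r + jumpCost r l'' y ≤ jumpCost x l y := by
  induction l generalizing x with
  | nil =>
    obtain ⟨r, hr, h⟩ := exists_between hf hx hy
    exact ⟨r, [], [], hr, rfl, h⟩
  | cons e l ih =>
    by_cases h : t ≤ f e.src
    · obtain ⟨r, hr, h'⟩ := exists_between hf hx h
      refine ⟨r, [], e :: l, hr, rfl, ?_⟩
      simp only [jumpCost]
      omega
    · obtain ⟨s, hs, hs'⟩ := l1_step e
      have h1 := hf e.src s hs
      rw [← hs'] at h1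
      obtain ⟨r, l', l'', hr, hl, h2⟩ := ih e.tgt (by omega)
      refine ⟨r, e :: l', l'', hr, by rw [hl]; rfl, ?_⟩
      simp only [jumpCost]
      omega

/-- An optimal list can be chosen without repeated edges, so its parts before and after the cut use
disjoint sets of free edges. -/
lemma exists_disjoint_cut {ι : Type*} [Fintype ι] [DecidableEq ι] {f : (ι → ℤ) → ℤ}
    (hf : ∀ x s, l1 s = 1 → f (x + s) ≤ f x + 1) {x y : ι → ℤ} {t : ℤ} (hx : f x ≤ t)
    (hy : t ≤ f y) (S : Set (Edge ι)) :
    ∃ r A B, f r = t ∧ A ⊆ S ∧ B ⊆ S ∧ Disjoint A B ∧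
      ptime A x r + ptime B r y ≤ ptime S x y := by
  obtain ⟨l, hl, hn, h⟩ := exists_nodup_jumpCost_eq_ptime S x y
  obtain ⟨r, l', l'', hr, rfl, h'⟩ := exists_cut hf hy l x hx
  refine ⟨r, {e | e ∈ l'.map Prod.fst}, {e | e ∈ l''.map Prod.fst}, hr, ?_, ?_, ?_, ?_⟩
  · rintro e he
    obtain ⟨f, hf, rfl⟩ := List.mem_map.1 he
    exact hl f (List.mem_append_left _ hf)
  · rintro e he
    obtain ⟨f, hf, rfl⟩ := List.mem_map.1 he
    exact hl f (List.mem_append_right _ hf)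
  · rw [List.map_append, List.nodup_append'] at hn
    exact Set.disjoint_left.2 fun e h1 h2 => hn.2.2 h1 h2
  · rw [← h]
    exact (add_le_add (ptime_le fun e he => List.mem_map_of_mem he)
      (ptime_le fun e he => List.mem_map_of_mem he)).trans h'

/-- The cell of a vertex in a grid of boxes. -/
def cellOf (side : EdgeType d₁ d₂ → ℕ) (x : EdgeType d₁ d₂ → ℤ) : EdgeType d₁ d₂ → ℤ :=
  fun t => x t / side t

/-- The lower corner of a cell. -/
def cellBase (side : EdgeType d₁ d₂ → ℕ) (c : EdgeType d₁ d₂ → ℤ) : EdgeType d₁ d₂ → ℤ :=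
  fun t => side t * c t

/-- The upper horizontal corner of a cell. -/
def cellTop (side : EdgeType d₁ d₂ → ℕ) (c : EdgeType d₁ d₂ → ℤ) : EdgeType d₁ d₂ → ℤ :=
  Sum.elim (fun i => side (Sum.inl i) * (c (Sum.inl i) + 1))
    (fun j => side (Sum.inr j) * c (Sum.inr j))

/-- The total vertical size of a cell. -/
def verSize (side : EdgeType d₁ d₂ → ℕ) : ℕ := ∑ j, side (Sum.inr j)

lemma hor_cellOf_add_le (side : EdgeType d₁ d₂ → ℕ) (hside : ∀ t, 0 < side t)
    (x s : EdgeType d₁ d₂ → ℤ) (hs : l1 s = 1) :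
    hor (cellOf side (x + s)) ≤ hor (cellOf side x) + 1 := by
  have hst : ∀ t, s t ≤ (s t).natAbs := fun t => Int.le_natAbs
  have h1 : ∀ t, cellOf side (x + s) t ≤ cellOf side x t + (s t).natAbs := by
    intro t
    have ht : (0 : ℤ) < side t := by exact_mod_cast hside t
    simp only [cellOf, Pi.add_apply]
    rw [← Int.add_mul_ediv_right _ _ ht.ne']
    refine Int.ediv_le_ediv ht ?_
    have : ((s t).natAbs : ℤ) * 1 ≤ (s t).natAbs * side t :=
      mul_le_mul_of_nonneg_left (by omega) (by omega)
    have := hst t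
    omega
  have h2 : (∑ i : Fin d₁, (s (Sum.inl i)).natAbs) ≤ 1 := by
    rw [← hs, l1_eq_sum]; omega
  calc hor (cellOf side (x + s))
      ≤ ∑ i : Fin d₁, (cellOf side x (Sum.inl i) + (s (Sum.inl i)).natAbs) :=
        Finset.sum_le_sum fun i _ => h1 _
    _ = hor (cellOf side x) + (∑ i : Fin d₁, (s (Sum.inl i)).natAbs : ℕ) := by
        rw [Finset.sum_add_distrib, hor]; push_cast; rfl
    _ ≤ _ := by have : ((∑ i : Fin d₁, (s (Sum.inl i)).natAbs : ℕ) : ℤ) ≤ 1 := by exact_mod_cast h2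
                omega

/-- Going from the lower corner of its cell to `x`, all horizontal moves are forward; only vertical
moves, at most `verSize`, are wasted. -/
lemma l1_sub_base_le (side : EdgeType d₁ d₂ → ℕ) (hside : ∀ t, 0 < side t)
    (x : EdgeType d₁ d₂ → ℤ) :
    (l1 (x - cellBase side (cellOf side x)) : ℤ) ≤
      hor (x - cellBase side (cellOf side x)) + verSize side := by
  have hm : ∀ t, 0 ≤ (x - cellBase side (cellOf side x)) t ∧
      (x - cellBase side (cellOf side x)) t < side t := fun t => by
    have ht : (0 : ℤ) < side t := by exact_mod_cast hside t
    have h1 := Int.emod_nonneg (x t) ht.ne'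
    have h2 := Int.emod_lt_of_pos (x t) ht
    have h3 := Int.emod_add_mul_ediv (x t) (side t)
    simp only [Pi.sub_apply, cellBase, cellOf]
    constructor <;> linarith
  rw [l1_of_nonneg fun i => (hm _).1]
  refine add_le_add_right ?_ _
  rw [l1, verSize]
  push_cast
  refine Finset.sum_le_sum fun j _ => ?_
  have := hm (Sum.inr j)
  rw [verPart, abs_of_nonneg this.1]
  exact this.2.le

lemma l1_top_sub_le (side : EdgeType d₁ d₂ → ℕ) (hside : ∀ t, 0 < side t)
    (x : EdgeType d₁ d₂ → ℤ) :
    (l1 (cellTop side (cellOf side x) - x) : ℤ) ≤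
      hor (cellTop side (cellOf side x) - x) + verSize side := by
  have hm : ∀ t, 0 ≤ x t - side t * (x t / side t) ∧ x t - side t * (x t / side t) < side t :=
    fun t => by
      have ht : (0 : ℤ) < side t := by exact_mod_cast hside t
      have h1 := Int.emod_nonneg (x t) ht.ne'
      have h2 := Int.emod_lt_of_pos (x t) ht
      have h3 := Int.emod_add_mul_ediv (x t) (side t)
      constructor <;> linarith
  rw [l1_of_nonneg fun i => by
    have := hm (Sum.inl i)
    simp only [Pi.sub_apply, cellTop, cellOf, Sum.elim_inl]
    linarith]
  refine add_le_add_right ?_ _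
  rw [l1, verSize]
  push_cast
  refine Finset.sum_le_sum fun j _ => ?_
  have := hm (Sum.inr j)
  simp only [verPart, Pi.sub_apply, cellTop, cellOf, Sum.elim_inr]
  rw [abs_sub_comm, abs_of_nonneg this.1]
  exact this.2.le

/-- Exponential of the savings between two cells. -/
def cellWeight (side : EdgeType d₁ d₂ → ℕ) (β : ℝ) (c b : EdgeType d₁ d₂ → ℤ)
    (S : Set (Edge (EdgeType d₁ d₂))) : ℝ≥0∞ :=
  ENNReal.ofReal (Real.exp (β * ((hor (cellTop side b) : ℝ) -
    ptime S (cellBase side c) (cellTop side (c + b)) + 2 * verSize side)))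

/-- Exponential of the largest savings from a cell to a vertex. -/
def restWeight (side : EdgeType d₁ d₂ → ℕ) (β : ℝ) (y c : EdgeType d₁ d₂ → ℤ)
    (S : Set (Edge (EdgeType d₁ d₂))) : ℝ≥0∞ :=
  ⨆ (x : EdgeType d₁ d₂ → ℤ) (_ : cellOf side x = c),
    ENNReal.ofReal (Real.exp (β * ((hor (y - x) : ℝ) - ptime S x y)))

lemma cellWeight_mono (side : EdgeType d₁ d₂ → ℕ) {β : ℝ} (hβ : 0 ≤ β)
    (c b : EdgeType d₁ d₂ → ℤ) : Monotone (cellWeight side β c b) := by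
  intro S S' h
  refine ENNReal.ofReal_le_ofReal (Real.exp_le_exp.2 (mul_le_mul_of_nonneg_left ?_ hβ))
  have : (ptime S' (cellBase side c) (cellTop side (c + b)) : ℝ) ≤
      ptime S (cellBase side c) (cellTop side (c + b)) := by exact_mod_cast ptime_anti h _ _
  linarith

lemma restWeight_mono (side : EdgeType d₁ d₂ → ℕ) {β : ℝ} (hβ : 0 ≤ β)
    (y c : EdgeType d₁ d₂ → ℤ) : Monotone (restWeight side β y c) := by
  intro S S' h
  refine iSup₂_mono fun x _ => ENNReal.ofReal_le_ofReal (Real.exp_le_exp.2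
    (mul_le_mul_of_nonneg_left ?_ hβ))
  have : (ptime S' x y : ℝ) ≤ ptime S x y := by exact_mod_cast ptime_anti h _ _
  linarith

lemma cellTop_sub_base (side : EdgeType d₁ d₂ → ℕ) (c b : EdgeType d₁ d₂ → ℤ) :
    cellTop side (c + b) - cellBase side c = cellTop side b := by
  ext t
  rcases t with i | j <;> simp only [cellTop, cellBase, Pi.sub_apply, Pi.add_apply, Sum.elim_inl,
    Sum.elim_inr] <;> ring

/-- Extend the path backwards to the lower corner of its first cell and forwards to the upper corner
of its last cell. Forward horizontal moves do not change the savings, and each end wastes at most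
`verSize`. Savings between arbitrary vertices are thus controlled by those between countably many
corners. -/
lemma cell_savings_le (side : EdgeType d₁ d₂ → ℕ) (hside : ∀ t, 0 < side t)
    (S : Set (Edge (EdgeType d₁ d₂))) (x r : EdgeType d₁ d₂ → ℤ) :
    (hor (r - x) : ℝ) - ptime S x r ≤
      (hor (cellTop side (cellOf side r - cellOf side x)) : ℝ) -
        ptime S (cellBase side (cellOf side x)) (cellTop side (cellOf side r)) +
        2 * verSize side := by
  set a := cellBase side (cellOf side x) with ha
  set t := cellTop side (cellOf side r) with ht
  have h0 : cellTop side (cellOf side r - cellOf side x) = t - a := by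
    rw [ha, ht, ← cellTop_sub_base, add_sub_cancel]
  have h1 := ptime_triangle S a x t
  have h2 := ptime_triangle S x r t
  have h3 := ptime_le_l1 S a x
  have h4 := ptime_le_l1 S r t
  have h5 := l1_sub_base_le side hside x
  have h6 := l1_top_sub_le side hside r
  rw [h0]
  rw [← ha, hor_sub] at h5
  rw [← ht, hor_sub] at h6
  rw [hor_sub, hor_sub]
  have h7 : (hor r - hor x) - (ptime S x r : ℤ) ≤ (hor t - hor a) - ptime S a t +
      2 * verSize side := by omega
  exact_mod_cast h7

lemma restWeight_le (side : EdgeType d₁ d₂ → ℕ) (hside : ∀ t, 0 < side t) {β : ℝ} (hβ : 0 ≤ β)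
    (y c : EdgeType d₁ d₂ → ℤ) (S : Set (Edge (EdgeType d₁ d₂))) :
    restWeight side β y c S ≤ cellWeight side β c (cellOf side y - c) S := by
  refine iSup₂_le fun x hx => ENNReal.ofReal_le_ofReal (Real.exp_le_exp.2
    (mul_le_mul_of_nonneg_left ?_ hβ))
  have := cell_savings_le side hside S x y
  rwa [hx, ← add_sub_cancel c (cellOf side y), add_sub_cancel_left] at this

/-- Decomposition of the rest weight at the next level. -/
lemma restWeight_le_tsum (side : EdgeType d₁ d₂ → ℕ) (hside : ∀ t, 0 < side t) {β : ℝ}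
    (hβ : 0 ≤ β) {y c : EdgeType d₁ d₂ → ℤ} {L : ℕ} (h : hor c + L ≤ hor (cellOf side y))
    (S : Set (Edge (EdgeType d₁ d₂))) :
    restWeight side β y c S ≤ ∑' b : {b : EdgeType d₁ d₂ → ℤ // hor b = L},
      disjointProd (cellWeight side β c b) (restWeight side β y (c + b)) S := by
  refine iSup₂_le fun x hx => ?_
  -- The path is cut when its cell first climbs `L` levels; the sum runs over the displacement of
  -- cells up to the cut.
  obtain ⟨r, A, B, hr, hA, hB, hAB, hp⟩ := exists_disjoint_cut
    (hor_cellOf_add_le side hside) (x := x) (y := y) (t := hor c + L) (by rw [hx]; omega) h S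
  refine le_trans ?_ (ENNReal.le_tsum ⟨cellOf side r - c, by rw [hor_sub, hr]; ring⟩)
  refine le_trans ?_ (le_disjointProd _ _ hA hB hAB)
  have h1 : ENNReal.ofReal (Real.exp (β * ((hor (y - r) : ℝ) - ptime B r y))) ≤
      restWeight side β y (c + (cellOf side r - c)) B :=
    le_iSup₂_of_le r (by rw [add_sub_cancel]) le_rfl
  have h2 : ENNReal.ofReal (Real.exp (β * ((hor (r - x) : ℝ) - ptime A x r))) ≤
      cellWeight side β c (cellOf side r - c) A := by
    refine ENNReal.ofReal_le_ofReal (Real.exp_le_exp.2 (mul_le_mul_of_nonneg_left ?_ hβ))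
    have := cell_savings_le side hside A x r
    rwa [hx, ← add_sub_cancel c (cellOf side r), add_sub_cancel_left] at this
  refine le_trans ?_ (mul_le_mul' h2 h1)
  rw [← ENNReal.ofReal_mul (Real.exp_pos _).le, ← Real.exp_add, ← mul_add]
  refine ENNReal.ofReal_le_ofReal (Real.exp_le_exp.2 (mul_le_mul_of_nonneg_left ?_ hβ))
  have h3 : (ptime A x r : ℝ) + ptime B r y ≤ ptime S x y := by exact_mod_cast hp
  rw [hor_sub, hor_sub, hor_sub]
  push_cast
  linarith

/-- Exponential moment of the savings between two cells. -/
def cellMoment (p : I) (side : EdgeType d₁ d₂ → ℕ) (β : ℝ) (b : EdgeType d₁ d₂ → ℤ) : ℝ≥0∞ :=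
  ∫⁻ S, ENNReal.ofReal (Real.exp (β * ((hor (cellTop side b) : ℝ) -
    ptime S 0 (cellTop side b) + 2 * verSize side))) ∂bernoulliSet (Edge (EdgeType d₁ d₂)) p

lemma lintegral_cellWeight_le (p : I) (side : EdgeType d₁ d₂ → ℕ) {β : ℝ} (hβ : 0 ≤ β)
    (c b : EdgeType d₁ d₂ → ℤ) (E : Set (Edge (EdgeType d₁ d₂))) :
    ∫⁻ S, cellWeight side β c b (S ∩ E) ∂bernoulliSet (Edge (EdgeType d₁ d₂)) p ≤
      cellMoment p side β b := by
  have hm : Measurable fun S : Set (Edge (EdgeType d₁ d₂)) =>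
      ENNReal.ofReal (Real.exp (β * ((hor (cellTop side b) : ℝ) -
        ptime S 0 (cellTop side b) + 2 * verSize side))) := by
    have := measurable_ptime_real (ι := EdgeType d₁ d₂) 0 (cellTop side b)
    fun_prop
  rw [cellMoment, ← (measurePreserving_shiftEdge p (cellBase side c)).lintegral_comp hm]
  refine lintegral_mono fun S => ?_
  refine (cellWeight_mono side hβ c b Set.inter_subset_left).trans (le_of_eq ?_)
  rw [cellWeight, ptime_shift, zero_add, ← cellTop_sub_base side c b, sub_add_cancel]

/-- Exponential moments along a path are controlled by the moments between cells. -/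
lemma lintegral_restWeight_le {p : I} (hp : (p : ℝ) ≤ 1 / 2) (side : EdgeType d₁ d₂ → ℕ)
    (hside : ∀ t, 0 < side t) {β : ℝ} (hβ : 0 ≤ β) {L : ℕ} {Q K : ℝ≥0∞}
    (hQ : ∑' b : {b : EdgeType d₁ d₂ → ℤ // hor b = L}, cellMoment p side β b ≤ Q)
    (hK : ∀ b : EdgeType d₁ d₂ → ℤ, hor b ≤ L → cellMoment p side β b ≤ K)
    (E : Finset (Edge (EdgeType d₁ d₂))) (y : EdgeType d₁ d₂ → ℤ) (m : ℕ)
    (c : EdgeType d₁ d₂ → ℤ) (h1 : hor c + m * L ≤ hor (cellOf side y))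
    (h2 : hor (cellOf side y) ≤ hor c + (m + 1) * L) :
    ∫⁻ S, restWeight side β y c (S ∩ E) ∂bernoulliSet (Edge (EdgeType d₁ d₂)) p ≤ Q ^ m * K := by
  induction m generalizing c with
  | zero =>
    rw [pow_zero, one_mul]
    refine (lintegral_mono fun S => restWeight_le side hside hβ y c _).trans ?_
    refine (lintegral_cellWeight_le p side hβ c _ E).trans (hK _ ?_)
    rw [hor_sub]
    push_cast at h2
    linarith
  | succ m ih =>
    have hL : (0 : ℤ) ≤ m * L := by positivity
    push_cast at h1 h2
    refine (lintegral_mono fun S => restWeight_le_tsum side hside hβ (L := L)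
      (by linarith) _).trans ?_
    rw [lintegral_tsum fun b => (measurable_finite_restrict E _).aemeasurable]
    have hb : ∀ b : {b : EdgeType d₁ d₂ → ℤ // hor b = L},
        ∫⁻ S, disjointProd (cellWeight side β c b) (restWeight side β y (c + b)) (S ∩ E)
          ∂bernoulliSet (Edge (EdgeType d₁ d₂)) p ≤ cellMoment p side β b * (Q ^ m * K) := by
      intro b
      -- The piece up to the cut and the rest of the path use disjoint free edges, so the mean of
      -- their product is at most the product of the means.
      refine (lintegral_disjointProd_le hp E (cellWeight_mono side hβ c b)
        (restWeight_mono side hβ y (c + b))).trans ?_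
      refine mul_le_mul' (lintegral_cellWeight_le p side hβ c b E) (ih (c + b) ?_ ?_)
      · rw [hor_add, b.2]; linarith
      · rw [hor_add, b.2]; linarith
    refine (ENNReal.tsum_le_tsum hb).trans ?_
    rw [ENNReal.tsum_mul_right, pow_succ', mul_assoc]
    exact mul_le_mul_left hQ _

/-- Each passage time is attained with finitely many free edges, so monotone convergence along
finite sets of edges removes the restriction in `lintegral_restWeight_le`. -/
theorem lintegral_exp_savings_le_pow {p : I} (hp : (p : ℝ) ≤ 1 / 2) (side : EdgeType d₁ d₂ → ℕ)
    (hside : ∀ t, 0 < side t) {β : ℝ} (hβ : 0 ≤ β) {L : ℕ} {Q K : ℝ≥0∞}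
    (hQ : ∑' b : {b : EdgeType d₁ d₂ → ℤ // hor b = L}, cellMoment p side β b ≤ Q)
    (hK : ∀ b : EdgeType d₁ d₂ → ℤ, hor b ≤ L → cellMoment p side β b ≤ K)
    (y : EdgeType d₁ d₂ → ℤ) (m : ℕ) (h1 : m * L ≤ hor (cellOf side y))
    (h2 : hor (cellOf side y) ≤ (m + 1) * L) :
    ∫⁻ S, ENNReal.ofReal (Real.exp (β * ((hor y : ℝ) - ptime S 0 y)))
      ∂bernoulliSet (Edge (EdgeType d₁ d₂)) p ≤ Q ^ m * K := by
  set F : Finset (Edge (EdgeType d₁ d₂)) → Set (Edge (EdgeType d₁ d₂)) → ℝ≥0∞ := fun E S =>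
    ENNReal.ofReal (Real.exp (β * ((hor y : ℝ) - ptime (S ∩ E) 0 y))) with hF
  have hFm : ∀ {E E' : Finset (Edge (EdgeType d₁ d₂))}, E ⊆ E' → F E ≤ F E' := by
    intro E E' h S
    refine ENNReal.ofReal_le_ofReal (Real.exp_le_exp.2 (mul_le_mul_of_nonneg_left ?_ hβ))
    have : (ptime (S ∩ E') 0 y : ℝ) ≤ ptime (S ∩ E) 0 y := by
      exact_mod_cast ptime_anti (Set.inter_subset_inter_right S (by exact_mod_cast h)) _ _
    linarith
  have hsup : ∀ S : Set (Edge (EdgeType d₁ d₂)),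
      ENNReal.ofReal (Real.exp (β * ((hor y : ℝ) - ptime S 0 y))) ≤ ⨆ E, F E S := by
    intro S
    obtain ⟨E, hE⟩ := exists_finset_ptime_inter S 0 y
    refine le_iSup_of_le E ?_
    rw [hF]
    simp only
    rw [hE E le_rfl]
  refine (lintegral_mono hsup).trans ?_
  rw [lintegral_iSup_directed (f := F) (fun E => (measurable_finite_restrict E fun S =>
    ENNReal.ofReal (Real.exp (β * ((hor y : ℝ) - ptime S 0 y)))).aemeasurable)]
  · refine iSup_le fun E => le_trans (lintegral_mono fun S => ?_)
      (lintegral_restWeight_le hp side hside hβ hQ hK E y m 0 (by simpa [hor] using h1)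
        (by simpa [hor] using h2))
    refine le_iSup₂_of_le 0 (by ext t; simp [cellOf]) ?_
    rw [sub_zero]
  · classical
    intro E E'
    exact ⟨E ∪ E', hFm Finset.subset_union_left, hFm Finset.subset_union_right⟩

end Skeleton

/-! ### Deviations of the savings between two cells -/

section Reflection

variable {d₁ d₂ : ℕ}

/-- The vertex with given horizontal and vertical coordinates. -/
def target (N : Fin d₁ → ℕ) (v : Fin d₂ → ℤ) : EdgeType d₁ d₂ → ℤ :=
  Sum.elim (fun i => (N i : ℤ)) v

lemma hor_target (N : Fin d₁ → ℕ) (v : Fin d₂ → ℤ) : hor (target N v) = ∑ i, (N i : ℤ) := by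
  simp [hor, target]

/-- Up to rare events, optimal paths stay in a slightly larger slab. -/
lemma measure_savings_gt_le {p : I} {θ : Fin d₁ → ℝ} (h0 : ∀ i, 0 < θ i)
    (h1 : ∀ i, θ i ≤ 1 / 2) (hs : stepBound d₂ p θ ≤ 1 / 4) (N : Fin d₁ → ℕ) (v : Fin d₂ → ℤ)
    (A : ℕ) {t : ℝ} (ht : 0 ≤ t) :
    bernoulliSet (Edge (EdgeType d₁ d₂)) p
      {S | t < (hor (target N v) : ℝ) - ptime S 0 (target N v)} ≤
    bernoulliSet (Edge (EdgeType d₁ d₂)) p {S | t < (hor (target (fun i => N i + A) v) : ℝ) -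
      ptime (S ∩ slab 0 fun i => N i + A) 0 (target (fun i => N i + A) v)} +
    ENNReal.ofReal (2 * (∑ i, θ i) * Real.exp (tilt θ (target N v))) +
    ENNReal.ofReal (2 * Real.exp (tilt θ (target N v) - A)) := by
  have hd := measure_defect_le (d₂ := d₂) h0 h1 hs 0 (target N v)
  have ho := measure_overshoot_le (d₂ := d₂) h0 h1 hs 0 (target N v) A
  rw [sub_zero] at hd ho
  refine le_trans ?_ (add_le_add (add_le_add_right hd _) ho)
  refine le_trans (measure_mono ?_) ((measure_union_le _ _).trans
    (add_le_add_left (measure_union_le _ _) _))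
  intro S hS
  obtain ⟨l, hl, hn, h⟩ := exists_nodup_jumpCost_eq_ptime S 0 (target N v)
  have hS' : t < (hor (target N v) : ℝ) - ptime S 0 (target N v) := hS
  rw [← h] at hS'
  have hcost : (jumpCost 0 l (target N v) : ℝ) ≤ hor (target N v) := by linarith
  by_cases hdef : HasDefect 0 l
  · exact Or.inl (Or.inr ⟨l, ⟨hn, hl⟩, hdef, hcost⟩)
  by_cases hov : ∃ i, ((target N v (Sum.inl i) : ℤ) : ℝ) + A ≤ lastVertex 0 l (Sum.inl i)
  · exact Or.inr ⟨l, ⟨hn, hl⟩, hov, hcost⟩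
  refine Or.inl (Or.inl ?_)
  push Not at hov
  obtain ⟨hb, _, _⟩ := increasing_of_not_hasDefect l 0 hdef
  have hl' : ∀ e ∈ l, e.1 ∈ S ∩ slab 0 fun i => N i + A := by
    intro e he
    refine ⟨hl e he, fun i => ?_⟩
    have h2 := hb e he i
    have h3 := hov i
    simp only [target, Sum.elim_inl, Int.cast_natCast] at h3
    have h3 : lastVertex 0 l (Sum.inl i) < N i + A := by exact_mod_cast h3
    simp only [Pi.zero_apply] at h2 ⊢
    push_cast
    omega
  have h4 := ptime_le (x := 0) (y := target N v) hl'
  have h5 := ptime_triangle (S ∩ slab 0 fun i => N i + A) 0 (target N v)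
    (target (fun i => N i + A) v)
  have h6 := ptime_le_l1 (S ∩ slab 0 fun i => N i + A) (target N v)
    (target (fun i => N i + A) v)
  have h7 := l1_of_nonneg (x := (target (fun i => N i + A) v - target N v : EdgeType d₁ d₂ → ℤ))
    (fun i => by simp [target])
  have h8 : verPart (target (fun i => N i + A) v - target N v : EdgeType d₁ d₂ → ℤ) = 0 := by
    ext j; simp [verPart, target]
  rw [h8, l1_zero, hor_sub] at h7
  change t < _
  refine hS'.trans_le ?_
  have h9 : (hor (target N v) : ℤ) - jumpCost 0 l (target N v) ≤
      hor (target (fun i => N i + A) v) -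
      ptime (S ∩ slab 0 fun i => N i + A) 0 (target (fun i => N i + A) v) := by omega
  exact_mod_cast h9

/-- An optimal trail with positive savings has a defect, or overshoots by `A`, or is increasing in
the enlarged box, in which case `savings_le_dscore` applies. -/
lemma measure_savings_gt_le_dscore {p : I} {θ : Fin d₁ → ℝ} (h0 : ∀ i, 0 < θ i)
    (h1 : ∀ i, θ i ≤ 1 / 2) (hs : stepBound d₂ p θ ≤ 1 / 4) (N : Fin d₁ → ℕ)
    (A : ℕ) {t : ℝ} (ht : 0 ≤ t) :
    bernoulliSet (Edge (EdgeType d₁ d₂)) p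
      {S | t < (hor (target N 0 : EdgeType d₁ d₂ → ℤ) : ℝ) - ptime S 0 (target N 0)} ≤
    bernoulliSet (Edge (EdgeType d₁ d₂)) p {S | ENNReal.ofReal t < dscore S fun i => N i + A} +
    ENNReal.ofReal (2 * (∑ i, θ i) * Real.exp (tilt θ (target N 0 : EdgeType d₁ d₂ → ℤ))) +
    ENNReal.ofReal (2 * Real.exp (tilt θ (target N 0 : EdgeType d₁ d₂ → ℤ) - A)) := by
  have hd := measure_defect_le (d₂ := d₂) h0 h1 hs 0 (target N 0)
  have ho := measure_overshoot_le (d₂ := d₂) h0 h1 hs 0 (target N 0) A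
  rw [sub_zero] at hd ho
  refine le_trans ?_ (add_le_add (add_le_add_right hd _) ho)
  refine le_trans (measure_mono ?_) ((measure_union_le _ _).trans
    (add_le_add_left (measure_union_le _ _) _))
  intro S hS
  obtain ⟨l, hl, hn, h⟩ := exists_nodup_jumpCost_eq_ptime S 0 (target N 0)
  have hS' : t < (hor (target N 0 : EdgeType d₁ d₂ → ℤ) : ℝ) - ptime S 0 (target N 0) := hS
  rw [← h] at hS'
  have hcost : (jumpCost 0 l (target N 0) : ℝ) ≤ hor (target N 0 : EdgeType d₁ d₂ → ℤ) := by
    linarith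
  by_cases hdef : HasDefect 0 l
  · exact Or.inl (Or.inr ⟨l, ⟨hn, hl⟩, hdef, hcost⟩)
  by_cases hov : ∃ i, ((target N 0 (Sum.inl i : EdgeType d₁ d₂) : ℤ) : ℝ) + A ≤
      lastVertex 0 l (Sum.inl i)
  · exact Or.inr ⟨l, ⟨hn, hl⟩, hov, hcost⟩
  refine Or.inl (Or.inl ?_)
  push Not at hov
  refine lt_of_lt_of_le ((ENNReal.ofReal_lt_ofReal_iff_of_nonneg ht).2 hS')
    (savings_le_dscore (by ext j; simp [verPart, target]) hl hdef fun i => ?_)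
  have h3 := hov i
  simp only [target, Sum.elim_inl, Int.cast_natCast] at h3
  exact_mod_cast h3

/-- Reflection of the horizontal coordinates. -/
def reflect (N : Fin d₁ → ℕ) (x : EdgeType d₁ d₂ → ℤ) : EdgeType d₁ d₂ → ℤ :=
  Sum.elim (fun i => 2 * N i - x (Sum.inl i)) fun j => x (Sum.inr j)

/-- Reflection of the horizontal coordinates of an edge. -/
def reflectEdge (N : Fin d₁ → ℕ) (e : Edge (EdgeType d₁ d₂)) : Edge (EdgeType d₁ d₂) :=
  (Sum.elim (fun i => 2 * N i - e.1 (Sum.inl i) - if e.2 = Sum.inl i then 1 else 0)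
    fun j => e.1 (Sum.inr j), e.2)

lemma reflectEdge_involutive (N : Fin d₁ → ℕ) :
    Function.Involutive (reflectEdge N : Edge (EdgeType d₁ d₂) → _) := by
  rintro ⟨x, t⟩
  refine Prod.ext ?_ rfl
  ext (i | j)
  · by_cases h : t = Sum.inl i
    · simp [reflectEdge, h]; ring
    · simp [reflectEdge, h]
  · rfl

/-- Reflection exchanges the ends of a horizontal edge, which explains the shift by one in
`reflectEdge` and the reversed orientation; vertical edges keep theirs. -/
lemma reflect_edge (N : Fin d₁ → ℕ) (e : OEdge (EdgeType d₁ d₂)) :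
    ∃ e' : OEdge (EdgeType d₁ d₂), e'.1 = reflectEdge N e.1 ∧ e'.src = reflect N e.src ∧
      e'.tgt = reflect N e.tgt := by
  obtain ⟨⟨x, i | j⟩, o⟩ := e
  · have e1 : (reflectEdge N (x, Sum.inl i) : Edge (EdgeType d₁ d₂)).1 =
        reflect N (x + Pi.single (Sum.inl i) 1) := by
      ext (k | k)
      · by_cases h : k = i
        · subst h; simp [reflectEdge, reflect]; ring
        · have h' : i ≠ k := fun h2 => h h2.symm
          simp [reflectEdge, reflect, h']
      · simp [reflectEdge, reflect]
    have e2 : (reflectEdge N (x, Sum.inl i) : Edge (EdgeType d₁ d₂)).1 +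
        Pi.single (Sum.inl i) 1 = reflect N x := by
      ext (k | k)
      · by_cases h : k = i
        · subst h; simp [reflectEdge, reflect]
        · have h' : i ≠ k := fun h2 => h h2.symm
          simp [reflectEdge, reflect, h']
      · simp [reflectEdge, reflect]
    refine ⟨(reflectEdge N (x, Sum.inl i), !o), rfl, ?_, ?_⟩
    · cases o
      · exact e1
      · exact e2
    · cases o
      · exact e2
      · exact e1
  · have e1 : (reflectEdge N (x, Sum.inr j) : Edge (EdgeType d₁ d₂)).1 = reflect N x := by
      ext (k | k) <;> simp [reflectEdge, reflect]
    have e2 : (reflectEdge N (x, Sum.inr j) : Edge (EdgeType d₁ d₂)).1 +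
        Pi.single (Sum.inr j) 1 = reflect N (x + Pi.single (Sum.inr j) 1) := by
      rw [e1]
      ext (k | k)
      · simp [reflect]
      · by_cases h : k = j
        · subst h; simp [reflect]
        · simp [reflect, Pi.single_eq_of_ne
            (show (Sum.inr k : EdgeType d₁ d₂) ≠ Sum.inr j by simpa using h)]
    refine ⟨(reflectEdge N (x, Sum.inr j), o), rfl, ?_, ?_⟩
    · cases o
      · exact e2
      · exact e1
    · cases o
      · exact e1
      · exact e2

lemma ptime_reflect_le (N : Fin d₁ → ℕ) (S : Set (Edge (EdgeType d₁ d₂)))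
    (x y : EdgeType d₁ d₂ → ℤ) :
    ptime S (reflect N x) (reflect N y) ≤ ptime (reflectEdge N ⁻¹' S) x y := by
  refine ptime_map_le (reflect N) (fun x y => le_of_eq ?_) (fun e he => ?_) x y
  · rw [l1, l1]
    refine Finset.sum_congr rfl fun t _ => ?_
    rcases t with i | j <;> simp only [reflect, Pi.sub_apply, Sum.elim_inl, Sum.elim_inr]
    omega
  · obtain ⟨e', h1, h2⟩ := reflect_edge N e
    exact ⟨e', by rw [h1]; exact he, h2⟩

/-- Reflection trick: savings with a vertical displacement are controlled by savings without
vertical displacement. -/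
lemma measure_slab_savings_sq_le (hd : 1 ≤ d₁) (p : I) (N : Fin d₁ → ℕ) (v : Fin d₂ → ℤ) (t : ℝ) :
    bernoulliSet (Edge (EdgeType d₁ d₂)) p
      {S | t < (hor (target N v) : ℝ) - ptime (S ∩ slab 0 N) 0 (target N v)} ^ 2 ≤
    bernoulliSet (Edge (EdgeType d₁ d₂)) p
      {S | 2 * t < (hor (target (fun i => 2 * N i) 0 : EdgeType d₁ d₂ → ℤ) : ℝ) -
        ptime S 0 (target (fun i => 2 * N i) 0)} := by
  set Q := bernoulliSet (Edge (EdgeType d₁ d₂)) p with hQ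
  set G : Set (Set (Edge (EdgeType d₁ d₂))) :=
    {S | t < (hor (target N v) : ℝ) - ptime S 0 (target N v)} with hG
  have hGm : MeasurableSet G := by
    have := measurable_ptime_real (ι := EdgeType d₁ d₂) 0 (target N v)
    exact measurableSet_lt measurable_const (measurable_const.sub this)
  set f : Set (Edge (EdgeType d₁ d₂)) → ℝ≥0∞ := fun S => G.indicator 1 (S ∩ slab 0 N) with hf
  have hfm : Measurable f := (measurable_one.indicator hGm).comp (measurable_inter_set _)
  set B : Set (Edge (EdgeType d₁ d₂)) := reflectEdge N ⁻¹' slab 0 N with hB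
  -- The mirror image of the slab lies beyond `N`, hence the two halves are independent.
  have hdisj : Disjoint (slab 0 N) B := by
    rw [Set.disjoint_left]
    intro e h1 h2
    have h1 := h1 ⟨0, hd⟩
    have h2 := h2 ⟨0, hd⟩
    simp only [reflectEdge, Pi.zero_apply, Sum.elim_inl] at h1 h2
    split_ifs at h2 <;> omega
  set ρ : Set (Edge (EdgeType d₁ d₂)) → Set (Edge (EdgeType d₁ d₂)) :=
    fun S => reflectEdge N ⁻¹' S with hρ
  have hinj := (reflectEdge_involutive (d₂ := d₂) N).injective
  have hρm : Measurable ρ := measurable_preimage_set _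
  have key := lintegral_mul_bernoulliSet p hdisj hfm (hfm.comp hρm)
  have e1 : ∀ S, f (S ∩ slab 0 N) = f S := fun S => by
    simp only [hf, Set.inter_assoc, Set.inter_self]
  have e2 : ∀ S, (f ∘ ρ) (S ∩ B) = f (ρ S) := fun S => by
    have : ρ (S ∩ B) = ρ S ∩ slab 0 N := by
      ext e
      simp only [hρ, hB, Set.mem_preimage, Set.mem_inter_iff, reflectEdge_involutive N e]
    simp only [Function.comp_apply, this, e1]
  simp only [e1, e2] at key
  have e4 : ∫⁻ S, f (ρ S) ∂Q = ∫⁻ S, f S ∂Q := lintegral_preimage_bernoulliSet p hinj hfm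
  have hP : ∫⁻ S, f S ∂Q =
      Q {S | t < (hor (target N v) : ℝ) - ptime (S ∩ slab 0 N) 0 (target N v)} := by
    have hm : MeasurableSet {S : Set (Edge (EdgeType d₁ d₂)) |
        t < (hor (target N v) : ℝ) - ptime (S ∩ slab 0 N) 0 (target N v)} :=
      (measurable_inter_set (slab 0 N)) hGm
    rw [← lintegral_indicator_one hm]
    rfl
  rw [← hQ, e4, hP] at key
  rw [pow_two, ← key]
  have hm2 : MeasurableSet {S : Set (Edge (EdgeType d₁ d₂)) |
      2 * t < (hor (target (fun i => 2 * N i) 0 : EdgeType d₁ d₂ → ℤ) : ℝ) -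
        ptime S 0 (target (fun i => 2 * N i) 0)} := by
    have := measurable_ptime_real (ι := EdgeType d₁ d₂) 0 (target (fun i => 2 * N i) 0)
    exact measurableSet_lt measurable_const (measurable_const.sub this)
  rw [← lintegral_indicator_one hm2]
  refine lintegral_mono fun S => ?_
  by_cases h1 : S ∩ slab 0 N ∈ G
  swap
  · simp [hf, Set.indicator_of_notMem h1]
  by_cases h2 : ρ S ∩ slab 0 N ∈ G
  swap
  · simp [hf, Set.indicator_of_notMem h2]
  simp only [hf]
  rw [Set.indicator_of_mem h1, Set.indicator_of_mem h2, Set.indicator_of_mem]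
  · simp
  change 2 * t < _
  have h1 : t < (hor (target N v) : ℝ) - ptime (S ∩ slab 0 N) 0 (target N v) := h1
  have h2 : t < (hor (target N v) : ℝ) - ptime (ρ S ∩ slab 0 N) 0 (target N v) := h2
  have h3 := ptime_triangle S 0 (target N v) (target (fun i => 2 * N i) 0)
  have h4 := ptime_anti (S := S ∩ slab 0 N) Set.inter_subset_left 0 (target N v)
  have h5 := ptime_anti (S := ρ S ∩ slab 0 N) Set.inter_subset_left 0 (target N v)
  have h6 := ptime_reflect_le N S 0 (target N v)
  have r1 : reflect N (0 : EdgeType d₁ d₂ → ℤ) = target (fun i => 2 * N i) 0 := by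
    ext (i | j) <;> simp [reflect, target]
  have r2 : reflect N (target N v) = target N v := by
    ext (i | j) <;> simp [reflect, target]
    ring
  rw [r1, r2, ptime_symm] at h6
  have h7 : hor (target (fun i => 2 * N i) 0 : EdgeType d₁ d₂ → ℤ) = 2 * hor (target N v) := by
    rw [hor_target, hor_target, Finset.mul_sum]
    push_cast
    rfl
  -- Go to `target N v`, then follow backwards the mirror image of a path ending at the same vertex:
  -- the vertical displacement cancels and the savings add up.
  have h8 : (ptime S 0 (target (fun i => 2 * N i) 0 : EdgeType d₁ d₂ → ℤ) : ℝ) ≤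
      ptime (S ∩ slab 0 N) 0 (target N v) + ptime (ρ S ∩ slab 0 N) 0 (target N v) := by
    exact_mod_cast h3.trans (add_le_add h4 (h6.trans h5))
  rw [h7]
  push_cast
  linarith

end Reflection

/-! ### Tail of the savings between cells -/

section CellSavings

variable {d₁ d₂ : ℕ}

/-- Arithmetic-geometric inequality: among displacements with a given number of levels `D`, diagonal
ones have the largest volume, hence the largest score. -/
lemma prod_le_mean_pow (hd : 1 ≤ d₁) (s : Fin d₁ → ℕ) {D : ℕ} (hD : ∑ i, s i = D) :
    ∏ i, (s i : ℝ) ≤ ((D : ℝ) / d₁) ^ d₁ := by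
  have h := Real.geom_mean_le_arith_mean Finset.univ (fun _ : Fin d₁ => (1 : ℝ))
    (fun i => (s i : ℝ)) (fun _ _ => zero_le_one) (by
      simp only [Finset.sum_const, Finset.card_univ, Fintype.card_fin, nsmul_eq_mul, mul_one]
      exact_mod_cast hd) (fun i _ => Nat.cast_nonneg _)
  simp only [Real.rpow_one, Finset.sum_const, Finset.card_univ, Fintype.card_fin, nsmul_eq_mul,
    mul_one, one_mul] at h
  rw [← Nat.cast_sum, hD] at h
  have hp : (0 : ℝ) ≤ ∏ i, (s i : ℝ) := Finset.prod_nonneg fun i _ => Nat.cast_nonneg _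
  have h2 := pow_le_pow_left₀ (Real.rpow_nonneg hp _) h d₁
  rwa [← Real.rpow_natCast, ← Real.rpow_mul hp, inv_mul_cancel₀ (by
    have : (0 : ℝ) < d₁ := by exact_mod_cast hd
    exact this.ne'), Real.rpow_one] at h2

/-- The savings between two cells rarely exceed the value predicted by the directional score. -/
theorem measure_cell_savings_gt_le (hd : 1 ≤ d₁) {η δ : ℝ} (hη : 0 < η) (hδ : 0 < δ) :
    ∃ k₀ > 0, ∀ k : ℝ, k₀ ≤ k → ∀ D : ℕ, ∃ ℓ₀ : ℝ, ∀ ℓ : Fin d₁ → ℕ, (∀ i, ℓ₀ ≤ ℓ i) →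
      ∀ a : ℝ, 0 ≤ a → (∏ i, ℓ i : ℕ) * a ≤ k ^ d₁ → ∀ s : Fin d₁ → ℕ, (∀ i, 1 ≤ s i) →
      ∑ i, s i = D → ∀ v : Fin d₂ → ℤ,
      bernoulliSet (Edge (EdgeType d₁ d₂)) (cellProb a)
        {S | (scoreConst d₁ d₂ + η) * (k * D / d₁) <
          (hor (target (fun i => ℓ i * s i) v) : ℝ) - ptime S 0 (target (fun i => ℓ i * s i) v)} ≤
      ENNReal.ofReal δ := by
  set c := scoreConst d₁ d₂ with hc
  have hc0 : 0 < c := scoreConst_pos hd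
  set K := crudeConst d₁ d₂ with hK
  have hK0 : 48 ≤ K := crudeConst_ge hd
  have hd0 : (0 : ℝ) < d₁ := by exact_mod_cast hd
  set δ' := min δ 1 with hδ'
  have hδ0 : 0 < δ' := lt_min hδ one_pos
  have hδ1 : δ' ≤ 1 := min_le_right _ _
  -- Chosen so that `(c + η / 2) * (1 + τ) = c + η`; the factor `1 + τ` absorbs the enlargement of
  -- the box by `A`.
  set τ := (η / 2) / (c + η / 2) with hτ
  have hτ0 : 0 < τ := by positivity
  obtain ⟨L, hL0, hL⟩ := measure_dscore_gt_le (d₁ := d₁) (d₂ := d₂) hd (η := η / 2)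
    (δ := δ' ^ 2 / 8) (by positivity) (by positivity)
  refine ⟨L, hL0, fun k hk D => ?_⟩
  have hk0 : 0 < k := hL0.trans_le hk
  set T := 2 * K * k * D + 2 with hT
  -- `T` bounds the tilts of the simple and of the doubled box; `A` makes overshooting by `A`
  -- improbable.
  obtain ⟨A, hA⟩ := exists_nat_ge (T + Real.log (32 / δ' ^ 2))
  have hAexp : 2 * Real.exp (T - A) ≤ δ' ^ 2 / 16 := by
    have h1 : Real.exp (T - A) ≤ Real.exp (- Real.log (32 / δ' ^ 2)) :=
      Real.exp_le_exp.2 (by linarith)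
    rw [Real.exp_neg, Real.exp_log (by positivity), inv_div] at h1
    linarith
  -- A bound for the total tilt, reached for large sides `ℓ`: small enough to make defects
  -- improbable and to keep the tilt of the enlarged doubled box below `T`.
  set θ₀ := min (1 / ((A : ℝ) + 1)) (δ' ^ 2 / (32 * Real.exp T)) with hθ₀
  have hθ0 : 0 < θ₀ := lt_min (by positivity) (by positivity)
  have hθA : A * θ₀ ≤ 1 := by
    have h1 : θ₀ ≤ 1 / ((A : ℝ) + 1) := min_le_left _ _
    calc A * θ₀ ≤ A * (1 / ((A : ℝ) + 1)) := mul_le_mul_of_nonneg_left h1 (Nat.cast_nonneg A)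
      _ ≤ 1 := by rw [mul_one_div, div_le_one (by positivity)]; linarith
  have hθT : 2 * θ₀ * Real.exp T ≤ δ' ^ 2 / 16 := by
    have h1 : θ₀ ≤ δ' ^ 2 / (32 * Real.exp T) := min_le_right _ _
    rw [le_div_iff₀ (by positivity)] at h1
    linarith
  refine ⟨max 1 (max (2 * K * k) (max (d₁ * K * k / θ₀) (3 * A / (2 * τ)))), ?_⟩
  intro ℓ hℓ a ha hvol s hs hD v
  have hℓ1 : ∀ i, (1 : ℝ) ≤ ℓ i := fun i => (le_max_left _ _).trans (hℓ i)
  have hℓ2 : ∀ i, 2 * K * k ≤ ℓ i := fun i =>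
    ((le_max_left _ _).trans (le_max_right _ _)).trans (hℓ i)
  have hℓ3 : ∀ i, d₁ * K * k / θ₀ ≤ ℓ i := fun i =>
    (((le_max_left _ _).trans (le_max_right _ _)).trans (le_max_right _ _)).trans (hℓ i)
  have hℓ4 : ∀ i, 3 * A / (2 * τ) ≤ ℓ i := fun i =>
    (((le_max_right _ _).trans (le_max_right _ _)).trans (le_max_right _ _)).trans (hℓ i)
  have hℓ0 : ∀ i, (0 : ℝ) < ℓ i := fun i => zero_lt_one.trans_le (hℓ1 i)
  have hs1 : ∀ i, (1 : ℝ) ≤ s i := fun i => by exact_mod_cast hs i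
  set θ : Fin d₁ → ℝ := fun i => K * (k / ℓ i) with hθ
  have hr0 : ∀ i, 0 < k / ℓ i := fun i => div_pos hk0 (hℓ0 i)
  have hθpos : ∀ i, 0 < θ i := fun i => mul_pos (by linarith) (hr0 i)
  have hθhalf : ∀ i, θ i ≤ 1 / 2 := fun i => by
    simp only [hθ]
    rw [mul_div_assoc', div_le_iff₀ (hℓ0 i)]
    have := hℓ2 i
    linarith
  have hθsum : ∑ i, θ i ≤ θ₀ := by
    calc ∑ i, θ i ≤ ∑ _i : Fin d₁, θ₀ / d₁ := Finset.sum_le_sum fun i _ => by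
          simp only [hθ]
          rw [mul_div_assoc', div_le_div_iff₀ (hℓ0 i) hd0]
          have := hℓ3 i
          rw [div_le_iff₀ hθ0] at this
          linarith
      _ = θ₀ := by simp; field_simp
  have hθsum0 : 0 ≤ ∑ i, θ i := Finset.sum_nonneg fun i _ => (hθpos i).le
  have hstep : stepBound d₂ (cellProb a) θ ≤ 1 / 4 := by
    refine stepBound_le hd hr0 (cellProb a).2.1 ((cellProb_le ha).trans ?_)
    rw [Finset.prod_div_distrib, Finset.prod_const, Finset.card_univ, Fintype.card_fin,
      le_div_iff₀ (Finset.prod_pos fun i _ => hℓ0 i), mul_comm]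
    exact_mod_cast hvol
  set N : Fin d₁ → ℕ := fun i => ℓ i * s i with hN
  set t := (c + η) * (k * D / d₁) with ht
  have ht0 : 0 ≤ t := by positivity
  have hlN : ∀ i, θ i * N i = K * k * s i := fun i => by
    simp only [hθ, hN]
    push_cast
    have := (hℓ0 i).ne'
    field_simp
  have hsumD : ∑ i, (s i : ℝ) = D := by exact_mod_cast hD
  have htilt1 : tilt θ (target N v) ≤ T := by
    have : tilt θ (target N v) = K * k * D := by
      simp only [tilt, target, Sum.elim_inl, Int.cast_natCast, hlN]
      rw [← Finset.mul_sum, hsumD]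
    rw [this, hT]
    have : 0 ≤ K * k * D := by positivity
    linarith
  have htilt2 : tilt θ (target (fun i => 2 * (N i + A)) 0 : EdgeType d₁ d₂ → ℤ) ≤ T := by
    have : tilt θ (target (fun i => 2 * (N i + A)) 0 : EdgeType d₁ d₂ → ℤ) =
        2 * (K * k * D) + 2 * (A * ∑ i, θ i) := by
      simp only [tilt, target, Sum.elim_inl, Int.cast_natCast]
      push_cast
      rw [← hsumD, Finset.mul_sum, Finset.mul_sum, Finset.mul_sum, Finset.mul_sum,
        ← Finset.sum_add_distrib]
      refine Finset.sum_congr rfl fun i _ => ?_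
      rw [← hlN]
      ring
    rw [this, hT]
    have : A * ∑ i, θ i ≤ 1 := (mul_le_mul_of_nonneg_left hθsum (Nat.cast_nonneg A)).trans hθA
    linarith
  have herr : ∀ x : ℝ, x ≤ T → 2 * (∑ i, θ i) * Real.exp x ≤ δ' ^ 2 / 16 := fun x hx => by
    refine le_trans ?_ hθT
    gcongr
  have herr' : ∀ x : ℝ, x ≤ T → 2 * Real.exp (x - A) ≤ δ' ^ 2 / 16 := fun x hx => by
    refine le_trans ?_ hAexp
    gcongr
  have h1 := measure_savings_gt_le (d₂ := d₂) hθpos hθhalf hstep N v A ht0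
  -- Reflecting doubles the box and the level `t`, and bounds the square of the probability.
  have h2 := measure_slab_savings_sq_le (d₂ := d₂) hd (cellProb a) (fun i => N i + A) v t
  have h3 := measure_savings_gt_le_dscore (d₂ := d₂) hθpos hθhalf hstep
    (fun i => 2 * (N i + A)) A (t := 2 * t) (by positivity)
  have h4 : bernoulliSet (Edge (EdgeType d₁ d₂)) (cellProb a)
      {S | ENNReal.ofReal (2 * t) < dscore S fun i => 2 * (N i + A) + A} ≤
      ENNReal.ofReal (δ' ^ 2 / 8) := by
    have hDd : (d₁ : ℝ) ≤ D := by
      rw [← hsumD]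
      calc (d₁ : ℝ) = ∑ _i : Fin d₁, (1 : ℝ) := by simp
        _ ≤ _ := Finset.sum_le_sum fun i _ => hs1 i
    have hlam : (c + η / 2) * (2 * (1 + τ) * (k * (D / d₁))) = 2 * t := by
      have : (c + η / 2) * (1 + τ) = c + η := by
        rw [hτ]; field_simp; ring
      rw [ht, ← this]; ring
    have h5 := hL (fun i => 2 * (N i + A) + A) (fun i => by
      have : 0 < ℓ i := by exact_mod_cast hℓ0 i
      have := hs i
      simp only [hN]; positivity) a ha
      (2 * (1 + τ) * (k * (D / d₁))) (by
        have : 1 ≤ (D : ℝ) / d₁ := (one_le_div hd0).2 hDd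
        have : k ≤ k * (D / d₁) := le_mul_of_one_le_right hk0.le this
        have : k * (D / d₁) ≤ 2 * (1 + τ) * (k * (D / d₁)) :=
          le_mul_of_one_le_left (by positivity) (by linarith)
        linarith) (by
        push_cast
        calc (∏ i, (2 * ((N i : ℝ) + A) + A)) * a
            ≤ (∏ i, (2 * (1 + τ) * ((ℓ i : ℝ) * s i))) * a := by
              refine mul_le_mul_of_nonneg_right (Finset.prod_le_prod (fun i _ => by positivity)
                fun i _ => ?_) ha
              have h6 := hℓ4 i
              rw [div_le_iff₀ (by positivity)] at h6
              have h7 : (ℓ i : ℝ) ≤ ℓ i * s i := le_mul_of_one_le_right (hℓ0 i).le (hs1 i)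
              have h8 : (ℓ i : ℝ) * (2 * τ) ≤ ℓ i * s i * (2 * τ) :=
                mul_le_mul_of_nonneg_right h7 (by positivity)
              simp only [hN]
              push_cast
              nlinarith
          _ = (2 * (1 + τ)) ^ d₁ * (((∏ i, ℓ i : ℕ) : ℝ) * a) * ∏ i, (s i : ℝ) := by
              rw [Finset.prod_mul_distrib (f := fun _ => 2 * (1 + τ)), Finset.prod_const,
                Finset.card_univ, Fintype.card_fin, Finset.prod_mul_distrib]
              push_cast
              ring
          _ ≤ (2 * (1 + τ)) ^ d₁ * k ^ d₁ * ((D : ℝ) / d₁) ^ d₁ := by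
              refine mul_le_mul (mul_le_mul_of_nonneg_left hvol (by positivity))
                (prod_le_mean_pow hd s hD) (Finset.prod_nonneg fun i _ => Nat.cast_nonneg _)
                (by positivity)
          _ = _ := by rw [mul_pow (2 * (1 + τ)), mul_pow k]; ring)
    rwa [hlam] at h5
  have e4 : ENNReal.ofReal (δ' ^ 2 / 4) = ENNReal.ofReal (δ' ^ 2 / 8) +
      ENNReal.ofReal (δ' ^ 2 / 16) + ENNReal.ofReal (δ' ^ 2 / 16) := by
    rw [← ENNReal.ofReal_add (by positivity) (by positivity),
      ← ENNReal.ofReal_add (by positivity) (by positivity)]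
    congr 1; ring
  have h6 := (h2.trans h3).trans (add_le_add (add_le_add h4
    (ENNReal.ofReal_le_ofReal (herr _ htilt2))) (ENNReal.ofReal_le_ofReal (herr' _ htilt2)))
  rw [← e4] at h6
  -- All errors were taken of order `δ' ^ 2` because reflection controls only a square.
  have e5 : ENNReal.ofReal (δ' ^ 2 / 4) = ENNReal.ofReal (δ' / 2) ^ 2 := by
    rw [← ENNReal.ofReal_pow (by positivity)]
    congr 1; ring
  rw [e5] at h6
  have h7 := (ENNReal.pow_le_pow_left_iff (by norm_num)).1 h6
  refine (h1.trans (add_le_add (add_le_add h7 (ENNReal.ofReal_le_ofReal (herr _ htilt1)))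
    (ENNReal.ofReal_le_ofReal (herr' _ htilt1)))).trans ?_
  rw [← ENNReal.ofReal_add (by positivity) (by positivity),
    ← ENNReal.ofReal_add (by positivity) (by positivity)]
  refine ENNReal.ofReal_le_ofReal ?_
  have : δ' ≤ δ := min_le_left _ _
  nlinarith

end CellSavings

/-! ### Moments of the savings between cells -/

section CellMoments

variable {d₁ d₂ : ℕ}

/-- For `β ≤ 1`, `exp (β * u)` is at most `exp (β * X)` when `u ≤ X` and at most `exp (β * X - X) *
exp u` otherwise. The scale of the bound is kept, with constant `1 + 2`. -/
lemma lintegral_exp_mul_savings_le {p : I} {θ : Fin d₁ → ℝ} (h0 : ∀ i, 0 < θ i)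
    (h1 : ∀ i, θ i ≤ 1 / 2) (hs : stepBound d₂ p θ ≤ 1 / 4) {β : ℝ} (hβ0 : 0 ≤ β) (hβ1 : β ≤ 1)
    (w : EdgeType d₁ d₂ → ℤ) :
    ∫⁻ S, ENNReal.ofReal (Real.exp (β * ((hor w : ℝ) - ptime S 0 w)))
      ∂bernoulliSet (Edge (EdgeType d₁ d₂)) p ≤
      ENNReal.ofReal (3 * Real.exp (β * (tilt θ w - exc w / 2))) := by
  set X := tilt θ w - exc w / 2 with hX
  have h := lintegral_exp_savings_le (d₂ := d₂) h0 h1 hs 0 w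
  rw [sub_zero, ← hX] at h
  calc ∫⁻ S, ENNReal.ofReal (Real.exp (β * ((hor w : ℝ) - ptime S 0 w)))
        ∂bernoulliSet (Edge (EdgeType d₁ d₂)) p
      ≤ ∫⁻ S, (ENNReal.ofReal (Real.exp (β * X)) + ENNReal.ofReal (Real.exp (β * X - X)) *
          ENNReal.ofReal (Real.exp ((hor w : ℝ) - ptime S 0 w)))
          ∂bernoulliSet (Edge (EdgeType d₁ d₂)) p := by
        refine lintegral_mono fun S => ?_
        rw [← ENNReal.ofReal_mul (Real.exp_pos _).le, ← Real.exp_add,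
          ← ENNReal.ofReal_add (Real.exp_pos _).le (Real.exp_pos _).le]
        refine ENNReal.ofReal_le_ofReal ?_
        set u := (hor w : ℝ) - ptime S 0 w
        rcases le_total u X with hu | hu
        · have : Real.exp (β * u) ≤ Real.exp (β * X) :=
            Real.exp_le_exp.2 (mul_le_mul_of_nonneg_left hu hβ0)
          have := Real.exp_pos (β * X - X + u)
          linarith
        · have : Real.exp (β * u) ≤ Real.exp (β * X - X + u) :=
            Real.exp_le_exp.2 (by nlinarith)
          have := Real.exp_pos (β * X)
          linarith
    _ ≤ ENNReal.ofReal (Real.exp (β * X)) + ENNReal.ofReal (Real.exp (β * X - X)) *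
          ENNReal.ofReal (2 * Real.exp X) := by
        rw [lintegral_add_left measurable_const, lintegral_const_mul' _ _ ENNReal.ofReal_ne_top,
          lintegral_const, measure_univ, mul_one]
        exact add_le_add_right (mul_le_mul_right h _) _
    _ = _ := by
        rw [← ENNReal.ofReal_mul (Real.exp_pos _).le,
          ← ENNReal.ofReal_add (by positivity) (by positivity), mul_left_comm, ← Real.exp_add,
          sub_add_cancel]
        congr 1; ring

/-- Exponential moments on the event of small deviations. -/
lemma lintegral_exp_le_of_tail {Ω : Type*} [MeasurableSpace Ω] {P : Measure Ω}
    [IsProbabilityMeasure P] {Y : Ω → ℝ} (hY : Measurable Y) {β t M R δ : ℝ} (hβ : 0 ≤ β)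
    (hM : 0 < M) (hR : 0 ≤ R) (hδ : 0 ≤ δ)
    (h2 : ∫⁻ ω, ENNReal.ofReal (Real.exp (2 * β * Y ω)) ∂P ≤ ENNReal.ofReal R)
    (ht : P {ω | t < Y ω} ≤ ENNReal.ofReal δ) :
    ∫⁻ ω, ENNReal.ofReal (Real.exp (β * Y ω)) ∂P ≤
      ENNReal.ofReal (Real.exp (β * t) + (R / M + M * δ)) := by
  have hA : MeasurableSet {ω | t < Y ω} := measurableSet_lt measurable_const hY
  calc ∫⁻ ω, ENNReal.ofReal (Real.exp (β * Y ω)) ∂P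
      ≤ ∫⁻ ω, (ENNReal.ofReal (Real.exp (β * t)) + (ENNReal.ofReal (1 / M) *
          ENNReal.ofReal (Real.exp (2 * β * Y ω)) +
          ENNReal.ofReal M * {ω | t < Y ω}.indicator 1 ω)) ∂P := by
        refine lintegral_mono fun ω => ?_
        by_cases h : t < Y ω
        · rw [Set.indicator_of_mem (show ω ∈ {ω | t < Y ω} from h), Pi.one_apply, mul_one,
            ← ENNReal.ofReal_mul (by positivity), ← ENNReal.ofReal_add (by positivity) hM.le]
          refine le_trans (ENNReal.ofReal_le_ofReal ?_) le_add_self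
          have e : Real.exp (2 * β * Y ω) = Real.exp (β * Y ω) ^ 2 := by
            rw [← Real.exp_nat_mul]; congr 1; push_cast; ring
          rw [e]
          -- Above `t`, `exp (β * Y) ≤ exp (2 * β * Y) / M + M`: the second moment pays for the
          -- first term, the tail bound for the second.
          have h3 : 0 ≤ (Real.exp (β * Y ω) - M) ^ 2 := sq_nonneg _
          have h4 := Real.exp_pos (β * Y ω)
          rw [one_div_mul_eq_div, ← sub_nonneg]
          have : Real.exp (β * Y ω) ^ 2 / M + M - Real.exp (β * Y ω) =
              ((Real.exp (β * Y ω) - M) ^ 2 + M * Real.exp (β * Y ω)) / M := by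
            field_simp
            ring
          rw [this]
          positivity
        · refine le_trans (ENNReal.ofReal_le_ofReal (Real.exp_le_exp.2
            (mul_le_mul_of_nonneg_left (not_lt.1 h) hβ))) le_self_add
    _ ≤ ENNReal.ofReal (Real.exp (β * t)) + (ENNReal.ofReal (1 / M) * ENNReal.ofReal R +
          ENNReal.ofReal M * ENNReal.ofReal δ) := by
        rw [lintegral_add_left measurable_const, lintegral_const, measure_univ, mul_one,
          lintegral_add_left (by fun_prop), lintegral_const_mul' _ _ ENNReal.ofReal_ne_top,
          lintegral_const_mul' _ _ ENNReal.ofReal_ne_top, lintegral_indicator_one hA]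
        gcongr
    _ = _ := by
        rw [← ENNReal.ofReal_mul (by positivity), ← ENNReal.ofReal_mul hM.le,
          ← ENNReal.ofReal_add (by positivity) (by positivity),
          ← ENNReal.ofReal_add (by positivity) (by positivity), one_div_mul_eq_div]

/-- The sides of the cells. -/
def sides (ℓ : Fin d₁ → ℕ) (k : ℕ) : EdgeType d₁ d₂ → ℕ := Sum.elim ℓ fun _ => k

lemma verSize_sides (ℓ : Fin d₁ → ℕ) (k : ℕ) :
    verSize (sides ℓ k : EdgeType d₁ d₂ → ℕ) = d₂ * k := by
  simp [verSize, sides]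

lemma tsum_exp_neg_l1_le {ι : Type*} [Fintype ι] [DecidableEq ι] :
    ∑' b : ι → ℤ, ENNReal.ofReal (Real.exp (-(l1 b : ℝ) / 2)) ≤
      ENNReal.ofReal (8 ^ Fintype.card ι) := by
  have e : ∀ b : ι → ℤ, ENNReal.ofReal (Real.exp (-(l1 b : ℝ) / 2)) = ∏ i, verWeight (b i) := by
    intro b
    simp only [verWeight]
    rw [← ENNReal.ofReal_prod_of_nonneg fun i _ => (Real.exp_pos _).le, ← Real.exp_sum, l1_cast,
      neg_div, Finset.sum_div, ← Finset.sum_neg_distrib]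
    simp only [neg_div]
  simp_rw [e]
  refine (tsum_pi_prod_le _).trans ?_
  rw [Finset.prod_const, Finset.card_univ, ENNReal.ofReal_pow (by norm_num)]
  exact pow_le_pow_left₀ (by simp) tsum_verWeight_le _

/-- Counting and summing over the displacements. -/
lemma tsum_le_of_small_large {ι : Type*} [Fintype ι] [DecidableEq ι]
    {f : (ι → ℤ) → ℝ≥0∞} {A q : ℝ} {r : ℕ} (hr : 2 * (A + Real.log (3 * 8 ^ Fintype.card ι)) ≤ r)
    {T : Set (ι → ℤ)}
    (h1 : ∀ b ∈ T, f b ≤ ENNReal.ofReal (3 * Real.exp (A - l1 b)))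
    (h2 : ∀ b ∈ T, f b ≤ ENNReal.ofReal q) :
    ∑' b : T, f b ≤ ENNReal.ofReal ((2 * r + 1) ^ Fintype.card ι) * ENNReal.ofReal q + 1 := by
  set F : Finset (ι → ℤ) := Fintype.piFinset fun _ => Finset.Icc (-(r : ℤ)) r with hF
  have hcard : (F.card : ℝ≥0∞) = ENNReal.ofReal ((2 * r + 1) ^ Fintype.card ι) := by
    have : F.card = (2 * r + 1) ^ Fintype.card ι := by
      rw [hF, Fintype.card_piFinset, Finset.prod_const, Finset.card_univ, Int.card_Icc]
      congr 1
      omega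
    rw [this, ← ENNReal.ofReal_natCast]
    congr 1
    push_cast
    ring
  set W : ℝ := 8 ^ Fintype.card ι with hW
  have hpt : ∀ b ∈ T, f b ≤ (if b ∈ F then ENNReal.ofReal q else 0) +
      ENNReal.ofReal (1 / W) * ENNReal.ofReal (Real.exp (-(l1 b : ℝ) / 2)) := by
    intro b hb
    by_cases hbF : b ∈ F
    · rw [if_pos hbF]
      exact (h2 b hb).trans le_self_add
    · rw [if_neg hbF, zero_add, ← ENNReal.ofReal_mul (by positivity)]
      refine (h1 b hb).trans (ENNReal.ofReal_le_ofReal ?_)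
      have hbr : (r : ℝ) ≤ l1 b := by
        have : r ≤ l1 b := by
          by_contra hcon
          refine hbF (Fintype.mem_piFinset.2 fun i => Finset.mem_Icc.2 ?_)
          have : (b i).natAbs ≤ l1 b :=
            Finset.single_le_sum (f := fun i => (b i).natAbs) (fun _ _ => Nat.zero_le _)
              (Finset.mem_univ i)
          omega
        exact_mod_cast this
      -- Outside the box of radius `r`, half of the decay beats `A` and the total mass `3 * W`; the
      -- other half remains summable.
      have h3 : A - l1 b ≤ - Real.log (3 * W) + -(l1 b : ℝ) / 2 := by linarith
      calc 3 * Real.exp (A - l1 b) ≤ 3 * Real.exp (- Real.log (3 * W) + -(l1 b : ℝ) / 2) :=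
            mul_le_mul_of_nonneg_left (Real.exp_le_exp.2 h3) (by norm_num)
        _ = _ := by
            rw [Real.exp_add, Real.exp_neg, Real.exp_log (by positivity)]
            field_simp
  calc ∑' b : T, f b ≤ ∑' b : T, ((if (b : ι → ℤ) ∈ F then ENNReal.ofReal q else 0) +
        ENNReal.ofReal (1 / W) * ENNReal.ofReal (Real.exp (-(l1 (b : ι → ℤ) : ℝ) / 2))) :=
        ENNReal.tsum_le_tsum fun b => hpt b b.2
    _ ≤ ∑' b : ι → ℤ, ((if b ∈ F then ENNReal.ofReal q else 0) +
        ENNReal.ofReal (1 / W) * ENNReal.ofReal (Real.exp (-(l1 b : ℝ) / 2))) :=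
        ENNReal.tsum_comp_le_tsum_of_injective Subtype.val_injective _
    _ ≤ _ := by
        rw [ENNReal.tsum_add, ENNReal.tsum_mul_left]
        refine add_le_add (le_of_eq ?_) ?_
        · rw [tsum_eq_sum (s := F) (fun b hb => if_neg hb), Finset.sum_congr rfl
            (fun b hb => if_pos hb), Finset.sum_const, nsmul_eq_mul, hcard]
        · refine (mul_le_mul_right tsum_exp_neg_l1_le _).trans (le_of_eq ?_)
          rw [← ENNReal.ofReal_mul (by positivity), ← hW, one_div_mul_cancel (by positivity),
            ENNReal.ofReal_one]

lemma exc_cellTop (ℓ : Fin d₁ → ℕ) (k : ℕ) (b : EdgeType d₁ d₂ → ℤ) :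
    exc (cellTop (sides ℓ k) b) = ∑ i, (ℓ i : ℝ) * (|(b (Sum.inl i) : ℝ) + 1| -
      ((b (Sum.inl i) : ℝ) + 1)) + k * ∑ j, |(b (Sum.inr j) : ℝ)| := by
  rw [exc_eq, Finset.mul_sum]
  congr 1
  · refine Finset.sum_congr rfl fun i _ => ?_
    simp only [cellTop, sides, Sum.elim_inl]
    push_cast
    rw [abs_mul, abs_of_nonneg (Nat.cast_nonneg (ℓ i) : (0 : ℝ) ≤ ℓ i)]
    ring
  · refine Finset.sum_congr rfl fun j _ => ?_
    simp only [cellTop, sides, Sum.elim_inr]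
    push_cast
    rw [abs_mul, abs_of_nonneg (Nat.cast_nonneg k : (0 : ℝ) ≤ k)]

/-- When `θ i * ℓ i` does not depend on `i`, the tilt sees only the level of a cell, so it is the
same for all the displacements summed together. -/
lemma tilt_cellTop {θ : Fin d₁ → ℝ} {ℓ : Fin d₁ → ℕ} {T : ℝ} (h : ∀ i, θ i * ℓ i = T) (k : ℕ)
    (b : EdgeType d₁ d₂ → ℤ) : tilt θ (cellTop (sides ℓ k) b) = T * (hor b + d₁) := by
  simp only [tilt, cellTop, sides, Sum.elim_inl, hor]
  push_cast
  have : ∀ i, θ i * ((ℓ i : ℝ) * ((b (Sum.inl i) : ℝ) + 1)) = T * ((b (Sum.inl i) : ℝ) + 1) :=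
    fun i => by rw [← mul_assoc, h]
  simp_rw [this]
  rw [← Finset.mul_sum, Finset.sum_add_distrib]
  simp

/-- Crude bound for the moments between cells. -/
lemma cellMoment_crude (hd : 1 ≤ d₁) {p : I} {ℓ : Fin d₁ → ℕ} {k : ℕ} {k' B : ℝ} (hk : 0 < k)
    (hk0 : 0 < k') (hk' : k' ≤ 2 * k) (hB : 0 ≤ B) (hBk : B ≤ k)
    (hℓ : ∀ i, 2 * crudeConst d₁ d₂ * k' ≤ ℓ i) (hp : (∏ i, ℓ i : ℕ) * (p : ℝ) ≤ k' ^ d₁) {L : ℕ}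
    (b : EdgeType d₁ d₂ → ℤ) (hb : hor b ≤ L) :
    cellMoment p (sides ℓ k) (B / k) b ≤ ENNReal.ofReal (3 * Real.exp (B *
      (2 * crudeConst d₁ d₂ * (L + d₁) + 2 * d₂) - B / k * (exc (cellTop (sides ℓ k) b) / 2))) := by
  set K := crudeConst d₁ d₂ with hK
  have hK0 : 48 ≤ K := crudeConst_ge hd
  have hkr : (0 : ℝ) < k := by exact_mod_cast hk
  have hℓ0 : ∀ i, (0 : ℝ) < ℓ i := fun i => lt_of_lt_of_le (by positivity) (hℓ i)
  have hr0 : ∀ i, 0 < k' / ℓ i := fun i => div_pos hk0 (hℓ0 i)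
  set θ : Fin d₁ → ℝ := fun i => K * (k' / ℓ i) with hθ
  have hstep : stepBound d₂ p θ ≤ 1 / 4 := by
    refine stepBound_le hd hr0 p.2.1 ?_
    rw [Finset.prod_div_distrib, Finset.prod_const, Finset.card_univ, Fintype.card_fin,
      le_div_iff₀ (Finset.prod_pos fun i _ => hℓ0 i), mul_comm]
    exact_mod_cast hp
  have hβ1 : B / k ≤ 1 := (div_le_one hkr).2 hBk
  have hcr := lintegral_exp_mul_savings_le (d₂ := d₂) (p := p) (θ := θ)
    (fun i => mul_pos (by linarith) (hr0 i)) (fun i => by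
      simp only [hθ]
      rw [mul_div_assoc', div_le_iff₀ (hℓ0 i)]
      have := hℓ i
      linarith) hstep (by positivity) hβ1 (cellTop (sides ℓ k) b)
  rw [tilt_cellTop (T := K * k') (fun i => by
    simp only [hθ]
    have := (hℓ0 i).ne'
    field_simp)] at hcr
  have e : ∀ S : Set (Edge (EdgeType d₁ d₂)), ENNReal.ofReal (Real.exp (B / k *
      ((hor (cellTop (sides ℓ k) b) : ℝ) - ptime S 0 (cellTop (sides ℓ k) b) +
        2 * verSize (sides ℓ k : EdgeType d₁ d₂ → ℕ)))) =
      ENNReal.ofReal (Real.exp (2 * B * d₂)) * ENNReal.ofReal (Real.exp (B / k *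
      ((hor (cellTop (sides ℓ k) b) : ℝ) - ptime S 0 (cellTop (sides ℓ k) b)))) := by
    intro S
    rw [← ENNReal.ofReal_mul (Real.exp_pos _).le, ← Real.exp_add, verSize_sides]
    congr 2
    push_cast
    field_simp
    ring
  rw [cellMoment]
  simp_rw [e]
  rw [lintegral_const_mul' _ _ ENNReal.ofReal_ne_top]
  refine (mul_le_mul_right hcr _).trans ?_
  rw [← ENNReal.ofReal_mul (Real.exp_pos _).le, mul_left_comm, ← Real.exp_add]
  refine ENNReal.ofReal_le_ofReal (mul_le_mul_of_nonneg_left (Real.exp_le_exp.2 ?_) (by norm_num))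
  have h1 : (hor b : ℝ) + d₁ ≤ L + d₁ := by
    have : (hor b : ℝ) ≤ L := by exact_mod_cast hb
    linarith
  have h2 : B / k * (K * k' * (hor b + d₁)) ≤ B / k * (K * (2 * k) * (L + d₁)) := by
    refine mul_le_mul_of_nonneg_left ?_ (by positivity)
    calc K * k' * (hor b + d₁) ≤ K * k' * (L + d₁) :=
          mul_le_mul_of_nonneg_left h1 (by positivity)
      _ ≤ _ := by gcongr
  have h3 : B / k * (K * (2 * k) * (L + d₁)) = B * (2 * K * (L + d₁)) := by
    field_simp
  rw [h3] at h2
  linarith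

end CellMoments

/-! ### Bounds for the moments between cells -/

section MomentBounds

variable {d₁ d₂ : ℕ}

lemma stepBound_crude_le (hd : 1 ≤ d₁) {p : I} {ℓ : Fin d₁ → ℕ} {k' : ℝ} (hk0 : 0 < k')
    (hℓ : ∀ i, 0 < ℓ i) (hp : (∏ i, ℓ i : ℕ) * (p : ℝ) ≤ k' ^ d₁) :
    stepBound d₂ p (fun i => crudeConst d₁ d₂ * (k' / ℓ i)) ≤ 1 / 4 := by
  have hℓ0 : ∀ i, (0 : ℝ) < ℓ i := fun i => by exact_mod_cast hℓ i
  refine stepBound_le hd (fun i => div_pos hk0 (hℓ0 i)) p.2.1 ?_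
  rw [Finset.prod_div_distrib, Finset.prod_const, Finset.card_univ, Fintype.card_fin,
    le_div_iff₀ (Finset.prod_pos fun i _ => hℓ0 i), mul_comm]
  exact_mod_cast hp

/-- The tail estimate bounds the savings up to a small probability, on which the crude moment at
twice the exponent takes over. -/
lemma cellMoment_typical (hd : 1 ≤ d₁) {η B : ℝ} (hη : 0 < η) (hB : 0 ≤ B) (D : ℕ) :
    ∃ k₀ : ℝ, 0 < k₀ ∧ ∀ k' : ℝ, k₀ ≤ k' → ∀ k : ℕ, 0 < k → k' ≤ 2 * k → 2 * B ≤ k →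
      ∃ ℓ₀ : ℝ, ∀ ℓ : Fin d₁ → ℕ, (∀ i, ℓ₀ ≤ ℓ i) → ∀ a : ℝ, 0 ≤ a →
        (∏ i, ℓ i : ℕ) * a ≤ k' ^ d₁ → ∀ b : EdgeType d₁ d₂ → ℤ, hor b + 2 * d₁ = D →
        (∀ i, -1 ≤ b (Sum.inl i)) → cellMoment (cellProb a) (sides ℓ k) (B / k) b ≤
          ENNReal.ofReal (Real.exp (B * ((scoreConst d₁ d₂ + η) * (k' / k) * (D / d₁) +
            2 * d₂)) + 1) := by
  set K := crudeConst d₁ d₂ with hK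
  have hK0 : 48 ≤ K := crudeConst_ge hd
  -- `E` is the cost of the vertical corrections and `R` bounds the moment at exponent `2 * B / k`.
  -- With `M = 2 * R * E` and tail probability `1 / (2 * E * M)`, the two error terms contribute `1
  -- / 2` each.
  set E : ℝ := Real.exp (2 * B * d₂) with hE
  set R : ℝ := 3 * Real.exp (4 * K * B * D) with hR
  set M : ℝ := 2 * R * E with hM
  have hE0 : 0 < E := Real.exp_pos _
  have hR0 : 0 < R := mul_pos (by norm_num) (Real.exp_pos _)
  have hM0 : 0 < M := by positivity
  obtain ⟨k₀, hk₀, H⟩ := measure_cell_savings_gt_le (d₂ := d₂) hd hη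
    (δ := 1 / (2 * E * M)) (by positivity)
  refine ⟨k₀, hk₀, fun k' hkk k hk hk2 hkB => ?_⟩
  obtain ⟨ℓ₀, H⟩ := H k' hkk D
  have hk0 : 0 < k' := hk₀.trans_le hkk
  have hkr : (0 : ℝ) < k := by exact_mod_cast hk
  refine ⟨max ℓ₀ (2 * K * k'), fun ℓ hℓ a ha hvol b hb hb1 => ?_⟩
  have hℓ1 : ∀ i, 2 * K * k' ≤ ℓ i := fun i => (le_max_right _ _).trans (hℓ i)
  have hℓ0 : ∀ i, (0 : ℝ) < ℓ i := fun i => lt_of_lt_of_le (by positivity) (hℓ1 i)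
  have hp : (∏ i, ℓ i : ℕ) * (cellProb a : ℝ) ≤ k' ^ d₁ :=
    le_trans (mul_le_mul_of_nonneg_left (cellProb_le ha) (Nat.cast_nonneg _)) hvol
  have hstep := stepBound_crude_le (d₂ := d₂) hd hk0 (fun i => by exact_mod_cast hℓ0 i) hp
  -- The target is pushed one layer beyond the top of the cell, at no loss of savings. Then all `s
  -- i` are at least `1`, as the tail estimate requires, and their sum is `hor b + 2 * d₁`.
  set s : Fin d₁ → ℕ := fun i => (b (Sum.inl i) + 2).toNat with hs
  have hsb : ∀ i, (s i : ℤ) = b (Sum.inl i) + 2 := fun i =>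
    Int.toNat_of_nonneg (by have := hb1 i; omega)
  have hsD : ∑ i, s i = D := by
    have : ((∑ i, s i : ℕ) : ℤ) = D := by
      push_cast
      simp_rw [hsb]
      rw [Finset.sum_add_distrib, ← hb, hor]
      simp [mul_comm]
    exact_mod_cast this
  set v : Fin d₂ → ℤ := fun j => k * b (Sum.inr j) with hv
  set w : EdgeType d₁ d₂ → ℤ := target (fun i => ℓ i * s i) v with hw
  have hdiff : ∀ t, (w - cellTop (sides ℓ k) b) t =
      Sum.elim (fun i => (ℓ i : ℤ)) (0 : Fin d₂ → ℤ) t := by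
    rintro (i | j)
    · simp only [hw, target, Pi.sub_apply, Sum.elim_inl, cellTop, sides]
      push_cast
      rw [hsb]; ring
    · simp [hw, target, cellTop, sides, hv]
  have hl1 : (l1 (w - cellTop (sides ℓ k) b) : ℤ) = hor w - hor (cellTop (sides ℓ k) b) := by
    rw [← hor_sub, l1, hor, Fintype.sum_sum_type]
    simp_rw [hdiff]
    simp
  have hmono : ∀ S : Set (Edge (EdgeType d₁ d₂)), (hor (cellTop (sides ℓ k) b) : ℝ) -
      ptime S 0 (cellTop (sides ℓ k) b) ≤ (hor w : ℝ) - ptime S 0 w := by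
    intro S
    have h1 := ptime_triangle S 0 (cellTop (sides ℓ k) b) w
    have h2 := ptime_le_l1 S (cellTop (sides ℓ k) b) w
    have h3 : hor (cellTop (sides ℓ k) b) - (ptime S 0 (cellTop (sides ℓ k) b) : ℤ) ≤
        hor w - ptime S 0 w := by omega
    exact_mod_cast h3
  have h2 := lintegral_exp_mul_savings_le (d₂ := d₂) (p := cellProb a)
    (θ := fun i => K * (k' / ℓ i)) (fun i => mul_pos (by linarith) (div_pos hk0 (hℓ0 i)))
    (fun i => by
      rw [mul_div_assoc', div_le_iff₀ (hℓ0 i)]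
      have := hℓ1 i
      linarith) hstep (β := 2 * (B / k)) (by positivity) (by
        rw [mul_div_assoc', div_le_one hkr]; exact hkB) w
  have htilt : tilt (fun i => K * (k' / ℓ i)) w = K * k' * D := by
    simp only [tilt, hw, target, Sum.elim_inl]
    push_cast
    rw [← hsD]
    push_cast
    rw [Finset.mul_sum]
    refine Finset.sum_congr rfl fun i _ => ?_
    have := (hℓ0 i).ne'
    field_simp
  rw [htilt] at h2
  have h3 : ENNReal.ofReal (3 * Real.exp (2 * (B / k) * (K * k' * D - exc w / 2))) ≤
      ENNReal.ofReal R := by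
    refine ENNReal.ofReal_le_ofReal (mul_le_mul_of_nonneg_left (Real.exp_le_exp.2 ?_)
      (by norm_num))
    have : 0 ≤ exc w := exc_nonneg w
    calc 2 * (B / k) * (K * k' * D - exc w / 2) ≤ 2 * (B / k) * (K * (2 * k) * D) := by
          refine mul_le_mul_of_nonneg_left ?_ (by positivity)
          have : K * k' * D ≤ K * (2 * k) * D := by gcongr
          linarith
      _ = _ := by field_simp; ring
  have h4 := lintegral_exp_le_of_tail (P := bernoulliSet (Edge (EdgeType d₁ d₂)) (cellProb a))
    (Y := fun S => (hor w : ℝ) - ptime S 0 w)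
    (measurable_const.sub (measurable_ptime_real (ι := EdgeType d₁ d₂) 0 w)) (β := B / k)
    (by positivity) hM0 hR0.le (by positivity) (h2.trans h3)
    (H ℓ (fun i => (le_max_left _ _).trans (hℓ i)) a ha hvol s
      (fun i => by have := hsb i; have := hb1 i; omega) hsD v)
  calc cellMoment (cellProb a) (sides ℓ k) (B / k) b
      ≤ ∫⁻ S, ENNReal.ofReal E * ENNReal.ofReal (Real.exp (B / k * ((hor w : ℝ) - ptime S 0 w)))
          ∂bernoulliSet (Edge (EdgeType d₁ d₂)) (cellProb a) := by
        refine lintegral_mono fun S => ?_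
        rw [← ENNReal.ofReal_mul hE0.le, hE, ← Real.exp_add]
        refine ENNReal.ofReal_le_ofReal (Real.exp_le_exp.2 ?_)
        have e : 2 * B * d₂ = B / k * (2 * (verSize (sides ℓ k : EdgeType d₁ d₂ → ℕ) : ℕ)) := by
          rw [verSize_sides]
          push_cast
          field_simp
        rw [e, ← mul_add]
        refine mul_le_mul_of_nonneg_left ?_ (by positivity)
        have := hmono S
        linarith
    _ ≤ _ := by
        rw [lintegral_const_mul' _ _ ENNReal.ofReal_ne_top]
        refine (mul_le_mul_right h4 _).trans ?_
        rw [← ENNReal.ofReal_mul hE0.le]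
        refine ENNReal.ofReal_le_ofReal (le_of_eq ?_)
        rw [mul_add, hE, ← Real.exp_add, ← hE]
        congr 1
        · congr 1
          field_simp
          ring
        · rw [hM]
          field_simp
          ring

/-- Far displacements with a fixed level have an excess at least proportional to their size, since
horizontal sides are at least `k`. `B ≥ 2` turns this into decay at rate `l1 b`; the term `2 * d₁`
accounts for the top corner being at `b + 1`. -/
lemma cellMoment_large (hd : 1 ≤ d₁) {p : I} {ℓ : Fin d₁ → ℕ} {k : ℕ} {k' B : ℝ} (hk : 0 < k)
    (hk0 : 0 < k') (hk' : k' ≤ 2 * k) (hB : 2 ≤ B) (hBk : B ≤ k) (hℓk : ∀ i, k ≤ ℓ i)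
    (hℓ : ∀ i, 2 * crudeConst d₁ d₂ * k' ≤ ℓ i) (hp : (∏ i, ℓ i : ℕ) * (p : ℝ) ≤ k' ^ d₁) {L : ℕ}
    (b : EdgeType d₁ d₂ → ℤ) (hb : hor b = L) :
    cellMoment p (sides ℓ k) (B / k) b ≤ ENNReal.ofReal (3 * Real.exp (B *
      (2 * crudeConst d₁ d₂ * (L + d₁) + 2 * d₂) + (L + 2 * d₁) - l1 b)) := by
  refine (cellMoment_crude hd hk hk0 hk' (by linarith) hBk hℓ hp b hb.le).trans
    (ENNReal.ofReal_le_ofReal (mul_le_mul_of_nonneg_left (Real.exp_le_exp.2 ?_) (by norm_num)))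
  have hkr : (0 : ℝ) < k := by exact_mod_cast hk
  have h1 : (l1 b : ℝ) ≤ L + 2 * d₁ + exc (cellTop (sides ℓ k) b) / k := by
    have h2 : (l1 b : ℝ) = L + exc b := by
      rw [exc, hb]; push_cast; ring
    have h3 : ∑ i, (|(b (Sum.inl i) : ℝ)| - b (Sum.inl i)) ≤ 2 * d₁ + ∑ i, ((ℓ i : ℝ) / k) *
        (|(b (Sum.inl i) : ℝ) + 1| - ((b (Sum.inl i) : ℝ) + 1)) := by
      have : (2 * d₁ : ℝ) = ∑ _i : Fin d₁, 2 := by simp [mul_comm]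
      rw [this, ← Finset.sum_add_distrib]
      refine Finset.sum_le_sum fun i _ => ?_
      have h4 : (1 : ℝ) ≤ (ℓ i : ℝ) / k := (one_le_div hkr).2 (by exact_mod_cast hℓk i)
      have h5 : 0 ≤ |(b (Sum.inl i) : ℝ) + 1| - ((b (Sum.inl i) : ℝ) + 1) :=
        sub_nonneg.2 (le_abs_self _)
      have h6 := le_mul_of_one_le_left h5 h4
      have h7 : |(b (Sum.inl i) : ℝ)| ≤ |(b (Sum.inl i) : ℝ) + 1| + 1 := by
        have := abs_sub (b (Sum.inl i) + 1 : ℝ) 1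
        simpa using this
      linarith
    rw [h2, exc_eq, exc_cellTop, add_div, Finset.sum_div, mul_div_cancel_left₀ _ hkr.ne']
    have : ∀ i, (ℓ i : ℝ) * (|(b (Sum.inl i) : ℝ) + 1| - ((b (Sum.inl i) : ℝ) + 1)) / k =
        ((ℓ i : ℝ) / k) * (|(b (Sum.inl i) : ℝ) + 1| - ((b (Sum.inl i) : ℝ) + 1)) :=
      fun i => by ring
    simp_rw [this]
    linarith
  have h8 : exc (cellTop (sides ℓ k) b) / k ≤ B / k * (exc (cellTop (sides ℓ k) b) / 2) := by
    have h9 : 0 ≤ exc (cellTop (sides ℓ k) b) := exc_nonneg _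
    rw [div_mul_div_comm, div_le_div_iff₀ hkr (by positivity)]
    have : 0 ≤ (B - 2) * (exc (cellTop (sides ℓ k) b) * k) :=
      mul_nonneg (by linarith) (by positivity)
    linarith
  linarith

/-- A coordinate at most `-2` adds at least `2 * ℓ i` to the excess. As horizontal sides may be
taken as long as desired compared with `k`, this beats all other terms. -/
lemma cellMoment_back (hd : 1 ≤ d₁) {p : I} {ℓ : Fin d₁ → ℕ} {k : ℕ} {k' B : ℝ} (hk : 0 < k)
    (hk0 : 0 < k') (hk' : k' ≤ 2 * k) (hB : 2 ≤ B) (hBk : B ≤ k)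
    (hℓ : ∀ i, 2 * crudeConst d₁ d₂ * k' ≤ ℓ i) (hp : (∏ i, ℓ i : ℕ) * (p : ℝ) ≤ k' ^ d₁) {L : ℕ}
    (hℓL : ∀ i, k * (2 * crudeConst d₁ d₂ * (L + d₁) + 2 * d₂ + 1) ≤ ℓ i)
    (b : EdgeType d₁ d₂ → ℤ) (hb : hor b = L) (hneg : ∃ i, b (Sum.inl i) < -1) :
    cellMoment p (sides ℓ k) (B / k) b ≤ 1 := by
  refine (cellMoment_crude hd hk hk0 hk' (by linarith) hBk hℓ hp b hb.le).trans ?_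
  have hkr : (0 : ℝ) < k := by exact_mod_cast hk
  obtain ⟨i, hi⟩ := hneg
  set X := 2 * crudeConst d₁ d₂ * (L + d₁) + 2 * d₂ with hX
  have h1 : 2 * (k * (X + 1)) ≤ exc (cellTop (sides ℓ k) b) := by
    rw [exc_cellTop]
    have h2 : (ℓ i : ℝ) * (|(b (Sum.inl i) : ℝ) + 1| - ((b (Sum.inl i) : ℝ) + 1)) ≤
        ∑ i, (ℓ i : ℝ) * (|(b (Sum.inl i) : ℝ) + 1| - ((b (Sum.inl i) : ℝ) + 1)) :=
      Finset.single_le_sum (f := fun i => (ℓ i : ℝ) * (|(b (Sum.inl i) : ℝ) + 1| -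
        ((b (Sum.inl i) : ℝ) + 1))) (fun i _ => mul_nonneg (Nat.cast_nonneg _)
        (sub_nonneg.2 (le_abs_self _))) (Finset.mem_univ i)
    have h3 : (b (Sum.inl i) : ℝ) ≤ -2 := by exact_mod_cast (by omega : b (Sum.inl i) ≤ -2)
    have h4 : 2 ≤ |(b (Sum.inl i) : ℝ) + 1| - ((b (Sum.inl i) : ℝ) + 1) := by
      rw [abs_of_nonpos (by linarith)]; linarith
    have h5 := mul_le_mul_of_nonneg_left h4 (Nat.cast_nonneg (ℓ i) : (0 : ℝ) ≤ ℓ i)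
    have h6 := hℓL i
    have h7 : (0 : ℝ) ≤ k * ∑ j, |(b (Sum.inr j) : ℝ)| := by positivity
    linarith
  have h2 : B * (X + 1) ≤ B / k * (exc (cellTop (sides ℓ k) b) / 2) := by
    calc B * (X + 1) = B / k * (2 * (k * (X + 1)) / 2) := by field_simp
      _ ≤ _ := by gcongr
  rw [← ENNReal.ofReal_one]
  refine ENNReal.ofReal_le_ofReal ?_
  calc 3 * Real.exp (B * X - B / k * (exc (cellTop (sides ℓ k) b) / 2))
      ≤ 3 * Real.exp (-2) :=
        mul_le_mul_of_nonneg_left (Real.exp_le_exp.2 (by linarith)) (by norm_num)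
    _ ≤ 1 := by
        have h3 := Real.add_one_le_exp (2 : ℝ)
        rw [Real.exp_neg, ← div_eq_mul_inv, div_le_one (Real.exp_pos _)]
        linarith

/-- The sum of the moments over the displacements of horizontal size `L`. -/
lemma tsum_cellMoment_le (hd : 1 ≤ d₁) {η : ℝ} (hη : 0 < η) :
    ∃ (L k : ℕ) (B τ G F : ℝ) (ℓ₀ : ℝ), 0 < L ∧ 0 < k ∧ 0 < B ∧ 0 < τ ∧ 0 ≤ G ∧
      d₁ * G ≤ (scoreConst d₁ d₂ + η) * (B * L) ∧
      ∀ ℓ : Fin d₁ → ℕ, (∀ i, ℓ₀ ≤ ℓ i) → ∀ a : ℝ, 0 ≤ a →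
        (∏ i, ℓ i : ℕ) * a ≤ ((1 + τ) * k) ^ d₁ →
        (∑' b : {b : EdgeType d₁ d₂ → ℤ // hor b = L},
          cellMoment (cellProb a) (sides ℓ k) (B / k) (b : EdgeType d₁ d₂ → ℤ) ≤
            ENNReal.ofReal (Real.exp G)) ∧
        ∀ b : EdgeType d₁ d₂ → ℤ, hor b ≤ L →
          cellMoment (cellProb a) (sides ℓ k) (B / k) b ≤ ENNReal.ofReal F := by
  set C := scoreConst d₁ d₂ with hC
  have hC0 : 0 < C := scoreConst_pos hd
  have hd0 : (0 : ℝ) < d₁ := by exact_mod_cast hd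
  set K := crudeConst d₁ d₂ with hK
  have hK0 : 48 ≤ K := crudeConst_ge hd
  set n := Fintype.card (EdgeType d₁ d₂) with hn
  -- The error `η` is shared in four: tail estimate and `τ` take two quarters together, boundary
  -- layers one, counting the last one.
  set τ : ℝ := min 1 (η / 4 / (C + η / 4)) with hτ
  have hτ0 : 0 < τ := lt_min one_pos (by positivity)
  have hτ1 : τ ≤ 1 := min_le_left _ _
  have hCτ : (C + η / 4) * (1 + τ) ≤ C + η / 2 := by
    have : (C + η / 4) * τ ≤ (C + η / 4) * (η / 4 / (C + η / 4)) :=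
      mul_le_mul_of_nonneg_left (min_le_right _ _) (by positivity)
    rw [mul_div_cancel₀ _ (by positivity)] at this
    linarith
  -- `L` makes the `2 * d₁` additional layers and the vertical corrections negligible.
  obtain ⟨L, hL⟩ := exists_nat_ge (max 1 (((C + η / 2) * (2 * d₁) + 2 * d₂ * d₁) / (η / 4)))
  have hL1 : (1 : ℝ) ≤ L := (le_max_left _ _).trans hL
  have hL0 : 0 < L := by exact_mod_cast hL1
  have hL2 : (C + η / 2) * (2 * d₁) + 2 * d₂ * d₁ ≤ η / 4 * L := by
    have := (le_max_right _ _).trans hL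
    rwa [div_le_iff₀' (by positivity)] at this
  set Y : ℝ := 2 * K * (L + d₁) + 2 * d₂ with hY
  set cst : ℝ := Real.log (3 * 8 ^ n) with hcst
  have hcst0 : 0 ≤ cst := Real.log_nonneg (by
    have : (1 : ℝ) ≤ 8 ^ n := one_le_pow₀ (by norm_num)
    linarith)
  have hY0 : 0 ≤ Y := by positivity
  set W : ℝ := 4 * Y + 4 * (L + 2 * d₁) + 4 * cst + 3 with hW
  have hW0 : 3 ≤ W := by
    have : (0 : ℝ) ≤ L + 2 * d₁ := by positivity
    linarith
  have hη' : 0 < η / 4 * L := by positivity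
  -- The radius `r` of relevant displacements is at most linear in `B`, so their number is
  -- polynomial and its logarithm is negligible against `B`.
  obtain ⟨B, hB2, hB3⟩ : ∃ B : ℝ, 2 ≤ B ∧
      d₁ * (Real.log 3 + n * (Real.log W + Real.log B)) ≤ η / 4 * L * B := by
    have h1 : ∀ᶠ B : ℝ in atTop, d₁ * n * Real.log B ≤ η / 4 * L / 2 * B := by
      have h2 := (Real.isLittleO_log_id_atTop.const_mul_left (d₁ * n : ℝ)).bound
        (half_pos hη')
      filter_upwards [h2, eventually_ge_atTop 0] with B hB hB0
      simp only [id, Real.norm_eq_abs, abs_of_nonneg hB0] at hB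
      exact (le_abs_self _).trans hB
    have h3 : ∀ᶠ B : ℝ in atTop, d₁ * (Real.log 3 + n * Real.log W) ≤ η / 4 * L / 2 * B := by
      filter_upwards [eventually_ge_atTop (d₁ * (Real.log 3 + n * Real.log W) /
        (η / 4 * L / 2))] with B hB
      rwa [div_le_iff₀' (by positivity)] at hB
    obtain ⟨B, h4, h5, h6⟩ := (h1.and (h3.and (eventually_ge_atTop 2))).exists
    refine ⟨B, h6, ?_⟩
    calc d₁ * (Real.log 3 + n * (Real.log W + Real.log B))
        = d₁ * (Real.log 3 + n * Real.log W) + d₁ * n * Real.log B := by ring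
      _ ≤ η / 4 * L / 2 * B + η / 4 * L / 2 * B := add_le_add h5 h4
      _ = _ := by ring
  have hB0 : 0 < B := by linarith
  set A : ℝ := B * Y + (L + 2 * d₁) with hA
  set r : ℕ := ⌈2 * (A + cst)⌉₊ with hr
  have hr1 : 2 * (A + cst) ≤ r := Nat.le_ceil _
  have hr2 : (2 * r + 1 : ℝ) ≤ W * B := by
    have h1 : (r : ℝ) < 2 * (A + cst) + 1 := Nat.ceil_lt_add_one (by positivity)
    have h2 : (L + 2 * d₁ : ℝ) ≤ (L + 2 * d₁) * B := le_mul_of_one_le_right (by positivity) (by linarith)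
    have h3 : cst ≤ cst * B := le_mul_of_one_le_right hcst0 (by linarith)
    rw [hW]
    linarith
  set D : ℕ := L + 2 * d₁ with hD
  set X : ℝ := B * ((C + η / 4) * (1 + τ) * (D / d₁) + 2 * d₂) with hX
  have hX0 : 0 ≤ X := by positivity
  obtain ⟨k₀, hk₀, H⟩ := cellMoment_typical (d₂ := d₂) hd (by positivity : 0 < η / 4) hB0.le D
  -- Only now is the size of the cells fixed: large enough for the tail estimate, and for the
  -- exponent `2 * (B / k)` to be at most `1`.
  obtain ⟨k, hk⟩ := exists_nat_ge (max k₀ (2 * B))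
  have hkB : 2 * B ≤ k := (le_max_right _ _).trans hk
  have hkr : (0 : ℝ) < k := by linarith
  have hk1 : 0 < k := by exact_mod_cast hkr
  have hk' : (1 + τ) * k ≤ 2 * k := mul_le_mul_of_nonneg_right (by linarith) hkr.le
  have hk'0 : 0 < (1 + τ) * k := by positivity
  obtain ⟨ℓ₁, H⟩ := H ((1 + τ) * k) (((le_max_left _ _).trans hk).trans
    (le_mul_of_one_le_left hkr.le (by linarith))) k hk1 hk' hkB
  have hratio : (1 + τ) * k / k = 1 + τ := mul_div_cancel_right₀ _ hkr.ne'
  rw [hratio, ← hC, ← hX] at H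
  have hq : (0 : ℝ) < (2 * r + 1) ^ n := by positivity
  refine ⟨L, k, B, τ, Real.log 3 + n * Real.log (2 * r + 1) + X, 3 * Real.exp (B * Y),
    max (max ℓ₁ (2 * K * ((1 + τ) * k))) (max k (k * (Y + 1))), hL0, hk1, hB0, hτ0, ?_, ?_, ?_⟩
  · have h1 : 0 ≤ Real.log 3 := Real.log_nonneg (by norm_num)
    have h2 : 0 ≤ Real.log (2 * r + 1) := Real.log_nonneg (by
      have : (0 : ℝ) ≤ r := Nat.cast_nonneg _
      linarith)
    positivity
  · have h1 : Real.log (2 * r + 1) ≤ Real.log W + Real.log B := by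
      rw [← Real.log_mul (by linarith) hB0.ne']
      exact Real.log_le_log (by positivity) hr2
    have h2 : d₁ * (Real.log 3 + n * Real.log (2 * r + 1)) ≤ η / 4 * L * B := by
      refine le_trans (mul_le_mul_of_nonneg_left ?_ hd0.le) hB3
      exact add_le_add le_rfl (mul_le_mul_of_nonneg_left h1 (Nat.cast_nonneg n))
    have h3 : d₁ * X = B * ((C + η / 4) * (1 + τ) * (L + 2 * d₁) + 2 * d₂ * d₁) := by
      rw [hX, hD]; push_cast; field_simp
    have h4 : (C + η / 4) * (1 + τ) * (L + 2 * d₁) ≤ (C + η / 2) * (L + 2 * d₁) :=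
      mul_le_mul_of_nonneg_right hCτ (by positivity)
    have h5 : d₁ * X ≤ B * ((C + 3 * η / 4) * L) := by
      rw [h3]
      refine mul_le_mul_of_nonneg_left ?_ hB0.le
      linarith
    linarith
  · intro ℓ hℓ a ha hvol
    have hℓ1 : ∀ i, ℓ₁ ≤ ℓ i := fun i =>
      ((le_max_left _ _).trans (le_max_left _ _)).trans (hℓ i)
    have hℓ2 : ∀ i, 2 * K * ((1 + τ) * k) ≤ ℓ i := fun i =>
      ((le_max_right _ _).trans (le_max_left _ _)).trans (hℓ i)
    have hℓ3 : ∀ i, k ≤ ℓ i := fun i => by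
      exact_mod_cast ((le_max_left _ _).trans (le_max_right _ _)).trans (hℓ i)
    have hℓ4 : ∀ i, k * (Y + 1) ≤ ℓ i := fun i =>
      ((le_max_right _ _).trans (le_max_right _ _)).trans (hℓ i)
    have hp : (∏ i, ℓ i : ℕ) * (cellProb a : ℝ) ≤ ((1 + τ) * k) ^ d₁ :=
      le_trans (mul_le_mul_of_nonneg_left (cellProb_le ha) (Nat.cast_nonneg _)) hvol
    refine ⟨?_, fun b hb => ?_⟩
    · have h1 := tsum_le_of_small_large (f := cellMoment (cellProb a) (sides ℓ k) (B / k))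
        (A := A) (q := Real.exp X + 1) (r := r) hr1
        (T := {b : EdgeType d₁ d₂ → ℤ | hor b = L})
        (fun b hb => by
          rw [hA, hY]
          exact cellMoment_large hd hk1 hk'0 hk' hB2 (by linarith) hℓ3 hℓ2 hp b hb)
        (fun b hb => by
          by_cases hneg : ∃ i, b (Sum.inl i) < -1
          · refine (cellMoment_back hd hk1 hk'0 hk' hB2 (by linarith) hℓ2 hp hℓ4 b hb hneg).trans ?_
            rw [← ENNReal.ofReal_one]
            exact ENNReal.ofReal_le_ofReal (by linarith [Real.exp_pos X])
          · push Not at hneg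
            exact H ℓ hℓ1 a ha hvol b (by rw [hD, show hor b = L from hb]; push_cast; ring) hneg)
      refine h1.trans ?_
      rw [← ENNReal.ofReal_one, ← ENNReal.ofReal_mul hq.le, ← ENNReal.ofReal_add
        (by positivity) zero_le_one]
      refine ENNReal.ofReal_le_ofReal ?_
      rw [Real.exp_add, Real.exp_add, Real.exp_log (by norm_num), Real.exp_nat_mul,
        Real.exp_log (by positivity)]
      have h2 : (1 : ℝ) ≤ (2 * r + 1) ^ n := one_le_pow₀ (by
        have : (0 : ℝ) ≤ r := Nat.cast_nonneg _
        linarith)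
      have h3 : ((2 * r + 1 : ℝ) ^ n) * 1 ≤ (2 * r + 1) ^ n * Real.exp X :=
        mul_le_mul_of_nonneg_left (Real.one_le_exp hX0) hq.le
      linarith
    · refine (cellMoment_crude hd hk1 hk'0 hk' hB0.le (by linarith) hℓ2 hp b hb).trans
        (ENNReal.ofReal_le_ofReal (mul_le_mul_of_nonneg_left (Real.exp_le_exp.2 ?_)
        (by norm_num)))
      have : 0 ≤ exc (cellTop (sides ℓ k) b) := exc_nonneg _
      have : 0 ≤ B / k * (exc (cellTop (sides ℓ k) b) / 2) := by positivity
      linarith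

end MomentBounds

/-! ### Upper bound for the mean savings -/

section UpperBound

variable {d₁ d₂ : ℕ}

/-- The intensity `a = -log (1 - p)` is equivalent to `p` as `p → 0`. -/
lemma exists_cellProb_eq {p : I} (hp : (p : ℝ) < 1) : ∃ a, 0 ≤ a ∧ cellProb a = p ∧
    (1 - p : ℝ) * a ≤ p := by
  have h0 : 0 < (1 - p : ℝ) := by linarith
  have ha : 0 ≤ -Real.log (1 - p) :=
    neg_nonneg.2 (Real.log_nonpos h0.le (by linarith [p.2.1]))
  refine ⟨-Real.log (1 - p), ha, Subtype.ext ?_, ?_⟩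
  · have := one_sub_cellProb ha
    rw [neg_neg, Real.exp_log h0] at this
    linarith
  · have h := Real.one_sub_inv_le_log_of_pos h0
    have : (1 - p : ℝ) * (1 - (1 - p : ℝ)⁻¹) ≤ (1 - p) * Real.log (1 - p) :=
      mul_le_mul_of_nonneg_left h h0.le
    rw [mul_sub, mul_inv_cancel₀ h0.ne'] at this
    linarith

/-- The vertex at the integer part of a horizontal direction. -/
def horPoint (d₂ : ℕ) (z : Fin d₁ → ℝ) (n : ℕ) : EdgeType d₁ d₂ → ℤ :=
  target (fun i => ⌊n * z i⌋₊) 0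

/-- Let `R = (p * ∏ z i) ^ (1 / d₁)`. Cells of sides about `z i * k / R` turn the direction `z` into
the diagonal and have total intensity about `k ^ d₁`. The path climbs about `n * R * d₁ / k` levels,
hence `m` pieces of `L` levels, and `m * G` divided by the exponent `B / k` is at most `R * (C + η)
* n`. -/
lemma lintegral_savings_le (hd : 1 ≤ d₁) {z : Fin d₁ → ℝ} (hz : ∀ i, 0 < z i) {η : ℝ}
    (hη : 0 < η) : ∃ ε₀ > 0, ∀ p : I, 0 < (p : ℝ) → (p : ℝ) < ε₀ → ∃ K : ℝ, ∀ n : ℕ,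
      ∫⁻ S, ENNReal.ofReal ((hor (horPoint d₂ z n) : ℝ) - ptime S 0 (horPoint d₂ z n))
        ∂bernoulliSet (Edge (EdgeType d₁ d₂)) p ≤
      ENNReal.ofReal ((p * ∏ i, z i) ^ (1 / d₁ : ℝ) * (scoreConst d₁ d₂ + η) * n + K) := by
  obtain ⟨L, k, B, τ, G, F, ℓ₀, hL, hk, hB, hτ, hG, hGC, H⟩ := tsum_cellMoment_le (d₂ := d₂) hd hη
  set C := scoreConst d₁ d₂ with hC
  have hd0 : (0 : ℝ) < d₁ := by exact_mod_cast hd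
  have hkr : (0 : ℝ) < k := by exact_mod_cast hk
  have hLr : (0 : ℝ) < L := by exact_mod_cast hL
  have hP : 0 < ∏ i, z i := Finset.prod_pos fun i _ => hz i
  set σ' : ℝ := min τ 1 / 3 with hσ
  have hm0 : 0 < min τ 1 := lt_min hτ one_pos
  have hσ0 : 0 < σ' := by positivity
  have hσ2 : (1 + σ') ^ 2 ≤ 1 + τ := by
    have h1 : min τ 1 ≤ τ := min_le_left _ _
    have h2 : min τ 1 ≤ 1 := min_le_right _ _
    rw [hσ]
    nlinarith
  -- If `R < ρ`, the sides exceed `ℓ₀` and rounding them up costs a factor at most `1 + σ'`.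
  obtain ⟨ρ, hρ0, hρ⟩ : ∃ ρ : ℝ, 0 < ρ ∧ ∀ i, max ℓ₀ 0 * ρ ≤ z i * k ∧ ρ ≤ σ' * (z i * k) := by
    have hne : (Finset.univ : Finset (Fin d₁)).Nonempty := ⟨⟨0, hd⟩, Finset.mem_univ _⟩
    obtain ⟨i₀, _, hi₀⟩ := Finset.exists_min_image Finset.univ z hne
    have hzk : 0 < z i₀ * k := mul_pos (hz i₀) hkr
    refine ⟨min (z i₀ * k / (max ℓ₀ 0 + 1)) (σ' * (z i₀ * k)), lt_min (by positivity)
      (by positivity), fun i => ?_⟩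
    have h1 : z i₀ * k ≤ z i * k := mul_le_mul_of_nonneg_right (hi₀ i (Finset.mem_univ i)) hkr.le
    have h2 : 0 ≤ max ℓ₀ 0 := le_max_right _ _
    refine ⟨?_, (min_le_right _ _).trans (mul_le_mul_of_nonneg_left h1 hσ0.le)⟩
    refine (mul_le_mul_of_nonneg_left (min_le_left _ _) h2).trans (le_trans ?_ h1)
    rw [mul_div_assoc', div_le_iff₀ (by linarith)]
    nlinarith
  refine ⟨min (ρ ^ d₁ / ∏ i, z i) (min (1 / 2) (σ' / (1 + σ'))), by positivity,
    fun p hp0 hp => ?_⟩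
  have hp1 : p * (∏ i, z i) < ρ ^ d₁ := by
    have := hp.trans_le (min_le_left _ _)
    rwa [lt_div_iff₀ hP] at this
  have hp2 : (p : ℝ) < 1 / 2 := hp.trans_le ((min_le_right _ _).trans (min_le_left _ _))
  have hp3 : (p : ℝ) * (1 + σ') < σ' := by
    have := hp.trans_le ((min_le_right _ _).trans (min_le_right _ _))
    rwa [lt_div_iff₀ (by positivity)] at this
  set R : ℝ := (p * ∏ i, z i) ^ (1 / d₁ : ℝ) with hR
  have hpP : 0 < p * ∏ i, z i := mul_pos hp0 hP
  have hR0 : 0 < R := Real.rpow_pos_of_pos hpP _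
  have hRd : R ^ d₁ = p * ∏ i, z i := by
    rw [hR, one_div, Real.rpow_inv_natCast_pow hpP.le (by omega)]
  have hRρ : R < ρ := by
    refine lt_of_pow_lt_pow_left₀ d₁ hρ0.le ?_
    rwa [hRd]
  obtain ⟨a, ha, hap, ha1⟩ := exists_cellProb_eq (p := p) (by linarith)
  have ha2 : a ≤ p * (1 + σ') := by
    have h1 : 1 ≤ (1 - p : ℝ) * (1 + σ') := by linarith
    calc a ≤ a * ((1 - p : ℝ) * (1 + σ')) := le_mul_of_one_le_right ha h1
      _ = ((1 - p : ℝ) * a) * (1 + σ') := by ring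
      _ ≤ _ := mul_le_mul_of_nonneg_right ha1 (by positivity)
  set ℓ : Fin d₁ → ℕ := fun i => ⌈z i * k / R⌉₊ with hℓ
  have hzk : ∀ i, 0 < z i * k := fun i => mul_pos (hz i) hkr
  have hℓl : ∀ i, z i * k / R ≤ ℓ i := fun i => Nat.le_ceil _
  have hℓp : ∀ i, (0 : ℝ) < ℓ i := fun i => (div_pos (hzk i) hR0).trans_le (hℓl i)
  have hℓu : ∀ i, (ℓ i : ℝ) ≤ z i * k / R * (1 + σ') := fun i => by
    have h1 : (ℓ i : ℝ) < z i * k / R + 1 := Nat.ceil_lt_add_one (div_pos (hzk i) hR0).le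
    have h2 : 1 ≤ z i * k / R * σ' := by
      rw [div_mul_eq_mul_div, one_le_div hR0]
      linarith [(hρ i).2]
    linarith
  have hℓ₀ : ∀ i, ℓ₀ ≤ ℓ i := fun i => by
    refine le_trans ?_ (hℓl i)
    rw [le_div_iff₀ hR0]
    have h1 := (hρ i).1
    have h2 : ℓ₀ * R ≤ max ℓ₀ 0 * R := mul_le_mul_of_nonneg_right (le_max_left _ _) hR0.le
    have h3 : max ℓ₀ 0 * R ≤ max ℓ₀ 0 * ρ :=
      mul_le_mul_of_nonneg_left hRρ.le (le_max_right _ _)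
    linarith
  have hvol : (∏ i, ℓ i : ℕ) * a ≤ ((1 + τ) * k) ^ d₁ := by
    push_cast
    calc (∏ i, (ℓ i : ℝ)) * a ≤ (∏ i, (z i * k / R * (1 + σ'))) * (p * (1 + σ')) := by
          refine mul_le_mul (Finset.prod_le_prod (fun i _ => (hℓp i).le) fun i _ => hℓu i) ha2 ha
            (Finset.prod_nonneg fun i _ => ?_)
          exact mul_nonneg (div_nonneg (hzk i).le hR0.le) (by positivity)
      _ = k ^ d₁ * (1 + σ') ^ (d₁ + 1) := by
          rw [Finset.prod_mul_distrib, Finset.prod_div_distrib, Finset.prod_mul_distrib]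
          simp only [Finset.prod_const, Finset.card_univ, Fintype.card_fin]
          rw [hRd]
          field_simp
          ring
      -- There is one factor `1 + σ'` for each side and one for `a` against `p`; `d₁ + 1 ≤ 2 * d₁`.
      _ ≤ k ^ d₁ * ((1 + σ') ^ 2) ^ d₁ := by
          rw [← pow_mul]
          refine mul_le_mul_of_nonneg_left (pow_le_pow_right₀ (by linarith) (by omega))
            (by positivity)
      _ ≤ k ^ d₁ * (1 + τ) ^ d₁ :=
          mul_le_mul_of_nonneg_left (pow_le_pow_left₀ (by positivity) hσ2 _) (by positivity)
      _ = _ := by rw [mul_pow, mul_comm]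
  obtain ⟨hQ, hF⟩ := H ℓ hℓ₀ a ha hvol
  rw [hap] at hQ hF
  set β : ℝ := B / k with hβ
  have hβ0 : 0 < β := div_pos hB hkr
  refine ⟨1 / β * max F 0, fun n => ?_⟩
  set y := horPoint d₂ z n with hy
  set side : EdgeType d₁ d₂ → ℕ := sides ℓ k with hside
  have hs : ∀ t, 0 < side t := by
    rintro (i | j)
    · exact_mod_cast hℓp i
    · exact hk
  set h : ℕ := ∑ i, ⌊n * z i⌋₊ / ℓ i with hh
  have hhor : hor (cellOf side y) = (h : ℤ) := by
    simp only [hor, cellOf, hy, horPoint, target, Sum.elim_inl, hside, sides, hh]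
    push_cast
    rfl
  set m : ℕ := h / L with hm
  have h1 : m * L ≤ h := Nat.div_mul_le_self h L
  have h2 : h ≤ (m + 1) * L := by
    rw [mul_comm]; exact (Nat.lt_mul_div_succ h hL).le
  have hint := lintegral_exp_savings_le_pow (d₂ := d₂) hp2.le side hs hβ0.le hQ hF y m
    (by rw [hhor]; exact_mod_cast h1) (by rw [hhor]; exact_mod_cast h2)
  -- Since `ℓ i ≥ z i * k / R`, at most `n * R / k` cells are crossed in each horizontal direction.
  have hmn : (m : ℝ) * (k * L) ≤ n * (R * d₁) := by
    have h3 : (h : ℝ) ≤ n * (R * d₁ / k) := by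
      rw [hh]
      push_cast
      calc ∑ i, ((⌊n * z i⌋₊ / ℓ i : ℕ) : ℝ) ≤ ∑ _i : Fin d₁, n * (R / k) := by
            refine Finset.sum_le_sum fun i _ => ?_
            refine Nat.cast_div_le.trans ?_
            have h4 : (⌊n * z i⌋₊ : ℝ) ≤ n * z i :=
              Nat.floor_le (mul_nonneg (Nat.cast_nonneg n) (hz i).le)
            rw [div_le_iff₀ (hℓp i)]
            refine h4.trans ?_
            calc n * z i = n * (R / k) * (z i * k / R) := by field_simp
              _ ≤ _ := mul_le_mul_of_nonneg_left (hℓl i) (by positivity)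
        _ = _ := by
            rw [Finset.sum_const, Finset.card_univ, Fintype.card_fin, nsmul_eq_mul]
            ring
    have h5 : (m * L : ℝ) ≤ h := by exact_mod_cast h1
    calc (m : ℝ) * (k * L) = k * (m * L) := by ring
      _ ≤ k * (n * (R * d₁ / k)) := mul_le_mul_of_nonneg_left (h5.trans h3) hkr.le
      _ = _ := by field_simp
  have hu : m * G / β ≤ R * (C + η) * n := by
    rw [hβ, div_div_eq_mul_div, div_le_iff₀ hB]
    refine le_of_mul_le_mul_right ?_ hLr
    calc m * G * k * L = m * (k * L) * G := by ring
      _ ≤ n * (R * d₁) * G := mul_le_mul_of_nonneg_right hmn hG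
      _ = n * R * (d₁ * G) := by ring
      _ ≤ n * R * ((C + η) * (B * L)) := mul_le_mul_of_nonneg_left hGC (by positivity)
      _ = _ := by ring
  -- Apply `u ≤ exp u` to `u = β * X - m * G`: centring at the logarithm of the moment bound leaves
  -- an error independent of `n`.
  calc ∫⁻ S, ENNReal.ofReal ((hor y : ℝ) - ptime S 0 y) ∂bernoulliSet (Edge (EdgeType d₁ d₂)) p
      ≤ ∫⁻ S, (ENNReal.ofReal (m * G / β) + ENNReal.ofReal (1 / β * Real.exp (-(m * G))) *
          ENNReal.ofReal (Real.exp (β * ((hor y : ℝ) - ptime S 0 y))))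
          ∂bernoulliSet (Edge (EdgeType d₁ d₂)) p := by
        refine lintegral_mono fun S => ?_
        rw [← ENNReal.ofReal_mul (by positivity), ← ENNReal.ofReal_add (by positivity)
          (by positivity)]
        refine ENNReal.ofReal_le_ofReal ?_
        rw [mul_assoc, ← Real.exp_add]
        have h6 := Real.add_one_le_exp (-(m * G) + β * ((hor y : ℝ) - ptime S 0 y))
        have h7 : (hor y : ℝ) - ptime S 0 y =
            m * G / β + 1 / β * (-(m * G) + β * ((hor y : ℝ) - ptime S 0 y)) := by
          field_simp
          ring
        calc (hor y : ℝ) - ptime S 0 y = _ := h7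
          _ ≤ _ := add_le_add le_rfl (mul_le_mul_of_nonneg_left (by linarith) (by positivity))
    _ ≤ ENNReal.ofReal (m * G / β) + ENNReal.ofReal (1 / β * Real.exp (-(m * G))) *
          ENNReal.ofReal (Real.exp (m * G) * max F 0) := by
        rw [lintegral_add_left measurable_const, lintegral_const_mul' _ _ ENNReal.ofReal_ne_top,
          lintegral_const, measure_univ, mul_one]
        refine add_le_add le_rfl (mul_le_mul_right (hint.trans ?_) _)
        rw [ENNReal.ofReal_mul (Real.exp_pos _).le, ← ENNReal.ofReal_pow (Real.exp_pos _).le,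
          ← Real.exp_nat_mul]
        exact mul_le_mul_right (ENNReal.ofReal_le_ofReal (le_max_left _ _)) _
    _ ≤ _ := by
        rw [← ENNReal.ofReal_mul (by positivity), ← ENNReal.ofReal_add (by positivity)
          (by positivity)]
        refine ENNReal.ofReal_le_ofReal (add_le_add hu (le_of_eq ?_))
        rw [mul_assoc, ← mul_assoc (Real.exp _), ← Real.exp_add, neg_add_cancel, Real.exp_zero,
          one_mul]

end UpperBound

/-! ### Lower bound for the mean savings -/

section LowerBound

variable {d₁ d₂ : ℕ}

lemma meanTime_nsmul_le {ι : Type*} [Fintype ι] [DecidableEq ι] (p : I) (y : ι → ℤ) (m : ℕ) :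
    meanTime p 0 (m • y) ≤ m * meanTime p 0 y := by
  have h := (subadditive_meanTime p y).apply_mul_add_le m 1 0
  have h0 := meanTime_le_l1 p (0 : ι → ℤ) 0
  have h1 : l1 (0 - 0 : ι → ℤ) = 0 := by simp [l1]
  rw [h1, Nat.cast_zero] at h0
  simp only [mul_one, add_zero, one_smul, zero_smul] at h
  linarith

lemma hor_corner (N : Fin d₁ → ℕ) : hor (corner N : EdgeType d₁ d₂ → ℤ) = ∑ i, (N i : ℤ) := by
  simp [hor, corner]

lemma l1_corner (N : Fin d₁ → ℕ) : l1 (corner N : EdgeType d₁ d₂ → ℤ) = ∑ i, N i := by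
  simp [l1, corner]

lemma meanTime_corner_le {p : I} {N : Fin d₁ → ℕ} {t : ℝ} (ht : 0 < t)
    (h : ENNReal.ofReal t ≤ ∫⁻ S, dscore S N ∂bernoulliSet (Edge (EdgeType d₁ d₂)) p) :
    meanTime p 0 (corner N : EdgeType d₁ d₂ → ℤ) ≤ (∑ i, N i : ℕ) - t := by
  have h1 := h.trans (lintegral_mono fun S => dscore_le_savings S N)
  have hpt : ∀ S, 0 ≤ (hor (corner N : EdgeType d₁ d₂ → ℤ) : ℝ) -
      ptime S 0 (corner N : EdgeType d₁ d₂ → ℤ) := by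
    intro S
    have h2 := ptime_le_l1 S 0 (corner N : EdgeType d₁ d₂ → ℤ)
    rw [sub_zero, l1_corner] at h2
    rw [hor_corner, sub_nonneg]
    exact_mod_cast h2
  have hi : Integrable (fun S => (hor (corner N : EdgeType d₁ d₂ → ℤ) : ℝ) -
      ptime S 0 (corner N : EdgeType d₁ d₂ → ℤ)) (bernoulliSet (Edge (EdgeType d₁ d₂)) p) :=
    (integrable_const _).sub (integrable_ptime p _ _)
  rw [← ofReal_integral_eq_lintegral_ofReal hi (ae_of_all _ hpt),
    integral_sub (integrable_const _) (integrable_ptime p _ _), integral_const,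
    probReal_univ, one_smul] at h1
  have h3 := ENNReal.ofReal_le_ofReal_iff'.1 h1
  have h4 : ((∑ i, N i : ℕ) : ℝ) = hor (corner N : EdgeType d₁ d₂ → ℤ) := by
    rw [hor_corner]; push_cast; rfl
  rw [h4, meanTime]
  rcases h3 with h3 | h3
  · linarith
  · linarith

/-- An almost optimal cubic box is stretched to sides proportional to `z`, and copies of it are
chained from the origin; the end of the way is completed by a geodesic, which loses no horizontal
progress. -/
lemma meanTime_horPoint_le (hd : 1 ≤ d₁) {z : Fin d₁ → ℝ} (hz : ∀ i, 0 < z i) {c : ℝ}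
    (hc0 : 0 ≤ c) (hc : c < scoreConst d₁ d₂) :
    ∃ ε₀ > 0, ∀ p : I, 0 < (p : ℝ) → (p : ℝ) < ε₀ → ∃ K : ℝ, ∀ n : ℕ,
      meanTime p 0 (horPoint d₂ z n) ≤
        hor (horPoint d₂ z n) - (p * ∏ i, z i) ^ (1 / d₁ : ℝ) * c * n + K := by
  obtain ⟨c', hcc, hc'⟩ := _root_.exists_between hc
  have hc'0 : 0 < c' := hc0.trans_lt hcc
  obtain ⟨n₀, hn₀, lam, hlam, hms⟩ := exists_meanScore_ge hd hc'0.le hc'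
  have hn₀r : (0 : ℝ) < n₀ := by exact_mod_cast hn₀
  have hP : 0 < ∏ i, z i := Finset.prod_pos fun i _ => hz i
  -- A relative slack with `c * (1 + s) ≤ c'`, reserved for rounding the sides up.
  set s : ℝ := (c' - c) / (c + 1) with hs
  have hs0 : 0 < s := div_pos (by linarith) (by linarith)
  have hcs : c * (1 + s) ≤ c' := by
    have h1 : c * s ≤ (c + 1) * s := mul_le_mul_of_nonneg_right (by linarith) hs0.le
    rw [hs, mul_div_cancel₀ _ (by positivity), ← hs] at h1
    linarith
  obtain ⟨ρ, hρ0, hρ⟩ : ∃ ρ : ℝ, 0 < ρ ∧ ∀ i, n₀ * ρ ≤ s * (z i * lam) := by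
    have hne : (Finset.univ : Finset (Fin d₁)).Nonempty := ⟨⟨0, hd⟩, Finset.mem_univ _⟩
    obtain ⟨i₀, _, hi₀⟩ := Finset.exists_min_image Finset.univ z hne
    have hzk : 0 < z i₀ * lam := mul_pos (hz i₀) hlam
    refine ⟨s * (z i₀ * lam) / n₀, by positivity, fun i => ?_⟩
    rw [mul_div_cancel₀ _ hn₀r.ne']
    exact mul_le_mul_of_nonneg_left
      (mul_le_mul_of_nonneg_right (hi₀ i (Finset.mem_univ i)) hlam.le) hs0.le
  refine ⟨min (ρ ^ d₁ / ∏ i, z i) 1, by positivity, fun p hp0 hp => ?_⟩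
  have hp1 : p * (∏ i, z i) < ρ ^ d₁ := by
    have := hp.trans_le (min_le_left _ _)
    rwa [lt_div_iff₀ hP] at this
  set R : ℝ := (p * ∏ i, z i) ^ (1 / d₁ : ℝ) with hR
  have hpP : 0 < p * ∏ i, z i := mul_pos hp0 hP
  have hR0 : 0 < R := Real.rpow_pos_of_pos hpP _
  have hRd : R ^ d₁ = p * ∏ i, z i := by
    rw [hR, one_div, Real.rpow_inv_natCast_pow hpP.le (by omega)]
  have hRρ : R < ρ := by
    refine lt_of_pow_lt_pow_left₀ d₁ hρ0.le ?_
    rwa [hRd]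
  obtain ⟨a, ha, hap, -⟩ := exists_cellProb_eq (p := p) (hp.trans_le (min_le_right _ _))
  have hpa : (p : ℝ) ≤ a := by rw [← hap]; exact cellProb_le ha
  have hzl : ∀ i, 0 < z i * lam := fun i => mul_pos (hz i) hlam
  -- Merging `g i` cells in direction `i` yields a coarse edge with probability at least that of the
  -- cubic box of size `n₀`.
  set g : Fin d₁ → ℕ := fun i => ⌈z i * lam / (n₀ * R)⌉₊ with hg
  have hg0 : ∀ i, 0 < g i := fun i => Nat.ceil_pos.2 (div_pos (hzl i) (by positivity))
  have hvol : (lam / n₀) ^ d₁ ≤ (∏ i, g i : ℕ) * a := by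
    push_cast
    calc (lam / n₀) ^ d₁ = (∏ i, (z i * lam / (n₀ * R))) * p := by
          rw [Finset.prod_div_distrib, Finset.prod_mul_distrib]
          simp only [Finset.prod_const, Finset.card_univ, Fintype.card_fin]
          rw [mul_pow, hRd, div_pow]
          field_simp
      _ ≤ _ := mul_le_mul (Finset.prod_le_prod (fun i _ => (div_pos (hzl i) (by positivity)).le)
          fun i _ => Nat.le_ceil _) hpa hp0.le (Finset.prod_nonneg fun i _ => Nat.cast_nonneg _)
  set N : Fin d₁ → ℕ := g * fun _ => n₀ with hN
  have hscore : ENNReal.ofReal (c' * lam) ≤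
      ∫⁻ S, dscore S N ∂bernoulliSet (Edge (EdgeType d₁ d₂)) p := by
    rw [← hap]
    refine hms.trans (le_trans ?_ (lintegral_dscore_refine (d₂ := d₂) (fun _ => n₀) g hg0 ha
      monotone_id))
    exact lintegral_dscore_mono _ (cellProb_mono (by positivity) hvol) monotone_id
  have hw := meanTime_corner_le (mul_pos hc'0 hlam) hscore
  set w : EdgeType d₁ d₂ → ℤ := corner N with hw'
  set t : ℝ := lam / R * (1 + s) with ht
  have ht0 : 0 < t := by positivity
  have hNt : ∀ i, (N i : ℝ) ≤ z i * t := by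
    intro i
    have h1 : (g i : ℝ) < z i * lam / (n₀ * R) + 1 :=
      Nat.ceil_lt_add_one (div_pos (hzl i) (by positivity)).le
    have h2 : (n₀ : ℝ) ≤ s * (z i * lam) / R := by
      rw [le_div_iff₀ hR0]
      exact (mul_le_mul_of_nonneg_left hRρ.le hn₀r.le).trans (hρ i)
    calc (N i : ℝ) = g i * n₀ := by simp [hN]
      _ ≤ (z i * lam / (n₀ * R) + 1) * n₀ := mul_le_mul_of_nonneg_right h1.le hn₀r.le
      _ = z i * lam / R + n₀ := by field_simp
      _ ≤ z i * lam / R + s * (z i * lam) / R := by linarith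
      _ = _ := by rw [ht]; ring
  refine ⟨c' * lam, fun n => ?_⟩
  set m : ℕ := ⌊n / t⌋₊ with hm
  have hmt : m * t ≤ n := by
    have := Nat.floor_le (div_nonneg (Nat.cast_nonneg n) ht0.le)
    rwa [le_div_iff₀ ht0] at this
  set y := horPoint d₂ z n with hy
  have hle : ∀ i, m * N i ≤ ⌊n * z i⌋₊ := fun i => by
    refine Nat.le_floor ?_
    push_cast
    calc (m : ℝ) * N i ≤ m * (z i * t) := mul_le_mul_of_nonneg_left (hNt i) (Nat.cast_nonneg m)
      _ = m * t * z i := by ring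
      _ ≤ _ := mul_le_mul_of_nonneg_right hmt (hz i).le
  have hl1 : (l1 (y - m • w) : ℝ) = hor y - m * (∑ i, N i : ℕ) := by
    have h3 : (l1 (y - m • w) : ℤ) = hor y - m * (∑ i, N i : ℕ) := by
      rw [l1, hor, Fintype.sum_sum_type]
      push_cast
      have e1 : ∀ i : Fin d₁, |(y - m • w) (Sum.inl i)| = y (Sum.inl i) - m * N i := by
        intro i
        have h4 : ((m * N i : ℕ) : ℤ) ≤ ⌊n * z i⌋₊ := by exact_mod_cast hle i
        push_cast at h4
        simp only [hy, horPoint, target, hw', corner, Pi.sub_apply, Sum.elim_inl,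
          nsmul_eq_mul]
        exact abs_of_nonneg (sub_nonneg.2 h4)
      have e2 : ∀ j : Fin d₂, |(y - m • w) (Sum.inr j)| = 0 := by
        intro j
        simp [hy, horPoint, target, hw', corner]
      simp_rw [e1, e2]
      rw [Finset.sum_const_zero, add_zero, Finset.sum_sub_distrib, Finset.mul_sum]
    exact_mod_cast h3
  have h5 := meanTime_triangle p 0 (m • w) y
  have h6 := meanTime_le_l1 p (m • w) y
  have h7 := (meanTime_nsmul_le p w m).trans (mul_le_mul_of_nonneg_left hw (Nat.cast_nonneg m))
  rw [hl1] at h6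
  have h8 : R * c * n ≤ m * (c' * lam) + c' * lam := by
    have h9 : n / t < m + 1 := Nat.lt_floor_add_one _
    rw [div_lt_iff₀ ht0] at h9
    have h10 : R * t = lam * (1 + s) := by rw [ht]; field_simp
    calc R * c * n ≤ R * c * ((m + 1) * t) := mul_le_mul_of_nonneg_left h9.le (by positivity)
      _ = (m + 1) * lam * (c * (1 + s)) := by
          rw [show R * c * ((m + 1) * t) = c * (m + 1) * (R * t) by ring, h10]; ring
      _ ≤ (m + 1) * lam * c' := mul_le_mul_of_nonneg_left hcs (by positivity)
      _ = _ := by ring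
  linarith

end LowerBound

/-! ### Passage times on the cubic lattice -/

section Lattice

variable {d : ℕ}

/-- An edge of the lattice, described by its lower endpoint and its direction. -/
def latticeEdge (e : Edge (Fin d)) : (lattice d).edgeSet :=
  ⟨s(e.1, e.1 + Pi.single e.2 1), by
    rw [SimpleGraph.mem_edgeSet, lattice_adj_iff]; simp⟩

lemma latticeEdge_injective : Function.Injective (latticeEdge (d := d)) := by
  rintro ⟨x, i⟩ ⟨y, j⟩ h
  have h1 := congrArg Subtype.val h
  simp only [latticeEdge, Sym2.eq_iff] at h1
  rcases h1 with ⟨rfl, h2⟩ | ⟨h2, h3⟩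
  · have h4 := add_left_cancel h2
    have h5 := congrFun h4 i
    rw [Pi.single_eq_same] at h5
    by_cases hij : i = j
    · rw [hij]
    · rw [Pi.single_eq_of_ne hij] at h5
      exact absurd h5 one_ne_zero
  · exfalso
    rw [h2, add_assoc] at h3
    have h4 := congrFun (add_eq_left.1 h3) i
    rw [Pi.add_apply, Pi.single_eq_same, Pi.zero_apply] at h4
    by_cases hij : i = j
    · rw [← hij, Pi.single_eq_same] at h4; omega
    · rw [Pi.single_eq_of_ne hij] at h4; omega

lemma exists_oedge {x y : Fin d → ℤ} (h : (lattice d).Adj x y) :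
    ∃ e : OEdge (Fin d), e.src = x ∧ e.tgt = y := by
  obtain ⟨i, hi, h1⟩ := exists_single_step (k := 0) (lattice_adj_iff.1 h)
  have h2 : y = x + Pi.single i ((y - x) i).sign := by
    rw [← sub_eq_iff_eq_add']
    exact sub_eq_zero.1 (l1_eq_zero.1 h1)
  rcases lt_or_gt_of_ne hi with h3 | h3
  · rw [Int.sign_eq_neg_one_of_neg h3] at h2
    have h4 : y + Pi.single i 1 = x := by
      rw [h2, add_assoc, ← Pi.single_add, neg_add_cancel, Pi.single_zero, add_zero]
    exact ⟨((y, i), false), by simp [OEdge.src, h4], by simp [OEdge.tgt]⟩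
  · rw [Int.sign_eq_one_of_pos h3] at h2
    exact ⟨((x, i), true), by simp [OEdge.src], by simp [OEdge.tgt, h2]⟩

lemma coe_latticeEdge (e : OEdge (Fin d)) :
    (latticeEdge e.1 : Sym2 (Fin d → ℤ)) = s(e.src, e.tgt) := by
  rcases e with ⟨e, _ | _⟩
  · simp [latticeEdge, OEdge.src, OEdge.tgt, Sym2.eq_swap]
  · simp [latticeEdge, OEdge.src, OEdge.tgt]

lemma adj_oedge (e : OEdge (Fin d)) : (lattice d).Adj e.src e.tgt := by
  rw [← SimpleGraph.mem_edgeSet, ← coe_latticeEdge]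
  exact (latticeEdge e.1).2

/-- The free edges of a configuration. -/
def freeEdges (t : (lattice d).edgeSet → ℝ) : Set (Edge (Fin d)) := {e | t (latticeEdge e) = 0}

lemma travelTime_append (t : (lattice d).edgeSet → ℝ) {x y z : Fin d → ℤ}
    (p : (lattice d).Walk x y) (q : (lattice d).Walk y z) :
    travelTime t (p.append q) = travelTime t p + travelTime t q := by
  induction p with
  | nil => simp [travelTime]
  | cons h p ih => simp [travelTime, ih, add_assoc]

variable {t : (lattice d).edgeSet → ℝ}

lemma travelTime_nonneg (ht : ∀ e, t e = 0 ∨ t e = 1) {x y : Fin d → ℤ}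
    (p : (lattice d).Walk x y) : 0 ≤ travelTime t p := by
  induction p with
  | nil => simp [travelTime]
  | cons h p ih =>
    refine add_nonneg ?_ ih
    rcases ht ⟨s(_, _), h⟩ with h | h <;> rw [h]
    exact zero_le_one

lemma exists_walk_le_l1 (ht : ∀ e, t e = 0 ∨ t e = 1) (x y : Fin d → ℤ) :
    ∃ p : (lattice d).Walk x y, travelTime t p ≤ l1 (y - x) := by
  obtain ⟨k, hk⟩ : ∃ k, l1 (y - x) = k := ⟨_, rfl⟩
  rw [hk]
  induction k generalizing x with
  | zero =>
    obtain rfl : y = x := sub_eq_zero.1 (l1_eq_zero.1 hk)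
    exact ⟨.nil, by simp [travelTime]⟩
  | succ k ih =>
    obtain ⟨s, hs, hs'⟩ := exists_unit_step hk
    obtain ⟨p, hp⟩ := ih (x + s) (by rw [← hs']; congr 1; abel)
    have hadj : (lattice d).Adj x (x + s) := lattice_adj_iff.2 (by rwa [add_sub_cancel_left])
    refine ⟨.cons hadj p, ?_⟩
    have : t ⟨s(x, x + s), hadj⟩ ≤ 1 := by
      rcases ht ⟨s(x, x + s), hadj⟩ with h | h <;> rw [h]
      exact zero_le_one
    rw [travelTime]
    push_cast
    linarith

lemma exists_walk_le_jumpCost (ht : ∀ e, t e = 0 ∨ t e = 1) (l : List (OEdge (Fin d)))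
    (hl : ∀ e ∈ l, e.1 ∈ freeEdges t) (x y : Fin d → ℤ) :
    ∃ p : (lattice d).Walk x y, travelTime t p ≤ jumpCost x l y := by
  induction l generalizing x with
  | nil => exact exists_walk_le_l1 ht x y
  | cons e l ih =>
    obtain ⟨p, hp⟩ := exists_walk_le_l1 ht x e.src
    obtain ⟨q, hq⟩ := ih (fun a ha => hl a (List.mem_cons_of_mem _ ha)) e.tgt
    refine ⟨p.append (.cons (adj_oedge e) q), ?_⟩
    have h0 : t ⟨s(e.src, e.tgt), adj_oedge e⟩ = 0 := by
      rw [← show t (latticeEdge e.1) = 0 from hl e List.mem_cons_self]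
      congr 1
      exact Subtype.ext (coe_latticeEdge e).symm
    rw [travelTime_append, travelTime, h0, jumpCost]
    push_cast
    linarith

lemma ptime_le_travelTime (ht : ∀ e, t e = 0 ∨ t e = 1) {x y : Fin d → ℤ}
    (p : (lattice d).Walk x y) : (ptime (freeEdges t) x y : ℝ) ≤ travelTime t p := by
  induction p with
  | nil => simp [travelTime, ptime_self]
  | @cons x x' y h p ih =>
    have h1 : (ptime (freeEdges t) x y : ℝ) ≤ ptime (freeEdges t) x x' +
        ptime (freeEdges t) x' y := by exact_mod_cast ptime_triangle _ _ _ _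
    have h2 : (ptime (freeEdges t) x x' : ℝ) ≤ t ⟨s(x, x'), h⟩ := by
      rcases ht ⟨s(x, x'), h⟩ with h0 | h0
      · obtain ⟨e, rfl, rfl⟩ := exists_oedge h
        have he : e.1 ∈ freeEdges t := by
          change t (latticeEdge e.1) = 0
          rw [← h0]
          congr 1
          exact Subtype.ext (coe_latticeEdge e)
        have h3 := ptime_le (x := e.src) (y := e.tgt) (l := [e]) (S := freeEdges t)
          (by simpa using he)
        have h4 : ptime (freeEdges t) e.src e.tgt = 0 := by simpa [jumpCost] using h3
        rw [h0, h4, Nat.cast_zero]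
      · rw [h0]
        have h3 := ptime_le_l1 (freeEdges t) x x'
        rw [lattice_adj_iff.1 h] at h3
        exact_mod_cast h3
    rw [travelTime]
    linarith

/-- A walk meets edges of cost `0` or `1`: keeping the free ones gives a list of jumps, and
conversely each jump is filled by a geodesic, whose edges cost at most one. -/
lemma passageTime_eq (ht : ∀ e, t e = 0 ∨ t e = 1) (x y : Fin d → ℤ) :
    passageTime t x y = ptime (freeEdges t) x y := by
  obtain ⟨p₀, -⟩ := exists_walk_le_l1 ht x y
  have : Nonempty ((lattice d).Walk x y) := ⟨p₀⟩
  refine le_antisymm ?_ (le_ciInf fun p => ptime_le_travelTime ht p)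
  obtain ⟨l, hl, h⟩ := exists_jumpCost_eq_ptime (freeEdges t) x y
  obtain ⟨p, hp⟩ := exists_walk_le_jumpCost ht l hl x y
  rw [h] at hp
  exact (ciInf_le ⟨0, by rintro _ ⟨q, rfl⟩; exact travelTime_nonneg ht q⟩ p).trans hp

variable {Ω : Type*} [MeasurableSpace Ω] {P : Measure Ω} [IsProbabilityMeasure P] {ε : I}
  {τ : (lattice d).edgeSet → Ω → ℝ}

lemma IsBernoulliBond.measure_preimage (h : IsBernoulliBond P ε τ) (e : (lattice d).edgeSet)
    {A : Set ℝ} (hA : MeasurableSet A) : P (τ e ⁻¹' A) =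
      ENNReal.ofReal ε * A.indicator 1 0 + ENNReal.ofReal (1 - ε) * A.indicator 1 1 := by
  rw [← Measure.map_apply (h.measurable e) hA, h.law e, bernoulliMeasure_def]
  simp only [Measure.coe_add, Pi.add_apply, Measure.coe_nnreal_smul_apply,
    Measure.dirac_apply' _ hA]
  congr 2
  · exact (ENNReal.ofReal_eq_coe_nnreal _).symm
  · exact (ENNReal.ofReal_eq_coe_nnreal _).symm

lemma IsBernoulliBond.ae_zero_or_one (h : IsBernoulliBond P ε τ) :
    ∀ᵐ ω ∂P, ∀ e, τ e ω = 0 ∨ τ e ω = 1 := by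
  have : Countable (lattice d).edgeSet := by
    have : Countable (Sym2 (Fin d → ℤ)) := by unfold Sym2; infer_instance
    infer_instance
  refine ae_all_iff.2 fun e => ?_
  have hA : MeasurableSet ({0, 1}ᶜ : Set ℝ) := (Set.toFinite {0, 1}).measurableSet.compl
  have := h.measure_preimage e hA
  simp only [Set.mem_compl_iff, Set.mem_insert_iff, Set.mem_singleton_iff, true_or, or_true,
    not_true_eq_false, not_false_eq_true, Set.indicator_of_notMem, mul_zero, add_zero] at this
  rw [ae_iff, ← this]
  congr 1

lemma IsBernoulliBond.measurable_freeEdges (h : IsBernoulliBond P ε τ) :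
    Measurable fun ω => freeEdges fun e => τ e ω := by
  refine measurable_set_iff.2 fun e => ?_
  exact measurableSet_setOfPred.1 (h.measurable (latticeEdge e) (measurableSet_singleton 0))

/-- Independence of the edges gives the avoidance probabilities, which determine the law. -/
lemma IsBernoulliBond.map_freeEdges (h : IsBernoulliBond P ε τ) :
    P.map (fun ω => freeEdges fun e => τ e ω) = bernoulliSet (Edge (Fin d)) ε := by
  refine map_eq_bernoulliSet h.measurable_freeEdges fun F => ?_
  have h1 := (h.indep.precomp latticeEdge_injective).measure_inter_preimage_eq_mul
    F (sets := fun _ => {0}ᶜ) fun _ _ => (measurableSet_singleton 0).compl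
  have h2 : ∀ e, P (τ (latticeEdge e) ⁻¹' {0}ᶜ) = ENNReal.ofReal (1 - ε) := by
    intro e
    rw [h.measure_preimage _ (measurableSet_singleton 0).compl]
    simp
  simp_rw [h2, Finset.prod_const] at h1
  rw [← h1]
  congr 1
  ext ω
  simp [freeEdges]

end Lattice

/-! ### Signed permutations of the coordinates -/

section SignedMap

variable {ι κ : Type*} [Fintype ι] [DecidableEq ι] [Fintype κ] [DecidableEq κ]

/-- The signed permutation of coordinates along `e` with signs `s`. -/
def signedMap (e : ι ≃ κ) (s : ι → ℤˣ) (x : ι → ℤ) : κ → ℤ :=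
  fun c => s (e.symm c) * x (e.symm c)

lemma signedMap_sub (e : ι ≃ κ) (s : ι → ℤˣ) (x y : ι → ℤ) :
    signedMap e s (x - y) = signedMap e s x - signedMap e s y := by
  ext c; simp [signedMap, mul_sub]

lemma signedMap_add (e : ι ≃ κ) (s : ι → ℤˣ) (x y : ι → ℤ) :
    signedMap e s (x + y) = signedMap e s x + signedMap e s y := by
  ext c; simp [signedMap, mul_add]

lemma signedMap_single (e : ι ≃ κ) (s : ι → ℤˣ) (i : ι) :
    signedMap e s (Pi.single i 1) = Pi.single (e i) (s i : ℤ) := by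
  ext c
  rcases eq_or_ne c (e i) with rfl | h
  · simp [signedMap]
  · rw [Pi.single_eq_of_ne h, signedMap, Pi.single_eq_of_ne, mul_zero]
    rintro h'
    exact h (by rw [← h', e.apply_symm_apply])

lemma l1_signedMap (e : ι ≃ κ) (s : ι → ℤˣ) (x : ι → ℤ) : l1 (signedMap e s x) = l1 x := by
  rw [l1, l1, ← e.sum_comp]
  simp [signedMap, Int.natAbs_mul]

lemma signedMap_symm (e : ι ≃ κ) (s : ι → ℤˣ) (x : ι → ℤ) :
    signedMap e.symm (fun c => s (e.symm c)) (signedMap e s x) = x := by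
  ext i
  simp only [signedMap, Equiv.symm_symm, Equiv.symm_apply_apply]
  rw [← mul_assoc, ← Units.val_mul, Int.units_mul_self, Units.val_one, one_mul]

/-- The image of an edge by a signed permutation. -/
def signedEdge (e : ι ≃ κ) (s : ι → ℤˣ) (a : Edge ι) : Edge κ :=
  (signedMap e s (if s a.2 = 1 then a.1 else a.1 + Pi.single a.2 1), e a.2)

lemma signedEdge_injective (e : ι ≃ κ) (s : ι → ℤˣ) : Function.Injective (signedEdge e s) := by
  rintro ⟨x, i⟩ ⟨y, j⟩ h
  obtain ⟨h1, h2⟩ := Prod.ext_iff.1 h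
  obtain rfl : i = j := e.injective h2
  have h3 := congrArg (signedMap e.symm fun c => s (e.symm c)) h1
  simp only [signedEdge, signedMap_symm] at h3
  split_ifs at h3
  · rw [h3]
  · rw [add_right_cancel h3]

/-- Where the sign is `-1` the lower end of the image is the image of the upper end, so the
orientation is reversed. -/
lemma ptime_signedMap_le (e : ι ≃ κ) (s : ι → ℤˣ) (S : Set (Edge κ)) (x y : ι → ℤ) :
    ptime S (signedMap e s x) (signedMap e s y) ≤ ptime (signedEdge e s ⁻¹' S) x y := by
  refine ptime_map_le _ (fun x y => by rw [← signedMap_sub, l1_signedMap]) ?_ x y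
  rintro ⟨⟨x, i⟩, b⟩ ha
  rcases Int.units_eq_one_or (s i) with hs | hs
  · refine ⟨(signedEdge e s (x, i), b), ha, ?_, ?_⟩ <;> rcases b with _ | _ <;>
      simp [OEdge.src, OEdge.tgt, signedEdge, hs, signedMap_add, signedMap_single]
  · refine ⟨(signedEdge e s (x, i), !b), ha, ?_, ?_⟩ <;> rcases b with _ | _ <;>
      simp [OEdge.src, OEdge.tgt, signedEdge, hs, signedMap_add, signedMap_single, add_assoc,
        ← Pi.single_add]

lemma meanTime_signedMap_le (p : I) (e : ι ≃ κ) (s : ι → ℤˣ) (y : ι → ℤ) :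
    meanTime p 0 (signedMap e s y) ≤ meanTime p 0 y := by
  have h0 : signedMap e s 0 = 0 := by ext c; simp [signedMap]
  have h1 : meanTime p 0 y =
      ∫ S, (ptime (signedEdge e s ⁻¹' S) 0 y : ℝ) ∂bernoulliSet (Edge κ) p := by
    rw [meanTime, ← map_preimage_bernoulliSet p (signedEdge_injective e s),
      integral_map (measurable_preimage_set _).aemeasurable
        (measurable_ptime_real 0 y).aestronglyMeasurable]
  rw [h1, meanTime]
  refine integral_mono (integrable_ptime p _ _)
    (integrable_of_natCast_le ((measurable_ptime 0 y).comp (measurable_preimage_set _)) (l1 (y - 0))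
      fun S => ptime_le_l1 _ _ _) fun S => ?_
  have := ptime_signedMap_le e s S 0 y
  rw [h0] at this
  exact Nat.cast_le.2 this

lemma meanTime_signedMap (p : I) (e : ι ≃ κ) (s : ι → ℤˣ) (y : ι → ℤ) :
    meanTime p 0 (signedMap e s y) = meanTime p 0 y := by
  refine le_antisymm (meanTime_signedMap_le p e s y) ?_
  have := meanTime_signedMap_le p e.symm (fun c => s (e.symm c)) (signedMap e s y)
  rwa [signedMap_symm] at this

end SignedMap

/-! ### The time constant -/

section TimeConstant

variable {d : ℕ}

/-- The time constant of Bernoulli percolation. -/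
def timeConstant (p : I) (z : Fin d → ℝ) : ℝ := (exists_timeConstant p z).choose

lemma ae_tendsto_timeConstant (p : I) (z : Fin d → ℝ) : ∀ᵐ S ∂bernoulliSet (Edge (Fin d)) p,
    Tendsto (fun n : ℕ => (ptime S 0 (floorVec z n) : ℝ) / n) atTop (𝓝 (timeConstant p z)) :=
  (exists_timeConstant p z).choose_spec

lemma l1_floorVec_le (z : Fin d → ℝ) {n : ℕ} (hn : 0 < n) :
    (l1 (floorVec z n) : ℝ) / n ≤ ∑ i, (|z i| + 1) := by
  have hn' : (1 : ℝ) ≤ n := by exact_mod_cast hn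
  rw [div_le_iff₀ (by linarith), l1_cast, Finset.sum_mul]
  refine Finset.sum_le_sum fun i _ => ?_
  rw [floorVec, abs_le]
  have h1 := Int.floor_le ((n : ℝ) * z i)
  have h2 := Int.lt_floor_add_one ((n : ℝ) * z i)
  have h3 : (n : ℝ) * z i ≤ n * |z i| := mul_le_mul_of_nonneg_left (le_abs_self _) (by linarith)
  have h4 : (n : ℝ) * -z i ≤ n * |z i| :=
    mul_le_mul_of_nonneg_left (neg_le_abs _) (by linarith)
  constructor <;> linarith

variable {Ω : Type*} [MeasurableSpace Ω] {P : Measure Ω} [IsProbabilityMeasure P]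

lemma ptime_floorVec_div_le (S : Set (Edge (Fin d))) (z : Fin d → ℝ) (n : ℕ) :
    (ptime S 0 (floorVec z n) : ℝ) / n ≤ ∑ i, (|z i| + 1) := by
  rcases Nat.eq_zero_or_pos n with rfl | hn
  · rw [Nat.cast_zero, div_zero]
    exact Finset.sum_nonneg fun i _ => by positivity
  · refine le_trans ?_ (l1_floorVec_le z hn)
    refine div_le_div_of_nonneg_right ?_ (Nat.cast_nonneg n)
    have := ptime_le_l1 S 0 (floorVec z n)
    rw [sub_zero] at this
    exact_mod_cast this

/-- Dominated convergence; it reduces the expansion to estimates of mean passage times. -/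
lemma tendsto_meanTime_floorVec (p : I) (z : Fin d → ℝ) :
    Tendsto (fun n : ℕ => meanTime p 0 (floorVec z n) / n) atTop (𝓝 (timeConstant p z)) := by
  have h := tendsto_integral_of_dominated_convergence
    (μ := bernoulliSet (Edge (Fin d)) p) (f := fun _ => timeConstant p z)
    (F := fun (n : ℕ) S => (ptime S 0 (floorVec z n) : ℝ) / n) (fun _ => ∑ i, (|z i| + 1))
    (fun n => ((measurable_ptime_real _ _).div_const _).aestronglyMeasurable)
    (integrable_const _) (fun n => ae_of_all _ fun S => by
      rw [Real.norm_of_nonneg (by positivity)]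
      exact ptime_floorVec_div_le S z n) (ae_tendsto_timeConstant p z)
  simp only [integral_const, probReal_univ, one_smul, integral_div] at h
  exact h

lemma isTimeConstant_timeConstant {ε : I} {τ : (lattice d).edgeSet → Ω → ℝ}
    (h : IsBernoulliBond P ε τ) (z : Fin d → ℝ) : IsTimeConstant P τ z (timeConstant ε z) := by
  set X : Ω → Set (Edge (Fin d)) := fun ω => freeEdges fun e => τ e ω with hX
  have hXm : Measurable X := h.measurable_freeEdges
  have heq : ∀ᵐ ω ∂P, ∀ n : ℕ, passageTime (fun e => τ e ω) 0 (floorPoint z n) =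
      ptime (X ω) 0 (floorVec z n) := by
    filter_upwards [h.ae_zero_or_one] with ω hω n
    exact passageTime_eq hω _ _
  have hlim : ∀ᵐ ω ∂P, Tendsto (fun n : ℕ => (ptime (X ω) 0 (floorVec z n) : ℝ) / n) atTop
      (𝓝 (timeConstant ε z)) := by
    have := ae_tendsto_timeConstant ε z
    rw [← h.map_freeEdges] at this
    exact ae_of_ae_map hXm.aemeasurable this
  have hm : ∀ n, Measurable fun ω => (ptime (X ω) 0 (floorVec z n) : ℝ) := fun n =>
    (measurable_ptime_real _ _).comp hXm
  refine ⟨?_, fun n => ?_, ?_⟩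
  · filter_upwards [heq, hlim] with ω h1 h2
    simpa only [h1] using h2
  · refine Integrable.congr (f := fun ω => (ptime (X ω) 0 (floorVec z n) : ℝ))
      (integrable_of_natCast_le ((measurable_ptime 0 (floorVec z n)).comp hXm) _
        fun ω => ptime_le_l1 _ _ _) ?_
    filter_upwards [heq] with ω h1
    exact (h1 n).symm
  · have h1 : ∀ n : ℕ, eLpNorm (fun ω => passageTime (fun e => τ e ω) 0 (floorPoint z n) / n -
        timeConstant ε z) 1 P = ∫⁻ ω, ENNReal.ofReal
          |(ptime (X ω) 0 (floorVec z n) : ℝ) / n - timeConstant ε z| ∂P := by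
      intro n
      rw [eLpNorm_one_eq_lintegral_enorm]
      refine lintegral_congr_ae ?_
      filter_upwards [heq] with ω h1
      rw [h1, Real.enorm_eq_ofReal_abs]
    simp_rw [h1]
    have h2 := tendsto_lintegral_of_dominated_convergence (μ := P)
      (F := fun (n : ℕ) ω => ENNReal.ofReal
        |(ptime (X ω) 0 (floorVec z n) : ℝ) / n - timeConstant ε z|) (f := fun _ => 0)
      (fun _ => ENNReal.ofReal (∑ i, (|z i| + 1) + |timeConstant ε z|))
      (fun n => (((hm n).div_const _).sub_const _).abs.ennreal_ofReal)
      (fun n => ae_of_all _ fun ω => ENNReal.ofReal_le_ofReal ?_) (by simp) ?_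
    · simpa using h2
    · refine (abs_sub _ _).trans (add_le_add ?_ le_rfl)
      rw [abs_of_nonneg (by positivity)]
      exact ptime_floorVec_div_le _ z n
    · filter_upwards [hlim] with ω h3
      have h4 := (h3.sub_const (timeConstant ε z)).abs
      rw [sub_self, abs_zero] at h4
      simpa using ENNReal.tendsto_ofReal h4

end TimeConstant

/-! ### Expansion of the time constant -/

section Expansion

variable {d : ℕ}

lemma exists_coordinates (z : Fin d → ℝ) :
    ∃ e : EdgeType (numNonzero z) (numZero z) ≃ Fin d,
      (∀ i, z (e (Sum.inl i)) ≠ 0) ∧ ∀ j, z (e (Sum.inr j)) = 0 := by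
  classical
  have h1 : Nat.card {i | z i ≠ 0} = numNonzero z := Nat.card_coe_set_eq _
  have h2 : Nat.card {i // ¬z i ≠ 0} = numZero z := by
    have : {i | z i = 0} = {i | ¬z i ≠ 0} := by ext; simp
    rw [numZero, this]
    exact Nat.card_coe_set_eq _
  let e₁ : Fin (numNonzero z) ≃ {i // z i ≠ 0} := (Finite.equivFinOfCardEq h1).symm
  let e₂ : Fin (numZero z) ≃ {i // ¬z i ≠ 0} := (Finite.equivFinOfCardEq h2).symm
  refine ⟨(Equiv.sumCongr e₁ e₂).trans (Equiv.sumCompl fun i => z i ≠ 0), fun i => ?_, fun j => ?_⟩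
  · simpa using (e₁ i).2
  · simpa using (e₂ j).2

lemma numNonzero_pos {z : Fin d → ℝ} (hz : z ≠ 0) : 1 ≤ numNonzero z := by
  obtain ⟨i, hi⟩ := Function.ne_iff.1 hz
  exact (Set.ncard_pos (Set.toFinite _)).2 ⟨i, hi⟩

lemma le_of_tendsto_div {u : ℕ → ℝ} {m a K : ℝ}
    (hu : Tendsto (fun n : ℕ => u n / n) atTop (𝓝 m)) (h : ∀ n, u n ≤ a * n + K) : m ≤ a := by
  have h1 : Tendsto (fun n : ℕ => a + K / n) atTop (𝓝 (a + 0)) :=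
    tendsto_const_nhds.add (tendsto_const_div_atTop_nhds_zero_nat K)
  rw [add_zero] at h1
  refine le_of_tendsto_of_tendsto hu h1 ?_
  filter_upwards [eventually_gt_atTop 0] with n hn
  have hn : (0 : ℝ) < n := by exact_mod_cast hn
  rw [div_le_iff₀ hn, add_mul, div_mul_cancel₀ _ hn.ne']
  exact h n

/-- Discarding the negative part of the savings only helps here. -/
lemma meanTime_ge_of_lintegral_le {d₁ d₂ : ℕ} {p : I} {y : EdgeType d₁ d₂ → ℤ} {t : ℝ} (ht : 0 ≤ t)
    (h : ∫⁻ S, ENNReal.ofReal ((hor y : ℝ) - ptime S 0 y)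
      ∂bernoulliSet (Edge (EdgeType d₁ d₂)) p ≤ ENNReal.ofReal t) :
    (hor y : ℝ) - t ≤ meanTime p 0 y := by
  have hi : Integrable (fun S => (hor y : ℝ) - ptime S 0 y)
      (bernoulliSet (Edge (EdgeType d₁ d₂)) p) :=
    (integrable_const _).sub (integrable_ptime p _ _)
  have h1 := integral_eq_lintegral_pos_part_sub_lintegral_neg_part hi
  rw [integral_sub (integrable_const _) (integrable_ptime p _ _), integral_const,
    probReal_univ, one_smul] at h1
  have h2 := ENNReal.toReal_le_of_le_ofReal ht h
  have h3 : 0 ≤ (∫⁻ S, ENNReal.ofReal (-((hor y : ℝ) - ptime S 0 y))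
    ∂bernoulliSet (Edge (EdgeType d₁ d₂)) p).toReal := ENNReal.toReal_nonneg
  rw [meanTime]
  linarith

variable {z : Fin d → ℝ} {e : EdgeType (numNonzero z) (numZero z) ≃ Fin d}

/-- Signed permutations preserve the law and bring the direction to positive horizontal coordinates
followed by zeros. Integer parts of opposite numbers are opposite up to one, whence an error of at
most one per coordinate. -/
lemma abs_meanTime_floorVec_sub_le (he : ∀ j, z (e (Sum.inr j)) = 0) (p : I) (n : ℕ) :
    |meanTime p 0 (floorVec z n) -
      meanTime p 0 (horPoint (numZero z) (fun i => |z (e (Sum.inl i))|) n)| ≤ d := by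
  set s : EdgeType (numNonzero z) (numZero z) → ℤˣ := fun t => if 0 ≤ z (e t) then 1 else -1
  set y := horPoint (numZero z) (fun i => |z (e (Sum.inl i))|) n with hy
  rw [← meanTime_signedMap p e s y]
  have h1 : l1 (floorVec z n - signedMap e s y) ≤ d := by
    rw [l1]
    refine (Finset.sum_le_card_nsmul _ _ 1 fun c _ => ?_).trans (by simp)
    obtain ⟨t, rfl⟩ := e.surjective c
    simp only [Pi.sub_apply, floorVec, signedMap, Equiv.symm_apply_apply]
    rcases t with i | j
    · have hyi : y (Sum.inl i) = ⌊(n : ℝ) * |z (e (Sum.inl i))|⌋ := by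
        simp only [hy, horPoint, target, Sum.elim_inl]
        exact Int.natCast_floor_eq_floor (by positivity)
      rw [hyi]
      by_cases h0 : 0 ≤ z (e (Sum.inl i))
      · simp [s, h0, abs_of_nonneg h0]
      · simp only [s, h0, if_false, abs_of_neg (not_le.1 h0)]
        have h2 := Int.floor_le ((n : ℝ) * z (e (Sum.inl i)))
        have h3 := Int.lt_floor_add_one ((n : ℝ) * z (e (Sum.inl i)))
        have h4 := Int.floor_le ((n : ℝ) * -z (e (Sum.inl i)))
        have h5 := Int.lt_floor_add_one ((n : ℝ) * -z (e (Sum.inl i)))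
        generalize ⌊(n : ℝ) * z (e (Sum.inl i))⌋ = a at *
        generalize ⌊(n : ℝ) * -z (e (Sum.inl i))⌋ = b at *
        have h6 : ((a + b : ℤ) : ℝ) ≤ 0 := by push_cast; linarith
        have h7 : (-2 : ℝ) < ((a + b : ℤ) : ℝ) := by push_cast; linarith
        have h6 : a + b ≤ 0 := by exact_mod_cast h6
        have h7 : -2 < a + b := by exact_mod_cast h7
        simp only [Units.val_neg, Units.val_one]
        omega
    · simp [he, hy, horPoint, target]
  refine le_trans ?_ (Nat.cast_le.2 h1)
  have h2 := meanTime_triangle p 0 (floorVec z n) (signedMap e s y)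
  have h3 := meanTime_triangle p 0 (signedMap e s y) (floorVec z n)
  have h4 := meanTime_le_l1 p (floorVec z n) (signedMap e s y)
  have h5 := meanTime_le_l1 p (signedMap e s y) (floorVec z n)
  rw [l1_sub_comm] at h4
  rw [abs_le]
  constructor <;> linarith

lemma l1norm_eq (he : ∀ j, z (e (Sum.inr j)) = 0) : l1norm z = ∑ i, |z (e (Sum.inl i))| := by
  rw [l1norm, ← e.sum_comp, Fintype.sum_sum_type]
  simp [he]

lemma rpow_mul_geomMean (he : ∀ i, z (e (Sum.inl i)) ≠ 0) (he' : ∀ j, z (e (Sum.inr j)) = 0)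
    {ε : ℝ} (hε : 0 ≤ ε) : (ε * ∏ i, |z (e (Sum.inl i))|) ^ (1 / numNonzero z : ℝ) =
      geomMean z * ε ^ (1 / numNonzero z : ℝ) := by
  rw [Real.mul_rpow hε (Finset.prod_nonneg fun i _ => abs_nonneg _), mul_comm,
    ← Real.finsetProd_rpow _ _ fun i _ => abs_nonneg _]
  congr 1
  rw [geomMean, Finset.prod_filter, ← e.prod_comp, Fintype.prod_sum_type]
  simp [he, he']

lemma geomMean_pos (z : Fin d → ℝ) : 0 < geomMean z :=
  Finset.prod_pos fun _ hi => Real.rpow_pos_of_pos (abs_pos.2 (Finset.mem_filter.1 hi).2) _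

lemma abs_hor_horPoint_sub_le (he : ∀ j, z (e (Sum.inr j)) = 0) (n : ℕ) :
    |(hor (horPoint (numZero z) (fun i => |z (e (Sum.inl i))|) n) : ℝ) - l1norm z * n| ≤
      numNonzero z := by
  rw [l1norm_eq he, horPoint, hor_target, Finset.sum_mul]
  push_cast
  rw [← Finset.sum_sub_distrib]
  refine (Finset.abs_sum_le_sum_abs _ _).trans
    ((Finset.sum_le_card_nsmul _ _ 1 fun i _ => ?_).trans (by simp))
  have h1 := Nat.floor_le (by positivity : 0 ≤ (n : ℝ) * |z (e (Sum.inl i))|)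
  have h2 := Nat.lt_floor_add_one ((n : ℝ) * |z (e (Sum.inl i))|)
  rw [abs_le]
  constructor <;> linarith

/-- For fixed `ε`, both bounds on the mean times are affine in `n`; dividing by `n` removes the
constants, which depend on `ε`. -/
theorem isLittleO_timeConstant (hz : z ≠ 0) {μ : ℝ → ℝ}
    (hμ : ∀ p : I, μ p = timeConstant p z) :
    (fun ε : ℝ => μ ε - (l1norm z - scoreConst (numNonzero z) (numZero z) * geomMean z *
      ε ^ ((1 : ℝ) / numNonzero z))) =o[𝓝[>] 0] fun ε : ℝ => ε ^ ((1 : ℝ) / numNonzero z) := by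
  obtain ⟨e, he, he'⟩ := exists_coordinates z
  have hd := numNonzero_pos hz
  set C := scoreConst (numNonzero z) (numZero z) with hC
  have hC0 : 0 < C := scoreConst_pos hd
  have hγ := geomMean_pos z
  refine isLittleO_iff.2 fun c hc => ?_
  -- Tuned so that the error `R * η` equals `c * ε ^ (1 / d₁)`.
  set η : ℝ := c / geomMean z with hη
  have hη0 : 0 < η := div_pos hc hγ
  have hzp : ∀ i, 0 < |z (e (Sum.inl i))| := fun i => abs_pos.2 (he i)
  obtain ⟨ε₁, hε₁, H₁⟩ := lintegral_savings_le (d₂ := numZero z) hd hzp hη0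
  obtain ⟨ε₂, hε₂, H₂⟩ := meanTime_horPoint_le (d₂ := numZero z) hd hzp
    (c := max (C - η) 0) (le_max_right _ _) (max_lt (by linarith) hC0)
  have hmem : Set.Ioo (0 : ℝ) (min 1 (min ε₁ ε₂)) ∈ 𝓝[>] (0 : ℝ) :=
    Ioo_mem_nhdsGT (lt_min one_pos (lt_min hε₁ hε₂))
  filter_upwards [hmem] with ε hε
  obtain ⟨hε0, hε'⟩ := hε
  have hε1 : ε < 1 := hε'.trans_le (min_le_left _ _)
  obtain ⟨p, rfl⟩ : ∃ p : I, (p : ℝ) = ε := ⟨⟨ε, hε0.le, hε1.le⟩, rfl⟩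
  obtain ⟨K₁, H₁⟩ := H₁ p hε0 (hε'.trans_le ((min_le_right _ _).trans (min_le_left _ _)))
  obtain ⟨K₂, H₂⟩ := H₂ p hε0 (hε'.trans_le ((min_le_right _ _).trans (min_le_right _ _)))
  rw [rpow_mul_geomMean he he' hε0.le] at H₁ H₂
  set q : ℝ := (p : ℝ) ^ (1 / numNonzero z : ℝ) with hq
  have hq0 : 0 < q := Real.rpow_pos_of_pos hε0 _
  set R := geomMean z * q with hR
  have hR0 : 0 < R := mul_pos hγ hq0
  have hlim := tendsto_meanTime_floorVec p z
  rw [← hμ] at hlim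
  have hup : μ p ≤ l1norm z - R * max (C - η) 0 := by
    refine le_of_tendsto_div hlim (K := K₂ + d + numNonzero z) fun n => ?_
    have h1 := (abs_le.1 (abs_meanTime_floorVec_sub_le he' p n)).2
    have h2 := (abs_le.1 (abs_hor_horPoint_sub_le he' n)).2
    have h3 := H₂ n
    linarith
  have hlow : -μ p ≤ -(l1norm z - R * (C + η)) := by
    have hlim' : Tendsto (fun n : ℕ => -meanTime p 0 (floorVec z n) / n) atTop (𝓝 (-μ p)) := by
      simpa only [neg_div] using hlim.neg
    refine le_of_tendsto_div hlim' (K := max K₁ 0 + d + numNonzero z)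
      fun n => ?_
    have h1 := (abs_le.1 (abs_meanTime_floorVec_sub_le he' p n)).1
    have h2 := (abs_le.1 (abs_hor_horPoint_sub_le he' n)).1
    have h3 := meanTime_ge_of_lintegral_le (t := R * (C + η) * n + max K₁ 0) (by positivity)
      ((H₁ n).trans (ENNReal.ofReal_le_ofReal (add_le_add le_rfl (le_max_left _ _))))
    linarith
  have h1 : R * (C - η) ≤ R * max (C - η) 0 := mul_le_mul_of_nonneg_left (le_max_left _ _) hR0.le
  have h2 : R * η = c * q := by
    rw [hR, hη]; field_simp
  have h3 : C * geomMean z * q = R * C := by rw [hR]; ring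
  rw [Real.norm_eq_abs, Real.norm_of_nonneg hq0.le, h3, abs_le]
  constructor <;> linarith

end Expansion

/-! ### Discretization of the Poisson model -/

section Poisson

variable {d₁ d₂ : ℕ}

/-- The cell of mesh `h` attached to an edge. -/
def cell (h : ℝ) (e : Edge (EdgeType d₁ d₂)) : Set (Position d₁ d₂) :=
  (Set.univ.pi fun i => Set.Ico (h * e.1 (Sum.inl i)) (h * (e.1 (Sum.inl i) + 1))) ×ˢ {verPart e.1}

lemma mem_cell {h : ℝ} {e : Edge (EdgeType d₁ d₂)} {x : Position d₁ d₂} : x ∈ cell h e ↔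
    (∀ i, h * e.1 (Sum.inl i) ≤ x.1 i ∧ x.1 i < h * (e.1 (Sum.inl i) + 1)) ∧ x.2 = verPart e.1 := by
  simp [cell, Set.mem_prod, Set.mem_pi]

/-- The edges whose cell contains a particle of the type of the edge. -/
def cellSet (h : ℝ) (X : EdgeType d₁ d₂ → Set (Position d₁ d₂)) : Set (Edge (EdgeType d₁ d₂)) :=
  {e | (X e.2 ∩ cell h e).Nonempty}

/-- Choose a particle in each occupied cell: particles of strictly ordered cells are strictly
ordered, and vertical data are unchanged. -/
lemma dscore_cellSet_le_score {h : ℝ} (hh : 0 < h) (X : EdgeType d₁ d₂ → Set (Position d₁ d₂))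
    {N : ℕ} {z : Fin d₁ → ℝ} (hz : ∀ i, h * N ≤ z i) :
    dscore (cellSet h X) (fun _ => N) ≤ score X z := by
  refine iSup₂_le fun l hl => ?_
  choose! pt hpt using fun (e : Edge (EdgeType d₁ d₂)) (he : e ∈ cellSet h X) => he
  have hcell : ∀ e ∈ l, (∀ i, h * e.1 (Sum.inl i) ≤ (pt e).1 i ∧
      (pt e).1 i < h * (e.1 (Sum.inl i) + 1)) ∧ (pt e).2 = verPart e.1 := fun e he =>
    mem_cell.1 (hpt e (hl.mem e he)).2
  set w : List (Particle d₁ d₂) := l.map fun e => (pt e, e.2) with hw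
  have hmono : IsMonotoneSeq X z w := by
    refine ⟨?_, ?_, ?_⟩
    · intro a ha
      obtain ⟨e, he, rfl⟩ := List.mem_map.1 ha
      exact (hpt e (hl.mem e he)).1
    · intro a ha i
      obtain ⟨e, he, rfl⟩ := List.mem_map.1 ha
      obtain ⟨h1, h2⟩ := hl.bounds e he i
      obtain ⟨h3, h4⟩ := (hcell e he).1 i
      have h1 : (0 : ℝ) ≤ e.1 (Sum.inl i) := by exact_mod_cast h1
      have h2 : (e.1 (Sum.inl i) : ℝ) + 1 ≤ N := by exact_mod_cast h2
      exact ⟨(mul_nonneg hh.le h1).trans h3,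
        h4.trans_le ((mul_le_mul_of_nonneg_left h2 hh.le).trans (hz i))⟩
    · rw [hw, List.pairwise_map]
      refine List.Pairwise.imp_of_mem ?_ hl.increasing
      intro a b ha hb hab i
      have h1 : (a.1 (Sum.inl i) : ℝ) + 1 ≤ b.1 (Sum.inl i) := by exact_mod_cast hab i
      exact (((hcell a ha).1 i).2.trans_le (mul_le_mul_of_nonneg_left h1 hh.le)).trans_le
        ((hcell b hb).1 i).1
  have hvert : verticalLength (l.map particleOf) = verticalLength w :=
    verticalLength_map_eq fun e he => ⟨(hcell e he).2.symm, rfl⟩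
  refine le_iSup₂_of_le w hmono ?_
  rw [hvert, show l.length = w.length by simp [hw], ← ENNReal.ofReal_natCast]
  rcases le_total w.length (verticalLength w) with h1 | h1
  · rw [Nat.sub_eq_zero_of_le h1]
    simp
  · rw [Nat.cast_sub h1]

lemma eventually_pairwise {α β : Type*} {f : Filter β} {R : β → α → α → Prop} {w : List α}
    (h : w.Pairwise fun a b => ∀ᶠ n in f, R n a b) : ∀ᶠ n in f, w.Pairwise (R n) := by
  induction w with
  | nil => simp
  | cons a w ih =>
    rw [List.pairwise_cons] at h
    simp only [List.pairwise_cons]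
    exact ((List.finite_toSet w).eventually_all.2 h.1).and (ih h.2)

/-- The edge whose cell contains a particle. -/
def edgeAt (h : ℝ) (a : Particle d₁ d₂) : Edge (EdgeType d₁ d₂) :=
  (Sum.elim (fun i => ⌊a.1.1 i / h⌋) a.1.2, a.2)

/-- A monotone sequence is finite and has positive gaps, so a fine enough mesh puts its particles in
strictly ordered cells. No uniformity is needed, since only a lower limit is claimed. -/
lemma score_le_liminf (X : EdgeType d₁ d₂ → Set (Position d₁ d₂)) {l : ℝ} (hl : 0 < l) :
    score X (l • fun _ => 1) ≤
      liminf (fun N : ℕ => dscore (cellSet (l / N) X) fun _ => N) atTop := by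
  refine iSup₂_le fun w hw => le_liminf_of_le (by isBoundedDefault) ?_
  have hgap : ∀ᶠ N : ℕ in atTop, w.Pairwise fun a b =>
      ∀ i, ⌊a.1.1 i / (l / N)⌋ < ⌊b.1.1 i / (l / N)⌋ := by
    refine eventually_pairwise (hw.2.2.imp fun {a b} hab => eventually_all.2 fun i => ?_)
    have h1 : 0 < b.1.1 i - a.1.1 i := sub_pos.2 (hab i)
    filter_upwards [eventually_gt_atTop 0,
      tendsto_natCast_atTop_atTop.eventually_ge_atTop (l / (b.1.1 i - a.1.1 i))] with N hN hN'
    have hN0 : (0 : ℝ) < N := by exact_mod_cast hN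
    rw [div_le_iff₀ h1] at hN'
    rw [Int.lt_iff_add_one_le, Int.le_floor]
    push_cast
    have h2 := Int.floor_le (a.1.1 i / (l / N))
    have h3 : 1 ≤ (b.1.1 i - a.1.1 i) / (l / N) := by
      rw [one_le_div (by positivity), div_le_iff₀ hN0, mul_comm]
      exact hN'
    rw [sub_div] at h3
    linarith
  filter_upwards [hgap, eventually_gt_atTop 0] with N hN hN0
  have hN0 : (0 : ℝ) < N := by exact_mod_cast hN0
  have hh : 0 < l / N := div_pos hl hN0
  have hinc : IsIncreasing (cellSet (l / N) X) (fun _ => N) (w.map (edgeAt (l / N))) := by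
    refine ⟨?_, ?_, ?_⟩
    · intro e he
      obtain ⟨a, ha, rfl⟩ := List.mem_map.1 he
      refine ⟨a.1, hw.1 a ha, mem_cell.2 ⟨fun i => ?_, rfl⟩⟩
      simp only [edgeAt, Sum.elim_inl]
      constructor
      · rw [← le_div_iff₀' hh]; exact Int.floor_le _
      · rw [← div_lt_iff₀' hh]; exact Int.lt_floor_add_one _
    · intro e he i
      obtain ⟨a, ha, rfl⟩ := List.mem_map.1 he
      obtain ⟨h1, h2⟩ := hw.2.1 a ha i
      simp only [Pi.smul_apply, smul_eq_mul, mul_one] at h2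
      simp only [edgeAt, Sum.elim_inl]
      refine ⟨Int.floor_nonneg.2 (div_nonneg h1 hh.le), Int.floor_lt.2 ?_⟩
      rw [div_lt_iff₀ hh, Int.cast_natCast, mul_div_cancel₀ _ hN0.ne']
      exact h2
    · rw [List.pairwise_map]
      exact hN
  have hvert : verticalLength ((w.map (edgeAt (l / N))).map particleOf) = verticalLength w := by
    rw [List.map_map]
    conv_rhs => rw [← List.map_id w]
    exact verticalLength_map_eq fun a _ => ⟨rfl, rfl⟩
  have h3 := le_dscore hinc
  rw [hvert, List.length_map] at h3
  refine le_trans ?_ h3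
  rw [← ENNReal.ofReal_natCast]
  refine ENNReal.ofReal_le_ofReal ?_
  rw [sub_le_iff_le_add]
  exact_mod_cast (by omega : w.length ≤ w.length - verticalLength w + verticalLength w)

lemma measurableSet_cell (h : ℝ) (e : Edge (EdgeType d₁ d₂)) : MeasurableSet (cell h e) :=
  (MeasurableSet.univ_pi fun _ => measurableSet_Ico).prod (measurableSet_singleton _)

lemma measure_cell {h : ℝ} (hh : 0 ≤ h) (e : Edge (EdgeType d₁ d₂)) :
    (volume : Measure (Fin d₁ → ℝ)).prod (Measure.count : Measure (Fin d₂ → ℤ)) (cell h e) =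
      ENNReal.ofReal (h ^ d₁) := by
  have h1 : ∀ i, h * ((e.1 (Sum.inl i) : ℝ) + 1) - h * e.1 (Sum.inl i) = h := fun i => by ring
  rw [cell, Measure.prod_prod, Measure.count_singleton, mul_one, Real.volume_pi_Ico]
  simp only [h1, Finset.prod_const, Finset.card_univ, Fintype.card_fin]
  rw [ENNReal.ofReal_pow hh]

lemma disjoint_cell {h : ℝ} (hh : 0 < h) {e e' : Edge (EdgeType d₁ d₂)} (ht : e.2 = e'.2)
    (hne : e ≠ e') : Disjoint (cell h e) (cell h e') := by
  refine Set.disjoint_left.2 fun x hx hx' => hne (Prod.ext ?_ ht)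
  obtain ⟨h1, h2⟩ := mem_cell.1 hx
  obtain ⟨h3, h4⟩ := mem_cell.1 hx'
  ext (i | j)
  · have h5 : ∀ a : ℤ, h * a ≤ x.1 i ∧ x.1 i < h * (a + 1) → ⌊x.1 i / h⌋ = a := fun a ha => by
      rw [Int.floor_eq_iff, le_div_iff₀' hh, div_lt_iff₀' hh]
      exact ha
    rw [← h5 _ (h1 i), ← h5 _ (h3 i)]
  · exact congrFun (h2.symm.trans h4) j

variable {Ω : Type*} [MeasurableSpace Ω] {P : Measure Ω} [IsProbabilityMeasure P]

lemma IsPoissonProcess.measure_inter_eq_empty {E : Type*} [MeasurableSpace E] {ν : Measure E}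
    {ξ : Ω → Set E} (h : IsPoissonProcess P ν ξ) {B : Set E} (hB : MeasurableSet B) {r : ℝ}
    (hr : 0 ≤ r) (hν : ν B = ENNReal.ofReal r) :
    P {ω | ξ ω ∩ B = ∅} = ENNReal.ofReal (Real.exp (-r)) := by
  have h1 := h.law B hB (by rw [hν]; exact ENNReal.ofReal_ne_top)
  have h2 : {ω | ξ ω ∩ B = ∅} = (fun ω => (ξ ω ∩ B).encard) ⁻¹' {0} := by
    ext ω; simp [Set.encard_eq_zero]
  have h3 : (fun n : ℕ => (n : ℕ∞)) ⁻¹' {0} = {0} := by ext n; simp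
  rw [h2, ← Measure.map_apply (h.measurable B hB) (measurableSet_singleton _), h1,
    Measure.map_apply measurable_from_top (measurableSet_singleton _), h3,
    poissonMeasure_singleton, hν, show (ENNReal.ofReal r).toNNReal = r.toNNReal from rfl,
    Real.coe_toNNReal r hr]
  simp

variable {ξ : EdgeType d₁ d₂ → Ω → Set (Position d₁ d₂)}

lemma IsPoissonModel.measurable_cellSet (hξ : IsPoissonModel P ξ) (h : ℝ) :
    Measurable fun ω => cellSet h fun j => ξ j ω := by
  refine measurable_set_iff.2 fun e => measurableSet_setOfPred.1 ?_
  have h1 : {ω | e ∈ cellSet h fun j => ξ j ω} =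
      (fun ω => (ξ e.2 ω ∩ cell h e).encard) ⁻¹' {0}ᶜ := by
    ext ω; simp [cellSet, Set.nonempty_iff_ne_empty]
  rw [h1]
  exact (hξ.poisson e.2).measurable _ (measurableSet_cell h e) (measurableSet_singleton _).compl

/-- For each type, avoiding the edges of `F` of that type means that a finite union of disjoint
cells is empty, with exponential probability; the types are independent. -/
lemma IsPoissonModel.map_cellSet (hξ : IsPoissonModel P ξ) {h : ℝ} (hh : 0 < h) :
    P.map (fun ω => cellSet h fun j => ξ j ω) =
      bernoulliSet (Edge (EdgeType d₁ d₂)) (cellProb (h ^ d₁)) := by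
  classical
  refine map_eq_bernoulliSet (hξ.measurable_cellSet h) fun F => ?_
  have hh0 : 0 ≤ h ^ d₁ := by positivity
  set B : EdgeType d₁ d₂ → Set (Position d₁ d₂) := fun j => ⋃ e ∈ F.filter fun e => e.2 = j, cell h e
    with hB
  have hBm : ∀ j, MeasurableSet (B j) := fun j =>
    Finset.measurableSet_biUnion _ fun e _ => measurableSet_cell h e
  have hBν : ∀ j, (volume : Measure (Fin d₁ → ℝ)).prod (Measure.count : Measure (Fin d₂ → ℤ)) (B j) =
      ENNReal.ofReal ((F.filter fun e => e.2 = j).card * h ^ d₁) := by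
    intro j
    rw [hB, measure_biUnion_finset _ fun e _ => measurableSet_cell h e]
    · simp_rw [measure_cell hh.le]
      rw [Finset.sum_const, nsmul_eq_mul, ENNReal.ofReal_mul (Nat.cast_nonneg _),
        ENNReal.ofReal_natCast]
    · intro e he e' he' hne
      have h1 := (Finset.mem_filter.1 (Finset.mem_coe.1 he)).2
      have h2 := (Finset.mem_filter.1 (Finset.mem_coe.1 he')).2
      exact disjoint_cell hh (h1.trans h2.symm) hne
  have h1 : {ω | ∀ e ∈ F, e ∉ cellSet h fun j => ξ j ω} = ⋂ j, {ω | ξ j ω ∩ B j = ∅} := by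
    ext ω
    simp only [Set.mem_ofPred_eq, Set.mem_iInter, cellSet, Set.not_nonempty_iff_eq_empty, hB,
      Set.inter_iUnion, Set.iUnion_eq_empty, Finset.mem_filter]
    exact ⟨fun H j e he => he.2 ▸ H e he.1, fun H e he => H e.2 e ⟨he, rfl⟩⟩
  have h2 : ∀ j, MeasurableSet[processSigma (ξ j)] {ω | ξ j ω ∩ B j = ∅} := by
    intro j
    refine le_iSup₂ (f := fun (B : Set (Position d₁ d₂)) (_ : MeasurableSet B) =>
      MeasurableSpace.comap (fun ω => (ξ j ω ∩ B).encard) inferInstance) (B j) (hBm j) _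
      ⟨{0}, measurableSet_singleton _, ?_⟩
    ext ω; simp [Set.encard_eq_zero]
  rw [h1, hξ.indep.meas_iInter h2, one_sub_cellProb hh0]
  have h3 : ∀ j, P {ω | ξ j ω ∩ B j = ∅} =
      ENNReal.ofReal (Real.exp (-h ^ d₁)) ^ (F.filter fun e => e.2 = j).card := by
    intro j
    rw [(hξ.poisson j).measure_inter_eq_empty (hBm j) (by positivity) (hBν j),
      ← ENNReal.ofReal_pow (Real.exp_pos _).le, ← Real.exp_nat_mul]
    ring_nf
  simp_rw [h3]
  rw [Finset.prod_pow_eq_pow_sum, ← Finset.card_eq_sum_card_fiberwise fun e _ => Finset.mem_univ _]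

lemma IsPoissonModel.lintegral_dscore (hξ : IsPoissonModel P ξ) {n : ℕ} (hn : 0 < n) {l : ℝ}
    (hl : 0 < l) : ∫⁻ ω, dscore (cellSet (l / n) fun j => ξ j ω) (fun _ => n) ∂P =
      meanScore d₁ d₂ n l := by
  have hn : (0 : ℝ) < n := by exact_mod_cast hn
  rw [meanScore, ← hξ.map_cellSet (div_pos hl hn),
    lintegral_map (measurable_dscore _) (hξ.measurable_cellSet _)]

/-- Fatou's lemma along the discretisations, whose means are all bounded by the supremum
`scoreConst`. The integral of the score is only bounded above pointwise, so its measurability plays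
no role. -/
lemma IsPoissonModel.lintegral_score_le (hξ : IsPoissonModel P ξ) (hd : 1 ≤ d₁) {l : ℝ}
    (hl : 0 < l) : ∫⁻ ω, score (fun j => ξ j ω) (l • fun _ => 1) ∂P ≤
      ENNReal.ofReal (scoreConst d₁ d₂ * l) := by
  refine (lintegral_mono fun ω => score_le_liminf (fun j => ξ j ω) hl).trans
    ((lintegral_liminf_le fun n => (measurable_dscore _).comp (hξ.measurable_cellSet _)).trans ?_)
  refine liminf_le_of_frequently_le' (Eventually.frequently ?_)
  filter_upwards [eventually_gt_atTop 0] with n hn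
  exact (hξ.lintegral_dscore hn hl).le.trans (meanScore_le hd hn hl)

/-- The constant is the mean directional score of the Poisson model. -/
theorem IsPoissonModel.isDirectionalScore (hξ : IsPoissonModel P ξ) (hd : 1 ≤ d₁) :
    IsDirectionalScore P ξ (fun _ => 1) (scoreConst d₁ d₂) := by
  refine tendsto_order.2 ⟨fun t ht => ?_, fun t ht => ?_⟩
  · have htop : t ≠ ∞ := ht.ne_top
    have ht' : t.toReal < scoreConst d₁ d₂ := by
      rw [← ENNReal.ofReal_toReal htop] at ht
      exact (ENNReal.ofReal_lt_ofReal_iff_of_nonneg ENNReal.toReal_nonneg).1 ht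
    obtain ⟨c, htc, hc⟩ := _root_.exists_between ht'
    have hc0 : 0 < c := ENNReal.toReal_nonneg.trans_lt htc
    obtain ⟨n, hn, lam, hlam, hms⟩ := exists_meanScore_ge hd hc0.le hc
    have hnr : (0 : ℝ) < n := by exact_mod_cast hn
    have hlim : Tendsto (fun l : ℝ => c * (1 - lam / l)) atTop (𝓝 (c * (1 - 0))) :=
      (tendsto_const_nhds.sub (tendsto_const_nhds.div_atTop tendsto_id)).const_mul c
    rw [sub_zero, mul_one] at hlim
    filter_upwards [(tendsto_order.1 hlim).1 _ htc, eventually_ge_atTop lam] with l h1 h2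
    have hl : 0 < l := hlam.trans_le h2
    rw [ENNReal.lt_div_iff_mul_lt (Or.inl (by simpa using hl)) (Or.inl ENNReal.ofReal_ne_top)]
    -- As many diagonal copies of an almost optimal box as fit in size `l`; the incomplete last one
    -- is negligible.
    set m : ℕ := ⌊l / lam⌋₊ with hm
    have hm0 : 0 < m := Nat.floor_pos.2 ((one_le_div hlam).2 h2)
    have hmr : (0 : ℝ) < m := by exact_mod_cast hm0
    have hml : m * lam ≤ l := by
      have := Nat.floor_le (div_pos hl hlam).le
      rwa [le_div_iff₀ hlam] at this
    have hml' : l - lam < m * lam := by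
      have := Nat.lt_floor_add_one (l / lam)
      rw [div_lt_iff₀ hlam] at this
      linarith
    have h3 : t * ENNReal.ofReal l < ENNReal.ofReal (m * (c * lam)) := by
      rw [← ENNReal.ofReal_toReal htop, ← ENNReal.ofReal_mul ENNReal.toReal_nonneg]
      refine (ENNReal.ofReal_lt_ofReal_iff (by positivity)).2 ?_
      calc t.toReal * l < c * (1 - lam / l) * l := mul_lt_mul_of_pos_right h1 hl
        _ = c * (l - lam) := by field_simp
        _ ≤ c * (m * lam) := mul_le_mul_of_nonneg_left hml'.le hc0.le
        _ = _ := by ring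
    refine h3.trans_le ?_
    calc ENNReal.ofReal (m * (c * lam)) = m * ENNReal.ofReal (c * lam) := by
          rw [ENNReal.ofReal_mul hmr.le, ENNReal.ofReal_natCast]
      _ ≤ m * meanScore d₁ d₂ n lam := mul_le_mul_right hms _
      _ ≤ meanScore d₁ d₂ (m * n) (m * lam) := mul_meanScore_le hm0 lam
      _ = ∫⁻ ω, dscore (cellSet (m * lam / (m * n : ℕ)) fun j => ξ j ω) (fun _ => m * n) ∂P :=
          (hξ.lintegral_dscore (Nat.mul_pos hm0 hn) (by positivity)).symm
      _ ≤ _ := lintegral_mono fun ω => dscore_cellSet_le_score (by push_cast; positivity) _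
          fun i => by
            simp only [Pi.smul_apply, smul_eq_mul, mul_one]
            rwa [div_mul_cancel₀ _ (by push_cast; positivity)]
  · filter_upwards [eventually_gt_atTop 0] with l hl
    refine lt_of_le_of_lt ?_ ht
    rw [ENNReal.div_le_iff (by simpa using hl) ENNReal.ofReal_ne_top,
      ← ENNReal.ofReal_mul (scoreConst_pos hd).le]
    exact hξ.lintegral_score_le hd hl

end Poisson

end FPP

end

theorem theorem1 :
    ∃ C : ℕ → ℕ → ℝ,
      (∀ d₁ d₂ : ℕ, 1 ≤ d₁ → 0 < C d₁ d₂ ∧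
        ∀ (Ω : Type*) [MeasurableSpace Ω] (P : Measure Ω) [IsProbabilityMeasure P]
          (ξ : FPP.EdgeType d₁ d₂ → Ω → Set (FPP.Position d₁ d₂)),
          FPP.IsPoissonModel P ξ → FPP.IsDirectionalScore P ξ (fun _ => 1) (C d₁ d₂)) ∧
      ∀ d : ℕ, 2 ≤ d →
        ∃ μ : ℝ → (Fin d → ℝ) → ℝ,
          (∀ (ε : I) (Ω : Type*) [MeasurableSpace Ω] (P : Measure Ω) [IsProbabilityMeasure P]
            (τ : (FPP.lattice d).edgeSet → Ω → ℝ),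
            FPP.IsBernoulliBond P ε τ →
              ∀ z : Fin d → ℝ, z ≠ 0 → FPP.IsTimeConstant P τ z (μ ε z)) ∧
          ∀ z : Fin d → ℝ, z ≠ 0 →
            (fun ε : ℝ => μ ε z - (FPP.l1norm z -
                C (FPP.numNonzero z) (FPP.numZero z) * FPP.geomMean z *
                  ε ^ ((1 : ℝ) / FPP.numNonzero z)))
              =o[𝓝[>] 0] (fun ε : ℝ => ε ^ ((1 : ℝ) / FPP.numNonzero z)) := by
  refine ⟨FPP.scoreConst, fun d₁ d₂ hd => ⟨FPP.scoreConst_pos hd, fun Ω _ P _ ξ hξ =>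
    hξ.isDirectionalScore hd⟩, fun d _ => ?_⟩
  classical
  -- The value outside `[0, 1]` is arbitrary, since only small positive `ε` enter the expansion.
  refine ⟨fun ε z => if h : ε ∈ I then FPP.timeConstant ⟨ε, h⟩ z else 0, ?_, fun z hz => ?_⟩
  · intro ε Ω _ P _ τ h z _
    simp only [ε.2, dif_pos]
    exact FPP.isTimeConstant_timeConstant h z
  · exact FPP.isLittleO_timeConstant hz fun p => dif_pos p.2
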